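/- Let $M>0$, $k>0$, $t_0^\star\in\mathbb R$, $\Delta=r^2+k^2r^4-2Mr$, $w=\Delta/r^4$, and let $r_+$ be the largest real zero of $\Delta$. On the Schwarzschild–AdS exterior $\{t^\star\ge t^\star_0,\ r>r_+\}\times\mathbb S^2$ let $t=t^\star-r^\star+\frac1k\arctan(kr)$ with $\frac{dr^\star}{dr}=\frac{r^2}{\Delta}$ and, in the coordinates $(t,r,\vartheta,\varphi)$, $L=\partial_t+\frac{\Delta}{r^2}\partial_r$, $\underline L=\partial_t-\frac{\Delta}{r^2}\partial_r$. For $s=\pm2$ put $$-\mathcal L^{[s]}=\tfrac1{\sin\vartheta}\partial_\vartheta(\sin\vartheta\,\partial_\vartheta)+\tfrac1{\sin^2\vartheta}\partial_\varphi^2+2si\tfrac{\cos\vartheta}{\sin^2\vartheta}\partial_\varphi-4\cot^2\vartheta-4 ,$$ and let $\tilde Z_1=-\sin\varphi\,\partial_\vartheta+\cos\varphi(-is\csc\vartheta-\cot\vartheta\,\partial_\varphi)$, $\tilde Z_2=-\cos\varphi\,\partial_\vartheta-\sin\varphi(-is\csc\vartheta-\cot\vartheta\,\partial_\varphi)$,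 $\tilde Z_3=\partial_\varphi$. All functions are smooth and spin-weighted; a spin-$s$-weighted function $f$ extends continuously to the poles in the sense that $e^{is\varphi}f$ does at $\vartheta=0$ and $e^{-is\varphi}f$ does at $\vartheta=\pi$, and for a smooth one this holds for $f$ and for all its derivatives along $L,\Delta^{-1}\underline L,\tilde Z_1,\tilde Z_2,\tilde Z_3$. It is regular at the horizon (at infinity) if $L^p(\Delta^{-1}\underline L)^q\tilde Z_1^{k_1}\tilde Z_2^{k_2}\tilde Z_3^{k_3}f$ (respectively $(L-\underline L)^p(L+\underline L)^q\tilde Z_1^{k_1}\tilde Z_2^{k_2}\tilde Z_3^{k_3}f$) extends continuously to $r=r_+$ (respectively $r=\infty$) for all $p,q,k_1,k_2,k_3\in\mathbb N$. *Teukolsky problem.* Spin-$\pm2$-weighted functions $\widetilde\alpha^{[\pm2]}$ are solutions of the Teukolsky problem on $\{t^\star\ge t_0^\star\}$ if $\widetilde\alpha^{[+2]}$ and $\Delta^{-2}\widetilde\alpha^{[-2]}$ are regular at the horizon, $\widetilde\alpha^{[\pm2]}$ are regular at infinity, $$0=-L\underline L\widetilde\alpha^{[+2]}+2\tfrac{\Delta}{r^2}\partial_r\big(\log\tfrac{\Delta}{r^4}\big)\underline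 L\widetilde\alpha^{[+2]}-\tfrac{\Delta}{r^4}\big(\mathcal L^{[+2]}-2+\tfrac{6M}r\big)\widetilde\alpha^{[+2]},$$ $$0=-L\underline L\widetilde\alpha^{[-2]}-2\tfrac{\Delta}{r^2}\partial_r\big(\log\tfrac{\Delta}{r^4}\big)L\widetilde\alpha^{[-2]}-\tfrac{\Delta}{r^4}\big(\mathcal L^{[-2]}-2+\tfrac{6M}r\big)\widetilde\alpha^{[-2]},$$ and, as $r\to\infty$, with $^*$ the complex conjugation, $\widetilde\alpha^{[+2]}-(\widetilde\alpha^{[-2]})^*\to0$ and $r^2\partial_r\widetilde\alpha^{[+2]}+r^2\partial_r(\widetilde\alpha^{[-2]})^*\to0$. *Symmetrisation.* Let $(S_{m\ell}(\vartheta)e^{im\varphi})_{\ell\ge2,|m|\le\ell}$ be a Hilbert basis of the spin-$+2$-weighted $L^2$ functions on $\mathbb S^2$ made of smooth unit eigenfunctions of $\mathcal L^{[+2]}$ with eigenvalues $\ell(\ell+1)$, with $S_{m\ell}$ real and with signs such that $D_{-1}D_0D_1D_2(S_{m\ell}e^{im\varphi})=(\ell-1)\ell(\ell+1)(\ell+2)S_{(-m)\ell}e^{im\varphi}$,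 where $D_n=\partial_\vartheta-\frac i{\sin\vartheta}\partial_\varphi+n\cot\vartheta$. Let $\mathcal C$ be the linear operator with $\mathcal C(S_{m\ell}e^{im\varphi})=S_{(-m)\ell}e^{im\varphi}$. (It does not depend on the choice of such a basis.) The symmetrised ($s$) and antisymmetrised ($a$) parts are $\phi_{s/a}=\frac12\phi\pm\frac12(\mathcal C\phi)^*$ for spin $+2$ and $\phi_{s/a}=\frac12\phi\pm\frac12\mathcal C(\phi^*)$ for spin $-2$. *Regge–Wheeler quantities.* Let $\Psi^{[+2]}=(w^{-1}\underline L)^2\widetilde\alpha^{[+2]}$ and $\Psi^{[-2]}=(w^{-1}L)^2\widetilde\alpha^{[-2]}$ be the Chandrasekhar transformations and, with $\mathcal L=\mathcal L^{[+2]}$, $$\Psi^D=\Psi^{[+2]}-(\Psi^{[-2]})^*,\qquad \Psi^R=\Psi^{[+2]}+(\Psi^{[-2]})^*+12M\,\big(\mathcal L(\mathcal L-2)\big)^{-1}\partial_t\big(\Psi^{[+2]}-(\Psi^{[-2]})^*\big).$$ Here $(\mathcal L(\mathcal L-2))^{-1}$ multiplies the $(m,\ell)$ mode by $\frac1{(\ell-1)\ell(\ell+1)(\ell+2)}$.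 **Proposition.** Let $\widetilde\alpha^{[\pm2]}$ be solutions of the Teukolsky problem on $\{t^\star\ge t^\star_0\}$. 1. One has $\Psi^D_s=0$ if and only if $$w^2(w^{-1}L)^4(\widetilde\alpha^{[-2]}_s)^*=\mathcal L^{[+2]}(\mathcal L^{[+2]}-2)\widetilde\alpha^{[+2]}_s-12M\partial_t\widetilde\alpha^{[+2]}_s,$$ $$w^2(w^{-1}\underline L)^4(\widetilde\alpha^{[+2]}_s)^*=\mathcal L^{[-2]}(\mathcal L^{[-2]}-2)\widetilde\alpha^{[-2]}_s+12M\partial_t\widetilde\alpha^{[-2]}_s.$$ 2. One has $\Psi^R_a=0$ if and only if $$w^2(w^{-1}L)^4(\widetilde\alpha^{[-2]}_a)^*=-\mathcal L^{[+2]}(\mathcal L^{[+2]}-2)\widetilde\alpha^{[+2]}_a-12M\partial_t\widetilde\alpha^{[+2]}_a,$$ $$w^2(w^{-1}\underline L)^4(\widetilde\alpha^{[+2]}_a)^*=-\mathcal L^{[-2]}(\mathcal L^{[-2]}-2)\widetilde\alpha^{[-2]}_a+12M\partial_t\widetilde\alpha^{[-2]}_a.$$ -/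

import Mathlib

open scoped ContDiff

namespace TeukolskySAdS

open Set Filter Topology

noncomputable section

/-- A complex-valued function of the coordinates `(t⋆, r, θ, φ)`. -/
abbrev Field4 := ℝ → ℝ → ℝ → ℝ → ℂ

/-! ### The Schwarzschild-AdS background -/

/-- `Δ = r² + k² r⁴ - 2 M r`. -/
def Del (M k r : ℝ) : ℝ := r ^ 2 + k ^ 2 * r ^ 4 - 2 * M * r

/-- `w = Δ / r⁴`. -/
def wfun (M k r : ℝ) : ℝ := Del M k r / r ^ 4

/-- The coordinate range of the exterior minus the horizon, intersected with `t⋆ ≥ t0`, minus the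
two axis points `θ = 0, π` of each sphere (`rp` is the horizon radius). -/
def Region (rp t0 : ℝ) (t r θ : ℝ) : Prop := t0 ≤ t ∧ rp < r ∧ 0 < θ ∧ θ < Real.pi

/-- Two functions agree on the region. -/
def EqOnRegion (rp t0 : ℝ) (f g : Field4) : Prop :=
  ∀ t r θ φ : ℝ, Region rp t0 t r θ → f t r θ φ = g t r θ φ

/-- Pointwise complex conjugation. -/
def cc (f : Field4) : Field4 := fun t r θ φ => (starRingEnd ℂ) (f t r θ φ)

/-- Multiplication by a real radial function. -/
def rmul (a : ℝ → ℝ) (f : Field4) : Field4 := fun t r θ φ => (a r : ℂ) * f t r θ φ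

/-- `∂_t` (which is also `∂_{t⋆}` at fixed `r`); one-sided at the initial time `t⋆ = t0`. -/
def dT (t0 : ℝ) (f : Field4) : Field4 :=
  fun t r θ φ => derivWithin (fun τ => f τ r θ φ) (Ici t0) t

/-- `∂_r` at fixed `t⋆`. -/
def dRstar (f : Field4) : Field4 := fun t r θ φ => deriv (fun ρ => f t ρ θ φ) r

/-- `∂_θ`. -/
def dTh (f : Field4) : Field4 := fun t r θ φ => deriv (fun x => f t r x φ) θ

/-- `∂_φ`. -/
def dPh (f : Field4) : Field4 := fun t r θ φ => deriv (fun x => f t r θ x) φ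

/-- `∂_r` at fixed `t`, where `t⋆ = t + r⋆(r) - k⁻¹ arctan (k r)` and `dr⋆/dr = r² / Δ`; hence
`∂_r|_t = ∂_r|_{t⋆} + (r² / Δ - 1 / (1 + k² r²)) ∂_{t⋆}`. -/
def dR (M k t0 : ℝ) (f : Field4) : Field4 :=
  dRstar f + rmul (fun r => r ^ 2 / Del M k r - 1 / (1 + k ^ 2 * r ^ 2)) (dT t0 f)

/-- `L = ∂_t + (Δ / r²) ∂_r`. -/
def opL (M k t0 : ℝ) (f : Field4) : Field4 :=
  dT t0 f + rmul (fun r => Del M k r / r ^ 2) (dR M k t0 f)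

/-- `L̲ = ∂_t - (Δ / r²) ∂_r`. -/
def opLb (M k t0 : ℝ) (f : Field4) : Field4 :=
  dT t0 f - rmul (fun r => Del M k r / r ^ 2) (dR M k t0 f)

/-- `w⁻¹ L`. -/
def winvL (M k t0 : ℝ) (f : Field4) : Field4 := rmul (fun r => (wfun M k r)⁻¹) (opL M k t0 f)

/-- `w⁻¹ L̲`. -/
def winvLb (M k t0 : ℝ) (f : Field4) : Field4 := rmul (fun r => (wfun M k r)⁻¹) (opLb M k t0 f)

/-! ### Spin-weighted functions and their regularity -/

/-- `Z̃₁ = - sin φ ∂_θ + cos φ (- i s csc θ - cot θ ∂_φ)`. -/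
def Z1 (s : ℤ) (f : Field4) : Field4 := fun t r θ φ =>
  -(Real.sin φ : ℂ) * dTh f t r θ φ
    + (Real.cos φ : ℂ) * (-Complex.I * (s : ℂ) * ((Real.sin θ)⁻¹ : ℝ) * f t r θ φ
      - (Real.cos θ / Real.sin θ : ℝ) * dPh f t r θ φ)

/-- `Z̃₂ = - cos φ ∂_θ - sin φ (- i s csc θ - cot θ ∂_φ)`. -/
def Z2 (s : ℤ) (f : Field4) : Field4 := fun t r θ φ =>
  -(Real.cos φ : ℂ) * dTh f t r θ φ
    - (Real.sin φ : ℂ) * (-Complex.I * (s : ℂ) * ((Real.sin θ)⁻¹ : ℝ) * f t r θ φ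
      - (Real.cos θ / Real.sin θ : ℝ) * dPh f t r θ φ)

/-- `Z̃₁^{k₁} Z̃₂^{k₂} Z̃₃^{k₃}`, with `Z̃₃ = ∂_φ`. -/
def Zpow (s : ℤ) (k₁ k₂ k₃ : ℕ) (f : Field4) : Field4 :=
  (Z1 s)^[k₁] ((Z2 s)^[k₂] (dPh^[k₃] f))

/-- The spin-`s`-weighted function `F` has a limit, continuously on the whole sphere, as `(t⋆, r)`
tends along `l`. Away from the poles this is a limit in the coordinates `(θ, φ)`; at the north
(south) pole it is `e^{isφ} F` (resp. `e^{-isφ} F`), the component in a frame that is regular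
there, which converges, uniformly in `φ`. -/
def SpinLimit (s : ℤ) (l : Filter (ℝ × ℝ)) (F : Field4) : Prop :=
  (∀ θ ∈ Ioo (0 : ℝ) Real.pi, ∀ φ : ℝ, ∃ c : ℂ,
    Tendsto (fun p : (ℝ × ℝ) × (ℝ × ℝ) => F p.1.1 p.1.2 p.2.1 p.2.2)
      (l ×ˢ (𝓝 θ ×ˢ 𝓝 φ)) (𝓝 c)) ∧
  (∃ c : ℂ, Tendsto (fun p : (ℝ × ℝ) × (ℝ × ℝ) =>
      Complex.exp (Complex.I * (s : ℂ) * (p.2.2 : ℂ)) * F p.1.1 p.1.2 p.2.1 p.2.2)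
      (l ×ˢ (𝓝[>] (0 : ℝ) ×ˢ (⊤ : Filter ℝ))) (𝓝 c)) ∧
  (∃ c : ℂ, Tendsto (fun p : (ℝ × ℝ) × (ℝ × ℝ) =>
      Complex.exp (-Complex.I * (s : ℂ) * (p.2.2 : ℂ)) * F p.1.1 p.1.2 p.2.1 p.2.2)
      (l ×ˢ (𝓝[<] Real.pi ×ˢ (⊤ : Filter ℝ))) (𝓝 c))

/-- `L^p (Δ⁻¹ L̲)^q Z̃₁^{k₁} Z̃₂^{k₂} Z̃₃^{k₃} f`. -/
def horizonDeriv (M k t0 : ℝ) (s : ℤ) (p q k₁ k₂ k₃ : ℕ) (f : Field4) : Field4 :=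
  (opL M k t0)^[p]
    ((fun g => rmul (fun r => (Del M k r)⁻¹) (opLb M k t0 g))^[q] (Zpow s k₁ k₂ k₃ f))

/-- `(L - L̲)^p (L + L̲)^q Z̃₁^{k₁} Z̃₂^{k₂} Z̃₃^{k₃} f`. -/
def infinityDeriv (M k t0 : ℝ) (s : ℤ) (p q k₁ k₂ k₃ : ℕ) (f : Field4) : Field4 :=
  (fun g => opL M k t0 g - opLb M k t0 g)^[p]
    ((fun g => opL M k t0 g + opLb M k t0 g)^[q] (Zpow s k₁ k₂ k₃ f))

/-- Smooth spin-`s`-weighted functions on `{t⋆ ≥ t0, r > rp} × S²`. -/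
structure IsSmoothSpin (M k rp t0 : ℝ) (s : ℤ) (f : Field4) : Prop where
  smooth : ContDiffOn ℝ ∞ (fun x : ℝ × ℝ × ℝ × ℝ => f x.1 x.2.1 x.2.2.1 x.2.2.2)
    (Ici t0 ×ˢ Ioi rp ×ˢ Ioo 0 Real.pi ×ˢ univ)
  periodic : ∀ t r θ φ : ℝ, Region rp t0 t r θ → f t r θ (φ + 2 * Real.pi) = f t r θ φ
  poles : ∀ p q k₁ k₂ k₃ : ℕ, ∀ t r : ℝ, t0 ≤ t → rp < r →
    SpinLimit s (𝓝[Ici t0] t ×ˢ 𝓝 r) (horizonDeriv M k t0 s p q k₁ k₂ k₃ f)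

/-- Regularity at the future event horizon `r = rp`. -/
def RegularAtHorizon (M k rp t0 : ℝ) (s : ℤ) (f : Field4) : Prop :=
  ∀ p q k₁ k₂ k₃ : ℕ, ∀ t : ℝ, t0 ≤ t →
    SpinLimit s (𝓝[Ici t0] t ×ˢ 𝓝[>] rp) (horizonDeriv M k t0 s p q k₁ k₂ k₃ f)

/-- Regularity at the conformal boundary `r = ∞`. -/
def RegularAtInfinity (M k t0 : ℝ) (s : ℤ) (f : Field4) : Prop :=
  ∀ p q k₁ k₂ k₃ : ℕ, ∀ t : ℝ, t0 ≤ t →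
    SpinLimit s (𝓝[Ici t0] t ×ˢ atTop) (infinityDeriv M k t0 s p q k₁ k₂ k₃ f)

/-! ### The Teukolsky problem -/

/-- The angular operator `𝓛^{[s]}`, `s = ±2`:
`-𝓛^{[s]} = (1/sin θ) ∂_θ (sin θ ∂_θ) + (1/sin² θ) ∂_φ² + 2 s i (cos θ/sin² θ) ∂_φ
  - 4 cot² θ - 4`. -/
def angL (s : ℤ) (f : Field4) : Field4 := fun t r θ φ =>
  -(((Real.sin θ)⁻¹ : ℝ) * deriv (fun x => (Real.sin x : ℂ) * dTh f t r x φ) θ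
    + ((Real.sin θ ^ 2)⁻¹ : ℝ) * dPh (dPh f) t r θ φ
    + 2 * (s : ℂ) * Complex.I * (Real.cos θ / Real.sin θ ^ 2 : ℝ) * dPh f t r θ φ
    - 4 * ((Real.cos θ / Real.sin θ) ^ 2 : ℝ) * f t r θ φ - 4 * f t r θ φ)

/-- `𝓛^{[s]} (𝓛^{[s]} - 2)`. -/
def angL4 (s : ℤ) (f : Field4) : Field4 := angL s (angL s f - (2 : ℂ) • f)

/-- `𝔗^{[+2]} f = - L L̲ f + 2 (Δ/r²) ∂_r (log (Δ/r⁴)) L̲ f - (Δ/r⁴) (𝓛^{[+2]} - 2 + 6M/r) f`. -/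
def teukP (M k t0 : ℝ) (f : Field4) : Field4 :=
  -opL M k t0 (opLb M k t0 f)
    + rmul (fun r => 2 * (Del M k r / r ^ 2) * deriv (fun ρ => Real.log (Del M k ρ / ρ ^ 4)) r)
        (opLb M k t0 f)
    - rmul (fun r => Del M k r / r ^ 4)
        (angL 2 f - (2 : ℂ) • f + rmul (fun r => 6 * M / r) f)

/-- `𝔗^{[-2]} f = - L L̲ f - 2 (Δ/r²) ∂_r (log (Δ/r⁴)) L f - (Δ/r⁴) (𝓛^{[-2]} - 2 + 6M/r) f`. -/
def teukM (M k t0 : ℝ) (f : Field4) : Field4 :=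
  -opL M k t0 (opLb M k t0 f)
    - rmul (fun r => 2 * (Del M k r / r ^ 2) * deriv (fun ρ => Real.log (Del M k ρ / ρ ^ 4)) r)
        (opL M k t0 f)
    - rmul (fun r => Del M k r / r ^ 4)
        (angL (-2) f - (2 : ℂ) • f + rmul (fun r => 6 * M / r) f)

/-- `(αp, αm) = (α̃^{[+2]}, α̃^{[-2]})` are solutions of the Teukolsky problem on `{t⋆ ≥ t0}`. -/
structure IsTeukolskySolution (M k rp t0 : ℝ) (αp αm : Field4) : Prop where
  smooth_p : IsSmoothSpin M k rp t0 2 αp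
  smooth_m : IsSmoothSpin M k rp t0 (-2) αm
  horizon_p : RegularAtHorizon M k rp t0 2 αp
  horizon_m : RegularAtHorizon M k rp t0 (-2) (rmul (fun r => (Del M k r ^ 2)⁻¹) αm)
  infinity_p : RegularAtInfinity M k t0 2 αp
  infinity_m : RegularAtInfinity M k t0 (-2) αm
  teukolsky_p : EqOnRegion rp t0 (teukP M k t0 αp) 0
  teukolsky_m : EqOnRegion rp t0 (teukM M k t0 αm) 0
  /-- `α̃^{[+2]} - (α̃^{[-2]})^* → 0` as `r → ∞`. -/
  dirichlet : ∀ t θ φ : ℝ, t0 ≤ t → 0 < θ → θ < Real.pi →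
    Tendsto (fun r => (αp - cc αm) t r θ φ) atTop (𝓝 0)
  /-- `r² ∂_r α̃^{[+2]} + r² ∂_r (α̃^{[-2]})^* → 0` as `r → ∞`. -/
  neumann : ∀ t θ φ : ℝ, t0 ≤ t → 0 < θ → θ < Real.pi →
    Tendsto (fun r => rmul (fun r => r ^ 2) (dR M k t0 αp + dR M k t0 (cc αm)) t r θ φ)
      atTop (𝓝 0)

/-! ### The spin-weighted harmonics, the conjugacy operator, (anti-)symmetrisation -/

/-- The real functions `S_{mℓ}(θ)`, `ℓ ≥ 2`, `|m| ≤ ℓ`, for which the spin-weighted spherical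
harmonics `S_{mℓ}(θ) e^{imφ}` form a Hilbert basis of the spin-`+2`-weighted functions in `L²`
made of eigenfunctions of `𝓛^{[+2]}` (eigenvalue `ℓ(ℓ+1)`), given by the Rodrigues formula: with
`x = cos θ`,
`S_{mℓ} = ε_m K (1-x)^{-(m+2)/2} (1+x)^{(m-2)/2} (d/dx)^{ℓ-2} [(1-x)^{ℓ+m} (1+x)^{ℓ-m}]`,
where `(1-x)^{-(m+2)/2} (1+x)^{(m-2)/2} = (1/4) sin(θ/2)^{-(m+2)} cos(θ/2)^{m-2}`. The constant
`K > 0` makes the `L²(S²)` norm of `S_{mℓ}(θ) e^{imφ}` equal to one. The sign (`ε_m = 1` for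
`m ≥ 0` and `ε_m = (-1)^m` for `m < 0`) gives, with `D_n = ∂_θ - (i/sin θ) ∂_φ + n cot θ`, the
normalisation
`D_{-1} D_0 D_1 D_2 (S_{mℓ} e^{imφ}) = (ℓ-1) ℓ (ℓ+1) (ℓ+2) S_{(-m)ℓ} e^{imφ}`. -/
def Sml (m : ℤ) (ℓ : ℕ) (θ : ℝ) : ℝ :=
  (if 0 ≤ m then 1 else (-1) ^ m.natAbs) *
  (Real.sqrt ((2 * ℓ + 1) / (4 * Real.pi) * ((ℓ + 2).factorial : ℝ)
      / ((ℓ - 2).factorial * ((ℓ + m).toNat).factorial * ((ℓ - m).toNat).factorial)) / 2 ^ ℓ) *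
  (1 / 4 * Real.sin (θ / 2) ^ (-(m + 2)) * Real.cos (θ / 2) ^ (m - 2)) *
  ((Polynomial.derivative^[ℓ - 2]
      ((1 - Polynomial.X) ^ (ℓ + m).toNat * (1 + Polynomial.X) ^ (ℓ - m).toNat :
        Polynomial ℝ)).eval (Real.cos θ))

/-- The coefficient `f_{mℓ}(t⋆, r)` of a spin-`+2`-weighted function on `S_{mℓ}(θ) e^{imφ}`. -/
def modeCoeff (m : ℤ) (ℓ : ℕ) (f : Field4) (t r : ℝ) : ℂ :=
  ∫ θ in (0 : ℝ)..Real.pi, ∫ φ in (0 : ℝ)..(2 * Real.pi),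
    f t r θ φ * (Sml m ℓ θ : ℂ) * Complex.exp (-Complex.I * (m : ℂ) * (φ : ℂ))
      * (Real.sin θ : ℂ)

/-- The conjugacy operator `𝓒` from spin-`+2`- to spin-`-2`-weighted functions: the linear
operator with `𝓒 (S_{mℓ}(θ) e^{imφ}) = S_{(-m)ℓ}(θ) e^{imφ}`. -/
def conjC (f : Field4) : Field4 := fun t r θ φ =>
  ∑' n : ℕ, ∑ m ∈ Finset.Icc (-((n + 2 : ℕ) : ℤ)) ((n + 2 : ℕ) : ℤ),
    modeCoeff m (n + 2) f t r * (Sml (-m) (n + 2) θ : ℂ)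
      * Complex.exp (Complex.I * (m : ℂ) * (φ : ℂ))

/-- The inverse of the elliptic operator `𝓛^{[+2]} (𝓛^{[+2]} - 2)` on spin-`+2`-weighted
functions: multiplication of the `(m, ℓ)` mode by `1 / ((ℓ-1) ℓ (ℓ+1) (ℓ+2))`. -/
def invAngL4 (f : Field4) : Field4 := fun t r θ φ =>
  ∑' n : ℕ, ∑ m ∈ Finset.Icc (-((n + 2 : ℕ) : ℤ)) ((n + 2 : ℕ) : ℤ),
    modeCoeff m (n + 2) f t r
      / (((n + 1 : ℕ) : ℂ) * ((n + 2 : ℕ) : ℂ) * ((n + 3 : ℕ) : ℂ) * ((n + 4 : ℕ) : ℂ))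
      * (Sml m (n + 2) θ : ℂ) * Complex.exp (Complex.I * (m : ℂ) * (φ : ℂ))

/-- Symmetrised part of a spin-`+2`-weighted function: `f/2 + (𝓒 f)^* / 2`. -/
def symP (f : Field4) : Field4 := (1 / 2 : ℂ) • f + (1 / 2 : ℂ) • cc (conjC f)

/-- Antisymmetrised part of a spin-`+2`-weighted function: `f/2 - (𝓒 f)^* / 2`. -/
def antiP (f : Field4) : Field4 := (1 / 2 : ℂ) • f - (1 / 2 : ℂ) • cc (conjC f)

/-- Symmetrised part of a spin-`-2`-weighted function: `f/2 + 𝓒 (f^*) / 2`. -/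
def symM (f : Field4) : Field4 := (1 / 2 : ℂ) • f + (1 / 2 : ℂ) • conjC (cc f)

/-- Antisymmetrised part of a spin-`-2`-weighted function: `f/2 - 𝓒 (f^*) / 2`. -/
def antiM (f : Field4) : Field4 := (1 / 2 : ℂ) • f - (1 / 2 : ℂ) • conjC (cc f)

/-! ### Chandrasekhar transformations and Regge-Wheeler quantities -/

/-- `Ψ^{[+2]} = w⁻¹ L̲ (w⁻¹ L̲ α̃^{[+2]})`. -/
def PsiP (M k t0 : ℝ) (αp : Field4) : Field4 := winvLb M k t0 (winvLb M k t0 αp)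

/-- `Ψ^{[-2]} = w⁻¹ L (w⁻¹ L α̃^{[-2]})`. -/
def PsiM (M k t0 : ℝ) (αm : Field4) : Field4 := winvL M k t0 (winvL M k t0 αm)

/-- `Ψ^D = Ψ^{[+2]} - (Ψ^{[-2]})^*`. -/
def PsiD (M k t0 : ℝ) (αp αm : Field4) : Field4 :=
  PsiP M k t0 αp - cc (PsiM M k t0 αm)

/-- `Ψ^R = (Ψ^{[+2]} + (Ψ^{[-2]})^*)
  + 12 M (𝓛^{[+2]} (𝓛^{[+2]} - 2))⁻¹ ∂_t (Ψ^{[+2]} - (Ψ^{[-2]})^*)`. -/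
def PsiR (M k t0 : ℝ) (αp αm : Field4) : Field4 :=
  (PsiP M k t0 αp + cc (PsiM M k t0 αm))
    + (12 * M : ℂ) • invAngL4 (dT t0 (PsiP M k t0 αp - cc (PsiM M k t0 αm)))

/-! ### Teukolsky-Starobinsky relations -/

/-- The Teukolsky-Starobinsky relations for the symmetrised (`σ = 1`) or antisymmetrised
(`σ = -1`) quantities:
`w² (w⁻¹ L)⁴ (β^{[-2]})^* = σ 𝓛^{[+2]} (𝓛^{[+2]} - 2) β^{[+2]} - 12 M ∂_t β^{[+2]}` and
`w² (w⁻¹ L̲)⁴ (β^{[+2]})^* = σ 𝓛^{[-2]} (𝓛^{[-2]} - 2) β^{[-2]} + 12 M ∂_t β^{[-2]}`. -/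
def TSRelations (M k rp t0 : ℝ) (σ : ℂ) (βp βm : Field4) : Prop :=
  EqOnRegion rp t0
    (rmul (fun r => wfun M k r ^ 2) ((winvL M k t0)^[4] (cc βm)))
    (σ • angL4 2 βp - (12 * M : ℂ) • dT t0 βp) ∧
  EqOnRegion rp t0
    (rmul (fun r => wfun M k r ^ 2) ((winvLb M k t0)^[4] (cc βp)))
    (σ • angL4 (-2) βm + (12 * M : ℂ) • dT t0 βm)

end

end TeukolskySAdS

/-! Expand the spin +2 field and the complex conjugate of the spin -2 field in the same spin +2
harmonics. For each (m, ℓ) there remains a pair a, b of smooth functions of (t⋆, r), and the claim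
becomes algebra in a commutative ring with two commuting derivations L, L̲ acting on x = 1/r, w and
v = w⁻¹ by explicit formulas (`NullPair`). Write λ = ℓ(ℓ+1), N = λ(λ-2), T = L + L̲ = 2∂_t. The
reflection (L, L̲) ↦ (-L̲, -L) exchanges the equations of a and b, so each fact about one has a twin
for the other (`NullPair.reverse`). Symmetrisation pairs the mode m with the conjugate of the mode
-m. The mode equations have real coefficients that do not depend on m, so it commutes with
everything.

The Chandrasekhar transforms Ψ₊ = (vL̲)²a and Ψ₋ = (vL)²b solve the same Regge-Wheeler equation
(`RW_of_Teuk`), and w²(vL)²Ψ₊ = Na - 6M Ta, w²(vL̲)²Ψ₋ = Nb + 6M Tb (`L_fourth`). Hence the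
symmetric relations say exactly that f = Ψ₊ - Ψ₋ is killed by (vL)² and by (vL̲)². A Regge-Wheeler
solution with that property is zero (`NullPair.eq_zero`): its two first derivatives satisfy linear
relations whose determinant is N ≠ 0. This proves part 1, with no boundary condition.

For part 2 the relevant quantity is N times the mode of Ψ^R, namely N(Ψ₊ + Ψ₋) + 6M T(Ψ₊ - Ψ₋). If
the antisymmetric relations hold, both operators kill it, and `NullPair.eq_zero` applies again
(`robin_eq_zero`). Conversely, if it vanishes, the defects y and z of the two relations are
algebraically special: Ny = 6M Ty, (vL̲)²y = 0, with reflected equations for z (`defects`). Such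
functions do exist locally, so the conditions at infinity must enter. They give y - z → 0
(`defect_sub_mem`). Here time derivatives of decaying functions decay by a Landau type inequality
(`T_mem_decInf`). Since y and z evolve with opposite signs, y + z = (6M/N) T(y - z) → 0 as well, so
both defects decay. Then δ = vL̲y decays and satisfies ∂_r δ = g δ with g ≥ 0, so |δ|² is
nondecreasing in r with limit zero; hence δ = 0 and y = 0 (`eq_zero_of_special`, `special_left`,
`special_right`).

The analysis justifies the passage to modes. `good` consists of periodic functions whose derivatives
along the null and rotation fields are bounded uniformly over the spheres; it is stable under 𝓛,
which is minus the Casimir of the rotations (`angA_eq`). Self-adjointness of 𝓛 turns this into rapid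
decay of the modes (`modeInt_angA`, `md_rd`). Orthonormality and completeness of the harmonics come
from the Rodrigues formula, and the harmonics grow at most polynomially in ℓ away from the poles
(`Sml_local_bound`). So a good field is the sum of its modes (`ev_eq_ser`) and all operators act
termwise on such sums (`RepS`). The conjugacy operator is defined by a series, so the fields it
produces are handled as sums of modes throughout. -/

open scoped ContDiff
namespace TeukolskySAdS
open Set Filter Topology
noncomputable section

/-! ### The algebra of null derivatives -/

/-- Commuting derivations `L`, `L̲` with `x = 1/r`, `w`, `v = w⁻¹`, and constants `m`, `lam`. -/
structure NullPair {A : Type*} [CommRing A] [Algebra ℂ A] (L Lb : Derivation ℂ A A)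
    (w v x m lam : A) : Prop where
  comm : ∀ a, Lb (L a) = L (Lb a)
  wv : w * v = 1
  Lx : L x = -w
  Lbx : Lb x = w
  Lw : L w = w * (6 * m * x ^ 2 - 2 * x)
  Lbw : Lb w = -(w * (6 * m * x ^ 2 - 2 * x))
  Lm : L m = 0
  Lbm : Lb m = 0
  Llam : L lam = 0
  Lblam : Lb lam = 0

namespace NullPair

variable {A : Type*} [CommRing A] [Algebra ℂ A] {L Lb : Derivation ℂ A A} {w v x m lam : A}

/-- This is t ↦ -t: it fixes the radial derivative and changes the sign of L + L̲. It exchanges the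
two spins and halves the work below. -/
theorem reverse (h : NullPair L Lb w v x m lam) : NullPair (-Lb) (-L) w v x m lam where
  comm a := by simp [h.comm]
  wv := h.wv
  Lx := by simp [h.Lbx]
  Lbx := by simp [h.Lx]
  Lw := by simp [h.Lbw]
  Lbw := by simp [h.Lw]
  Lm := by simp [h.Lbm]
  Lbm := by simp [h.Lm]
  Llam := by simp [h.Lblam]
  Lblam := by simp [h.Llam]

theorem Lv (h : NullPair L Lb w v x m lam) : L v = -(v * (6 * m * x ^ 2 - 2 * x)) := by
  have h1 := congrArg L h.wv
  simp only [Derivation.leibniz, smul_eq_mul, Derivation.map_one_eq_zero, h.Lw] at h1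
  linear_combination v * h1 - (L v + v * (6 * m * x ^ 2 - 2 * x)) * h.wv

theorem Lbv (h : NullPair L Lb w v x m lam) : Lb v = v * (6 * m * x ^ 2 - 2 * x) := by
  have h1 := h.reverse.Lv
  simp only [Derivation.neg_apply] at h1
  linear_combination -h1

theorem L_ofNat (L : Derivation ℂ A A) (n : ℕ) [n.AtLeastTwo] :
    L (ofNat(n) : A) = 0 := by
  exact_mod_cast L.map_natCast n

theorem Lq (h : NullPair L Lb w v x m lam) :
    L (6 * m * x ^ 2 - 2 * x) = w * (2 - 12 * m * x) := by
  simp only [map_sub, Derivation.leibniz, Derivation.leibniz_pow, smul_eq_mul, h.Lx, h.Lm, L_ofNat,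
    nsmul_eq_mul]
  push_cast
  ring

theorem Lbq (h : NullPair L Lb w v x m lam) :
    Lb (6 * m * x ^ 2 - 2 * x) = -(w * (2 - 12 * m * x)) := by
  have h1 := h.reverse.Lq
  simp only [Derivation.neg_apply] at h1
  linear_combination -h1

/-- The spin `+2` Teukolsky equation on a mode. -/
def Teuk (L Lb : Derivation ℂ A A) (w x m lam a : A) : Prop :=
  L (Lb a) = 2 * (6 * m * x ^ 2 - 2 * x) * Lb a - w * (lam - 2 + 6 * m * x) * a

/-- The Regge-Wheeler equation on a mode. -/
def RW (L Lb : Derivation ℂ A A) (w x m lam a : A) : Prop :=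
  Lb (L a) = -(w * (lam - 6 * m * x) * a)

theorem RW.rev (h : NullPair L Lb w v x m lam) {a : A} (ha : RW L Lb w x m lam a) :
    RW (-Lb) (-L) w x m lam a := by
  unfold RW at *
  simp [← h.comm, ha]

/-- With q = 6mx² - 2x one has Lv = -qv, so passing from L̲a to vL̲a lowers the coefficient of the
first-order term from 2q to q. -/
theorem L_first (h : NullPair L Lb w v x m lam) {a : A} (ha : Teuk L Lb w x m lam a) :
    L (v * Lb a) = (6 * m * x ^ 2 - 2 * x) * (v * Lb a) - (lam - 2 + 6 * m * x) * a := by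
  unfold Teuk at ha
  simp only [Derivation.leibniz, smul_eq_mul, h.Lv, ha]
  linear_combination -((lam - 2 + 6 * m * x) * a) * h.wv

/-- Differentiating `L_first` along L̲ and multiplying by v removes the remaining q. What is left
has no derivative of p = vL̲a. -/
theorem L_second (h : NullPair L Lb w v x m lam) {a : A} (ha : Teuk L Lb w x m lam a) :
    L (v * Lb (v * Lb a)) = -((lam - 6 * m * x) * (v * Lb a)) - 6 * m * a := by
  have h1 := congrArg Lb (h.L_first ha)
  have hw := h.wv
  have hbp : Lb a = w * (v * Lb a) := by linear_combination -(Lb a) * hw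
  generalize v * Lb a = p at *
  rw [h.comm] at h1
  rw [map_sub, Derivation.leibniz, h.Lbq, Derivation.leibniz] at h1
  simp only [map_add, map_sub, Derivation.leibniz, smul_eq_mul, h.Lbx, h.Lbm, h.Lblam, L_ofNat,
    hbp] at h1
  simp only [Derivation.leibniz, smul_eq_mul, h.Lv, h1]
  linear_combination (-(2 - 12 * m * x) * p - (lam - 2 + 6 * m * x) * p - 6 * m * a) * hw

/-- One more L̲: the source -6m L̲a = -6m w p cancels the derivative of the potential, so the
equation for the second transform closes. -/
theorem RW_of_Teuk (h : NullPair L Lb w v x m lam) {a : A} (ha : Teuk L Lb w x m lam a) :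
    RW L Lb w x m lam (v * Lb (v * Lb a)) := by
  unfold RW
  have hw := h.wv
  rw [h.L_second ha]
  have hbp : Lb a = w * (v * Lb a) := by linear_combination -(Lb a) * hw
  generalize v * Lb a = p at *
  simp only [map_sub, map_neg, Derivation.leibniz, smul_eq_mul, h.Lbx, h.Lbm, h.Lblam, L_ofNat, hbp]
  linear_combination ((lam - 6 * m * x) * Lb p) * hw

/-- Going back with (vL)²: apply L to `L_second` and eliminate Lp by `L_first`. The x-dependent
terms cancel and leave the constant λ(λ-2). This is the Teukolsky-Starobinsky identity within one
spin. -/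
theorem L_fourth (h : NullPair L Lb w v x m lam) {a : A} (ha : Teuk L Lb w x m lam a) :
    w ^ 2 * (v * L (v * L (v * Lb (v * Lb a)))) =
      lam * (lam - 2) * a - 6 * m * (L a + Lb a) := by
  have hw := h.wv
  have h0 := h.L_first ha
  rw [h.L_second ha]
  have hbp : Lb a = w * (v * Lb a) := by linear_combination -(Lb a) * hw
  generalize v * Lb a = p at *
  simp only [map_sub, map_neg, Derivation.leibniz, smul_eq_mul, h.Lx, h.Lm, h.Llam, L_ofNat, hbp,
    h.Lv, h0]
  have e : w ^ 2 * v * v = 1 := by linear_combination (w * v + 1) * hw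
  have e1 : w ^ 2 * v * v * w = w := by linear_combination w * e
  linear_combination (lam * (lam - 2) * a - 6 * m * L a) * e - 6 * m * p * e1

/-- Put u = vLf. The Regge-Wheeler equation reads L̲u = qu - (λ - 6mx)f. Apply L: the left side
vanishes because Lu = 0 and the derivations commute, which leaves a relation without derivatives of
u. -/
theorem six_m_mul (h : NullPair L Lb w v x m lam) {f : A} (hf : RW L Lb w x m lam f)
    (h0 : L (v * L f) = 0) :
    6 * m * f = -((lam - 2 + 6 * m * x) * (v * L f)) := by
  have hw := h.wv
  have hLf : L f = w * (v * L f) := by linear_combination -(L f) * hw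
  generalize v * L f = u at *
  unfold RW at hf
  rw [hLf, Derivation.leibniz, h.Lbw] at hf
  simp only [smul_eq_mul] at hf
  have h1 : Lb u = (6 * m * x ^ 2 - 2 * x) * u - (lam - 6 * m * x) * f := by
    linear_combination v * hf +
      (-(Lb u) + (6 * m * x ^ 2 - 2 * x) * u - (lam - 6 * m * x) * f) * hw
  have h2 := congrArg L h1
  rw [← h.comm, h0, map_zero, map_sub, Derivation.leibniz, h.Lq, h0] at h2
  simp only [map_sub, Derivation.leibniz, smul_eq_mul, h.Lx, h.Lm, h.Llam, L_ofNat, hLf] at h2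
  linear_combination v * h2 + ((6 * m * f) + (lam - 2 + 6 * m * x) * u) * (-hw)

/-- A Regge-Wheeler solution annihilated by `(w⁻¹L)²` and `(w⁻¹L̲)²` vanishes. -/
theorem eq_zero (h : NullPair L Lb w v x m lam) {f : A} (hf : RW L Lb w x m lam f)
    (h0 : L (v * L f) = 0) (h1 : Lb (v * Lb f) = 0)
    (hm : IsUnit m) (hN : IsUnit (lam * (lam - 2))) (hh : IsUnit (lam - 2 + 6 * m * x)) :
    f = 0 := by
  have hw := h.wv
  have e1 := h.six_m_mul hf h0
  have e2 := h.reverse.six_m_mul (hf.rev h) (by simpa using h1)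
  simp only [Derivation.neg_apply] at e2
  -- The reflected relation expresses the same 6mf through L̲f with the opposite sign, so Lf = -L̲f.
  have e3 : (lam - 2 + 6 * m * x) * (v * L f + v * Lb f) = 0 := by linear_combination e1 - e2
  have e4 : v * L f + v * Lb f = 0 := by simpa [hh.mul_right_eq_zero] using e3
  have hLf : L f = w * (v * L f) := by linear_combination -(L f) * hw
  generalize v * L f = u at *
  have hbu : Lb u = 0 := by
    rw [eq_neg_of_add_eq_zero_left e4, map_neg, h1, neg_zero]
  unfold RW at hf
  rw [hLf, Derivation.leibniz, h.Lbw, hbu] at hf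
  simp only [smul_eq_mul] at hf
  -- Now L̲u = 0, so u and f satisfy two linear relations: (λ - 6mx)f = qu and 6mf = -(λ - 2 +
  -- 6mx)u. Eliminating f gives Nu = 0, because (λ - 6mx)(λ - 2 + 6mx) + 6mq = λ(λ - 2).
  have hNu : lam * (lam - 2) * u = 0 := by
    linear_combination (lam - 6 * m * x) * e1 - 6 * m * v * hf +
      (-6 * m * (lam - 6 * m * x) * f + 6 * m * u * (6 * m * x ^ 2 - 2 * x) ) * (-hw) 
  have hu0 : u = 0 := by simpa [hN.mul_right_eq_zero] using hNu
  rw [hu0] at e1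
  have h6 : IsUnit (6 : A) := by
    have := (IsUnit.mk0 (6 : ℂ) (by norm_num)).map (algebraMap ℂ A)
    rwa [map_ofNat] at this
  have : (6 * m) * f = 0 := by linear_combination e1
  simpa [(h6.mul hm).mul_right_eq_zero] using this

/-- This is the computation of `six_m_mul` without the assumption that the second transform
vanishes. -/
theorem Lb_op (h : NullPair L Lb w v x m lam) {f : A} (hf : RW L Lb w x m lam f) :
    v * Lb (w ^ 2 * (v * L (v * L f))) =
      -(w * ((lam - 2 + 6 * m * x) * (v * L f) + 6 * m * f)) := by
  have hw := h.wv
  have hLf : L f = w * (v * L f) := by linear_combination -(L f) * hw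
  generalize v * L f = u at *
  unfold RW at hf
  rw [hLf, Derivation.leibniz, h.Lbw] at hf
  simp only [smul_eq_mul] at hf
  have h1 : Lb u = (6 * m * x ^ 2 - 2 * x) * u - (lam - 6 * m * x) * f := by
    linear_combination v * hf +
      (-(Lb u) + (6 * m * x ^ 2 - 2 * x) * u - (lam - 6 * m * x) * f) * hw
  have h2 := congrArg L h1
  rw [← h.comm, map_sub, Derivation.leibniz, h.Lq] at h2
  simp only [map_sub, Derivation.leibniz, smul_eq_mul, h.Lx, h.Lm, h.Llam, L_ofNat, hLf] at h2
  have hX : w ^ 2 * (v * L u) = w * L u := by linear_combination w * L u * hw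
  rw [hX, Derivation.leibniz, h.Lbw]
  simp only [smul_eq_mul, h2]
  linear_combination (-(w * ((lam - 2 + 6 * m * x) * u + 6 * m * f))) * hw

/-- The counterpart of `L_fourth` on the Regge-Wheeler side: the transforms composed in the other
order give the same constant-coefficient operator in ∂_t. -/
theorem Lb_Lb_op (h : NullPair L Lb w v x m lam) {f : A} (hf : RW L Lb w x m lam f) :
    v * Lb (v * Lb (w ^ 2 * (v * L (v * L f)))) =
      lam * (lam - 2) * f - 6 * m * (L f + Lb f) := by
  have hw := h.wv
  rw [h.Lb_op hf]
  have hLf : L f = w * (v * L f) := by linear_combination -(L f) * hw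
  generalize v * L f = u at *
  unfold RW at hf
  rw [hLf, Derivation.leibniz, h.Lbw] at hf
  simp only [smul_eq_mul] at hf
  have h1 : Lb u = (6 * m * x ^ 2 - 2 * x) * u - (lam - 6 * m * x) * f := by
    linear_combination v * hf +
      (-(Lb u) + (6 * m * x ^ 2 - 2 * x) * u - (lam - 6 * m * x) * f) * hw
  simp only [map_neg, map_sub, map_add, Derivation.leibniz, smul_eq_mul, h.Lbx, h.Lbm, h.Lblam,
    L_ofNat, hLf, h1, h.Lbw]
  linear_combination (lam * (lam - 2) * f - 6 * m * (w * u + Lb f)) * hw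

/-- Used for the first-order relation between the defect y and vL̲y in `defect_special`. The
combination on the left is chosen so that the terms in f itself disappear. -/
theorem Lb_op_add (h : NullPair L Lb w v x m lam) {f : A} (hf : RW L Lb w x m lam f) :
    (lam - 6 * m * x) * (v * Lb (w ^ 2 * (v * L (v * L f))))
        + 6 * m * (w ^ 2 * (v * L (v * L f))) =
      -(lam * (lam - 2) * L f) + 6 * m * L (L f + Lb f) := by
  have hw := h.wv
  rw [h.Lb_op hf, map_add, ← h.comm f]
  unfold RW at hf
  rw [hf]
  have hLf : L f = w * (v * L f) := by linear_combination -(L f) * hw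
  generalize v * L f = u at *
  have hX : w ^ 2 * (v * L u) = w * L u := by linear_combination w * L u * hw
  rw [hX, hLf, Derivation.leibniz, h.Lw]
  simp only [smul_eq_mul]
  ring

end NullPair
end
end TeukolskySAdS

/-! ### Pairs of Teukolsky modes: the two equivalences at the algebraic level -/

open scoped ContDiff
namespace TeukolskySAdS
open Set Filter Topology
noncomputable section

namespace NullPair

variable {A : Type*} [CommRing A] [Algebra ℂ A] {L Lb : Derivation ℂ A A} {w v x m lam : A}

/-- L + L̲ = 2∂_t annihilates w and v and commutes with L, hence commutes with the whole operator.
-/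
theorem op_sum (h : NullPair L Lb w v x m lam) (f : A) :
    w ^ 2 * (v * L (v * L (L f + Lb f))) =
      L (w ^ 2 * (v * L (v * L f))) + Lb (w ^ 2 * (v * L (v * L f))) := by
  have h1 : L (v * L f) + Lb (v * L f) = v * L (L f + Lb f) := by
    simp only [map_add, Derivation.leibniz, smul_eq_mul, h.Lv, h.Lbv, h.comm]
    ring
  rw [← h1]
  generalize v * L f = u
  simp only [map_add, Derivation.leibniz, Derivation.leibniz_pow, smul_eq_mul, h.Lv, h.Lbv, h.comm,
    h.Lw, h.Lbw, nsmul_eq_mul]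
  push_cast
  ring

theorem L_N (h : NullPair L Lb w v x m lam) : L (lam * (lam - 2)) = 0 := by
  simp [Derivation.leibniz, h.Llam, L_ofNat]

theorem L_six_m (h : NullPair L Lb w v x m lam) : L (6 * m) = 0 := by
  simp [Derivation.leibniz, h.Lm, L_ofNat]

theorem op_const_mul {c : A} (hc : L c = 0) (f : A) :
    w ^ 2 * (v * L (v * L (c * f))) = c * (w ^ 2 * (v * L (v * L f))) := by
  have e1 : L (c * f) = c * L f := by simp [Derivation.leibniz, hc]
  have e2 : L (v * (c * L f)) = c * L (v * L f) := by
    rw [show v * (c * L f) = c * (v * L f) by ring]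
    simp [Derivation.leibniz, hc]
  rw [e1, e2]
  ring

theorem leibniz_const {c : A} (hc : L c = 0) (f : A) : L (c * f) = c * L f := by
  simp [Derivation.leibniz, hc]

theorem op_add (f g : A) :
    w ^ 2 * (v * L (v * L (f + g))) =
      w ^ 2 * (v * L (v * L f)) + w ^ 2 * (v * L (v * L g)) := by
  simp only [map_add, mul_add]

theorem op_sub (f g : A) :
    w ^ 2 * (v * L (v * L (f - g))) =
      w ^ 2 * (v * L (v * L f)) - w ^ 2 * (v * L (v * L g)) := by
  simp only [map_sub, mul_sub]

theorem RW.sub {f g : A} (hf : RW L Lb w x m lam f) (hg : RW L Lb w x m lam g) :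
    RW L Lb w x m lam (f - g) := by
  unfold RW at *
  rw [map_sub, map_sub, hf, hg]; ring

theorem RW.add {f g : A} (hf : RW L Lb w x m lam f) (hg : RW L Lb w x m lam g) :
    RW L Lb w x m lam (f + g) := by
  unfold RW at *
  rw [map_add, map_add, hf, hg]; ring

theorem RW.const_mul {c f : A} (hc : L c = 0) (hc' : Lb c = 0) (hf : RW L Lb w x m lam f) :
    RW L Lb w x m lam (c * f) := by
  unfold RW at *
  simp only [Derivation.leibniz, hc, hc', smul_eq_mul, mul_zero, add_zero, hf]
  ring

/-- The Regge-Wheeler coefficients are stationary, so ∂_t maps solutions to solutions. -/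
theorem RW.sum (h : NullPair L Lb w v x m lam) {f : A} (hf : RW L Lb w x m lam f) :
    RW L Lb w x m lam (L f + Lb f) := by
  unfold RW at *
  have e : Lb (L (L f + Lb f)) = L (Lb (L f)) + Lb (Lb (L f)) := by
    rw [map_add, map_add, h.comm, h.comm f]
  rw [e, hf]
  simp only [map_neg, map_sub, Derivation.leibniz, smul_eq_mul, h.Lx, h.Lbx, h.Lm, h.Lbm, h.Llam,
    h.Lblam, h.Lw, h.Lbw, L_ofNat]
  ring

/-- Data of a mode of a solution of the Teukolsky system. -/
structure TeukPair (L Lb : Derivation ℂ A A) (w v x m lam a b : A) : Prop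
    extends NullPair L Lb w v x m lam where
  ha : Teuk L Lb w x m lam a
  hb : Teuk (-Lb) (-L) w x m lam b

namespace TeukPair

variable {a b : A}

theorem rev (h : TeukPair L Lb w v x m lam a b) : TeukPair (-Lb) (-L) w v x m lam b a where
  toNullPair := h.reverse
  ha := h.hb
  hb := by simpa using h.ha

theorem RWp (h : TeukPair L Lb w v x m lam a b) : RW L Lb w x m lam (v * Lb (v * Lb a)) :=
  h.RW_of_Teuk h.ha

theorem RWm (h : TeukPair L Lb w v x m lam a b) : RW L Lb w x m lam (v * L (v * L b)) := by
  simpa using (h.rev.RWp).rev h.reverse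

theorem op_p (h : TeukPair L Lb w v x m lam a b) :
    w ^ 2 * (v * L (v * L (v * Lb (v * Lb a)))) =
      lam * (lam - 2) * a - 6 * m * (L a + Lb a) :=
  h.L_fourth h.ha

theorem op_m (h : TeukPair L Lb w v x m lam a b) :
    w ^ 2 * (v * Lb (v * Lb (v * L (v * L b)))) =
      lam * (lam - 2) * b + 6 * m * (L b + Lb b) := by
  have := h.rev.op_p
  simp only [Derivation.neg_apply, mul_neg, map_neg, neg_neg] at this
  rw [this]; ring

theorem cancel_op (h : NullPair L Lb w v x m lam) {f : A}
    (hf : w ^ 2 * (v * L (v * L f)) = 0) : L (v * L f) = 0 := by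
  linear_combination v * hf - ((w * v + 1) * L (v * L f)) * h.wv

/-- The Teukolsky-Starobinsky relations of a symmetrised mode are equivalent to `Ψ^D = 0`. -/
theorem dirichlet_iff (h : TeukPair L Lb w v x m lam a b)
    (hm : IsUnit m) (hN : IsUnit (lam * (lam - 2))) (hh : IsUnit (lam - 2 + 6 * m * x)) :
    (w ^ 2 * (v * L (v * L (v * L (v * L b)))) = lam * (lam - 2) * a - 6 * m * (L a + Lb a) ∧
     w ^ 2 * (v * Lb (v * Lb (v * Lb (v * Lb a)))) =
        lam * (lam - 2) * b + 6 * m * (L b + Lb b)) ↔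
    v * Lb (v * Lb a) - v * L (v * L b) = 0 := by
  -- After this both right-hand sides are transforms of Ψ₊ and Ψ₋, and the relations say that the
  -- two operators agree on Ψ₊ and Ψ₋.
  rw [← h.op_p, ← h.op_m]
  constructor
  · rintro ⟨h1, h2⟩
    refine h.eq_zero (h.RWp.sub h.RWm) (cancel_op h.toNullPair ?_) ?_ hm hN hh
    · rw [op_sub, h1, sub_self]
    · have := cancel_op h.reverse (f := v * Lb (v * Lb a) - v * L (v * L b)) ?_
      · simpa only [Derivation.neg_apply, mul_neg, map_neg, neg_neg] using this
      · rw [op_sub]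
        simp only [Derivation.neg_apply, mul_neg, map_neg, neg_neg]
        rw [h2, sub_self]
  · intro h1
    rw [sub_eq_zero] at h1
    rw [h1]
    exact ⟨rfl, rfl⟩

/-- The antisymmetric Teukolsky-Starobinsky relations imply `Ψ^R = 0`. -/
theorem robin_eq_zero (h : TeukPair L Lb w v x m lam a b)
    (hm : IsUnit m) (hN : IsUnit (lam * (lam - 2))) (hh : IsUnit (lam - 2 + 6 * m * x))
    (h1 : w ^ 2 * (v * L (v * L (v * L (v * L b)))) =
      -(lam * (lam - 2) * a) - 6 * m * (L a + Lb a))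
    (h2 : w ^ 2 * (v * Lb (v * Lb (v * Lb (v * Lb a)))) =
      -(lam * (lam - 2) * b) + 6 * m * (L b + Lb b)) :
    lam * (lam - 2) * (v * Lb (v * Lb a) + v * L (v * L b)) +
      6 * m * (L (v * Lb (v * Lb a) - v * L (v * L b)) +
        Lb (v * Lb (v * Lb a) - v * L (v * L b))) = 0 := by
  have hp := h.op_p
  have hq := h.op_m
  -- Here p, q stand for Ψ₊, Ψ₋. The image is N(-12m Ta) + 6m T(2Na) = 0. It is stated for arbitrary
  -- derivations so that it also applies to the reflected pair.
  have key : ∀ {L Lb : Derivation ℂ A A} {a b p q : A}, TeukPair L Lb w v x m lam a b →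
      w ^ 2 * (v * L (v * L p)) = lam * (lam - 2) * a - 6 * m * (L a + Lb a) →
      w ^ 2 * (v * L (v * L q)) = -(lam * (lam - 2) * a) - 6 * m * (L a + Lb a) →
      w ^ 2 * (v * L (v * L (lam * (lam - 2) * (p + q) +
        6 * m * (L (p - q) + Lb (p - q))))) = 0 := by
    intro L Lb a b p q h hp hq
    have hNb : Lb (lam * (lam - 2)) = 0 := neg_eq_zero.mp h.reverse.L_N
    have hmb : Lb (6 * m) = 0 := neg_eq_zero.mp h.reverse.L_six_m
    rw [op_add, op_const_mul h.L_N, op_const_mul h.L_six_m, h.op_sum, op_add, op_sub, hp, hq]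
    have e : lam * (lam - 2) * a - 6 * m * (L a + Lb a) -
      (-(lam * (lam - 2) * a) - 6 * m * (L a + Lb a)) = 2 * ((lam * (lam - 2)) * a) := by ring
    rw [e]
    have h2 : L (2 * ((lam * (lam - 2)) * a)) = 2 * ((lam * (lam - 2)) * L a) := by
      rw [Derivation.leibniz, Derivation.leibniz, h.L_N, L_ofNat]; simp
    have h2' : Lb (2 * ((lam * (lam - 2)) * a)) = 2 * ((lam * (lam - 2)) * Lb a) := by
      rw [Derivation.leibniz, Derivation.leibniz, hNb, L_ofNat]; simp
    rw [h2, h2']; ring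
  have hNb : Lb (lam * (lam - 2)) = 0 := neg_eq_zero.mp h.reverse.L_N
  have hmb : Lb (6 * m) = 0 := neg_eq_zero.mp h.reverse.L_six_m
  refine h.eq_zero ?_ (cancel_op h.toNullPair (key h hp h1)) ?_ hm hN hh
  · exact ((h.RWp.add h.RWm).const_mul h.L_N hNb).add
      (((h.RWp.sub h.RWm).sum h.toNullPair).const_mul h.L_six_m hmb)
  -- The reflection changes the sign of T and exchanges p and q, so the combination N(p + q) + 6m
  -- T(p - q) is invariant.
  · have := cancel_op h.reverse (key h.rev (p := v * L (v * L b)) (q := v * Lb (v * Lb a)) ?_ ?_)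
    · simp only [Derivation.neg_apply, mul_neg, map_neg, neg_neg] at this
      rw [← this]
      congr 2
      congr 1
      simp only [map_sub]
      ring_nf
    · simpa using h.rev.op_p
    · simp only [Derivation.neg_apply, mul_neg, map_neg, neg_neg, h2]
      ring

/-- The defect of the first antisymmetric Teukolsky-Starobinsky relation. -/
theorem defect_eq (h : TeukPair L Lb w v x m lam a b) :
    w ^ 2 * (v * L (v * L (v * L (v * L b)))) + lam * (lam - 2) * a + 6 * m * (L a + Lb a) =
      2 * (lam * (lam - 2)) * a -
        w ^ 2 * (v * L (v * L (v * Lb (v * Lb a) - v * L (v * L b)))) := by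
  rw [op_sub, h.op_p]; ring

/-- When `Ψ^R = 0` the defect of the first antisymmetric Teukolsky-Starobinsky relation is an
algebraically special solution. -/
theorem defect_special (h : TeukPair L Lb w v x m lam a b)
    (h0 : lam * (lam - 2) * (v * Lb (v * Lb a) + v * L (v * L b)) +
      6 * m * (L (v * Lb (v * Lb a) - v * L (v * L b)) +
        Lb (v * Lb (v * Lb a) - v * L (v * L b))) = 0) {y : A}
    (hy : y = w ^ 2 * (v * L (v * L (v * L (v * L b)))) + lam * (lam - 2) * a +
      6 * m * (L a + Lb a)) :
    lam * (lam - 2) * y = 6 * m * (L y + Lb y) ∧ v * Lb (v * Lb y) = 0 ∧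
      (lam - 6 * m * x) * (v * Lb y) + 6 * m * y = 0 := by
  have hNb : Lb (lam * (lam - 2)) = 0 := neg_eq_zero.mp h.reverse.L_N
  have hmb : Lb (6 * m) = 0 := neg_eq_zero.mp h.reverse.L_six_m
  have hN := h.L_N
  have hm := h.L_six_m
  have hp := h.op_p
  have hD := h.RWp.sub h.RWm
  have h2N : Lb (2 * (lam * (lam - 2))) = 0 := by
    rw [Derivation.leibniz, hNb, L_ofNat]; simp
  refine ⟨?_, ?_, ?_⟩
  -- Applying w²(vL)² to the hypothesis replaces Ψ₊ by Na - 6m Ta and Ψ₋ by y - Na - 6m Ta. The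
  -- terms in a then cancel, leaving Ny = 6m Ty.
  · have h1 : w ^ 2 * (v * L (v * L (lam * (lam - 2) * (v * Lb (v * Lb a) + v * L (v * L b)) +
      6 * m * (L (v * Lb (v * Lb a) - v * L (v * L b)) +
        Lb (v * Lb (v * Lb a) - v * L (v * L b)))))) = 0 := by
      rw [h0]; simp
    rw [op_add, op_const_mul hN, op_const_mul hm, h.op_sum, op_add, op_sub, hp] at h1
    rw [hy]
    generalize w ^ 2 * (v * L (v * L (v * L (v * L b)))) = q at *
    generalize lam * (lam - 2) = N at *
    generalize 6 * m = c at *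
    simp only [map_add, map_sub, Derivation.leibniz, hN, hm, hNb, hmb, smul_eq_mul] at h1 ⊢
    linear_combination h1
  -- With y = 2Na - w²(vL)²(Ψ₊ - Ψ₋), the identity `Lb_Lb_op` shows that (vL̲)²y is exactly the left
  -- side of the hypothesis.
  · rw [hy, h.defect_eq]
    have hRp : ∀ f : A, v * Lb (v * Lb (2 * (lam * (lam - 2)) * a - f)) =
        2 * (lam * (lam - 2)) * (v * Lb (v * Lb a)) - v * Lb (v * Lb f) := by
      intro f
      have e1 : Lb (2 * (lam * (lam - 2)) * a) = 2 * (lam * (lam - 2)) * Lb a := by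
        rw [Derivation.leibniz, h2N]; simp
      rw [map_sub, mul_sub, map_sub, e1,
        show v * (2 * (lam * (lam - 2)) * Lb a) = 2 * (lam * (lam - 2)) * (v * Lb a) by ring,
        Derivation.leibniz, h2N]
      simp only [smul_eq_mul]
      ring
    rw [hRp, h.Lb_Lb_op hD]
    linear_combination h0
  · rw [hy, h.defect_eq]
    have e := h.Lb_op_add hD
    have e2 := h.L_second h.ha
    have e3 := congrArg L h0
    have e1 : Lb (2 * (lam * (lam - 2)) * a) = 2 * (lam * (lam - 2)) * Lb a := by
      rw [Derivation.leibniz, h2N]; simp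
    rw [map_zero, map_add, leibniz_const hN, leibniz_const hm, map_add L (v * Lb (v * Lb a))] at e3
    rw [map_sub Lb, e1]
    have e4 := map_sub L (v * Lb (v * Lb a)) (v * L (v * L b))
    linear_combination -e + 2 * (lam * (lam - 2)) * e2 - e3 + lam * (lam - 2) * e4

end TeukPair
end NullPair
end
end TeukolskySAdS

open scoped ContDiff
namespace TeukolskySAdS
open Set Filter Topology
noncomputable section

/-! ### The algebra of smooth functions on a set -/

open Classical in
/-- Extension by zero. -/
def extZ {E : Type*} {s : Set E} (F : s → ℂ) (x : E) : ℂ := if h : x ∈ s then F ⟨x, h⟩ else 0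

theorem extZ_of_mem {E : Type*} {s : Set E} (F : s → ℂ) {x : E} (h : x ∈ s) : extZ F x = F ⟨x, h⟩ := by
  simp [extZ, h]

section SmoothAlgebra

variable {E : Type*} [NormedAddCommGroup E] [NormedSpace ℝ E]

/-- A set on which derivatives are unique and symmetric. -/
class NiceSet (s : Set E) : Prop where
  uniq : UniqueDiffOn ℝ s
  sub_closure : s ⊆ closure (interior s)

theorem NiceSet.of_convex {s : Set E} (hs : Convex ℝ s) (h : (interior s).Nonempty) :
    NiceSet s where
  uniq := uniqueDiffOn_convex hs h
  sub_closure := by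
    rw [hs.closure_interior_eq_closure_of_nonempty_interior h]
    exact subset_closure

/-- The algebra of smooth complex functions on `s`. -/
def smAlg (s : Set E) : Subalgebra ℂ (s → ℂ) where
  carrier := {F | ContDiffOn ℝ ∞ (extZ F) s}
  mul_mem' {F G} hF hG := (hF.mul hG).congr fun x hx => by simp [extZ_of_mem, hx]
  add_mem' {F G} hF hG := (hF.add hG).congr fun x hx => by simp [extZ_of_mem, hx]
  algebraMap_mem' c := (contDiffOn_const (c := c)).congr fun x hx => by simp [extZ_of_mem, hx]

variable {s : Set E}

/-- The smooth function on `s` given by a function which is smooth on `s`. -/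
def smMk (f : E → ℂ) (hf : ContDiffOn ℝ ∞ f s) : smAlg s :=
  ⟨fun x => f x, hf.congr fun x hx => by simp [extZ_of_mem, hx]⟩

/-- Value of (the extension by zero of) a smooth function. -/
def smEv (F : smAlg s) (x : E) : ℂ := extZ F.1 x

theorem smEv_mem (F : smAlg s) {x : E} (h : x ∈ s) : smEv F x = F.1 ⟨x, h⟩ := extZ_of_mem _ h

theorem smEv_contDiffOn (F : smAlg s) : ContDiffOn ℝ ∞ (smEv F) s := F.2

theorem sm_ext {F G : smAlg s} (h : ∀ x ∈ s, smEv F x = smEv G x) : F = G := by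
  apply Subtype.ext
  funext x
  simpa [smEv_mem _ x.2] using h x.1 x.2

theorem smEv_smMk (f : E → ℂ) (hf : ContDiffOn ℝ ∞ f s) {x : E} (h : x ∈ s) :
    smEv (smMk f hf) x = f x := by rw [smEv_mem _ h]; rfl

theorem smEv_add (F G : smAlg s) (x : E) : smEv (F + G) x = smEv F x + smEv G x := by
  simp only [smEv, extZ]; split_ifs <;> simp

theorem smEv_sub (F G : smAlg s) (x : E) : smEv (F - G) x = smEv F x - smEv G x := by
  simp only [smEv, extZ]; split_ifs <;> simp

theorem smEv_neg (F : smAlg s) (x : E) : smEv (-F) x = -smEv F x := by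
  simp only [smEv, extZ]; split_ifs <;> simp

theorem smEv_mul (F G : smAlg s) (x : E) : smEv (F * G) x = smEv F x * smEv G x := by
  simp only [smEv, extZ]; split_ifs <;> simp

theorem smEv_smul (c : ℂ) (F : smAlg s) (x : E) : smEv (c • F) x = c * smEv F x := by
  simp only [smEv, extZ]; split_ifs <;> simp

theorem smEv_zero (x : E) : smEv (0 : smAlg s) x = 0 := by
  simp only [smEv, extZ]; split_ifs <;> simp

theorem smEv_one {x : E} (h : x ∈ s) : smEv (1 : smAlg s) x = 1 := by
  rw [smEv_mem _ h]; simp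

theorem smEv_pow (F : smAlg s) (n : ℕ) {x : E} (h : x ∈ s) : smEv (F ^ n) x = smEv F x ^ n := by
  rw [smEv_mem _ h, smEv_mem _ h]; simp

theorem smEv_algebraMap (c : ℂ) {x : E} (h : x ∈ s) : smEv (algebraMap ℂ (smAlg s) c) x = c := by
  rw [smEv_mem _ h]; rfl

theorem smEv_ofNat (n : ℕ) [n.AtLeastTwo] {x : E} (h : x ∈ s) :
    smEv (ofNat(n) : smAlg s) x = ofNat(n) := by
  rw [smEv_mem _ h]; rfl

theorem smEv_differentiable (F : smAlg s) {x : E} (h : x ∈ s) :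
    DifferentiableWithinAt ℝ (smEv F) s x :=
  ((smEv_contDiffOn F).differentiableOn (by simp)) x h

theorem smEv_continuousOn (F : smAlg s) : ContinuousOn (smEv F) s := (smEv_contDiffOn F).continuousOn

variable {E' : Type*} [NormedAddCommGroup E'] [NormedSpace ℝ E'] {s' : Set E'}

/-- Pull-back along a continuous linear map. -/
def pull (p : E →L[ℝ] E') (hp : MapsTo p s s') : smAlg s' →ₐ[ℂ] smAlg s where
  toFun a := smMk (fun x => smEv a (p x)) ((smEv_contDiffOn a).comp p.contDiff.contDiffOn hp)
  map_one' := sm_ext fun x hx => by rw [smEv_smMk _ _ hx, smEv_one hx, smEv_one (hp hx)]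
  map_mul' a b := sm_ext fun x hx => by simp only [smEv_mul, smEv_smMk _ _ hx]
  map_zero' := sm_ext fun x hx => by simp only [smEv_zero, smEv_smMk _ _ hx]
  map_add' a b := sm_ext fun x hx => by simp only [smEv_add, smEv_smMk _ _ hx]
  commutes' c := sm_ext fun x hx => by
    rw [smEv_smMk _ _ hx, smEv_algebraMap c hx, smEv_algebraMap c (hp hx)]

theorem smEv_pull (p : E →L[ℝ] E') (hp : MapsTo p s s') (a : smAlg s') {x : E} (hx : x ∈ s) :
    smEv (pull p hp a) x = smEv a (p x) := smEv_smMk _ _ hx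

/-- Complex conjugation. -/
def smConj (F : smAlg s) : smAlg s :=
  smMk (fun x => (starRingEnd ℂ) (smEv F x))
    (Complex.conjCLE.contDiff.comp_contDiffOn (smEv_contDiffOn F))

theorem smEv_conj (F : smAlg s) (x : E) : smEv (smConj F) x = (starRingEnd ℂ) (smEv F x) := by
  by_cases hx : x ∈ s
  · exact smEv_smMk _ _ hx
  · simp [smEv, extZ, hx]

variable [hs : NiceSet s]

theorem contDiffOn_pd (F : smAlg s) (v : E) :
    ContDiffOn ℝ ∞ (fun x => fderivWithin ℝ (smEv F) s x v) s :=
  ((smEv_contDiffOn F).fderivWithin hs.uniq (by simp)).clm_apply contDiffOn_const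

/-- The derivative along `v`, as a linear map. -/
def pdLin (v : E) : smAlg s →ₗ[ℂ] smAlg s where
  toFun F := smMk (fun x => fderivWithin ℝ (smEv F) s x v) (contDiffOn_pd F v)
  map_add' F G := sm_ext fun x hx => by
    rw [smEv_smMk _ _ hx, smEv_add, smEv_smMk _ _ hx, smEv_smMk _ _ hx]
    have : smEv (F + G) = smEv F + smEv G := funext fun y => smEv_add F G y
    rw [this, fderivWithin_add (hs.uniq x hx) (smEv_differentiable F hx) (smEv_differentiable G hx)]
    rfl
  map_smul' c F := sm_ext fun x hx => by
    rw [RingHom.id_apply, smEv_smMk _ _ hx, smEv_smul, smEv_smMk _ _ hx]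
    have : smEv (c • F) = c • smEv F := funext fun y => smEv_smul c F y
    rw [this, fderivWithin_const_smul (hs.uniq x hx)]
    · rfl
    · exact smEv_differentiable F hx

/-- The derivation along `v`. -/
def pd (v : E) : Derivation ℂ (smAlg s) (smAlg s) :=
  Derivation.mk' (pdLin v) fun F G => sm_ext fun x hx => by
    have hm : smEv (F * G) = fun y => smEv F y * smEv G y := funext fun y => smEv_mul F G y
    simp only [smul_eq_mul, smEv_add, smEv_mul]
    change smEv (smMk _ _) x = smEv F x * smEv (smMk _ _) x + smEv G x * smEv (smMk _ _) x
    rw [smEv_smMk _ _ hx, smEv_smMk _ _ hx, smEv_smMk _ _ hx, hm,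
      fderivWithin_fun_mul (hs.uniq x hx) (smEv_differentiable F hx) (smEv_differentiable G hx)]
    simp

theorem smEv_pd (v : E) (F : smAlg s) {x : E} (hx : x ∈ s) :
    smEv (pd v F) x = fderivWithin ℝ (smEv F) s x v := smEv_smMk _ _ hx

/-- The set contains the boundary t⋆ = t0. Second derivatives within it are still symmetric because
every point is a limit of interior points. -/
theorem pd_comm (v u : E) (F : smAlg s) : pd v (pd u F) = pd u (pd v F) := by
  refine sm_ext fun x hx => ?_
  have hsym : IsSymmSndFDerivWithinAt ℝ (smEv F) s x :=
    ((smEv_contDiffOn F) x hx).isSymmSndFDerivWithinAt (n := ∞) (by simpa using WithTop.coe_le_coe.mpr (le_top : (2 : ℕ∞) ≤ ⊤)) hs.uniq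
      (hs.sub_closure hx) hx
  have hd : DifferentiableWithinAt ℝ (fderivWithin ℝ (smEv F) s) s x :=
    ((smEv_contDiffOn F).fderivWithin hs.uniq (m := 1) (by norm_cast)).differentiableOn one_ne_zero x hx
  have key : ∀ v u : E, smEv (pd v (pd u F)) x =
      fderivWithin ℝ (fderivWithin ℝ (smEv F) s) s x v u := by
    intro v u
    rw [smEv_pd _ _ hx, fderivWithin_congr (fun y hy => smEv_pd u F hy) (smEv_pd u F hx),
      fderivWithin_clm_apply (hs.uniq x hx) hd (differentiableWithinAt_const u)]
    simp
  rw [key, key]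
  exact hsym v u

theorem pd_smMk (f : E → ℂ) (hf : ContDiffOn ℝ ∞ f s) (v : E) {x : E} (hx : x ∈ s) :
    smEv (pd v (smMk f hf)) x = fderivWithin ℝ f s x v := by
  rw [smEv_pd _ _ hx]
  rw [fderivWithin_congr (fun y hy => smEv_smMk f hf hy) (smEv_smMk f hf hx)]

/-- The derivative of a smooth function along a curve in `s`. -/
theorem smEv_comp_hasDerivWithinAt (F : smAlg s) {γ : ℝ → E} {v : E} {J : Set ℝ} {τ : ℝ}
    (hγ : HasDerivWithinAt γ v J τ) (hm : MapsTo γ J s) (hτ : γ τ ∈ s) :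
    HasDerivWithinAt (fun y => smEv F (γ y)) (smEv (pd v F) (γ τ)) J τ := by
  rw [smEv_pd _ _ hτ]
  exact (smEv_differentiable F hτ).hasFDerivWithinAt.comp_hasDerivWithinAt τ hγ hm

theorem pd_pull [NiceSet s'] (p : E →L[ℝ] E') (hp : MapsTo p s s') (a : smAlg s') (v : E) :
    pd v (pull p hp a) = pull p hp (pd (p v) a) := sm_ext fun x hx => by
  rw [smEv_pd _ _ hx, smEv_pull _ _ _ hx, smEv_pd _ _ (hp hx),
    fderivWithin_congr (fun y hy => smEv_pull p hp a hy) (smEv_pull p hp a hx)]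
  have := ((smEv_differentiable a (hp hx)).hasFDerivWithinAt.comp x
    p.hasFDerivWithinAt hp).fderivWithin (hs.uniq x hx)
  change fderivWithin ℝ (smEv a ∘ p) s x v = _
  rw [this]
  rfl

theorem pd_conj (v : E) (F : smAlg s) : pd v (smConj F) = smConj (pd v F) := sm_ext fun x hx => by
  rw [smEv_conj, smEv_pd _ _ hx, smEv_pd _ _ hx]
  have h2 : (smEv (smConj F)) = Complex.conjCLE ∘ smEv F := funext fun y => smEv_conj F y
  have := ((Complex.conjCLE : ℂ →L[ℝ] ℂ).hasFDerivAt.comp_hasFDerivWithinAt x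
    (smEv_differentiable F hx).hasFDerivWithinAt).fderivWithin (hs.uniq x hx)
  rw [h2]
  change fderivWithin ℝ ((Complex.conjCLE : ℂ →L[ℝ] ℂ) ∘ smEv F) s x v = _
  rw [this]
  rfl

end SmoothAlgebra
end
end TeukolskySAdS

open scoped ContDiff
namespace TeukolskySAdS
open Set Filter Topology
noncomputable section

/-! ### The background -/

/-- The parameters of a Schwarzschild-AdS exterior. -/
structure Background (M k rp : ℝ) : Prop where
  M_pos : 0 < M
  k_pos : 0 < k
  rp_nonneg : 0 ≤ rp
  Del_pos : ∀ r, rp < r → 0 < Del M k r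

theorem Background.of_isGreatest {M k rp : ℝ} (hM : 0 < M) (hk : 0 < k)
    (hrp : IsGreatest {r : ℝ | Del M k r = 0} rp) : Background M k rp where
  M_pos := hM
  k_pos := hk
  rp_nonneg := hrp.2 (by simp [Del])
  Del_pos r hr := by
    by_contra! h
    have h0 : 0 ≤ rp := hrp.2 (by simp [Del])
    -- Δ ≥ 0 beyond r = 2M, so Δ ≤ 0 at some r > rp would force a root to the right of rp by the
    -- intermediate value theorem.
    set R := max r (2 * M + 1) with hR
    have hR1 : 2 * M + 1 ≤ R := le_max_right _ _
    have hR2 : r ≤ R := le_max_left _ _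
    have hpos : 0 ≤ Del M k R := by
      have : Del M k R = R * (R - 2 * M) + k ^ 2 * R ^ 4 := by unfold Del; ring
      rw [this]
      have h1 : 0 ≤ R := by linarith
      have h2 : 0 ≤ R - 2 * M := by linarith
      positivity
    have hc : ContinuousOn (Del M k) (Icc r R) := by
      unfold Del; fun_prop
    obtain ⟨c, hc1, hc2⟩ := intermediate_value_Icc hR2 hc ⟨h, hpos⟩
    have := hrp.2 (show c ∈ {r : ℝ | Del M k r = 0} from hc2)
    linarith [hc1.1]

instance niceSet_Ioi (a : ℝ) : NiceSet (Ioi a) :=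
  NiceSet.of_convex (convex_Ioi a) ⟨a + 1, by simp⟩

section Radial

variable {rp : ℝ}

/-- A smooth real radial function as an element of the algebra of radial functions. -/
def rmk (a : ℝ → ℝ) (ha : ContDiffOn ℝ ∞ a (Ioi rp)) : smAlg (Ioi rp) :=
  smMk (fun r => (a r : ℂ)) (Complex.ofRealCLM.contDiff.comp_contDiffOn ha)

theorem smEv_rmk (a : ℝ → ℝ) (ha : ContDiffOn ℝ ∞ a (Ioi rp)) {r : ℝ} (hr : rp < r) :
    smEv (rmk a ha) r = a r := smEv_smMk _ _ hr

theorem smEv_pd_rmk {a : ℝ → ℝ} (ha : ContDiffOn ℝ ∞ a (Ioi rp)) {r a' : ℝ} (hr : rp < r)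
    (h : HasDerivAt a a' r) : smEv (pd 1 (rmk a ha)) r = a' := by
  refine (pd_smMk (fun r => (a r : ℂ)) _ 1 (mem_Ioi.2 hr)).trans ?_
  have := h.ofReal_comp.hasFDerivAt.hasFDerivWithinAt (s := Ioi rp)
  rw [this.fderivWithin ((niceSet_Ioi rp).uniq r hr)]
  simp

end Radial

namespace Background

variable {M k rp : ℝ}

theorem r_pos (hB : Background M k rp) {r : ℝ} (hr : rp < r) : 0 < r := hB.rp_nonneg.trans_lt hr

theorem w_pos (hB : Background M k rp) {r : ℝ} (hr : rp < r) : 0 < wfun M k r :=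
  div_pos (hB.Del_pos r hr) (pow_pos (hB.r_pos hr) 4)

theorem contDiff_Del : ContDiff ℝ ∞ (Del M k) := by unfold Del; fun_prop

theorem smooth_inv (hB : Background M k rp) : ContDiffOn ℝ ∞ (fun r : ℝ => r⁻¹) (Ioi rp) :=
  contDiffOn_id.inv fun _ hr => (hB.r_pos hr).ne'

theorem smooth_w (hB : Background M k rp) : ContDiffOn ℝ ∞ (wfun M k) (Ioi rp) := by
  unfold wfun
  exact (contDiff_Del (M := M) (k := k)).contDiffOn.div (contDiffOn_id.pow 4)
    fun r hr => (pow_pos (hB.r_pos hr) 4).ne'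

theorem smooth_v (hB : Background M k rp) : ContDiffOn ℝ ∞ (fun r => (wfun M k r)⁻¹) (Ioi rp) :=
  hB.smooth_w.inv fun _ hr => (hB.w_pos hr).ne'

theorem smooth_f (hB : Background M k rp) : ContDiffOn ℝ ∞ (fun r => Del M k r / r ^ 2) (Ioi rp) :=
  (contDiff_Del (M := M) (k := k)).contDiffOn.div (contDiffOn_id.pow 2) fun r hr => (pow_pos (hB.r_pos hr) 2).ne'

theorem smooth_shift (hB : Background M k rp) :
    ContDiffOn ℝ ∞ (fun r => r ^ 2 / Del M k r - 1 / (1 + k ^ 2 * r ^ 2)) (Ioi rp) := by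
  refine ((contDiffOn_id.pow 2).div (contDiff_Del (M := M) (k := k)).contDiffOn
    fun r hr => (hB.Del_pos r hr).ne').sub (contDiffOn_const.div (by fun_prop) fun _ _ => ?_)
  positivity

theorem smooth_Del_inv (hB : Background M k rp) : ContDiffOn ℝ ∞ (fun r => (Del M k r)⁻¹) (Ioi rp) :=
  (contDiff_Del (M := M) (k := k)).contDiffOn.inv fun r hr => (hB.Del_pos r hr).ne'

end Background

/-- Since w = r⁻² + k² - 2M r⁻³, the constant k drops out of the derivative. That is why the algebra
of modes does not see the cosmological constant. -/
theorem hasDerivAt_wfun {M k r : ℝ} (hr' : r ≠ 0) :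
    HasDerivAt (wfun M k) (-2 / r ^ 3 + 6 * M / r ^ 4) r := by
  have h1 : HasDerivAt (Del M k) (2 * r + k ^ 2 * (4 * r ^ 3) - 2 * M) r := by
    have a := hasDerivAt_pow 2 r
    have b := (hasDerivAt_pow 4 r).const_mul (k ^ 2)
    have c := (hasDerivAt_id r).const_mul (2 * M)
    have := (a.add b).sub c
    refine (this.congr_deriv ?_).congr_of_eventuallyEq (Eventually.of_forall fun x => ?_)
    · push_cast
      ring
    · simp [Del]
  have := h1.div (hasDerivAt_pow 4 r) (pow_ne_zero 4 hr')
  refine this.congr_deriv ?_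
  simp only [Del]
  push_cast
  field_simp
  ring

/-! ### Charts with a radial coordinate -/

section Chart

variable {E : Type*} [NormedAddCommGroup E] [NormedSpace ℝ E]

/-- Time and radial directions, and the radial coordinate, on a subset of `E`. -/
structure Chart (rp : ℝ) (s : Set E) where
  /-- the time direction -/
  eT : E
  /-- the radial direction -/
  eR : E
  /-- the radial coordinate -/
  ρ : E →L[ℝ] ℝ
  ρT : ρ eT = 0
  ρR : ρ eR = 1
  maps : MapsTo ρ s (Ioi rp)

namespace Chart

variable {M k rp : ℝ} {s : Set E} [NiceSet s] (C : Chart rp s) (hB : Background M k rp)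

/-- Radial functions. -/
def rad : smAlg (Ioi rp) →ₐ[ℂ] smAlg s := pull C.ρ C.maps

/-- `∂_t`. -/
def T : Derivation ℂ (smAlg s) (smAlg s) := pd C.eT

/-- `∂_r` at fixed `t⋆`. -/
def R : Derivation ℂ (smAlg s) (smAlg s) := pd C.eR

/-- `(Δ / r²) ∂_r` at fixed `t`. -/
def D : Derivation ℂ (smAlg s) (smAlg s) :=
  C.rad (rmk _ hB.smooth_f) • (C.R + C.rad (rmk _ hB.smooth_shift) • C.T)

/-- `L`. -/
def L : Derivation ℂ (smAlg s) (smAlg s) := C.T + C.D hB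

/-- `L̲`. -/
def Lb : Derivation ℂ (smAlg s) (smAlg s) := C.T - C.D hB

/-- `1/r`. -/
def x : smAlg s := C.rad (rmk _ hB.smooth_inv)

/-- `w`. -/
def w : smAlg s := C.rad (rmk _ hB.smooth_w)

/-- `w⁻¹`. -/
def v : smAlg s := C.rad (rmk _ hB.smooth_v)

theorem T_rad (a : smAlg (Ioi rp)) : C.T (C.rad a) = 0 := by
  unfold T rad
  rw [pd_pull, C.ρT]
  refine sm_ext fun x hx => ?_
  rw [smEv_pull _ _ _ hx, smEv_pd _ _ (C.maps hx)]
  simp [smEv_zero]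

theorem R_rad (a : smAlg (Ioi rp)) : C.R (C.rad a) = C.rad (pd 1 a) := by
  unfold R rad
  rw [pd_pull, C.ρR]

theorem T_R (F : smAlg s) : C.T (C.R F) = C.R (C.T F) := pd_comm _ _ _

theorem D_apply (F : smAlg s) :
    C.D hB F = C.rad (rmk _ hB.smooth_f) * (C.R F + C.rad (rmk _ hB.smooth_shift) * C.T F) := rfl

theorem L_apply (F : smAlg s) : C.L hB F = C.T F + C.D hB F := rfl

theorem Lb_apply (F : smAlg s) : C.Lb hB F = C.T F - C.D hB F := rfl

theorem D_rad (a : smAlg (Ioi rp)) :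
    C.D hB (C.rad a) = C.rad (rmk _ hB.smooth_f * pd 1 a) := by
  rw [D_apply, T_rad, R_rad]; simp

theorem T_D (F : smAlg s) : C.T (C.D hB F) = C.D hB (C.T F) := by
  simp only [D_apply, Derivation.leibniz, T_rad, T_R, map_add, smul_eq_mul]
  ring

theorem smEv_rad (a : smAlg (Ioi rp)) {y : E} (hy : y ∈ s) :
    smEv (C.rad a) y = smEv a (C.ρ y) := smEv_pull _ _ _ hy

theorem smEv_rad_rmk (a : ℝ → ℝ) (ha : ContDiffOn ℝ ∞ a (Ioi rp)) {y : E} (hy : y ∈ s) :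
    smEv (C.rad (rmk a ha)) y = a (C.ρ y) := by
  rw [smEv_rad _ _ hy, smEv_rmk _ _ (C.maps hy)]

theorem D_x : C.D hB (C.x hB) = -C.w hB := by
  unfold x w
  rw [D_rad, ← map_neg]
  congr 1
  refine sm_ext fun r hr => ?_
  have hr' := (hB.r_pos hr).ne'
  rw [smEv_mul, smEv_neg, smEv_pd_rmk _ hr (hasDerivAt_inv hr'), smEv_rmk _ _ hr, smEv_rmk _ _ hr]
  unfold wfun
  push_cast
  have : (r : ℂ) ≠ 0 := by exact_mod_cast hr'
  field_simp

theorem D_w (m : smAlg s) (hm : m = algebraMap ℂ _ (M : ℂ)) :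
    C.D hB (C.w hB) = C.w hB * (6 * m * C.x hB ^ 2 - 2 * C.x hB) := by
  unfold x w
  rw [D_rad]
  refine sm_ext fun y hy => ?_
  have hr := C.maps hy
  have hr' := (hB.r_pos hr).ne'
  rw [hm, smEv_rad _ _ hy]
  simp only [smEv_mul, smEv_sub, smEv_rad_rmk _ _ _ hy, smEv_ofNat _ hy, smEv_pow _ _ hy,
    smEv_algebraMap _ hy]
  rw [smEv_pd_rmk _ hr (hasDerivAt_wfun hr'), smEv_rmk _ _ hr]
  unfold wfun
  push_cast
  have : (C.ρ y : ℂ) ≠ 0 := by exact_mod_cast hr'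
  field_simp
  ring

theorem w_mul_v : C.w hB * C.v hB = 1 := by
  unfold w v
  rw [← map_mul, ← map_one C.rad]
  congr 1
  refine sm_ext fun r hr => ?_
  rw [smEv_mul, smEv_rmk _ _ hr, smEv_rmk _ _ hr, smEv_one hr]
  have := (hB.w_pos hr).ne'
  exact_mod_cast mul_inv_cancel₀ this

theorem L_Lb (F : smAlg s) : C.Lb hB (C.L hB F) = C.L hB (C.Lb hB F) := by
  simp only [L_apply, Lb_apply, map_add, map_sub, T_D]
  ring

/-- Radial functions do not depend on time, so L and L̲ act on them as the radial derivation and its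
negative. This connects the abstract algebra with both charts. -/
theorem nullPair (lam : ℂ) :
    NullPair (C.L hB) (C.Lb hB) (C.w hB) (C.v hB) (C.x hB)
      (algebraMap ℂ (smAlg s) (M : ℂ)) (algebraMap ℂ (smAlg s) lam) where
  comm := C.L_Lb hB
  wv := C.w_mul_v hB
  Lx := by rw [L_apply, D_x]; unfold x; rw [T_rad]; simp
  Lbx := by rw [Lb_apply, D_x]; unfold x; rw [T_rad]; simp
  Lw := by rw [L_apply, C.D_w hB _ rfl]; unfold w; rw [T_rad]; simp
  Lbw := by rw [Lb_apply, C.D_w hB _ rfl]; unfold w; rw [T_rad]; simp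
  Lm := Derivation.map_algebraMap _ _
  Lbm := Derivation.map_algebraMap _ _
  Llam := Derivation.map_algebraMap _ _
  Lblam := Derivation.map_algebraMap _ _

end Chart
end Chart

/-! ### The four-dimensional region -/

/-- The region as a subset of `ℝ⁴`. -/
def Om (rp t0 : ℝ) : Set (ℝ × ℝ × ℝ × ℝ) := Ici t0 ×ˢ Ioi rp ×ˢ Ioo 0 Real.pi ×ˢ univ

theorem mem_Om {rp t0 t r θ φ : ℝ} : (t, r, θ, φ) ∈ Om rp t0 ↔ Region rp t0 t r θ := by
  simp [Om, Region]

/-- The quotient `{(t⋆, r)}`. -/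
def U2 (rp t0 : ℝ) : Set (ℝ × ℝ) := Ici t0 ×ˢ Ioi rp

theorem mem_U2 {rp t0 t r : ℝ} : (t, r) ∈ U2 rp t0 ↔ t0 ≤ t ∧ rp < r := by simp [U2]

instance niceSet_Om (rp t0 : ℝ) : NiceSet (Om rp t0) := by
  refine NiceSet.of_convex ((convex_Ici t0).prod
    ((convex_Ioi rp).prod ((convex_Ioo _ _).prod convex_univ))) ?_
  unfold Om
  rw [interior_prod_eq, interior_prod_eq, interior_prod_eq]
  refine ⟨(t0 + 1, rp + 1, Real.pi / 2, 0), ?_⟩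
  simp [Real.pi_pos]

instance niceSet_U2 (rp t0 : ℝ) : NiceSet (U2 rp t0) := by
  refine NiceSet.of_convex ((convex_Ici t0).prod (convex_Ioi rp)) ?_
  unfold U2
  rw [interior_prod_eq]
  exact ⟨(t0 + 1, rp + 1), by simp⟩

/-- The chart of the region. -/
def C4 (rp t0 : ℝ) : Chart rp (Om rp t0) where
  eT := (1, 0, 0, 0)
  eR := (0, 1, 0, 0)
  ρ := (ContinuousLinearMap.fst ℝ ℝ (ℝ × ℝ)).comp (ContinuousLinearMap.snd ℝ ℝ (ℝ × ℝ × ℝ))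
  ρT := rfl
  ρR := rfl
  maps x hx := hx.2.1

/-- The chart of the quotient. -/
def C2 (rp t0 : ℝ) : Chart rp (U2 rp t0) where
  eT := (1, 0)
  eR := (0, 1)
  ρ := ContinuousLinearMap.snd ℝ ℝ ℝ
  ρT := rfl
  ρR := rfl
  maps x hx := hx.2

section Dictionary

variable {M k rp t0 : ℝ}

/-- The field of a smooth function on the region. -/
def ev (F : smAlg (Om rp t0)) : Field4 := fun t r θ φ => smEv F (t, r, θ, φ)

/-- `f` is represented by `F`. -/
def Rep (f : Field4) (F : smAlg (Om rp t0)) : Prop := EqOnRegion rp t0 f (ev F)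

/-- `∂_θ`. -/
def Th : Derivation ℂ (smAlg (Om rp t0)) (smAlg (Om rp t0)) := pd (0, 0, 1, 0)

/-- `∂_φ`. -/
def Ph : Derivation ℂ (smAlg (Om rp t0)) (smAlg (Om rp t0)) := pd (0, 0, 0, 1)

theorem hasDerivWithinAt_ev_t (F : smAlg (Om rp t0)) {t r θ φ : ℝ} (h : Region rp t0 t r θ) :
    HasDerivWithinAt (fun τ => ev F τ r θ φ) (ev ((C4 rp t0).T F) t r θ φ) (Ici t0) t :=
  smEv_comp_hasDerivWithinAt F (γ := fun τ => (τ, r, θ, φ)) (v := (1, 0, 0, 0))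
    ((hasDerivWithinAt_id _ _).prodMk ((hasDerivWithinAt_const _ _ _).prodMk
      ((hasDerivWithinAt_const _ _ _).prodMk (hasDerivWithinAt_const _ _ _))))
    (fun τ hτ => mem_Om.2 ⟨hτ, h.2⟩) (mem_Om.2 h)

theorem hasDerivAt_ev_r (F : smAlg (Om rp t0)) {t r θ φ : ℝ} (h : Region rp t0 t r θ) :
    HasDerivAt (fun ρ => ev F t ρ θ φ) (ev ((C4 rp t0).R F) t r θ φ) r :=
  (smEv_comp_hasDerivWithinAt F (γ := fun τ => (t, τ, θ, φ)) (v := (0, 1, 0, 0)) (J := Ioi rp)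
    ((hasDerivWithinAt_const _ _ _).prodMk ((hasDerivWithinAt_id _ _).prodMk
      ((hasDerivWithinAt_const _ _ _).prodMk (hasDerivWithinAt_const _ _ _))))
    (fun τ hτ => mem_Om.2 ⟨h.1, hτ, h.2.2⟩) (mem_Om.2 h)).hasDerivAt (Ioi_mem_nhds h.2.1)

theorem hasDerivAt_ev_th (F : smAlg (Om rp t0)) {t r θ φ : ℝ} (h : Region rp t0 t r θ) :
    HasDerivAt (fun y => ev F t r y φ) (ev (Th F) t r θ φ) θ :=
  (smEv_comp_hasDerivWithinAt F (γ := fun τ => (t, r, τ, φ)) (v := (0, 0, 1, 0))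
    (J := Ioo 0 Real.pi)
    ((hasDerivWithinAt_const _ _ _).prodMk ((hasDerivWithinAt_const _ _ _).prodMk
      ((hasDerivWithinAt_id _ _).prodMk (hasDerivWithinAt_const _ _ _))))
    (fun τ hτ => mem_Om.2 ⟨h.1, h.2.1, hτ.1, hτ.2⟩) (mem_Om.2 h)).hasDerivAt
    (Ioo_mem_nhds h.2.2.1 h.2.2.2)

theorem hasDerivAt_ev_ph (F : smAlg (Om rp t0)) {t r θ φ : ℝ} (h : Region rp t0 t r θ) :
    HasDerivAt (fun y => ev F t r θ y) (ev (Ph F) t r θ φ) φ :=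
  (smEv_comp_hasDerivWithinAt F (γ := fun τ => (t, r, θ, τ)) (v := (0, 0, 0, 1))
    (J := univ)
    ((hasDerivWithinAt_const _ _ _).prodMk ((hasDerivWithinAt_const _ _ _).prodMk
      ((hasDerivWithinAt_const _ _ _).prodMk (hasDerivWithinAt_id _ _))))
    (fun τ _ => mem_Om.2 h) (mem_Om.2 h)).hasDerivAt univ_mem

namespace EqOnRegion

variable {f g : Field4}

/-- Fields are arbitrary outside the region, yet derivatives there depend only on values in the
region: r, θ, φ range over open sets and ∂_t is taken within t⋆ ≥ t0. -/
theorem dT (h : EqOnRegion rp t0 f g) : EqOnRegion rp t0 (dT t0 f) (dT t0 g) :=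
  fun t r θ φ hr => derivWithin_congr (fun τ hτ => h τ r θ φ ⟨hτ, hr.2⟩) (h t r θ φ hr)

theorem dRstar (h : EqOnRegion rp t0 f g) : EqOnRegion rp t0 (dRstar f) (dRstar g) :=
  fun t r θ φ hr => Filter.EventuallyEq.deriv_eq <| by
    filter_upwards [Ioi_mem_nhds hr.2.1] with ρ hρ using h t ρ θ φ ⟨hr.1, hρ, hr.2.2⟩

theorem dTh (h : EqOnRegion rp t0 f g) : EqOnRegion rp t0 (dTh f) (dTh g) :=
  fun t r θ φ hr => Filter.EventuallyEq.deriv_eq <| by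
    filter_upwards [Ioo_mem_nhds hr.2.2.1 hr.2.2.2] with y hy using h t r y φ ⟨hr.1, hr.2.1, hy⟩

theorem dPh (h : EqOnRegion rp t0 f g) : EqOnRegion rp t0 (dPh f) (dPh g) :=
  fun t r θ φ hr => Filter.EventuallyEq.deriv_eq <| by
    filter_upwards with y using h t r θ y hr

theorem rmul (h : EqOnRegion rp t0 f g) (a : ℝ → ℝ) :
    EqOnRegion rp t0 (rmul a f) (rmul a g) :=
  fun t r θ φ hr => by simp only [TeukolskySAdS.rmul, h t r θ φ hr]

theorem symm (h : EqOnRegion rp t0 f g) : EqOnRegion rp t0 g f :=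
  fun t r θ φ hr => (h t r θ φ hr).symm

theorem trans {e : Field4} (h : EqOnRegion rp t0 f g) (h' : EqOnRegion rp t0 g e) :
    EqOnRegion rp t0 f e :=
  fun t r θ φ hr => (h t r θ φ hr).trans (h' t r θ φ hr)

theorem add {f' g' : Field4} (h : EqOnRegion rp t0 f g) (h' : EqOnRegion rp t0 f' g') :
    EqOnRegion rp t0 (f + f') (g + g') :=
  fun t r θ φ hr => congrArg₂ (· + ·) (h t r θ φ hr) (h' t r θ φ hr)

theorem sub {f' g' : Field4} (h : EqOnRegion rp t0 f g) (h' : EqOnRegion rp t0 f' g') :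
    EqOnRegion rp t0 (f - f') (g - g') :=
  fun t r θ φ hr => congrArg₂ (· - ·) (h t r θ φ hr) (h' t r θ φ hr)

theorem smul (h : EqOnRegion rp t0 f g) (c : ℂ) : EqOnRegion rp t0 (c • f) (c • g) :=
  fun t r θ φ hr => congrArg (c * ·) (h t r θ φ hr)

end EqOnRegion

namespace Rep

variable {f g : Field4} {F G : smAlg (Om rp t0)}

theorem dT (h : Rep f F) : Rep (dT t0 f) ((C4 rp t0).T F) :=
  (EqOnRegion.dT h).trans fun t _ _ _ hr =>
    (hasDerivWithinAt_ev_t F hr).derivWithin (uniqueDiffOn_Ici t0 t hr.1)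

theorem dRstar (h : Rep f F) : Rep (dRstar f) ((C4 rp t0).R F) :=
  (EqOnRegion.dRstar h).trans fun _ _ _ _ hr => (hasDerivAt_ev_r F hr).deriv

theorem dTh (h : Rep f F) : Rep (dTh f) (Th F) :=
  (EqOnRegion.dTh h).trans fun _ _ _ _ hr => (hasDerivAt_ev_th F hr).deriv

theorem dPh (h : Rep f F) : Rep (dPh f) (Ph F) :=
  (EqOnRegion.dPh h).trans fun _ _ _ _ hr => (hasDerivAt_ev_ph F hr).deriv

theorem add (h : Rep f F) (h' : Rep g G) : Rep (f + g) (F + G) :=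
  (EqOnRegion.add h h').trans fun _ _ _ _ _ => (smEv_add F G _).symm

theorem sub (h : Rep f F) (h' : Rep g G) : Rep (f - g) (F - G) :=
  (EqOnRegion.sub h h').trans fun _ _ _ _ _ => (smEv_sub F G _).symm

theorem rmul (h : Rep f F) (a : ℝ → ℝ) (ha : ContDiffOn ℝ ∞ a (Ioi rp)) :
    Rep (rmul a f) ((C4 rp t0).rad (rmk a ha) * F) :=
  (EqOnRegion.rmul h a).trans fun t r θ φ hr => by
    simp only [ev, smEv_mul, TeukolskySAdS.rmul]
    rw [(C4 rp t0).smEv_rad_rmk a ha (mem_Om.2 hr)]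
    rfl

variable (hB : Background M k rp)

theorem dR (h : Rep f F) : Rep (dR M k t0 f)
    ((C4 rp t0).R F + (C4 rp t0).rad (rmk _ hB.smooth_shift) * (C4 rp t0).T F) :=
  h.dRstar.add (h.dT.rmul _ hB.smooth_shift)

theorem opL (h : Rep f F) : Rep (opL M k t0 f) ((C4 rp t0).L hB F) :=
  h.dT.add ((h.dR hB).rmul _ hB.smooth_f)

theorem opLb (h : Rep f F) : Rep (opLb M k t0 f) ((C4 rp t0).Lb hB F) :=
  h.dT.sub ((h.dR hB).rmul _ hB.smooth_f)

theorem cc (h : Rep f F) : Rep (cc f) (smConj F) := fun t r θ φ hr => by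
  simp only [TeukolskySAdS.cc, h t r θ φ hr, ev, smEv_conj]

end Rep

/-- A smooth field as an element of the algebra. -/
theorem exists_rep {f : Field4} (h : ContDiffOn ℝ ∞
    (fun x : ℝ × ℝ × ℝ × ℝ => f x.1 x.2.1 x.2.2.1 x.2.2.2)
    (Ici t0 ×ˢ Ioi rp ×ˢ Ioo 0 Real.pi ×ˢ univ)) : ∃ F : smAlg (Om rp t0), Rep f F :=
  ⟨smMk _ h, fun t r θ φ hr => (smEv_smMk _ h (mem_Om.2 hr)).symm⟩

end Dictionary
end
end TeukolskySAdS

open scoped ContDiff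
namespace TeukolskySAdS
open Set Filter Topology
noncomputable section

/-! ### Closure properties of iterated derivatives -/

section Words

variable {A : Type*} [CommRing A] [Algebra ℂ A]

/-- All derivatives `X^p Y^q g` belong to `B`. -/
def AllDer (X Y : Derivation ℂ A A) (B : Submodule ℂ A) (g : A) : Prop :=
  ∀ p q : ℕ, X^[p] (Y^[q] g) ∈ B

variable {X Y : Derivation ℂ A A} {B : Submodule ℂ A} {Rad : Set A} {κ : A}

theorem AllDer.add {g h : A} (hg : AllDer X Y B g) (hh : AllDer X Y B h) :
    AllDer X Y B (g + h) := fun p q => by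
  rw [iterate_map_add, iterate_map_add]
  exact B.add_mem (hg p q) (hh p q)

theorem iterate_map_smul' (X : Derivation ℂ A A) (c : ℂ) (g : A) (p : ℕ) :
    X^[p] (c • g) = c • X^[p] g := by
  induction p generalizing g with
  | zero => rfl
  | succ p ih => rw [Function.iterate_succ_apply, X.map_smul, ih, Function.iterate_succ_apply]

theorem AllDer.smul {g : A} (c : ℂ) (hg : AllDer X Y B g) : AllDer X Y B (c • g) :=
  fun p q => by
    rw [iterate_map_smul', iterate_map_smul']
    exact B.smul_mem c (hg p q)

theorem AllDer.zero : AllDer X Y B 0 := fun p q => by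
  rw [iterate_map_zero, iterate_map_zero]
  exact B.zero_mem

theorem AllDer.right {g : A} (hg : AllDer X Y B g) : AllDer X Y B (Y g) := fun p q => by
  rw [← Function.iterate_succ_apply]
  exact hg p (q + 1)

/-- A set of multipliers which is stable under the derivations and preserves `B`. -/
structure Multipliers (X Y : Derivation ℂ A A) (B : Submodule ℂ A) (Rad : Set A) : Prop where
  left : ∀ a ∈ Rad, X a ∈ Rad
  right : ∀ a ∈ Rad, Y a ∈ Rad
  mul : ∀ a ∈ Rad, ∀ g ∈ B, a * g ∈ B

theorem Multipliers.iterate_mem (h : Multipliers X Y B Rad) (p : ℕ) :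
    ∀ {a g : A}, a ∈ Rad → (∀ p, X^[p] g ∈ B) → X^[p] (a * g) ∈ B := by
  induction p with
  | zero => exact fun ha hg => h.mul _ ha _ (hg 0)
  | succ p ih =>
    intro a g ha hg
    rw [Function.iterate_succ_apply, Derivation.leibniz, smul_eq_mul, smul_eq_mul, iterate_map_add,
      mul_comm g]
    refine B.add_mem (ih ha fun p => ?_) (ih (h.left a ha) hg)
    rw [← Function.iterate_succ_apply]
    exact hg _

theorem Multipliers.allDer_mul (h : Multipliers X Y B Rad) {a g : A} (ha : a ∈ Rad)
    (hg : AllDer X Y B g) : AllDer X Y B (a * g) := by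
  intro p q
  induction q generalizing a g with
  | zero => exact h.iterate_mem p ha fun p => hg p 0
  | succ q ih =>
    rw [Function.iterate_succ_apply, Derivation.leibniz, smul_eq_mul, smul_eq_mul, iterate_map_add,
      iterate_map_add, mul_comm g]
    exact B.add_mem (ih ha hg.right) (ih (h.right a ha) hg)

/-- Only ordered words X^p Y^q are controlled, so an inner X has to be moved past Y^q. Each exchange
costs a term κY, which is a multiplier times a word with no new X. -/
theorem Multipliers.allDer_left (h : Multipliers X Y B Rad) (hκ : κ ∈ Rad)
    (hc : ∀ g, Y (X g) = X (Y g) + κ * Y g) {g : A} (hg : AllDer X Y B g) :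
    AllDer X Y B (X g) := by
  intro p q
  induction q generalizing g with
  | zero =>
    rw [Function.iterate_zero_apply, ← Function.iterate_succ_apply]
    exact hg (p + 1) 0
  | succ q ih =>
    rw [Function.iterate_succ_apply, hc, iterate_map_add, iterate_map_add]
    exact B.add_mem (ih hg.right) (h.allDer_mul hκ hg.right p q)

end Words

/-! ### Reordering monomials in the rotation operators -/

section PBW

variable {V : Type*} [AddCommGroup V] [Module ℂ V] {Z₁ Z₂ Z₃ : V →ₗ[ℂ] V}

/-- The span of the ordered monomials of degree at most `n` applied to `f`. -/
def monSpan (Z₁ Z₂ Z₃ : V →ₗ[ℂ] V) (f : V) (n : ℕ) : Submodule ℂ V :=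
  Submodule.span ℂ {g | ∃ a b c : ℕ, a + b + c ≤ n ∧ g = Z₁^[a] (Z₂^[b] (Z₃^[c] f))}

theorem monSpan_mono {f : V} {n k : ℕ} (h : n ≤ k) :
    monSpan Z₁ Z₂ Z₃ f n ≤ monSpan Z₁ Z₂ Z₃ f k := by
  apply Submodule.span_mono
  rintro g ⟨a, b, c, habc, rfl⟩
  exact ⟨a, b, c, habc.trans h, rfl⟩

theorem mem_monSpan {f : V} {n : ℕ} (a b c : ℕ) (h : a + b + c ≤ n) :
    Z₁^[a] (Z₂^[b] (Z₃^[c] f)) ∈ monSpan Z₁ Z₂ Z₃ f n :=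
  Submodule.subset_span ⟨a, b, c, h, rfl⟩

/-- Operators with the commutation relations of `so(3)` preserve the filtration by ordered
monomials. -/
theorem monSpan_map (h12 : ∀ g, Z₂ (Z₁ g) = Z₁ (Z₂ g) - Z₃ g)
    (h13 : ∀ g, Z₃ (Z₁ g) = Z₁ (Z₃ g) + Z₂ g) (h23 : ∀ g, Z₃ (Z₂ g) = Z₂ (Z₃ g) - Z₁ g)
    (f : V) (n : ℕ) : ∀ g ∈ monSpan Z₁ Z₂ Z₃ f n,
      Z₁ g ∈ monSpan Z₁ Z₂ Z₃ f (n + 1) ∧ Z₂ g ∈ monSpan Z₁ Z₂ Z₃ f (n + 1) ∧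
        Z₃ g ∈ monSpan Z₁ Z₂ Z₃ f (n + 1) := by
  have lift : ∀ (Z : V →ₗ[ℂ] V) (k : ℕ),
      (∀ a b c : ℕ, a + b + c ≤ k → Z (Z₁^[a] (Z₂^[b] (Z₃^[c] f))) ∈
        monSpan Z₁ Z₂ Z₃ f (k + 1)) →
      ∀ g ∈ monSpan Z₁ Z₂ Z₃ f k, Z g ∈ monSpan Z₁ Z₂ Z₃ f (k + 1) := by
    intro Z k h g hg
    have : monSpan Z₁ Z₂ Z₃ f k ≤ (monSpan Z₁ Z₂ Z₃ f (k + 1)).comap Z := by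
      refine Submodule.span_le.2 ?_
      rintro g ⟨a, b, c, habc, rfl⟩
      exact h a b c habc
    exact this hg
  -- Z₁ stands leftmost in the ordered monomials, so no commutation is needed.
  have l1 : ∀ k, ∀ g ∈ monSpan Z₁ Z₂ Z₃ f k, Z₁ g ∈ monSpan Z₁ Z₂ Z₃ f (k + 1) := by
    refine fun k => lift Z₁ k fun a b c habc => ?_
    rw [← Function.iterate_succ_apply' Z₁]
    exact mem_monSpan _ _ _ (by omega)
  -- Each commutator with Z₁ turns Z₂ into Z₃ and conversely, so the two cases go through one
  -- induction on the degree.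
  have l23 : ∀ k, (∀ g ∈ monSpan Z₁ Z₂ Z₃ f k, Z₂ g ∈ monSpan Z₁ Z₂ Z₃ f (k + 1)) ∧
      ∀ g ∈ monSpan Z₁ Z₂ Z₃ f k, Z₃ g ∈ monSpan Z₁ Z₂ Z₃ f (k + 1) := by
    intro k
    induction k with
    | zero =>
      constructor
      · refine lift Z₂ 0 fun a b c habc => ?_
        obtain ⟨rfl, rfl, rfl⟩ : a = 0 ∧ b = 0 ∧ c = 0 := by omega
        exact mem_monSpan (Z₁ := Z₁) (Z₂ := Z₂) (Z₃ := Z₃) (f := f) 0 1 0 (by omega)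
      · refine lift Z₃ 0 fun a b c habc => ?_
        obtain ⟨rfl, rfl, rfl⟩ : a = 0 ∧ b = 0 ∧ c = 0 := by omega
        exact mem_monSpan (Z₁ := Z₁) (Z₂ := Z₂) (Z₃ := Z₃) (f := f) 0 0 1 (by omega)
    | succ k ih =>
      have h2 : ∀ g ∈ monSpan Z₁ Z₂ Z₃ f (k + 1), Z₂ g ∈ monSpan Z₁ Z₂ Z₃ f (k + 1 + 1) := by
        refine lift Z₂ (k + 1) fun a b c habc => ?_
        cases a with
        | zero =>
          rw [Function.iterate_zero_apply, ← Function.iterate_succ_apply' Z₂]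
          exact mem_monSpan 0 (b + 1) c (by omega)
        | succ a =>
          have hm := mem_monSpan (Z₁ := Z₁) (Z₂ := Z₂) (Z₃ := Z₃) (f := f) (n := k) a b c (by omega)
          rw [Function.iterate_succ_apply', h12]
          exact Submodule.sub_mem _ (l1 _ _ (ih.1 _ hm)) (monSpan_mono (by omega) (ih.2 _ hm))
      refine ⟨h2, lift Z₃ (k + 1) fun a b c habc => ?_⟩
      cases a with
      | zero =>
        cases b with
        | zero =>
          rw [Function.iterate_zero_apply, Function.iterate_zero_apply,
            ← Function.iterate_succ_apply' Z₃]
          exact mem_monSpan 0 0 (c + 1) (by omega)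
        | succ b =>
          have hm := mem_monSpan (Z₁ := Z₁) (Z₂ := Z₂) (Z₃ := Z₃) (f := f) (n := k) 0 b c (by omega)
          rw [Function.iterate_zero_apply] at hm ⊢
          rw [Function.iterate_succ_apply', h23]
          exact Submodule.sub_mem _ (h2 _ (ih.2 _ hm)) (monSpan_mono (by omega) (l1 _ _ hm))
      | succ a =>
        have hm := mem_monSpan (Z₁ := Z₁) (Z₂ := Z₂) (Z₃ := Z₃) (f := f) (n := k) a b c (by omega)
        rw [Function.iterate_succ_apply', h13]
        exact Submodule.add_mem _ (l1 _ _ (ih.2 _ hm)) (monSpan_mono (by omega) (ih.1 _ hm))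
  exact fun g hg => ⟨l1 n g hg, (l23 n).1 g hg, (l23 n).2 g hg⟩

/-- If a submodule contains all ordered monomials applied to `f`, then it contains all ordered
monomials applied to `Zᵢ f`. -/
theorem ordered_monomials_mem (h12 : ∀ g, Z₂ (Z₁ g) = Z₁ (Z₂ g) - Z₃ g)
    (h13 : ∀ g, Z₃ (Z₁ g) = Z₁ (Z₃ g) + Z₂ g) (h23 : ∀ g, Z₃ (Z₂ g) = Z₂ (Z₃ g) - Z₁ g)
    {f : V} {Q : Submodule ℂ V} (hQ : ∀ a b c, Z₁^[a] (Z₂^[b] (Z₃^[c] f)) ∈ Q) {Z : V →ₗ[ℂ] V}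
    (hZ : Z = Z₁ ∨ Z = Z₂ ∨ Z = Z₃) (a b c : ℕ) : Z₁^[a] (Z₂^[b] (Z₃^[c] (Z f))) ∈ Q := by
  have hmap := monSpan_map h12 h13 h23 f
  have hle : ∀ n, monSpan Z₁ Z₂ Z₃ f n ≤ Q := fun n => by
    refine Submodule.span_le.2 ?_
    rintro g ⟨a, b, c, _, rfl⟩
    exact hQ a b c
  have h0 : Z f ∈ monSpan Z₁ Z₂ Z₃ f 1 := by
    have := hmap 0 f (mem_monSpan 0 0 0 (by omega))
    rcases hZ with rfl | rfl | rfl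
    exacts [this.1, this.2.1, this.2.2]
  have it : ∀ (Z : V →ₗ[ℂ] V), (∀ n, ∀ g ∈ monSpan Z₁ Z₂ Z₃ f n, Z g ∈ monSpan Z₁ Z₂ Z₃ f (n + 1)) →
      ∀ k n, ∀ g ∈ monSpan Z₁ Z₂ Z₃ f n, Z^[k] g ∈ monSpan Z₁ Z₂ Z₃ f (n + k) := by
    intro Z h k
    induction k with
    | zero => exact fun n g hg => hg
    | succ k ih =>
      intro n g hg
      rw [Function.iterate_succ_apply']
      exact h _ _ (ih n g hg)
  exact hle _ (it Z₁ (fun n g hg => (hmap n g hg).1) a _ _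
    (it Z₂ (fun n g hg => (hmap n g hg).2.1) b _ _
      (it Z₃ (fun n g hg => (hmap n g hg).2.2) c _ _ h0)))

end PBW
end
end TeukolskySAdS

open scoped ContDiff
namespace TeukolskySAdS
open Set Filter Topology
noncomputable section

/-! ### Local boundedness -/

/-- The frame factors e^{±isφ} are unimodular, so the limits at the poles bound F on neighbourhoods
of the poles, uniformly in φ. The remaining part of the sphere is compact and is covered by finitely
many local limits. -/
theorem SpinLimit.bounded {s : ℤ} {l : Filter (ℝ × ℝ)} {F : Field4} (h : SpinLimit s l F) :
    ∃ C : ℝ, ∀ᶠ p in l, ∀ θ ∈ Ioo (0 : ℝ) Real.pi, ∀ φ ∈ Icc (0 : ℝ) (2 * Real.pi),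
      ‖F p.1 p.2 θ φ‖ ≤ C := by
  obtain ⟨hmid, ⟨cn, hn⟩, ⟨cs, hs⟩⟩ := h
  have pole : ∀ (ε : ℂ) (c : ℂ) (lθ : Filter ℝ), (∀ φ : ℝ, ‖Complex.exp (ε * φ)‖ = 1) →
      Tendsto (fun p : (ℝ × ℝ) × (ℝ × ℝ) => Complex.exp (ε * (p.2.2 : ℂ)) *
        F p.1.1 p.1.2 p.2.1 p.2.2) (l ×ˢ (lθ ×ˢ (⊤ : Filter ℝ))) (𝓝 c) →
      ∃ P : ℝ → Prop, (∀ᶠ θ in lθ, P θ) ∧ ∀ᶠ p in l, ∀ θ, P θ → ∀ φ,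
        ‖F p.1 p.2 θ φ‖ ≤ ‖c‖ + 1 := by
    intro ε c lθ hε ht
    have h1 := ht.norm.eventually_le_const (lt_add_one ‖c‖)
    obtain ⟨pa, ha, pb, hb, hab⟩ := eventually_prod_iff.1 h1
    obtain ⟨pc, hc, pd, hd, hcd⟩ := eventually_prod_iff.1 hb
    rw [eventually_top] at hd
    refine ⟨pc, hc, ha.mono fun p hp θ hθ φ => ?_⟩
    have := hab hp (hcd hθ (hd φ))
    simpa [hε] using this
  obtain ⟨Pn, hPn, hn⟩ := pole (Complex.I * s) cn _ (fun φ => by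
    have : Complex.I * s * φ = ((s * φ : ℝ) : ℂ) * Complex.I := by push_cast; ring
    rw [this, Complex.norm_exp_ofReal_mul_I]) hn
  obtain ⟨Ps, hPs, hs⟩ := pole (-Complex.I * s) cs _ (fun φ => by
    have : -Complex.I * s * φ = ((-(s * φ) : ℝ) : ℂ) * Complex.I := by push_cast; ring
    rw [this, Complex.norm_exp_ofReal_mul_I]) hs
  obtain ⟨u, hu, hPu⟩ := (mem_nhdsGT_iff_exists_Ioo_subset).1 hPn
  obtain ⟨u', hu', hPu'⟩ := (mem_nhdsLT_iff_exists_Ioo_subset).1 hPs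
  rw [mem_Ioi] at hu
  rw [mem_Iio] at hu'
  have hK : IsCompact (Icc u u' ×ˢ Icc (0 : ℝ) (2 * Real.pi)) := isCompact_Icc.prod isCompact_Icc
  obtain ⟨C, hC⟩ : ∃ C : ℝ, ∀ᶠ p in l, ∀ y ∈ Icc u u' ×ˢ Icc (0 : ℝ) (2 * Real.pi),
      ‖F p.1 p.2 y.1 y.2‖ ≤ C := by
    refine hK.induction_on (p := fun S => ∃ C : ℝ, ∀ᶠ p in l, ∀ y ∈ S, ‖F p.1 p.2 y.1 y.2‖ ≤ C)
      ⟨0, by simp⟩ ?_ ?_ ?_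
    · rintro S S' hSS ⟨C, hC⟩
      exact ⟨C, hC.mono fun p hp y hy => hp y (hSS hy)⟩
    · rintro S S' ⟨C, hC⟩ ⟨C', hC'⟩
      refine ⟨max C C', ?_⟩
      filter_upwards [hC, hC'] with p hp hp' y hy
      rcases hy with hy | hy
      · exact (hp y hy).trans (le_max_left _ _)
      · exact (hp' y hy).trans (le_max_right _ _)
    · rintro ⟨θ, φ⟩ hy
      obtain ⟨c, hc⟩ := hmid θ ⟨hu.trans_le hy.1.1, hy.1.2.trans_lt hu'⟩ φ
      have h1 := hc.norm.eventually_le_const (lt_add_one ‖c‖)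
      obtain ⟨pa, ha, pb, hb, hab⟩ := eventually_prod_iff.1 h1
      rw [← nhds_prod_eq] at hb
      refine ⟨{y | pb y}, mem_nhdsWithin_of_mem_nhds hb, ‖c‖ + 1, ha.mono fun p hp y hy => ?_⟩
      exact hab hp hy
  refine ⟨max C (max (‖cn‖ + 1) (‖cs‖ + 1)), ?_⟩
  filter_upwards [hC, hn, hs] with p h1 h2 h3 θ hθ φ hφ
  rcases lt_or_ge θ u with h | h
  · exact (h2 θ (hPu ⟨hθ.1, h⟩) φ).trans ((le_max_left _ _).trans (le_max_right _ _))
  rcases lt_or_ge u' θ with h' | h'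
  · exact (h3 θ (hPu' ⟨h', hθ.2⟩) φ).trans ((le_max_right _ _).trans (le_max_right _ _))
  · exact (h1 (θ, φ) ⟨⟨h, h'⟩, hφ⟩).trans (le_max_left _ _)

variable {M k rp t0 : ℝ}

/-- Bounded near `(t, r)`, uniformly on the sphere. -/
def BddNear (l : Filter (ℝ × ℝ)) (f : Field4) : Prop :=
  ∃ C : ℝ, ∀ᶠ p in l, ∀ θ ∈ Ioo (0 : ℝ) Real.pi, ∀ φ ∈ Icc (0 : ℝ) (2 * Real.pi),
      ‖f p.1 p.2 θ φ‖ ≤ C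

theorem BddNear.add {l : Filter (ℝ × ℝ)} {f g : Field4} (hf : BddNear l f) (hg : BddNear l g) :
    BddNear l (f + g) := by
  obtain ⟨C, hC⟩ := hf
  obtain ⟨C', hC'⟩ := hg
  refine ⟨C + C', ?_⟩
  filter_upwards [hC, hC'] with p h h' θ hθ φ hφ
  exact (norm_add_le _ _).trans (add_le_add (h θ hθ φ hφ) (h' θ hθ φ hφ))

theorem BddNear.smul {l : Filter (ℝ × ℝ)} {f : Field4} (hf : BddNear l f) (c : ℂ) :
    BddNear l (c • f) := by
  obtain ⟨C, hC⟩ := hf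
  refine ⟨‖c‖ * C, ?_⟩
  filter_upwards [hC] with p h θ hθ φ hφ
  change ‖c * f p.1 p.2 θ φ‖ ≤ _
  rw [norm_mul]
  exact mul_le_mul_of_nonneg_left (h θ hθ φ hφ) (norm_nonneg _)

/-- Locally bounded smooth functions. -/
def locBdd (rp t0 : ℝ) : Submodule ℂ (smAlg (Om rp t0)) where
  carrier := {F | ∀ t r, t0 ≤ t → rp < r → BddNear (𝓝[Ici t0] t ×ˢ 𝓝 r) (ev F)}
  add_mem' {F G} hF hG t r ht hr := by
    have := (hF t r ht hr).add (hG t r ht hr)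
    have e : ev (F + G) = ev F + ev G := by
      funext t r θ φ; exact smEv_add F G _
    rwa [e]
  zero_mem' t r _ _ := ⟨0, Eventually.of_forall fun p θ _ φ _ => by simp [ev, smEv_zero]⟩
  smul_mem' c F hF t r ht hr := by
    have := (hF t r ht hr).smul c
    have e : ev (c • F) = c • ev F := by
      funext t r θ φ; exact smEv_smul c F _
    rwa [e]

/-- Radial elements. -/
def RadSet (rp t0 : ℝ) : Set (smAlg (Om rp t0)) := range (C4 rp t0).rad

theorem rad_mul_locBdd (a : smAlg (Ioi rp)) {F : smAlg (Om rp t0)} (hF : F ∈ locBdd rp t0) :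
    (C4 rp t0).rad a * F ∈ locBdd rp t0 := by
  intro t r ht hr
  obtain ⟨C, hC⟩ := hF t r ht hr
  have hc : ContinuousAt (smEv a) r := (smEv_continuousOn a).continuousAt (Ioi_mem_nhds hr)
  have h1 : ∀ᶠ r' in 𝓝 r, ‖smEv a r'‖ ≤ ‖smEv a r‖ + 1 :=
    hc.norm.eventually_le_const (lt_add_one _)
  refine ⟨(‖smEv a r‖ + 1) * max C 0, ?_⟩
  filter_upwards [hC, prod_mem_prod (self_mem_nhdsWithin (s := Ici t0) (a := t))
    (inter_mem h1 (Ioi_mem_nhds hr))] with p hp hp' θ hθ φ hφ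
  have hm : (p.1, p.2, θ, φ) ∈ Om rp t0 := mem_Om.2 ⟨hp'.1, hp'.2.2, hθ⟩
  change ‖smEv _ _‖ ≤ _
  rw [smEv_mul, norm_mul, (C4 rp t0).smEv_rad _ hm]
  exact mul_le_mul hp'.2.1 ((hp θ hθ φ hφ).trans (le_max_left _ _)) (norm_nonneg _) (by positivity)

namespace Chart

variable (hB : Background M k rp)

/-- `Δ⁻¹ L̲`. -/
def Y (rp t0 : ℝ) (hB : Background M k rp) :
    Derivation ℂ (smAlg (Om rp t0)) (smAlg (Om rp t0)) :=
  (C4 rp t0).rad (rmk _ hB.smooth_Del_inv) • (C4 rp t0).Lb hB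

theorem Y_apply (F : smAlg (Om rp t0)) :
    Y rp t0 hB F = (C4 rp t0).rad (rmk _ hB.smooth_Del_inv) * (C4 rp t0).Lb hB F := rfl

end Chart

open Chart

variable (hB : Background M k rp)

theorem L_rad (a : smAlg (Ioi rp)) : (C4 rp t0).L hB ((C4 rp t0).rad a) =
    (C4 rp t0).rad (rmk _ hB.smooth_f * pd 1 a) := by
  rw [Chart.L_apply, T_rad, D_rad, zero_add]

theorem Lb_rad (a : smAlg (Ioi rp)) : (C4 rp t0).Lb hB ((C4 rp t0).rad a) =
    (C4 rp t0).rad (-(rmk _ hB.smooth_f * pd 1 a)) := by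
  rw [Lb_apply, T_rad, D_rad, zero_sub, map_neg]

theorem multipliers (rp t0 : ℝ) (hB : Background M k rp) :
    Multipliers ((C4 rp t0).L hB) (Y rp t0 hB) (locBdd rp t0) (RadSet rp t0) where
  left := by
    rintro _ ⟨a, rfl⟩
    exact ⟨_, (L_rad hB a).symm⟩
  right := by
    rintro _ ⟨a, rfl⟩
    rw [Y_apply, Lb_rad, ← map_mul]
    exact ⟨_, rfl⟩
  mul := by
    rintro _ ⟨a, rfl⟩ F hF
    exact rad_mul_locBdd a hF

/-- `Δ` as a radial element. -/
def rDel (rp M k : ℝ) : smAlg (Ioi rp) := rmk (Del M k) Background.contDiff_Del.contDiffOn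

theorem rDel_mul_inv : rDel rp M k * rmk _ hB.smooth_Del_inv = 1 := by
  refine sm_ext fun r hr => ?_
  unfold rDel
  rw [smEv_mul, smEv_rmk _ _ hr, smEv_rmk _ _ hr, smEv_one hr]
  exact_mod_cast mul_inv_cancel₀ (hB.Del_pos r hr).ne'

theorem rad_Del_Y (F : smAlg (Om rp t0)) :
    (C4 rp t0).rad (rDel rp M k) * Y rp t0 hB F = (C4 rp t0).Lb hB F := by
  rw [Y_apply, ← mul_assoc, ← map_mul, rDel_mul_inv hB, map_one, one_mul]

/-- L and L̲ commute and Δ is radial, so the commutator only differentiates Δ⁻¹ and is a radial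
multiple of Δ⁻¹L̲. This provides the κ of `Multipliers.allDer_left`. -/
theorem Y_L (F : smAlg (Om rp t0)) : Y rp t0 hB ((C4 rp t0).L hB F) =
    (C4 rp t0).L hB (Y rp t0 hB F) +
      (C4 rp t0).rad (-(rmk _ hB.smooth_f * pd 1 (rmk _ hB.smooth_Del_inv)) * rDel rp M k) *
        Y rp t0 hB F := by
  rw [map_mul, mul_assoc, rad_Del_Y, Y_apply, Y_apply, Derivation.leibniz, L_rad, L_Lb]
  simp only [smul_eq_mul, map_neg]
  ring

/-- Locally bounded with all derivatives in `t`, `r`. -/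
def radGood (rp t0 : ℝ) (hB : Background M k rp) : Submodule ℂ (smAlg (Om rp t0)) where
  carrier := {F | AllDer ((C4 rp t0).L hB) (Y rp t0 hB) (locBdd rp t0) F}
  add_mem' hF hG := hF.add hG
  zero_mem' := AllDer.zero
  smul_mem' c _ hF := hF.smul c

theorem radGood_rad {F : smAlg (Om rp t0)} (hF : F ∈ radGood rp t0 hB) (a : smAlg (Ioi rp)) :
    (C4 rp t0).rad a * F ∈ radGood rp t0 hB :=
  (multipliers rp t0 hB).allDer_mul ⟨a, rfl⟩ hF

theorem radGood_L {F : smAlg (Om rp t0)} (hF : F ∈ radGood rp t0 hB) :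
    (C4 rp t0).L hB F ∈ radGood rp t0 hB :=
  (multipliers rp t0 hB).allDer_left ⟨_, rfl⟩ (Y_L hB) hF

theorem radGood_Lb {F : smAlg (Om rp t0)} (hF : F ∈ radGood rp t0 hB) :
    (C4 rp t0).Lb hB F ∈ radGood rp t0 hB := by
  rw [← rad_Del_Y]
  exact radGood_rad hB hF.right _

theorem radGood_T {F : smAlg (Om rp t0)} (hF : F ∈ radGood rp t0 hB) :
    (C4 rp t0).T F ∈ radGood rp t0 hB := by
  have : (C4 rp t0).T F = (1 / 2 : ℂ) • ((C4 rp t0).L hB F + (C4 rp t0).Lb hB F) := by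
    rw [Chart.L_apply, Lb_apply, add_add_sub_cancel, ← two_smul ℂ ((C4 rp t0).T F), smul_smul]
    norm_num
  rw [this]
  exact Submodule.smul_mem _ _ (Submodule.add_mem _ (radGood_L hB hF) (radGood_Lb hB hF))

theorem smooth_f_inv (hB : Background M k rp) :
    ContDiffOn ℝ ∞ (fun r => (Del M k r / r ^ 2)⁻¹) (Ioi rp) :=
  hB.smooth_f.inv fun r hr => (div_pos (hB.Del_pos r hr) (pow_pos (hB.r_pos hr) 2)).ne'

/-- Off the horizon Δ/r² is positive, so ∂_r can be solved for from L and ∂_t with smooth radial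
coefficients. -/
theorem radGood_R {F : smAlg (Om rp t0)} (hF : F ∈ radGood rp t0 hB) :
    (C4 rp t0).R F ∈ radGood rp t0 hB := by
  have e : (C4 rp t0).rad (rmk _ (smooth_f_inv hB)) * (C4 rp t0).rad (rmk _ hB.smooth_f) = 1 := by
    rw [← map_mul, ← map_one (C4 rp t0).rad]
    congr 1
    refine sm_ext fun r hr => ?_
    rw [smEv_mul, smEv_rmk _ _ hr, smEv_rmk _ _ hr, smEv_one hr]
    have := (div_pos (hB.Del_pos r hr) (pow_pos (hB.r_pos hr) 2)).ne'
    exact_mod_cast inv_mul_cancel₀ this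
  have : (C4 rp t0).R F = (C4 rp t0).rad (rmk _ (smooth_f_inv hB)) *
      ((C4 rp t0).L hB F - (C4 rp t0).T F) -
      (C4 rp t0).rad (rmk _ hB.smooth_shift) * (C4 rp t0).T F := by
    rw [Chart.L_apply, D_apply]
    linear_combination -((C4 rp t0).R F +
      (C4 rp t0).rad (rmk _ hB.smooth_shift) * (C4 rp t0).T F) * e
  rw [this]
  exact Submodule.sub_mem _ (radGood_rad hB (Submodule.sub_mem _ (radGood_L hB hF)
    (radGood_T hB hF)) _) (radGood_rad hB (radGood_T hB hF) _)

end
end TeukolskySAdS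

open scoped ContDiff
namespace TeukolskySAdS
open Set Filter Topology
noncomputable section

open Chart

/-! ### Angular elements and the rotation operators -/

instance niceSet_Ioo : NiceSet (Ioo 0 Real.pi) :=
  NiceSet.of_convex (convex_Ioo _ _) (by rw [interior_Ioo]; exact ⟨Real.pi / 2, by simp [Real.pi_pos]⟩)

instance niceSet_univ : NiceSet (univ : Set ℝ) :=
  NiceSet.of_convex convex_univ (by simp)

/-- A real function as a smooth function on a subset of the line. -/
def lineElt {J : Set ℝ} (a : ℝ → ℝ) (ha : ContDiffOn ℝ ∞ a J) : smAlg J :=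
  smMk (fun r => (a r : ℂ)) (Complex.ofRealCLM.contDiff.comp_contDiffOn ha)

theorem smEv_lineElt {J : Set ℝ} (a : ℝ → ℝ) (ha : ContDiffOn ℝ ∞ a J) {y : ℝ} (hy : y ∈ J) :
    smEv (lineElt a ha) y = a y := smEv_smMk _ _ hy

theorem pd_lineElt {J : Set ℝ} [NiceSet J] {a a' : ℝ → ℝ} (ha : ContDiffOn ℝ ∞ a J)
    (ha' : ContDiffOn ℝ ∞ a' J) (h : ∀ y ∈ J, HasDerivAt a (a' y) y) :
    pd 1 (lineElt a ha) = lineElt a' ha' := sm_ext fun y hy => by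
  refine (pd_smMk (fun r => (a r : ℂ)) _ 1 hy).trans ?_
  have := (h y hy).ofReal_comp.hasFDerivAt.hasFDerivWithinAt (s := J)
  rw [this.fderivWithin (NiceSet.uniq y hy), smEv_lineElt _ _ hy]
  simp

variable {rp t0 : ℝ}

/-- The projection to `θ`. -/
def prTh : ℝ × ℝ × ℝ × ℝ →L[ℝ] ℝ :=
  (ContinuousLinearMap.fst ℝ ℝ ℝ).comp ((ContinuousLinearMap.snd ℝ ℝ (ℝ × ℝ)).comp
    (ContinuousLinearMap.snd ℝ ℝ (ℝ × ℝ × ℝ)))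

/-- The projection to `φ`. -/
def prPh : ℝ × ℝ × ℝ × ℝ →L[ℝ] ℝ :=
  (ContinuousLinearMap.snd ℝ ℝ ℝ).comp ((ContinuousLinearMap.snd ℝ ℝ (ℝ × ℝ)).comp
    (ContinuousLinearMap.snd ℝ ℝ (ℝ × ℝ × ℝ)))

/-- Functions of `θ`. -/
def thElt : smAlg (Ioo 0 Real.pi) →ₐ[ℂ] smAlg (Om rp t0) := pull prTh fun _ hx => hx.2.2.1

/-- Functions of `φ`. -/
def phElt : smAlg (univ : Set ℝ) →ₐ[ℂ] smAlg (Om rp t0) := pull prPh fun _ _ => mem_univ _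

theorem smEv_thElt (a : smAlg (Ioo 0 Real.pi)) {t r θ φ : ℝ} (h : Region rp t0 t r θ) :
    ev (thElt a : smAlg (Om rp t0)) t r θ φ = smEv a θ := smEv_pull _ _ _ (mem_Om.2 h)

theorem smEv_phElt (a : smAlg (univ : Set ℝ)) {t r θ φ : ℝ} (h : Region rp t0 t r θ) :
    ev (phElt a : smAlg (Om rp t0)) t r θ φ = smEv a φ := smEv_pull _ _ _ (mem_Om.2 h)

theorem pd_zero_vec {E : Type*} [NormedAddCommGroup E] [NormedSpace ℝ E] {s : Set E} [NiceSet s]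
    (F : smAlg s) : pd 0 F = 0 := sm_ext fun x hx => by
  rw [smEv_pd _ _ hx, map_zero, smEv_zero]

section
variable (a : smAlg (Ioo 0 Real.pi)) (b : smAlg (univ : Set ℝ))

theorem T_thElt : (C4 rp t0).T (thElt a) = 0 := by
  refine (pd_pull _ _ _ _).trans ?_
  rw [show prTh (C4 rp t0).eT = 0 from rfl, pd_zero_vec, map_zero]

theorem R_thElt : (C4 rp t0).R (thElt a) = 0 := by
  refine (pd_pull _ _ _ _).trans ?_
  rw [show prTh (C4 rp t0).eR = 0 from rfl, pd_zero_vec, map_zero]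

theorem Ph_thElt : Ph (thElt a : smAlg (Om rp t0)) = 0 := by
  refine (pd_pull _ _ _ _).trans ?_
  rw [show prTh (0, 0, 0, 1) = 0 from rfl, pd_zero_vec, map_zero]

theorem Th_thElt : Th (thElt a : smAlg (Om rp t0)) = thElt (pd 1 a) := pd_pull _ _ _ _

theorem T_phElt : (C4 rp t0).T (phElt b) = 0 := by
  refine (pd_pull _ _ _ _).trans ?_
  rw [show prPh (C4 rp t0).eT = 0 from rfl, pd_zero_vec, map_zero]

theorem R_phElt : (C4 rp t0).R (phElt b) = 0 := by
  refine (pd_pull _ _ _ _).trans ?_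
  rw [show prPh (C4 rp t0).eR = 0 from rfl, pd_zero_vec, map_zero]

theorem Th_phElt : Th (phElt b : smAlg (Om rp t0)) = 0 := by
  refine (pd_pull _ _ _ _).trans ?_
  rw [show prPh (0, 0, 1, 0) = 0 from rfl, pd_zero_vec, map_zero]

theorem Ph_phElt : Ph (phElt b : smAlg (Om rp t0)) = phElt (pd 1 b) := pd_pull _ _ _ _

end

theorem sin_pos' {y : ℝ} (hy : y ∈ Ioo 0 Real.pi) : 0 < Real.sin y := Real.sin_pos_of_mem_Ioo hy

theorem smooth_csc : ContDiffOn ℝ ∞ (fun y : ℝ => (Real.sin y)⁻¹) (Ioo 0 Real.pi) :=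
  Real.contDiff_sin.contDiffOn.inv fun _ hy => (sin_pos' hy).ne'

theorem smooth_cot : ContDiffOn ℝ ∞ (fun y : ℝ => Real.cos y / Real.sin y) (Ioo 0 Real.pi) :=
  Real.contDiff_cos.contDiffOn.div Real.contDiff_sin.contDiffOn fun _ hy => (sin_pos' hy).ne'

/-- `sin θ` -/
def sTh : smAlg (Om rp t0) := thElt (lineElt Real.sin Real.contDiff_sin.contDiffOn)
/-- `cos θ` -/
def cTh : smAlg (Om rp t0) := thElt (lineElt Real.cos Real.contDiff_cos.contDiffOn)
/-- `csc θ` -/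
def csc : smAlg (Om rp t0) := thElt (lineElt _ smooth_csc)
/-- `cot θ` -/
def cot : smAlg (Om rp t0) := thElt (lineElt _ smooth_cot)
/-- `sin φ` -/
def sPh : smAlg (Om rp t0) := phElt (lineElt Real.sin Real.contDiff_sin.contDiffOn)
/-- `cos φ` -/
def cPh : smAlg (Om rp t0) := phElt (lineElt Real.cos Real.contDiff_cos.contDiffOn)

section
variable {t r θ φ : ℝ} (h : Region rp t0 t r θ)

theorem Region.mem {rp t0 t r θ : ℝ} (h : Region rp t0 t r θ) : θ ∈ Ioo 0 Real.pi := h.2.2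

theorem ev_sTh (h : Region rp t0 t r θ) : ev (sTh : smAlg (Om rp t0)) t r θ φ = Real.sin θ := by
  unfold sTh; rw [smEv_thElt _ h, smEv_lineElt _ _ h.mem]
theorem ev_cTh (h : Region rp t0 t r θ) : ev (cTh : smAlg (Om rp t0)) t r θ φ = Real.cos θ := by
  unfold cTh; rw [smEv_thElt _ h, smEv_lineElt _ _ h.mem]
theorem ev_csc (h : Region rp t0 t r θ) :
    ev (csc : smAlg (Om rp t0)) t r θ φ = ((Real.sin θ)⁻¹ : ℝ) := by
  unfold csc; rw [smEv_thElt _ h, smEv_lineElt _ _ h.mem]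
theorem ev_cot (h : Region rp t0 t r θ) :
    ev (cot : smAlg (Om rp t0)) t r θ φ = (Real.cos θ / Real.sin θ : ℝ) := by
  unfold cot; rw [smEv_thElt _ h, smEv_lineElt _ _ h.mem]
theorem ev_sPh (h : Region rp t0 t r θ) : ev (sPh : smAlg (Om rp t0)) t r θ φ = Real.sin φ := by
  unfold sPh; rw [smEv_phElt _ h, smEv_lineElt _ _ (mem_univ _)]
theorem ev_cPh (h : Region rp t0 t r θ) : ev (cPh : smAlg (Om rp t0)) t r θ φ = Real.cos φ := by
  unfold cPh; rw [smEv_phElt _ h, smEv_lineElt _ _ (mem_univ _)]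
end

theorem ev_ext {F G : smAlg (Om rp t0)}
    (h : ∀ t r θ φ, Region rp t0 t r θ → ev F t r θ φ = ev G t r θ φ) : F = G := by
  refine sm_ext fun x hx => ?_
  obtain ⟨t, r, θ, φ⟩ := x
  exact h t r θ φ (mem_Om.1 hx)

theorem ev_mul (F G : smAlg (Om rp t0)) (t r θ φ : ℝ) :
    ev (F * G) t r θ φ = ev F t r θ φ * ev G t r θ φ := smEv_mul _ _ _
theorem ev_add (F G : smAlg (Om rp t0)) (t r θ φ : ℝ) :
    ev (F + G) t r θ φ = ev F t r θ φ + ev G t r θ φ := smEv_add _ _ _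
theorem ev_sub (F G : smAlg (Om rp t0)) (t r θ φ : ℝ) :
    ev (F - G) t r θ φ = ev F t r θ φ - ev G t r θ φ := smEv_sub _ _ _
theorem ev_neg (F : smAlg (Om rp t0)) (t r θ φ : ℝ) :
    ev (-F) t r θ φ = -ev F t r θ φ := smEv_neg _ _
theorem ev_smul (c : ℂ) (F : smAlg (Om rp t0)) (t r θ φ : ℝ) :
    ev (c • F) t r θ φ = c * ev F t r θ φ := smEv_smul _ _ _

theorem ev_one {t r θ φ : ℝ} (h : Region rp t0 t r θ) : ev (1 : smAlg (Om rp t0)) t r θ φ = 1 :=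
  smEv_one (mem_Om.2 h)

theorem ev_algebraMap (c : ℂ) {t r θ φ : ℝ} (h : Region rp t0 t r θ) :
    ev (algebraMap ℂ (smAlg (Om rp t0)) c) t r θ φ = c :=
  smEv_algebraMap c (mem_Om.2 h)

theorem csc_sq : (csc : smAlg (Om rp t0)) ^ 2 = 1 + cot ^ 2 := ev_ext fun t r θ φ h => by
  rw [pow_two, pow_two, ev_add, ev_mul, ev_mul, ev_csc h, ev_cot h, ev_one h]
  have h1 := (sin_pos' h.mem).ne'
  have h2 := Real.sin_sq_add_cos_sq θ
  norm_cast
  field_simp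
  linarith

theorem sTh_csc : (sTh : smAlg (Om rp t0)) * csc = 1 := ev_ext fun t r θ φ h => by
  rw [ev_mul, ev_csc h, ev_sTh h, ev_one h]
  exact_mod_cast mul_inv_cancel₀ (sin_pos' h.mem).ne'

theorem cTh_csc : (cTh : smAlg (Om rp t0)) * csc = cot := ev_ext fun t r θ φ h => by
  rw [ev_mul, ev_csc h, ev_cTh h, ev_cot h, div_eq_mul_inv, Complex.ofReal_mul]

theorem sPh_sq : (sPh : smAlg (Om rp t0)) ^ 2 + cPh ^ 2 = 1 := ev_ext fun t r θ φ h => by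
  rw [pow_two, pow_two, ev_add, ev_mul, ev_mul, ev_sPh h, ev_cPh h, ev_one h, ← pow_two, ← pow_two]
  exact_mod_cast Real.sin_sq_add_cos_sq φ

theorem Th_sTh : Th (sTh : smAlg (Om rp t0)) = cTh := by
  unfold sTh cTh
  rw [Th_thElt, pd_lineElt _ Real.contDiff_cos.contDiffOn fun y _ => Real.hasDerivAt_sin y]

theorem lineElt_neg {J : Set ℝ} (a : ℝ → ℝ) (ha : ContDiffOn ℝ ∞ a J) :
    lineElt (fun y => -a y) ha.neg = -lineElt a ha := sm_ext fun y hy => by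
  rw [smEv_neg, smEv_lineElt _ _ hy, smEv_lineElt _ _ hy, Complex.ofReal_neg]

theorem lineElt_mul {J : Set ℝ} (a b : ℝ → ℝ) (ha : ContDiffOn ℝ ∞ a J) (hb : ContDiffOn ℝ ∞ b J) :
    lineElt (fun y => a y * b y) (ha.mul hb) = lineElt a ha * lineElt b hb :=
  sm_ext fun y hy => by
    rw [smEv_mul, smEv_lineElt _ _ hy, smEv_lineElt _ _ hy, smEv_lineElt _ _ hy,
      Complex.ofReal_mul]

theorem Th_csc : Th (csc : smAlg (Om rp t0)) = -(cot * csc) := by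
  unfold csc cot
  rw [Th_thElt, ← map_mul, ← map_neg, ← lineElt_mul, ← lineElt_neg,
    pd_lineElt _ _ fun y hy => ?_]
  have h1 := (sin_pos' hy).ne'
  refine (Real.hasDerivAt_sin y).inv h1 |>.congr_deriv ?_
  field_simp

theorem Th_cot : Th (cot : smAlg (Om rp t0)) = -(csc * csc) := by
  unfold csc cot
  rw [Th_thElt, ← map_mul, ← map_neg, ← lineElt_mul, ← lineElt_neg,
    pd_lineElt _ _ fun y hy => ?_]
  have h1 := (sin_pos' hy).ne'
  refine (Real.hasDerivAt_cos y).div (Real.hasDerivAt_sin y) h1 |>.congr_deriv ?_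
  have h2 := Real.sin_sq_add_cos_sq y
  field_simp
  linarith

theorem Ph_sPh : Ph (sPh : smAlg (Om rp t0)) = cPh := by
  unfold sPh cPh
  rw [Ph_phElt, pd_lineElt _ Real.contDiff_cos.contDiffOn fun y _ => Real.hasDerivAt_sin y]

theorem Ph_cPh : Ph (cPh : smAlg (Om rp t0)) = -sPh := by
  unfold sPh cPh
  rw [Ph_phElt, ← map_neg, ← lineElt_neg, pd_lineElt _ _ fun y _ => Real.hasDerivAt_cos y]

theorem Th_sPh : Th (sPh : smAlg (Om rp t0)) = 0 := Th_phElt _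
theorem Th_cPh : Th (cPh : smAlg (Om rp t0)) = 0 := Th_phElt _
theorem Ph_csc : Ph (csc : smAlg (Om rp t0)) = 0 := Ph_thElt _
theorem Ph_cot : Ph (cot : smAlg (Om rp t0)) = 0 := Ph_thElt _

theorem Ph_Th (F : smAlg (Om rp t0)) : Ph (Th F) = Th (Ph F) := pd_comm _ _ _

/-- `i s` as a constant. -/
def iS (s : ℤ) : smAlg (Om rp t0) := algebraMap ℂ _ (Complex.I * s)

/-- `- i s csc θ - cot θ ∂_φ` -/
def wZ (s : ℤ) : smAlg (Om rp t0) →ₗ[ℂ] smAlg (Om rp t0) where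
  toFun F := -(iS s * csc * F) - cot * Ph F
  map_add' F G := by rw [map_add]; ring
  map_smul' c F := by
    rw [Derivation.map_smul, mul_smul_comm, mul_smul_comm, ← smul_neg, ← smul_sub]; rfl

/-- `Z̃₁` -/
def Z1A (s : ℤ) : smAlg (Om rp t0) →ₗ[ℂ] smAlg (Om rp t0) where
  toFun F := -(sPh * Th F) + cPh * wZ s F
  map_add' F G := by rw [map_add, map_add]; ring
  map_smul' c F := by
    rw [Derivation.map_smul, map_smul, mul_smul_comm, mul_smul_comm, ← smul_neg, ← smul_add]; rfl

/-- `Z̃₂` -/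
def Z2A (s : ℤ) : smAlg (Om rp t0) →ₗ[ℂ] smAlg (Om rp t0) where
  toFun F := -(cPh * Th F) - sPh * wZ s F
  map_add' F G := by rw [map_add, map_add]; ring
  map_smul' c F := by
    rw [Derivation.map_smul, map_smul, mul_smul_comm, mul_smul_comm, ← smul_neg, ← smul_sub]; rfl

/-- `Z̃₃` -/
def Z3A : smAlg (Om rp t0) →ₗ[ℂ] smAlg (Om rp t0) := Ph.toLinearMap

theorem wZ_apply (s : ℤ) (F : smAlg (Om rp t0)) : wZ s F = -(iS s * csc * F) - cot * Ph F := rfl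
theorem Z1A_apply (s : ℤ) (F : smAlg (Om rp t0)) : Z1A s F = -(sPh * Th F) + cPh * wZ s F := rfl
theorem Z2A_apply (s : ℤ) (F : smAlg (Om rp t0)) : Z2A s F = -(cPh * Th F) - sPh * wZ s F := rfl
theorem Z3A_apply (F : smAlg (Om rp t0)) : Z3A F = Ph F := rfl

theorem Th_iS (s : ℤ) : Th (iS s : smAlg (Om rp t0)) = 0 := Derivation.map_algebraMap _ _
theorem Ph_iS (s : ℤ) : Ph (iS s : smAlg (Om rp t0)) = 0 := Derivation.map_algebraMap _ _

/-- The spin terms do not disturb the so(3) relations: they cancel in the commutator, and the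
coefficient of ∂_φ reduces by csc² = 1 + cot². -/
theorem Z2_Z1 (s : ℤ) (F : smAlg (Om rp t0)) :
    Z2A s (Z1A s F) = Z1A s (Z2A s F) - Z3A F := by
  simp only [Z1A_apply, Z2A_apply, Z3A_apply, wZ_apply, map_add, map_sub, map_neg,
    Derivation.leibniz, smul_eq_mul, Th_csc, Th_cot, Th_sPh, Th_cPh, Ph_sPh, Ph_cPh, Ph_csc,
    Ph_cot, Th_iS, Ph_iS, Ph_Th]
  linear_combination (-(csc ^ 2 - cot ^ 2) * Ph F) * sPh_sq (rp := rp) (t0 := t0)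
    - Ph F * csc_sq (rp := rp) (t0 := t0)

theorem Z3_Z1 (s : ℤ) (F : smAlg (Om rp t0)) :
    Z3A (Z1A s F) = Z1A s (Z3A F) + Z2A s F := by
  simp only [Z1A_apply, Z2A_apply, Z3A_apply, wZ_apply, map_add, map_sub, map_neg,
    Derivation.leibniz, smul_eq_mul, Ph_sPh, Ph_cPh, Ph_csc, Ph_cot, Ph_iS, Ph_Th]
  ring

theorem Z3_Z2 (s : ℤ) (F : smAlg (Om rp t0)) :
    Z3A (Z2A s F) = Z2A s (Z3A F) - Z1A s F := by
  simp only [Z1A_apply, Z2A_apply, Z3A_apply, wZ_apply, map_add, map_sub, map_neg,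
    Derivation.leibniz, smul_eq_mul, Ph_sPh, Ph_cPh, Ph_csc, Ph_cot, Ph_iS, Ph_Th]
  ring

/-- The angular operator `𝓛^{[s]}`. -/
def angA (s : ℤ) (F : smAlg (Om rp t0)) : smAlg (Om rp t0) :=
  -(csc * Th (sTh * Th F) + csc ^ 2 * Ph (Ph F) + 2 * iS s * (cot * csc) * Ph F
    - 4 * cot ^ 2 * F - 4 * F)

/-- 𝓛 is minus the Casimir of the rotations, the square (is)² = -4 supplying the zeroth-order terms.
Its coordinate formula is singular at the poles; this form shows that it preserves regular
functions. -/
theorem angA_eq (F : smAlg (Om rp t0)) :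
    angA 2 F = -(Z1A 2 (Z1A 2 F) + Z2A 2 (Z2A 2 F) + Z3A (Z3A F)) := by
  have hI : (iS 2 : smAlg (Om rp t0)) ^ 2 = -4 := by
    unfold iS
    rw [← map_pow, mul_pow, Complex.I_sq]
    norm_num [map_ofNat]
  unfold angA
  simp only [Z1A_apply, Z2A_apply, Z3A_apply, wZ_apply, map_add, map_sub, map_neg,
    Derivation.leibniz, smul_eq_mul, Th_csc, Th_cot, Th_sPh, Th_cPh, Ph_sPh, Ph_cPh, Ph_csc,
    Ph_cot, Th_iS, Ph_iS, Ph_Th, Th_sTh]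
  linear_combination (2 * csc * iS 2 * cot * Ph F + csc ^ 2 * iS 2 ^ 2 * F + Th (Th F) +
    Th F * cot + Ph (Ph F) * cot ^ 2) * sPh_sq (rp := rp) (t0 := t0)
    - Th (Th F) * sTh_csc (rp := rp) (t0 := t0) - Th F * cTh_csc (rp := rp) (t0 := t0)
    - (Ph (Ph F) + 4 * F) * csc_sq (rp := rp) (t0 := t0) + csc ^ 2 * F * hI

end
end TeukolskySAdS

open scoped ContDiff
namespace TeukolskySAdS
open Set Filter Topology
noncomputable section

open Chart

variable {M k rp t0 : ℝ} (hB : Background M k rp)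

/-! ### Regular spin-weighted functions -/

/-- Periodic in `φ`. -/
def Per (F : smAlg (Om rp t0)) : Prop :=
  ∀ t r θ φ : ℝ, Region rp t0 t r θ → ev F t r θ (φ + 2 * Real.pi) = ev F t r θ φ

namespace Per

variable {F G : smAlg (Om rp t0)}

theorem add (hF : Per F) (hG : Per G) : Per (F + G) := fun t r θ φ h => by
  rw [ev_add, ev_add, hF t r θ φ h, hG t r θ φ h]

theorem sub (hF : Per F) (hG : Per G) : Per (F - G) := fun t r θ φ h => by
  rw [ev_sub, ev_sub, hF t r θ φ h, hG t r θ φ h]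

theorem neg (hF : Per F) : Per (-F) := fun t r θ φ h => by
  rw [ev_neg, ev_neg, hF t r θ φ h]

theorem mul (hF : Per F) (hG : Per G) : Per (F * G) := fun t r θ φ h => by
  rw [ev_mul, ev_mul, hF t r θ φ h, hG t r θ φ h]

theorem smul (c : ℂ) (hF : Per F) : Per (c • F) := fun t r θ φ h => by
  rw [ev_smul, ev_smul, hF t r θ φ h]

theorem rad (a : smAlg (Ioi rp)) : Per ((C4 rp t0).rad a) := fun t r θ φ h => by
  unfold ev
  rw [(C4 rp t0).smEv_rad _ (mem_Om.2 h), (C4 rp t0).smEv_rad _ (mem_Om.2 h)]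
  rfl

theorem thElt (a : smAlg (Ioo 0 Real.pi)) : Per (thElt a : smAlg (Om rp t0)) :=
  fun t r θ φ h => by rw [smEv_thElt _ h, smEv_thElt _ h]

theorem sPh : Per (sPh : smAlg (Om rp t0)) := fun t r θ φ h => by
  rw [ev_sPh h, ev_sPh h, Real.sin_add_two_pi]

theorem cPh : Per (cPh : smAlg (Om rp t0)) := fun t r θ φ h => by
  rw [ev_cPh h, ev_cPh h, Real.cos_add_two_pi]

theorem iS (s : ℤ) : Per (iS s : smAlg (Om rp t0)) := fun t r θ φ h => by
  unfold TeukolskySAdS.iS; rw [ev_algebraMap _ h, ev_algebraMap _ h]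

theorem T (hF : Per F) : Per ((C4 rp t0).T F) := fun t r θ φ h => by
  rw [← (hasDerivWithinAt_ev_t F h).derivWithin (uniqueDiffOn_Ici t0 t h.1),
    ← (hasDerivWithinAt_ev_t F h).derivWithin (uniqueDiffOn_Ici t0 t h.1)]
  exact derivWithin_congr (fun τ hτ => hF τ r θ φ ⟨hτ, h.2⟩) (hF t r θ φ h)

theorem R (hF : Per F) : Per ((C4 rp t0).R F) := fun t r θ φ h => by
  rw [← (hasDerivAt_ev_r F h).deriv, ← (hasDerivAt_ev_r F h).deriv]
  refine Filter.EventuallyEq.deriv_eq ?_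
  filter_upwards [Ioi_mem_nhds h.2.1] with ρ hρ using hF t ρ θ φ ⟨h.1, hρ, h.2.2⟩

theorem Th (hF : Per F) : Per (Th F) := fun t r θ φ h => by
  rw [← (hasDerivAt_ev_th F h).deriv, ← (hasDerivAt_ev_th F h).deriv]
  refine Filter.EventuallyEq.deriv_eq ?_
  filter_upwards [Ioo_mem_nhds h.2.2.1 h.2.2.2] with y hy using hF t r y φ ⟨h.1, h.2.1, hy⟩

theorem Ph (hF : Per F) : Per (Ph F) := fun t r θ φ h => by
  rw [← (hasDerivAt_ev_ph F h).deriv, ← (hasDerivAt_ev_ph F h).deriv, ← deriv_comp_add_const]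
  refine Filter.EventuallyEq.deriv_eq ?_
  filter_upwards with y using hF t r θ y h

theorem wZ (s : ℤ) (hF : Per F) : Per (wZ s F) :=
  (((Per.iS s).mul (Per.thElt _)).mul hF).neg.sub ((Per.thElt _).mul hF.Ph)

theorem Z1A (s : ℤ) (hF : Per F) : Per (Z1A s F) :=
  (Per.sPh.mul hF.Th).neg.add (Per.cPh.mul (hF.wZ s))

theorem Z2A (s : ℤ) (hF : Per F) : Per (Z2A s F) :=
  (Per.cPh.mul hF.Th).neg.sub (Per.sPh.mul (hF.wZ s))

theorem conj (hF : Per F) : Per (smConj F) := fun t r θ φ h => by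
  have := hF t r θ φ h
  simp only [ev, smEv_conj] at this ⊢
  rw [this]

end Per

/-- Smooth spin-`2`-weighted functions on the region, regular at the poles. -/
def good (rp t0 : ℝ) (hB : Background M k rp) : Submodule ℂ (smAlg (Om rp t0)) where
  carrier := {F | Per F ∧ ∀ a b c : ℕ,
    (Z1A 2)^[a] ((Z2A 2)^[b] (Z3A^[c] F)) ∈ radGood rp t0 hB}
  add_mem' {F G} hF hG := ⟨hF.1.add hG.1, fun a b c => by
    rw [iterate_map_add, iterate_map_add, iterate_map_add]
    exact Submodule.add_mem _ (hF.2 a b c) (hG.2 a b c)⟩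
  zero_mem' := ⟨fun t r θ φ h => by simp [ev, smEv_zero], fun a b c => by
    rw [iterate_map_zero, iterate_map_zero, iterate_map_zero]
    exact Submodule.zero_mem _⟩
  smul_mem' z F hF := ⟨hF.1.smul z, fun a b c => by
    have e : ∀ (Z : smAlg (Om rp t0) →ₗ[ℂ] smAlg (Om rp t0)) (n : ℕ) G,
        Z^[n] (z • G) = z • Z^[n] G := fun Z n G => by
      rw [← Module.End.pow_apply, ← Module.End.pow_apply, LinearMap.map_smul]
    rw [e, e, e]
    exact Submodule.smul_mem _ _ (hF.2 a b c)⟩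

theorem T_wZ (s : ℤ) (F : smAlg (Om rp t0)) : (C4 rp t0).T (wZ s F) = wZ s ((C4 rp t0).T F) := by
  have hP : (C4 rp t0).T (Ph F) = Ph ((C4 rp t0).T F) := pd_comm _ _ _
  have hi : (C4 rp t0).T (iS s) = 0 := Derivation.map_algebraMap _ _
  have h1 : (C4 rp t0).T csc = 0 := T_thElt _
  have h2 : (C4 rp t0).T cot = 0 := T_thElt _
  simp only [wZ_apply, map_sub, map_neg, Derivation.leibniz, smul_eq_mul, hP, hi, h1, h2]
  ring

theorem R_wZ (s : ℤ) (F : smAlg (Om rp t0)) : (C4 rp t0).R (wZ s F) = wZ s ((C4 rp t0).R F) := by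
  have hP : (C4 rp t0).R (Ph F) = Ph ((C4 rp t0).R F) := pd_comm _ _ _
  have hi : (C4 rp t0).R (iS s) = 0 := Derivation.map_algebraMap _ _
  have h1 : (C4 rp t0).R csc = 0 := R_thElt _
  have h2 : (C4 rp t0).R cot = 0 := R_thElt _
  simp only [wZ_apply, map_sub, map_neg, Derivation.leibniz, smul_eq_mul, hP, hi, h1, h2]
  ring

theorem T_Th (F : smAlg (Om rp t0)) : (C4 rp t0).T (Th F) = Th ((C4 rp t0).T F) := pd_comm _ _ _
theorem R_Th (F : smAlg (Om rp t0)) : (C4 rp t0).R (Th F) = Th ((C4 rp t0).R F) := pd_comm _ _ _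
theorem T_sPh : (C4 rp t0).T sPh = 0 := T_phElt _
theorem T_cPh : (C4 rp t0).T cPh = 0 := T_phElt _
theorem R_sPh : (C4 rp t0).R sPh = 0 := R_phElt _
theorem R_cPh : (C4 rp t0).R cPh = 0 := R_phElt _

theorem T_Z1 (s : ℤ) (F : smAlg (Om rp t0)) :
    (C4 rp t0).T (Z1A s F) = Z1A s ((C4 rp t0).T F) := by
  simp only [Z1A_apply, map_add, map_neg, Derivation.leibniz, smul_eq_mul, T_wZ, T_Th, T_sPh, T_cPh]
  ring
theorem R_Z1 (s : ℤ) (F : smAlg (Om rp t0)) :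
    (C4 rp t0).R (Z1A s F) = Z1A s ((C4 rp t0).R F) := by
  simp only [Z1A_apply, map_add, map_neg, Derivation.leibniz, smul_eq_mul, R_wZ, R_Th, R_sPh, R_cPh]
  ring
theorem T_Z2 (s : ℤ) (F : smAlg (Om rp t0)) :
    (C4 rp t0).T (Z2A s F) = Z2A s ((C4 rp t0).T F) := by
  simp only [Z2A_apply, map_sub, map_neg, Derivation.leibniz, smul_eq_mul, T_wZ, T_Th, T_sPh, T_cPh]
  ring
theorem R_Z2 (s : ℤ) (F : smAlg (Om rp t0)) :
    (C4 rp t0).R (Z2A s F) = Z2A s ((C4 rp t0).R F) := by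
  simp only [Z2A_apply, map_sub, map_neg, Derivation.leibniz, smul_eq_mul, R_wZ, R_Th, R_sPh, R_cPh]
  ring

theorem Th_rad (a : smAlg (Ioi rp)) : Th ((C4 rp t0).rad a) = 0 := by
  refine (pd_pull _ _ _ _).trans ?_
  rw [show (C4 rp t0).ρ (0, 0, 1, 0) = 0 from rfl, pd_zero_vec, map_zero]

theorem Ph_rad (a : smAlg (Ioi rp)) : Ph ((C4 rp t0).rad a) = 0 := by
  refine (pd_pull _ _ _ _).trans ?_
  rw [show (C4 rp t0).ρ (0, 0, 0, 1) = 0 from rfl, pd_zero_vec, map_zero]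

theorem wZ_rad (s : ℤ) (a : smAlg (Ioi rp)) (F : smAlg (Om rp t0)) :
    wZ s ((C4 rp t0).rad a * F) = (C4 rp t0).rad a * wZ s F := by
  simp only [wZ_apply, Derivation.leibniz, smul_eq_mul, Ph_rad]; ring

theorem Z1_rad (s : ℤ) (a : smAlg (Ioi rp)) (F : smAlg (Om rp t0)) :
    Z1A s ((C4 rp t0).rad a * F) = (C4 rp t0).rad a * Z1A s F := by
  simp only [Z1A_apply, wZ_rad, Derivation.leibniz, smul_eq_mul, Th_rad]; ring

theorem Z2_rad (s : ℤ) (a : smAlg (Ioi rp)) (F : smAlg (Om rp t0)) :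
    Z2A s ((C4 rp t0).rad a * F) = (C4 rp t0).rad a * Z2A s F := by
  simp only [Z2A_apply, wZ_rad, Derivation.leibniz, smul_eq_mul, Th_rad]; ring

theorem Z3_rad (a : smAlg (Ioi rp)) (F : smAlg (Om rp t0)) :
    Z3A ((C4 rp t0).rad a * F) = (C4 rp t0).rad a * Z3A F := by
  simp only [Z3A_apply, Derivation.leibniz, smul_eq_mul, Ph_rad]; ring

/-- A map commuting with the rotations commutes with ordered monomials in them. -/
theorem mono_comm {s : ℤ} {f : smAlg (Om rp t0) → smAlg (Om rp t0)}
    (h1 : ∀ F, f (Z1A s F) = Z1A s (f F)) (h2 : ∀ F, f (Z2A s F) = Z2A s (f F))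
    (h3 : ∀ F, f (Z3A F) = Z3A (f F)) (a b c : ℕ) (F : smAlg (Om rp t0)) :
    f ((Z1A s)^[a] ((Z2A s)^[b] (Z3A^[c] F))) = (Z1A s)^[a] ((Z2A s)^[b] (Z3A^[c] (f F))) := by
  have it : ∀ (Z : smAlg (Om rp t0) → smAlg (Om rp t0)), (∀ F, f (Z F) = Z (f F)) →
      ∀ n F, f (Z^[n] F) = Z^[n] (f F) := fun Z h n F =>
    (Function.Semiconj.iterate_right (f := f) (ga := Z) (gb := Z) h n) F
  rw [it _ h1, it _ h2, it _ h3]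

theorem good_T {F : smAlg (Om rp t0)} (hF : F ∈ good rp t0 hB) :
    (C4 rp t0).T F ∈ good rp t0 hB :=
  ⟨hF.1.T, fun a b c => by
    rw [← mono_comm (f := (C4 rp t0).T) (T_Z1 2) (T_Z2 2) (fun F => pd_comm _ _ _)]
    exact radGood_T hB (hF.2 a b c)⟩

theorem good_R {F : smAlg (Om rp t0)} (hF : F ∈ good rp t0 hB) :
    (C4 rp t0).R F ∈ good rp t0 hB :=
  ⟨hF.1.R, fun a b c => by
    rw [← mono_comm (f := (C4 rp t0).R) (R_Z1 2) (R_Z2 2) (fun F => pd_comm _ _ _)]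
    exact radGood_R hB (hF.2 a b c)⟩

theorem good_rad {F : smAlg (Om rp t0)} (hF : F ∈ good rp t0 hB) (α : smAlg (Ioi rp)) :
    (C4 rp t0).rad α * F ∈ good rp t0 hB :=
  ⟨(Per.rad α).mul hF.1, fun a b c => by
    rw [← mono_comm (f := fun F => (C4 rp t0).rad α * F) (fun F => (Z1_rad 2 α F).symm)
      (fun F => (Z2_rad 2 α F).symm) (fun F => (Z3_rad α F).symm)]
    exact radGood_rad hB (hF.2 a b c) α⟩

theorem good_D {F : smAlg (Om rp t0)} (hF : F ∈ good rp t0 hB) :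
    (C4 rp t0).D hB F ∈ good rp t0 hB :=
  good_rad hB (Submodule.add_mem _ (good_R hB hF) (good_rad hB (good_T hB hF) _)) _

theorem good_L {F : smAlg (Om rp t0)} (hF : F ∈ good rp t0 hB) :
    (C4 rp t0).L hB F ∈ good rp t0 hB :=
  Submodule.add_mem _ (good_T hB hF) (good_D hB hF)

theorem good_Lb {F : smAlg (Om rp t0)} (hF : F ∈ good rp t0 hB) :
    (C4 rp t0).Lb hB F ∈ good rp t0 hB :=
  Submodule.sub_mem _ (good_T hB hF) (good_D hB hF)

/-- Membership only controls ordered monomials in the rotations, so applying one more rotation on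
the inside requires the reordering of `ordered_monomials_mem`. -/
theorem good_Z {F : smAlg (Om rp t0)} (hF : F ∈ good rp t0 hB)
    {Z : smAlg (Om rp t0) →ₗ[ℂ] smAlg (Om rp t0)} (hZ : Z = Z1A 2 ∨ Z = Z2A 2 ∨ Z = Z3A) :
    Z F ∈ good rp t0 hB := by
  refine ⟨?_, ordered_monomials_mem (Z2_Z1 2) (Z3_Z1 2) (Z3_Z2 2) hF.2 hZ⟩
  rcases hZ with rfl | rfl | rfl
  exacts [hF.1.Z1A 2, hF.1.Z2A 2, hF.1.Ph]

theorem good_ang {F : smAlg (Om rp t0)} (hF : F ∈ good rp t0 hB) : angA 2 F ∈ good rp t0 hB := by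
  rw [angA_eq]
  have h : ∀ Z : smAlg (Om rp t0) →ₗ[ℂ] smAlg (Om rp t0), (Z = Z1A 2 ∨ Z = Z2A 2 ∨ Z = Z3A) →
      Z (Z F) ∈ good rp t0 hB := fun Z hZ => good_Z hB (good_Z hB hF hZ) hZ
  exact Submodule.neg_mem _ (Submodule.add_mem _ (Submodule.add_mem _
    (h _ (Or.inl rfl)) (h _ (Or.inr (Or.inl rfl)))) (h _ (Or.inr (Or.inr rfl))))

theorem good_locBdd {F : smAlg (Om rp t0)} (hF : F ∈ good rp t0 hB) : F ∈ locBdd rp t0 :=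
  hF.2 0 0 0 0 0

namespace Rep

variable {f : Field4} {F : smAlg (Om rp t0)}

theorem Z1 (s : ℤ) (h : Rep f F) : Rep (Z1 s f) (Z1A s F) := fun t r θ φ hr => by
  rw [Z1A_apply, wZ_apply, ev_add, ev_neg, ev_mul, ev_mul, ev_sub, ev_neg, ev_mul, ev_mul, ev_mul,
    ev_sPh hr, ev_cPh hr, ev_csc hr, ev_cot hr, iS, ev_algebraMap _ hr]
  simp only [TeukolskySAdS.Z1, h t r θ φ hr, h.dTh t r θ φ hr, h.dPh t r θ φ hr]
  ring

theorem Z2 (s : ℤ) (h : Rep f F) : Rep (Z2 s f) (Z2A s F) := fun t r θ φ hr => by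
  rw [Z2A_apply, wZ_apply, ev_sub, ev_neg, ev_mul, ev_mul, ev_sub, ev_neg, ev_mul, ev_mul, ev_mul,
    ev_sPh hr, ev_cPh hr, ev_csc hr, ev_cot hr, iS, ev_algebraMap _ hr]
  simp only [TeukolskySAdS.Z2, h t r θ φ hr, h.dTh t r θ φ hr, h.dPh t r θ φ hr]
  ring

theorem iterate {o : Field4 → Field4} {O : smAlg (Om rp t0) → smAlg (Om rp t0)}
    (ho : ∀ f F, Rep f F → Rep (o f) (O F)) (n : ℕ) (h : Rep f F) : Rep (o^[n] f) (O^[n] F) := by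
  induction n generalizing f F with
  | zero => exact h
  | succ n ih => exact ih (ho f F h)

theorem zpow (s : ℤ) (a b c : ℕ) (h : Rep f F) :
    Rep (Zpow s a b c f) ((Z1A s)^[a] ((Z2A s)^[b] (Z3A^[c] F))) :=
  iterate (fun _ _ => Z1 s) a (iterate (fun _ _ => Z2 s) b
    (iterate (O := Z3A) (fun _ _ => dPh) c h))

theorem horizon (s : ℤ) (p q a b c : ℕ) (h : Rep f F) :
    Rep (horizonDeriv M k t0 s p q a b c f) (((C4 rp t0).L hB)^[p]
      ((Y rp t0 hB)^[q] ((Z1A s)^[a] ((Z2A s)^[b] (Z3A^[c] F))))) :=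
  iterate (fun _ _ h => h.opL hB) p (iterate (O := Y rp t0 hB)
    (fun _ _ h => (h.opLb hB).rmul _ hB.smooth_Del_inv) q (h.zpow s a b c))

end Rep

theorem locBdd_of_spinLimit {f : Field4} {F : smAlg (Om rp t0)} (h : Rep f F) {s : ℤ}
    (hf : ∀ t r : ℝ, t0 ≤ t → rp < r → SpinLimit s (𝓝[Ici t0] t ×ˢ 𝓝 r) f) :
    F ∈ locBdd rp t0 := fun t r ht hr => by
  obtain ⟨C, hC⟩ := (hf t r ht hr).bounded
  refine ⟨C, ?_⟩
  filter_upwards [hC, prod_mem_prod (self_mem_nhdsWithin (s := Ici t0) (a := t))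
    (Ioi_mem_nhds hr)] with p hp hp' θ hθ φ hφ
  rw [← h p.1 p.2 θ φ ⟨hp'.1, hp'.2, hθ⟩]
  exact hp θ hθ φ hφ

theorem exists_good {f : Field4} (hf : IsSmoothSpin M k rp t0 2 f) :
    ∃ F ∈ good rp t0 hB, Rep f F := by
  obtain ⟨F, hF⟩ := exists_rep hf.smooth
  refine ⟨F, ⟨fun t r θ φ h => ?_, fun a b c p q => ?_⟩, hF⟩
  · rw [← hF t r θ φ h, ← hF t r θ _ h, hf.periodic t r θ φ h]
  · exact locBdd_of_spinLimit (hF.horizon hB 2 p q a b c) (hf.poles p q a b c)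

/-! ### Complex conjugation and the change of spin -/

section Conj

variable (F G : smAlg (Om rp t0))

theorem conj_mul : smConj (F * G) = smConj F * smConj G := sm_ext fun x _ => by
  simp only [smEv_conj, smEv_mul, map_mul]
theorem conj_add : smConj (F + G) = smConj F + smConj G := sm_ext fun x _ => by
  simp only [smEv_conj, smEv_add, map_add]
theorem conj_sub : smConj (F - G) = smConj F - smConj G := sm_ext fun x _ => by
  simp only [smEv_conj, smEv_sub, map_sub]
theorem conj_neg : smConj (-F) = -smConj F := sm_ext fun x _ => by
  simp only [smEv_conj, smEv_neg, map_neg]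
end Conj

theorem conj_rad (a : ℝ → ℝ) (ha : ContDiffOn ℝ ∞ a (Ioi rp)) :
    smConj ((C4 rp t0).rad (rmk a ha)) = (C4 rp t0).rad (rmk a ha) := sm_ext fun x hx => by
  rw [smEv_conj, (C4 rp t0).smEv_rad_rmk _ _ hx, Complex.conj_ofReal]

theorem conj_thElt (a : ℝ → ℝ) (ha : ContDiffOn ℝ ∞ a (Ioo 0 Real.pi)) :
    smConj (thElt (lineElt a ha) : smAlg (Om rp t0)) = thElt (lineElt a ha) :=
  ev_ext fun t r θ φ h => by
    have := smEv_thElt (φ := φ) (lineElt a ha) h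
    rw [smEv_lineElt _ _ h.mem] at this
    rw [this]
    unfold ev at this ⊢
    rw [smEv_conj, this, Complex.conj_ofReal]

theorem conj_phElt (a : ℝ → ℝ) (ha : ContDiffOn ℝ ∞ a univ) :
    smConj (phElt (lineElt a ha) : smAlg (Om rp t0)) = phElt (lineElt a ha) :=
  ev_ext fun t r θ φ h => by
    have := smEv_phElt (φ := φ) (lineElt a ha) h
    rw [smEv_lineElt _ _ (mem_univ _)] at this
    rw [this]
    unfold ev at this ⊢
    rw [smEv_conj, this, Complex.conj_ofReal]

theorem conj_iS (s : ℤ) : smConj (iS s : smAlg (Om rp t0)) = iS (-s) := sm_ext fun x hx => by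
  unfold iS
  rw [smEv_conj, smEv_algebraMap _ hx, smEv_algebraMap _ hx]
  simp

theorem conj_T (F : smAlg (Om rp t0)) : smConj ((C4 rp t0).T F) = (C4 rp t0).T (smConj F) :=
  (pd_conj _ _).symm
theorem conj_R (F : smAlg (Om rp t0)) : smConj ((C4 rp t0).R F) = (C4 rp t0).R (smConj F) :=
  (pd_conj _ _).symm
theorem conj_Th (F : smAlg (Om rp t0)) : smConj (Th F) = Th (smConj F) := (pd_conj _ _).symm
theorem conj_Ph (F : smAlg (Om rp t0)) : smConj (Ph F) = Ph (smConj F) := (pd_conj _ _).symm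

theorem conj_D (F : smAlg (Om rp t0)) :
    smConj ((C4 rp t0).D hB F) = (C4 rp t0).D hB (smConj F) := by
  simp only [D_apply, conj_mul, conj_add, conj_rad, conj_T, conj_R]

theorem conj_L (F : smAlg (Om rp t0)) :
    smConj ((C4 rp t0).L hB F) = (C4 rp t0).L hB (smConj F) := by
  simp only [Chart.L_apply, conj_add, conj_T, conj_D]

theorem conj_Lb (F : smAlg (Om rp t0)) :
    smConj ((C4 rp t0).Lb hB F) = (C4 rp t0).Lb hB (smConj F) := by
  simp only [Chart.Lb_apply, conj_sub, conj_T, conj_D]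

theorem conj_Y (F : smAlg (Om rp t0)) :
    smConj (Y rp t0 hB F) = Y rp t0 hB (smConj F) := by
  simp only [Y_apply, conj_mul, conj_Lb, conj_rad]

theorem conj_wZ (s : ℤ) (F : smAlg (Om rp t0)) : smConj (wZ s F) = wZ (-s) (smConj F) := by
  have h1 : smConj (csc : smAlg (Om rp t0)) = csc := conj_thElt _ _
  have h2 : smConj (cot : smAlg (Om rp t0)) = cot := conj_thElt _ _
  simp only [wZ_apply, conj_sub, conj_neg, conj_mul, conj_iS, conj_Ph, h1, h2]

theorem conj_Z1 (s : ℤ) (F : smAlg (Om rp t0)) : smConj (Z1A s F) = Z1A (-s) (smConj F) := by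
  have h1 : smConj (sPh : smAlg (Om rp t0)) = sPh := conj_phElt _ _
  have h2 : smConj (cPh : smAlg (Om rp t0)) = cPh := conj_phElt _ _
  simp only [Z1A_apply, conj_add, conj_neg, conj_mul, conj_Th, conj_wZ, h1, h2]

theorem conj_Z2 (s : ℤ) (F : smAlg (Om rp t0)) : smConj (Z2A s F) = Z2A (-s) (smConj F) := by
  have h1 : smConj (sPh : smAlg (Om rp t0)) = sPh := conj_phElt _ _
  have h2 : smConj (cPh : smAlg (Om rp t0)) = cPh := conj_phElt _ _
  simp only [Z2A_apply, conj_sub, conj_neg, conj_mul, conj_Th, conj_wZ, h1, h2]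

theorem conj_Z3 (F : smAlg (Om rp t0)) : smConj (Z3A F) = Z3A (smConj F) := conj_Ph F

theorem conj_locBdd {F : smAlg (Om rp t0)} (hF : F ∈ locBdd rp t0) : smConj F ∈ locBdd rp t0 :=
  fun t r ht hr => by
    obtain ⟨C, hC⟩ := hF t r ht hr
    refine ⟨C, hC.mono fun p hp θ hθ φ hφ => ?_⟩
    have := hp θ hθ φ hφ
    simpa [ev, smEv_conj] using this

/-- The null derivatives are real, while conjugation replaces is by -is in the rotations. Hence the
conjugate of a regular spin -2 function is a regular spin +2 function, and one set of harmonics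
serves both fields. -/
theorem conj_word (s : ℤ) (p q a b c : ℕ) (F : smAlg (Om rp t0)) :
    smConj (((C4 rp t0).L hB)^[p] ((Y rp t0 hB)^[q] ((Z1A s)^[a] ((Z2A s)^[b] (Z3A^[c] F))))) =
      ((C4 rp t0).L hB)^[p] ((Y rp t0 hB)^[q]
        ((Z1A (-s))^[a] ((Z2A (-s))^[b] (Z3A^[c] (smConj F))))) := by
  have it : ∀ (Z Z' : smAlg (Om rp t0) → smAlg (Om rp t0)), (∀ F, smConj (Z F) = Z' (smConj F)) →
      ∀ n F, smConj (Z^[n] F) = Z'^[n] (smConj F) := fun Z Z' h n F =>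
    (Function.Semiconj.iterate_right (f := smConj) (ga := Z) (gb := Z') h n) F
  rw [it _ _ (conj_L hB), it _ _ (conj_Y hB), it _ _ (conj_Z1 s), it _ _ (conj_Z2 s),
    it _ _ conj_Z3]

theorem exists_good_conj {f : Field4} (hf : IsSmoothSpin M k rp t0 (-2) f) :
    ∃ F ∈ good rp t0 hB, Rep (cc f) F := by
  obtain ⟨F, hF⟩ := exists_rep hf.smooth
  refine ⟨smConj F, ⟨Per.conj fun t r θ φ h => ?_, fun a b c p q => ?_⟩, hF.cc⟩
  · rw [← hF t r θ φ h, ← hF t r θ _ h, hf.periodic t r θ φ h]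
  · have h1 := conj_locBdd (locBdd_of_spinLimit (hF.horizon hB (-2) p q a b c)
      (hf.poles p q a b c))
    rw [conj_word] at h1
    exact h1

end
end TeukolskySAdS

open scoped ContDiff
namespace TeukolskySAdS
open Set Filter Topology
noncomputable section

/-! ### The polynomials in the Rodrigues formula -/

open Polynomial in
/-- `(1 - X)^A (1 + X)^B` -/
def yPoly (A B : ℕ) : Polynomial ℝ := (1 - X) ^ A * (1 + X) ^ B

open Polynomial

theorem natDegree_one_sub_X : (1 - X : ℝ[X]).natDegree = 1 := by
  rw [show (1 - X : ℝ[X]) = C (-1) * X + C 1 by simp; ring]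
  exact natDegree_linear (by norm_num)

theorem natDegree_one_add_X : (1 + X : ℝ[X]).natDegree = 1 := by
  rw [show (1 + X : ℝ[X]) = C 1 * X + C 1 by simp; ring]
  exact natDegree_linear (by norm_num)

theorem leadingCoeff_one_sub_X : (1 - X : ℝ[X]).leadingCoeff = -1 := by
  rw [show (1 - X : ℝ[X]) = C (-1) * X + C 1 by simp; ring]
  exact leadingCoeff_linear (by norm_num)

theorem leadingCoeff_one_add_X : (1 + X : ℝ[X]).leadingCoeff = 1 := by
  rw [show (1 + X : ℝ[X]) = C 1 * X + C 1 by simp; ring]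
  exact leadingCoeff_linear (by norm_num)

theorem one_sub_X_ne : (1 - X : ℝ[X]) ≠ 0 := fun h => by
  have := leadingCoeff_one_sub_X; rw [h] at this; simp at this

theorem one_add_X_ne : (1 + X : ℝ[X]) ≠ 0 := fun h => by
  have := leadingCoeff_one_add_X; rw [h] at this; simp at this

theorem yPoly_ne (A B : ℕ) : yPoly A B ≠ 0 :=
  mul_ne_zero (pow_ne_zero _ one_sub_X_ne) (pow_ne_zero _ one_add_X_ne)

theorem natDegree_yPoly (A B : ℕ) : (yPoly A B).natDegree = A + B := by
  unfold yPoly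
  rw [natDegree_mul (pow_ne_zero _ one_sub_X_ne) (pow_ne_zero _ one_add_X_ne), natDegree_pow,
    natDegree_pow, natDegree_one_sub_X, natDegree_one_add_X]
  ring

theorem leadingCoeff_yPoly (A B : ℕ) : (yPoly A B).leadingCoeff = (-1) ^ A := by
  unfold yPoly
  rw [leadingCoeff_mul, leadingCoeff_pow, leadingCoeff_pow, leadingCoeff_one_sub_X,
    leadingCoeff_one_add_X, one_pow, mul_one]

theorem isCoprime_one_sub_add : IsCoprime (1 - X : ℝ[X]) (1 + X) :=
  ⟨C (1 / 2), C (1 / 2), by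
    rw [← mul_add, show (1 - X + (1 + X) : ℝ[X]) = C 2 by rw [show (2:ℝ) = 1 + 1 by norm_num]; simp,
      ← C_mul]
    norm_num⟩

/-- Each derivative lowers an order of vanishing by at most one, and the factors at the two
endpoints are coprime. The subtractions are truncated: beyond the order nothing is claimed. -/
theorem dvd_iterate_derivative_yPoly (A B n : ℕ) :
    yPoly (A - n) (B - n) ∣ derivative^[n] (yPoly A B) := by
  refine (isCoprime_one_sub_add.pow).mul_dvd ?_ ?_
  · exact pow_sub_dvd_iterate_derivative_of_pow_dvd n (dvd_mul_right _ _)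
  · exact pow_sub_dvd_iterate_derivative_of_pow_dvd n (dvd_mul_left _ _)

theorem natDegree_iterate_yPoly {A B n : ℕ} (h : n ≤ A + B) :
    (derivative^[n] (yPoly A B)).natDegree = A + B - n ∧
      (derivative^[n] (yPoly A B)).leadingCoeff = ((A + B).descFactorial n : ℝ) * (-1) ^ A := by
  have hc : (derivative^[n] (yPoly A B)).coeff (A + B - n) =
      ((A + B).descFactorial n : ℝ) * (-1) ^ A := by
    rw [coeff_iterate_derivative, Nat.sub_add_cancel h, nsmul_eq_mul, ← leadingCoeff_yPoly A B,
      leadingCoeff, natDegree_yPoly]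
  have hne : (derivative^[n] (yPoly A B)).coeff (A + B - n) ≠ 0 := by
    rw [hc]
    refine mul_ne_zero ?_ (pow_ne_zero _ (by norm_num))
    exact_mod_cast (Nat.descFactorial_pos.2 h).ne'
  have hd : (derivative^[n] (yPoly A B)).natDegree = A + B - n :=
    natDegree_eq_of_le_of_coeff_ne_zero
      ((natDegree_iterate_derivative _ _).trans (by rw [natDegree_yPoly])) hne
  exact ⟨hd, by rw [leadingCoeff, hd, hc]⟩

/-- The equation of hypergeometric type satisfied by derivatives of `yPoly`. -/
theorem yPoly_ode (A B n : ℕ) :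
    (1 - X ^ 2) * derivative^[n + 2] (yPoly A B) =
      (C (2 * (n + 1 : ℝ)) * X + C ((B : ℝ) - A) - C ((A : ℝ) + B) * X) *
        derivative^[n + 1] (yPoly A B) +
      C ((n : ℝ) * (n + 1) - (n + 1) * (A + B)) * derivative^[n] (yPoly A B) := by
  -- The first-order (Pearson) equation of the weight; the claim is its (n+1)-st derivative.
  have h0 : (1 - X ^ 2) * derivative (yPoly A B) =
      (C ((B : ℝ) - A) - C ((A : ℝ) + B) * X) * yPoly A B := by
    have hA : (1 - X) * derivative ((1 - X : ℝ[X]) ^ A) = -(C (A : ℝ) * (1 - X) ^ A) := by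
      cases A with
      | zero => simp
      | succ A => rw [derivative_pow]; simp; ring
    have hB : (1 + X) * derivative ((1 + X : ℝ[X]) ^ B) = C (B : ℝ) * (1 + X) ^ B := by
      cases B with
      | zero => simp
      | succ B => rw [derivative_pow]; simp; ring
    unfold yPoly
    rw [derivative_mul]
    simp only [C_sub, C_add]
    linear_combination (1 + X) * (1 + X) ^ B * hA + (1 - X) * (1 - X) ^ A * hB
  induction n with
  | zero =>
    have h1 := congrArg derivative h0
    simp only [derivative_mul, derivative_sub, derivative_one, derivative_X_pow, derivative_C,
      derivative_X] at h1
    simp only [Function.iterate_succ_apply', Function.iterate_zero_apply, C_sub, C_add, C_mul] at h1 ⊢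
    push_cast at h1 ⊢
    simp only [map_ofNat, map_one, map_zero, map_natCast] at h1 ⊢
    linear_combination h1
  | succ n ih =>
    have h1 := congrArg derivative ih
    simp only [derivative_mul, derivative_sub, derivative_add, derivative_one, derivative_X_pow,
      derivative_C, derivative_X, ← Function.iterate_succ_apply' derivative] at h1
    simp only [C_sub, C_add, C_mul] at h1 ⊢
    push_cast at h1 ⊢
    simp only [map_ofNat, map_one, map_zero, map_natCast, C_add] at h1 ⊢
    linear_combination h1

/-- Iterated integration by parts for polynomials. -/
theorem integral_mul_iterate_derivative (n : ℕ) : ∀ (P Q : ℝ[X]),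
    (∀ i j, i + j + 1 = n → ((derivative^[i] P).eval 1 = 0 ∨ (derivative^[j] Q).eval 1 = 0) ∧
      ((derivative^[i] P).eval (-1) = 0 ∨ (derivative^[j] Q).eval (-1) = 0)) →
    ∫ x in (-1 : ℝ)..1, P.eval x * (derivative^[n] Q).eval x =
      (-1) ^ n * ∫ x in (-1 : ℝ)..1, (derivative^[n] P).eval x * Q.eval x := by
  induction n with
  | zero => intro P Q _; simp
  | succ n ih =>
    intro P Q h
    have hp : ∫ x in (-1 : ℝ)..1, P.eval x * (derivative^[n + 1] Q).eval x =
        P.eval 1 * (derivative^[n] Q).eval 1 - P.eval (-1) * (derivative^[n] Q).eval (-1) -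
          ∫ x in (-1 : ℝ)..1, (derivative P).eval x * (derivative^[n] Q).eval x := by
      refine intervalIntegral.integral_mul_deriv_eq_deriv_mul (u := fun x => P.eval x)
        (v := fun x => (derivative^[n] Q).eval x) (fun x _ => P.hasDerivAt x) (fun x _ => ?_) ?_ ?_
      · rw [Function.iterate_succ_apply']
        exact (derivative^[n] Q).hasDerivAt x
      · exact (derivative P).continuous.intervalIntegrable _ _
      · exact (derivative^[n + 1] Q).continuous.intervalIntegrable _ _
    have h0 := h 0 n (by omega)
    simp only [Function.iterate_zero_apply] at h0
    have e1 : P.eval 1 * (derivative^[n] Q).eval 1 = 0 := mul_eq_zero.2 h0.1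
    have e2 : P.eval (-1) * (derivative^[n] Q).eval (-1) = 0 := mul_eq_zero.2 h0.2
    rw [hp, e1, e2, ih (derivative P) Q fun i j hij => ?_]
    · rw [← Function.iterate_succ_apply, pow_succ]; ring
    · rw [← Function.iterate_succ_apply]
      exact h (i + 1) j (by omega)

/-- The Beta integral on [-1, 1]: integration by parts trades one factor 1 - x for one factor 1 + x.
-/
theorem integral_yPoly (A : ℕ) : ∀ B : ℕ, ∫ x in (-1 : ℝ)..1, (yPoly A B).eval x =
    2 ^ (A + B + 1) * (A.factorial * B.factorial : ℝ) / ((A + B + 1).factorial : ℝ) := by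
  induction A with
  | zero =>
    intro B
    have : ∀ x : ℝ, (yPoly 0 B).eval x = (1 + x) ^ B := fun x => by simp [yPoly]
    simp only [this]
    rw [intervalIntegral.integral_comp_add_left (fun x => x ^ B) (1 : ℝ), integral_pow]
    rw [Nat.zero_add, Nat.factorial_succ]
    have : (B.factorial : ℝ) ≠ 0 := by exact_mod_cast B.factorial_ne_zero
    push_cast
    norm_num
    field_simp
  | succ A ih =>
    intro B
    have hp : ∫ x in (-1 : ℝ)..1, (1 - x) ^ (A + 1) * ((B + 1) * (1 + x) ^ B) =
        (1 - 1) ^ (A + 1) * (1 + 1) ^ (B + 1) - (1 - (-1)) ^ (A + 1) * (1 + (-1)) ^ (B + 1) -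
          ∫ x in (-1 : ℝ)..1, (-((A + 1) * (1 - x) ^ A)) * (1 + x) ^ (B + 1) := by
      refine intervalIntegral.integral_mul_deriv_eq_deriv_mul (u := fun x : ℝ => (1 - x) ^ (A + 1))
        (v := fun x : ℝ => (1 + x) ^ (B + 1)) (fun x _ => ?_) (fun x _ => ?_) ?_ ?_
      · have := ((hasDerivAt_const x (1 : ℝ)).sub (hasDerivAt_id x)).pow (A + 1)
        refine this.congr_deriv ?_
        simp
      · have := ((hasDerivAt_const x (1 : ℝ)).add (hasDerivAt_id x)).pow (B + 1)
        refine this.congr_deriv ?_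
        simp
      · exact Continuous.intervalIntegrable (by fun_prop) _ _
      · exact Continuous.intervalIntegrable (by fun_prop) _ _
    have e1 : ∀ x : ℝ, (1 - x) ^ (A + 1) * ((B + 1) * (1 + x) ^ B) =
        (B + 1) * (yPoly (A + 1) B).eval x := fun x => by simp [yPoly]; ring
    have e2 : ∀ x : ℝ, (-((A + 1) * (1 - x) ^ A)) * (1 + x) ^ (B + 1) =
        -(A + 1) * (yPoly A (B + 1)).eval x := fun x => by simp [yPoly]; ring
    simp only [e1, e2] at hp
    rw [intervalIntegral.integral_const_mul, intervalIntegral.integral_const_mul, ih (B + 1)] at hp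
    have hB : (B + 1 : ℝ) ≠ 0 := by positivity
    have e3 : A + 1 + B + 1 = A + (B + 1) + 1 := by ring
    rw [e3, Nat.factorial_succ A]
    rw [Nat.factorial_succ B] at hp
    have : ((A + (B + 1) + 1).factorial : ℝ) ≠ 0 := by exact_mod_cast Nat.factorial_ne_zero _
    apply mul_left_cancel₀ hB
    rw [hp]
    push_cast
    norm_num
    field_simp
    ring

end
end TeukolskySAdS

open scoped ContDiff
namespace TeukolskySAdS
open Set Filter Topology
noncomputable section

open Polynomial

/-! ### The spin-weighted harmonics -/

/-- Admissible indices of the spin-weighted harmonics. -/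
def Adm (m : ℤ) (ℓ : ℕ) : Prop := 2 ≤ ℓ ∧ -(ℓ : ℤ) ≤ m ∧ m ≤ ℓ

/-- The polynomial of the Rodrigues formula. -/
def rod (m : ℤ) (ℓ : ℕ) : ℝ[X] := derivative^[ℓ - 2] (yPoly (ℓ + m).toNat (ℓ - m).toNat)

/-- The Jacobi polynomial, up to normalisation. -/
def jac (m : ℤ) (ℓ : ℕ) : ℝ[X] := rod m ℓ / yPoly (m + 2).toNat (2 - m).toNat

/-- The Jacobi polynomial times the remaining weight. -/
def qP (m : ℤ) (ℓ : ℕ) : ℝ[X] := yPoly (-(m + 2)).toNat (m - 2).toNat * jac m ℓ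

/-- The normalisation constant. -/
def kap (m : ℤ) (ℓ : ℕ) : ℝ :=
  (if 0 ≤ m then 1 else (-1) ^ m.natAbs) *
  (Real.sqrt ((2 * ℓ + 1) / (4 * Real.pi) * ((ℓ + 2).factorial : ℝ)
      / ((ℓ - 2).factorial * ((ℓ + m).toNat).factorial * ((ℓ - m).toNat).factorial)) / 2 ^ ℓ)

/-- The weight of the Rodrigues formula. -/
def gW (m : ℤ) (θ : ℝ) : ℝ := 1 / 4 * Real.sin (θ / 2) ^ (-(m + 2)) * Real.cos (θ / 2) ^ (m - 2)

theorem Sml_eq (m : ℤ) (ℓ : ℕ) (θ : ℝ) :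
    Sml m ℓ θ = kap m ℓ * gW m θ * (rod m ℓ).eval (Real.cos θ) := rfl

variable {m : ℤ} {ℓ ℓ' : ℕ}

theorem Adm.sub (h : Adm m ℓ) : (ℓ + m).toNat - (ℓ - 2) = (m + 2).toNat ∧
    (ℓ - m).toNat - (ℓ - 2) = (2 - m).toNat := by
  obtain ⟨h1, h2, h3⟩ := h
  omega

theorem rod_eq (h : Adm m ℓ) : yPoly (m + 2).toNat (2 - m).toNat * jac m ℓ = rod m ℓ := by
  refine EuclideanDomain.mul_div_cancel' (yPoly_ne _ _) ?_
  rw [← h.sub.1, ← h.sub.2]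
  exact dvd_iterate_derivative_yPoly _ _ _

theorem rod_degree (h : Adm m ℓ) : (rod m ℓ).natDegree = ℓ + 2 ∧
    (rod m ℓ).leadingCoeff = ((2 * ℓ).descFactorial (ℓ - 2) : ℝ) * (-1) ^ (ℓ + m).toNat := by
  obtain ⟨h1, h2, h3⟩ := h
  have := natDegree_iterate_yPoly (A := (ℓ + m).toNat) (B := (ℓ - m).toNat) (n := ℓ - 2) (by omega)
  have e : (ℓ + m).toNat + (ℓ - m).toNat = 2 * ℓ := by omega
  rw [e] at this
  refine ⟨this.1.trans (by omega), this.2⟩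

theorem rod_ne (h : Adm m ℓ) : rod m ℓ ≠ 0 := fun h0 => by
  have := (rod_degree h).1
  rw [h0] at this
  simp at this

theorem jac_ne (h : Adm m ℓ) : jac m ℓ ≠ 0 := fun h0 => by
  have := rod_eq h
  rw [h0, mul_zero] at this
  exact rod_ne h this.symm

theorem jac_degree (h : Adm m ℓ) :
    (jac m ℓ).natDegree + ((m + 2).toNat + (2 - m).toNat) = ℓ + 2 := by
  have := congrArg natDegree (rod_eq h)
  rw [natDegree_mul (yPoly_ne _ _) (jac_ne h), natDegree_yPoly, (rod_degree h).1] at this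
  omega

/-- The positive parts of m + 2 and 2 - m removed from the Rodrigues polynomial and the negative
parts put back differ by (m + 2) + (2 - m) = 4, so degree ℓ + 2 drops to ℓ - 2. That is below the
number of derivatives in any higher Rodrigues formula, which gives orthogonality. -/
theorem qP_degree (h : Adm m ℓ) : (qP m ℓ).natDegree = ℓ - 2 := by
  unfold qP
  rw [natDegree_mul (yPoly_ne _ _) (jac_ne h), natDegree_yPoly]
  have := jac_degree h
  obtain ⟨h1, h2, h3⟩ := h
  omega

theorem qP_leading (h : Adm m ℓ) :
    (qP m ℓ).leadingCoeff = (-1) ^ ℓ * ((2 * ℓ).descFactorial (ℓ - 2) : ℝ) := by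
  have h1 := congrArg leadingCoeff (rod_eq h)
  rw [leadingCoeff_mul, leadingCoeff_yPoly, (rod_degree h).2] at h1
  unfold qP
  rw [leadingCoeff_mul, leadingCoeff_yPoly]
  have hsq : ∀ n : ℕ, ((-1 : ℝ) ^ n) * (-1) ^ n = 1 := fun n => by
    rw [← mul_pow]; norm_num
  have h2 : (jac m ℓ).leadingCoeff = (-1) ^ (m + 2).toNat *
      (((2 * ℓ).descFactorial (ℓ - 2) : ℝ) * (-1) ^ (ℓ + m).toNat) := by
    rw [← h1, ← mul_assoc, hsq, one_mul]
  rw [h2]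
  have h3 : ((-1 : ℝ)) ^ (-(m + 2)).toNat * ((-1) ^ (m + 2).toNat * (-1) ^ (ℓ + m).toNat) =
      (-1) ^ ℓ := by
    rw [← pow_add, ← pow_add]
    obtain ⟨h1, h2, h3⟩ := h
    refine neg_one_pow_congr ?_
    grind
  rw [← h3]; ring

theorem integral_cos_sin (P : ℝ[X]) :
    ∫ θ in (0 : ℝ)..Real.pi, P.eval (Real.cos θ) * Real.sin θ = ∫ x in (-1 : ℝ)..1, P.eval x := by
  have := intervalIntegral.integral_comp_mul_deriv (a := 0) (b := Real.pi) (f := Real.cos)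
    (f' := fun θ => -Real.sin θ) (g := fun x => P.eval x) (fun x _ => Real.hasDerivAt_cos x)
    (by fun_prop) P.continuous
  rw [Real.cos_zero, Real.cos_pi, intervalIntegral.integral_symm (-1) 1] at this
  rw [← neg_inj, ← this, ← intervalIntegral.integral_neg]
  simp

theorem half_sq (θ : ℝ) : 1 - Real.cos θ = 2 * Real.sin (θ / 2) ^ 2 ∧
    1 + Real.cos θ = 2 * Real.cos (θ / 2) ^ 2 := by
  have h1 : Real.cos θ = 2 * Real.cos (θ / 2) ^ 2 - 1 := by
    rw [← Real.cos_two_mul]; congr 1; ring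
  have h2 := Real.sin_sq_add_cos_sq (θ / 2)
  constructor <;> linarith

theorem half_pos {θ : ℝ} (h : θ ∈ Ioo 0 Real.pi) :
    0 < Real.sin (θ / 2) ∧ 0 < Real.cos (θ / 2) := by
  obtain ⟨h1, h2⟩ := h
  exact ⟨Real.sin_pos_of_pos_of_lt_pi (by linarith) (by linarith),
    Real.cos_pos_of_mem_Ioo ⟨by linarith, by linarith⟩⟩

theorem eval_yPoly_cos (A B : ℕ) (θ : ℝ) : (yPoly A B).eval (Real.cos θ) =
    2 ^ (A + B) * Real.sin (θ / 2) ^ (2 * A) * Real.cos (θ / 2) ^ (2 * B) := by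
  have : (yPoly A B).eval (Real.cos θ) = (1 - Real.cos θ) ^ A * (1 + Real.cos θ) ^ B := by
    simp [yPoly]
  rw [this, (half_sq θ).1, (half_sq θ).2, mul_pow, mul_pow, pow_mul, pow_mul, pow_add]
  ring

/-- The possibly singular half-angle powers of the weight are absorbed by the zeros of the Rodrigues
polynomial. Only exponents |m + 2| and |m - 2| remain, so the harmonics extend smoothly across θ =
0, π. -/
theorem gW_mul {θ : ℝ} (h : θ ∈ Ioo 0 Real.pi) (m : ℤ) :
    gW m θ * (yPoly (m + 2).toNat (2 - m).toNat).eval (Real.cos θ) =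
      1 / 4 * 2 ^ ((m + 2).toNat + (2 - m).toNat) *
        Real.sin (θ / 2) ^ (m + 2).natAbs * Real.cos (θ / 2) ^ (m - 2).natAbs := by
  obtain ⟨hs, hc⟩ := half_pos h
  rw [eval_yPoly_cos]
  have e1 : Real.sin (θ / 2) ^ (-(m + 2)) * Real.sin (θ / 2) ^ (2 * (m + 2).toNat) =
      Real.sin (θ / 2) ^ (m + 2).natAbs := by
    rw [← zpow_natCast, ← zpow_natCast, ← zpow_add₀ hs.ne']
    congr 1; omega
  have e2 : Real.cos (θ / 2) ^ (m - 2) * Real.cos (θ / 2) ^ (2 * (2 - m).toNat) =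
      Real.cos (θ / 2) ^ (m - 2).natAbs := by
    rw [← zpow_natCast, ← zpow_natCast, ← zpow_add₀ hc.ne']
    congr 1; omega
  rw [← e1, ← e2]
  unfold gW
  ring

/-- In a product of two harmonics with the same m the weight occurs squared and becomes polynomial
in cos θ, so the inner products are integrals of polynomials over [-1, 1]. -/
theorem gW_sq_mul {θ : ℝ} (h : θ ∈ Ioo 0 Real.pi) (m : ℤ) :
    gW m θ * (gW m θ * (yPoly (m + 2).toNat (2 - m).toNat).eval (Real.cos θ)) =
      (yPoly (-(m + 2)).toNat (m - 2).toNat).eval (Real.cos θ) := by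
  obtain ⟨hs, hc⟩ := half_pos h
  rw [gW_mul h, eval_yPoly_cos]
  have e1 : Real.sin (θ / 2) ^ (-(m + 2)) * Real.sin (θ / 2) ^ (m + 2).natAbs =
      Real.sin (θ / 2) ^ (2 * (-(m + 2)).toNat) := by
    rw [← zpow_natCast, ← zpow_natCast, ← zpow_add₀ hs.ne']
    congr 1; omega
  have e2 : Real.cos (θ / 2) ^ (m - 2) * Real.cos (θ / 2) ^ (m - 2).natAbs =
      Real.cos (θ / 2) ^ (2 * (m - 2).toNat) := by
    rw [← zpow_natCast, ← zpow_natCast, ← zpow_add₀ hc.ne']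
    congr 1; omega
  have e3 : (2 : ℝ) ^ ((m + 2).toNat + (2 - m).toNat) =
      2 ^ ((-(m + 2)).toNat + (m - 2).toNat) * 16 := by
    rw [show (16 : ℝ) = 2 ^ 4 by norm_num, ← pow_add]
    congr 1; omega
  rw [e3, ← e1, ← e2]
  unfold gW
  ring

/-- The harmonics as smooth functions on the line. -/
def Sreg (m : ℤ) (ℓ : ℕ) (θ : ℝ) : ℝ :=
  kap m ℓ * (1 / 4 * 2 ^ ((m + 2).toNat + (2 - m).toNat) *
        Real.sin (θ / 2) ^ (m + 2).natAbs * Real.cos (θ / 2) ^ (m - 2).natAbs) *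
    (jac m ℓ).eval (Real.cos θ)

theorem Sml_eq_Sreg (hA : Adm m ℓ) {θ : ℝ} (h : θ ∈ Ioo 0 Real.pi) : Sml m ℓ θ = Sreg m ℓ θ := by
  rw [Sml_eq, Sreg, ← gW_mul h, ← rod_eq hA, eval_mul]
  ring

theorem Sml_mul_Sml (hA : Adm m ℓ) {θ : ℝ} (h : θ ∈ Ioo 0 Real.pi) :
    Sml m ℓ θ * Sml m ℓ' θ = kap m ℓ * kap m ℓ' * (qP m ℓ * rod m ℓ').eval (Real.cos θ) := by
  rw [Sml_eq, Sml_eq, ← rod_eq hA, eval_mul, eval_mul, qP, eval_mul, ← gW_sq_mul h]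
  ring

theorem eval_of_dvd {p : ℝ[X]} {A B : ℕ} (h : yPoly A B ∣ p) :
    (0 < A → p.eval 1 = 0) ∧ (0 < B → p.eval (-1) = 0) := by
  obtain ⟨c, rfl⟩ := h
  constructor <;> intro h <;> simp [yPoly, h.ne']

theorem dvd_iterate_qP (i : ℕ) :
    yPoly ((-(m + 2)).toNat - i) ((m - 2).toNat - i) ∣ derivative^[i] (qP m ℓ) := by
  refine (isCoprime_one_sub_add.pow).mul_dvd ?_ ?_
  · refine pow_sub_dvd_iterate_derivative_of_pow_dvd i ?_
    exact (dvd_mul_right _ _).trans (dvd_mul_right _ _)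
  · refine pow_sub_dvd_iterate_derivative_of_pow_dvd i ?_
    exact (dvd_mul_left _ _).trans (dvd_mul_right _ _)

/-- Boundary terms have i + j = ℓ' - 3. At x = 1 either j < ℓ' + m and the Rodrigues factor
vanishes, or i ≤ -m - 3 and `qP` still vanishes there. The point x = -1 is the same with m replaced
by -m. -/
theorem integral_qP_rod (hA' : Adm m ℓ') :
    ∫ x in (-1 : ℝ)..1, (qP m ℓ).eval x * (rod m ℓ').eval x =
      (-1) ^ (ℓ' - 2) * ∫ x in (-1 : ℝ)..1, (derivative^[ℓ' - 2] (qP m ℓ)).eval x *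
        (yPoly (ℓ' + m).toNat (ℓ' - m).toNat).eval x := by
  refine integral_mul_iterate_derivative _ _ _ fun i j hij => ?_
  obtain ⟨h1, h2, h3⟩ := hA'
  have hq := eval_of_dvd (dvd_iterate_qP (m := m) (ℓ := ℓ) i)
  have hy := eval_of_dvd (dvd_iterate_derivative_yPoly (ℓ' + m).toNat (ℓ' - m).toNat j)
  constructor
  · by_cases hj : j < (ℓ' + m).toNat
    · exact Or.inr (hy.1 (by omega))
    · exact Or.inl (hq.1 (by omega))
  · by_cases hj : j < (ℓ' - m).toNat
    · exact Or.inr (hy.2 (by omega))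
    · exact Or.inl (hq.2 (by omega))

theorem integral_Sml_mul (hA : Adm m ℓ) :
    ∫ θ in (0 : ℝ)..Real.pi, Sml m ℓ θ * Sml m ℓ' θ * Real.sin θ =
      kap m ℓ * kap m ℓ' * ∫ x in (-1 : ℝ)..1, (qP m ℓ).eval x * (rod m ℓ').eval x := by
  have e : ∀ x : ℝ, (qP m ℓ).eval x * (rod m ℓ').eval x = (qP m ℓ * rod m ℓ').eval x :=
    fun x => (eval_mul).symm
  simp only [e]
  rw [← integral_cos_sin, ← intervalIntegral.integral_const_mul]
  refine intervalIntegral.integral_congr_Ioo_of_le Real.pi_pos.le fun θ hθ => ?_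
  simp only [Sml_mul_Sml hA hθ]
  ring

theorem kap_sq (hA : Adm m ℓ) : kap m ℓ * kap m ℓ = (2 * ℓ + 1) / (4 * Real.pi) *
    ((ℓ + 2).factorial : ℝ) /
      ((ℓ - 2).factorial * ((ℓ + m).toNat).factorial * ((ℓ - m).toNat).factorial) / 4 ^ ℓ := by
  have h1 : ((if 0 ≤ m then 1 else (-1) ^ m.natAbs : ℝ)) *
      (if 0 ≤ m then 1 else (-1) ^ m.natAbs) = 1 := by
    split_ifs
    · norm_num
    · rw [← mul_pow]; norm_num
  unfold kap
  rw [mul_mul_mul_comm, h1, one_mul, div_mul_div_comm, Real.mul_self_sqrt (by positivity),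
    ← mul_pow]
  norm_num

theorem integral_Sml_of_lt (hA : Adm m ℓ) (hA' : Adm m ℓ') (h : ℓ < ℓ') :
    ∫ θ in (0 : ℝ)..Real.pi, Sml m ℓ θ * Sml m ℓ' θ * Real.sin θ = 0 := by
  have h0 : derivative^[ℓ' - 2] (qP m ℓ) = 0 :=
    iterate_derivative_eq_zero (by rw [qP_degree hA]; have := hA.1; omega)
  rw [integral_Sml_mul hA, integral_qP_rod hA', h0]
  simp

theorem integral_Sml_ne (hA : Adm m ℓ) (hA' : Adm m ℓ') (h : ℓ ≠ ℓ') :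
    ∫ θ in (0 : ℝ)..Real.pi, Sml m ℓ θ * Sml m ℓ' θ * Real.sin θ = 0 := by
  rcases lt_or_gt_of_ne h with h | h
  · exact integral_Sml_of_lt hA hA' h
  · refine Eq.trans ?_ (integral_Sml_of_lt hA' hA h)
    simp only [mul_comm (Sml m ℓ _)]

/-- Here the derivative of `qP` is the constant (ℓ-2)! times its leading coefficient, so only a Beta
integral is left. The value is 1/(2π) because unit norm refers to the sphere and the φ-integral
supplies 2π. -/
theorem integral_Sml_sq (hA : Adm m ℓ) :
    ∫ θ in (0 : ℝ)..Real.pi, Sml m ℓ θ * Sml m ℓ θ * Real.sin θ = 1 / (2 * Real.pi) := by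
  have h0 : derivative^[ℓ - 2] (qP m ℓ) =
      C (((ℓ - 2).factorial : ℝ) * ((-1) ^ ℓ * ((2 * ℓ).descFactorial (ℓ - 2) : ℝ))) := by
    have hd : (derivative^[ℓ - 2] (qP m ℓ)).natDegree = 0 := by
      have := natDegree_iterate_derivative (qP m ℓ) (ℓ - 2)
      rw [qP_degree hA] at this
      omega
    rw [eq_C_of_natDegree_eq_zero hd, coeff_iterate_derivative, zero_add, Nat.descFactorial_self,
      ← qP_leading hA, leadingCoeff, qP_degree hA, nsmul_eq_mul]
  rw [integral_Sml_mul hA, integral_qP_rod hA, h0, kap_sq hA]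
  simp only [eval_C]
  rw [intervalIntegral.integral_const_mul, integral_yPoly]
  obtain ⟨h1, h2, h3⟩ := hA
  have e1 : (ℓ + m).toNat + (ℓ - m).toNat = 2 * ℓ := by omega
  have e2 : ((-1 : ℝ)) ^ (ℓ - 2) * (-1) ^ ℓ = 1 := by
    rw [← pow_add]
    refine Even.neg_one_pow ⟨ℓ - 1, by omega⟩
  have e3 : ((2 * ℓ).descFactorial (ℓ - 2) : ℝ) * (ℓ + 2).factorial = (2 * ℓ).factorial := by
    have := Nat.factorial_mul_descFactorial (n := 2 * ℓ) (k := ℓ - 2) (by omega)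
    rw [show 2 * ℓ - (ℓ - 2) = ℓ + 2 by omega, mul_comm] at this
    exact_mod_cast this
  rw [e1, Nat.factorial_succ (2 * ℓ), Nat.cast_mul, ← e3, pow_succ, pow_mul]
  have p1 : ((ℓ - 2).factorial : ℝ) ≠ 0 := by positivity
  have p2 : ((ℓ + m).toNat.factorial : ℝ) ≠ 0 := by positivity
  have p3 : ((ℓ - m).toNat.factorial : ℝ) ≠ 0 := by positivity
  have p4 : ((ℓ + 2).factorial : ℝ) ≠ 0 := by positivity
  have p5 : ((2 * ℓ).descFactorial (ℓ - 2) : ℝ) ≠ 0 := by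
    intro h; rw [h, zero_mul] at e3; exact (by positivity : ((2 * ℓ).factorial : ℝ) ≠ 0) e3.symm
  have p6 : ((2 * ℓ + 1 : ℕ) : ℝ) = 2 * ℓ + 1 := by push_cast; ring
  have p7 : (2 * (ℓ : ℝ) + 1) ≠ 0 := by positivity
  have p8 := Real.pi_ne_zero
  rw [p6, show (2 : ℝ) ^ 2 = 4 by norm_num]
  calc _ = ((-1 : ℝ)) ^ (ℓ - 2) * (-1) ^ ℓ * (1 / (2 * Real.pi)) := by field_simp; norm_num
    _ = _ := by rw [e2, one_mul]

/-! ### The differential equation -/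

/-- `sin θ ∂_θ S_{mℓ}` -/
def ySml (m : ℤ) (ℓ : ℕ) (θ : ℝ) : ℝ :=
  kap m ℓ * gW m θ * (-(m + 2 * Real.cos θ) * (rod m ℓ).eval (Real.cos θ)
    - Real.sin θ ^ 2 * (derivative (rod m ℓ)).eval (Real.cos θ))

/-- The potential of the angular operator. -/
def Vang (m : ℤ) (θ : ℝ) : ℝ := (m + 2 * Real.cos θ) ^ 2 / Real.sin θ ^ 2 + 4

theorem hasDerivAt_gW {θ : ℝ} (h : θ ∈ Ioo 0 Real.pi) :
    HasDerivAt (gW m) (-(m + 2 * Real.cos θ) / Real.sin θ * gW m θ) θ := by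
  obtain ⟨hs, hc⟩ := half_pos h
  have hh : HasDerivAt (fun θ : ℝ => θ / 2) (1 / 2) θ := (hasDerivAt_id θ).div_const 2
  have h1 := (hasDerivAt_zpow (-(m + 2)) _ (Or.inl hs.ne')).comp θ hh.sin
  have h2 := (hasDerivAt_zpow (m - 2) _ (Or.inl hc.ne')).comp θ hh.cos
  have h3 := ((h1.const_mul (1 / 4 : ℝ)).mul h2)
  refine h3.congr_deriv ?_
  have e1 : Real.sin θ = 2 * Real.sin (θ / 2) * Real.cos (θ / 2) := by
    rw [← Real.sin_two_mul]; congr 1; ring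
  have e2 : Real.cos θ = Real.cos (θ / 2) ^ 2 - Real.sin (θ / 2) ^ 2 := by
    rw [← Real.cos_two_mul']; congr 1; ring
  have e3 := Real.sin_sq_add_cos_sq (θ / 2)
  simp only [Function.comp, gW]
  rw [zpow_sub_one₀ hs.ne', zpow_sub_one₀ hc.ne', e1, e2]
  push_cast
  field_simp
  linear_combination (-(m : ℝ)) * e3

theorem hasDerivAt_Sml {θ : ℝ} (h : θ ∈ Ioo 0 Real.pi) :
    HasDerivAt (Sml m ℓ) (ySml m ℓ θ / Real.sin θ) θ := by
  have hs := Real.sin_pos_of_pos_of_lt_pi h.1 h.2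
  have h1 := ((hasDerivAt_gW (m := m) h).const_mul (kap m ℓ)).mul
    (((rod m ℓ).hasDerivAt (Real.cos θ)).comp θ (Real.hasDerivAt_cos θ))
  refine h1.congr_deriv ?_
  simp only [Function.comp, ySml]
  field_simp
  ring

/-- This is `yPoly_ode` with n = ℓ - 2, A + B = 2ℓ and B - A = -2m. -/
theorem rod_ode (hA : Adm m ℓ) (x : ℝ) :
    (1 - x ^ 2) * (derivative (derivative (rod m ℓ))).eval x =
      (-2 * x - 2 * m) * (derivative (rod m ℓ)).eval x - (ℓ - 1) * (ℓ + 2) * (rod m ℓ).eval x := by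
  have := congrArg (eval x) (yPoly_ode (ℓ + m).toNat (ℓ - m).toNat (ℓ - 2))
  obtain ⟨h1, h2, h3⟩ := hA
  have eA : (((ℓ + m).toNat : ℕ) : ℝ) = ℓ + m := by
    have : (((ℓ + m).toNat : ℕ) : ℤ) = ℓ + m := Int.toNat_of_nonneg (by omega)
    exact_mod_cast this
  have eB : (((ℓ - m).toNat : ℕ) : ℝ) = ℓ - m := by
    have : (((ℓ - m).toNat : ℕ) : ℤ) = ℓ - m := Int.toNat_of_nonneg (by omega)
    exact_mod_cast this
  have en : ((ℓ - 2 : ℕ) : ℝ) = ℓ - 2 := by push_cast [h1]; ring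
  rw [Function.iterate_succ_apply', Function.iterate_succ_apply'] at this
  simp only [eval_mul, eval_add, eval_sub, eval_C, eval_X, eval_one, eval_pow, eA, eB, en] at this
  unfold rod
  linear_combination this

/-- The eigenvalue equation in self-adjoint form, as a first-order system in S and sin θ ∂_θ S. The
second derivative of S never has to be treated separately. -/
theorem hasDerivAt_ySml (hA : Adm m ℓ) {θ : ℝ} (h : θ ∈ Ioo 0 Real.pi) :
    HasDerivAt (ySml m ℓ) ((Vang m θ - ℓ * (ℓ + 1)) * Real.sin θ * Sml m ℓ θ) θ := by
  have hs := Real.sin_pos_of_pos_of_lt_pi h.1 h.2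
  have hc := Real.hasDerivAt_cos θ
  have h1 := ((hasDerivAt_gW (m := m) h).const_mul (kap m ℓ)).mul
    (((((hc.const_mul 2).const_add (m : ℝ)).neg.mul
      (((rod m ℓ).hasDerivAt (Real.cos θ)).comp θ hc)).sub
      (((Real.hasDerivAt_sin θ).pow 2).mul
        (((derivative (rod m ℓ)).hasDerivAt (Real.cos θ)).comp θ hc))))
  refine h1.congr_deriv ?_
  have ho := rod_ode hA (Real.cos θ)
  rw [show 1 - Real.cos θ ^ 2 = Real.sin θ ^ 2 by rw [Real.sin_sq]] at ho
  simp only [Function.comp, Sml_eq, Vang]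
  field_simp
  simp
  linear_combination (kap m ℓ * gW m θ * Real.sin θ ^ 2) * ho

theorem Sreg_contDiff : ContDiff ℝ ∞ (Sreg m ℓ) := by
  unfold Sreg
  have h1 : ContDiff ℝ ∞ fun θ : ℝ => (jac m ℓ).eval (Real.cos θ) :=
    (show ContDiff ℝ ∞ fun x => (jac m ℓ).eval x from by
      have := (jac m ℓ).contDiff_aeval (𝕜 := ℝ) ∞
      exact this).comp
      Real.contDiff_cos
  have h2 : ContDiff ℝ ∞ fun θ : ℝ => Real.sin (θ / 2) :=
    Real.contDiff_sin.comp (contDiff_id.div_const 2)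
  have h3 : ContDiff ℝ ∞ fun θ : ℝ => Real.cos (θ / 2) :=
    Real.contDiff_cos.comp (contDiff_id.div_const 2)
  exact (contDiff_const.mul ((contDiff_const.mul (h2.pow _)).mul (h3.pow _))).mul h1

theorem ySml_eq (hA : Adm m ℓ) {θ : ℝ} (h : θ ∈ Ioo 0 Real.pi) :
    ySml m ℓ θ = Real.sin θ * deriv (Sreg m ℓ) θ := by
  have hs := Real.sin_pos_of_pos_of_lt_pi h.1 h.2
  have h1 : HasDerivAt (Sreg m ℓ) (ySml m ℓ θ / Real.sin θ) θ :=
    (hasDerivAt_Sml h).congr_of_eventuallyEq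
      (Filter.eventuallyEq_of_mem (Ioo_mem_nhds h.1 h.2) fun x hx => (Sml_eq_Sreg hA hx).symm)
  rw [h1.deriv]
  field_simp

/-- The harmonics and their derivatives are bounded. -/
theorem Sml_bounded (hA : Adm m ℓ) : ∃ C, 0 ≤ C ∧ ∀ θ ∈ Ioo 0 Real.pi,
    |Sml m ℓ θ| ≤ C ∧ |ySml m ℓ θ| ≤ C * Real.sin θ := by
  obtain ⟨C1, h1⟩ := (isCompact_Icc (a := 0) (b := Real.pi)).exists_bound_of_continuousOn
    (Sreg_contDiff (m := m) (ℓ := ℓ)).continuous.continuousOn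
  obtain ⟨C2, h2⟩ := (isCompact_Icc (a := 0) (b := Real.pi)).exists_bound_of_continuousOn
    ((Sreg_contDiff (m := m) (ℓ := ℓ)).continuous_deriv (by simp)).continuousOn
  refine ⟨max (max C1 C2) 0, le_max_right _ _, fun θ hθ => ⟨?_, ?_⟩⟩
  · rw [Sml_eq_Sreg hA hθ]
    exact (h1 θ ⟨hθ.1.le, hθ.2.le⟩).trans ((le_max_left _ _).trans (le_max_left _ _))
  · have hs := Real.sin_pos_of_pos_of_lt_pi hθ.1 hθ.2
    rw [ySml_eq hA hθ, abs_mul, abs_of_pos hs, mul_comm]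
    exact mul_le_mul_of_nonneg_right ((h2 θ ⟨hθ.1.le, hθ.2.le⟩).trans
      ((le_max_right _ _).trans (le_max_left _ _))) hs.le

end
end TeukolskySAdS

open scoped ContDiff
namespace TeukolskySAdS
open Set Filter Topology
noncomputable section

open Polynomial MeasureTheory

theorem intervalIntegrable_of_bounded {E : Type*} [NormedAddCommGroup E] {f : ℝ → E} {a b C : ℝ}
    (hab : a ≤ b) (hf : ContinuousOn f (Ioo a b)) (hC : ∀ x ∈ Ioo a b, ‖f x‖ ≤ C) :
    IntervalIntegrable f volume a b := by
  rw [intervalIntegrable_iff_integrableOn_Ioo_of_le hab]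
  exact (integrable_const C).mono' (hf.aestronglyMeasurable measurableSet_Ioo)
    (ae_restrict_of_forall_mem measurableSet_Ioo hC)

/-! ### Completeness of the harmonics -/

section Completeness

variable {m : ℤ} {ℓ : ℕ}

theorem kap_ne (hA : Adm m ℓ) : kap m ℓ ≠ 0 := fun h => by
  have := integral_Sml_sq hA
  simp only [Sml_eq, h, zero_mul] at this
  have hp := Real.pi_pos
  rw [intervalIntegral.integral_zero] at this
  exact (by positivity : 1 / (2 * Real.pi) ≠ 0) this.symm

/-- The weight of the orthogonality relation of the Jacobi polynomials against `S`. -/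
def jacW (m : ℤ) (θ : ℝ) : ℝ :=
  1 / 4 * 2 ^ ((m + 2).toNat + (2 - m).toNat) *
    Real.sin (θ / 2) ^ (m + 2).natAbs * Real.cos (θ / 2) ^ (m - 2).natAbs

theorem Sml_eq_jacW (hA : Adm m ℓ) {θ : ℝ} (h : θ ∈ Ioo 0 Real.pi) :
    Sml m ℓ θ = kap m ℓ * jacW m θ * (jac m ℓ).eval (Real.cos θ) := Sml_eq_Sreg hA h

theorem jacW_continuous (m : ℤ) : Continuous (jacW m) := by unfold jacW; fun_prop

theorem jacW_pos {θ : ℝ} (h : θ ∈ Ioo 0 Real.pi) (m : ℤ) : 0 < jacW m θ := by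
  obtain ⟨hs, hc⟩ := half_pos h
  unfold jacW
  positivity

/-- By Weierstrass, u integrates to at most zero against every continuous function. Testing with u
times a cutoff around a point where u ≠ 0 gives a contradiction. -/
theorem eq_zero_of_integral_cos {u : ℝ → ℝ} (hu : ContinuousOn u (Ioo 0 Real.pi))
    (hi : IntervalIntegrable u volume 0 Real.pi)
    (h : ∀ P : ℝ[X], ∫ θ in (0 : ℝ)..Real.pi, u θ * P.eval (Real.cos θ) = 0) :
    ∀ θ ∈ Ioo 0 Real.pi, u θ = 0 := by
  have hπ := Real.pi_pos
  have hI : ∀ {g : ℝ → ℝ}, Continuous g → IntervalIntegrable (fun θ => u θ * g θ) volume 0 Real.pi :=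
    fun hg => hi.mul_continuousOn hg.continuousOn
  set K := ∫ θ in (0 : ℝ)..Real.pi, |u θ|
  have hK : 0 ≤ K := intervalIntegral.integral_nonneg hπ.le fun _ _ => abs_nonneg _
  have hz : ∀ g : ℝ → ℝ, Continuous g → ∫ θ in (0 : ℝ)..Real.pi, u θ * g θ ≤ 0 := by
    intro g hg
    refine le_of_forall_pos_le_add fun ε hε => ?_
    have hε' : 0 < ε / (K + 1) := by positivity
    -- Approximating g ∘ arccos on [-1, 1] approximates g uniformly by polynomials in cos θ.
    obtain ⟨p, hp⟩ := exists_polynomial_near_of_continuousOn (-1) 1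
      (fun x => g (Real.arccos x)) (hg.comp Real.continuous_arccos).continuousOn _ hε'
    have hpc : Continuous fun θ => p.eval (Real.cos θ) := p.continuous.comp Real.continuous_cos
    have e1 : ∫ θ in (0 : ℝ)..Real.pi, u θ * g θ =
        ∫ θ in (0 : ℝ)..Real.pi, u θ * (g θ - p.eval (Real.cos θ)) := by
      simp only [mul_sub]
      rw [intervalIntegral.integral_sub (hI hg) (hI hpc), h p, sub_zero]
    have e2 : ∫ θ in (0 : ℝ)..Real.pi, u θ * (g θ - p.eval (Real.cos θ)) ≤ ε / (K + 1) * K := by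
      rw [← intervalIntegral.integral_const_mul]
      refine intervalIntegral.integral_mono_on hπ.le (hI (hg.sub hpc))
        (hi.abs.const_mul _) fun θ hθ => ?_
      have := hp (Real.cos θ) ⟨Real.neg_one_le_cos θ, Real.cos_le_one θ⟩
      rw [Real.arccos_cos hθ.1 hθ.2, abs_sub_comm] at this
      calc u θ * (g θ - p.eval (Real.cos θ)) ≤ |u θ * (g θ - p.eval (Real.cos θ))| := le_abs_self _
        _ = |g θ - p.eval (Real.cos θ)| * |u θ| := by rw [abs_mul, mul_comm]
        _ ≤ _ := mul_le_mul_of_nonneg_right this.le (abs_nonneg _)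
    rw [e1, zero_add]
    refine e2.trans ?_
    rw [div_mul_eq_mul_div, div_le_iff₀ (by positivity)]
    nlinarith
  by_contra hne
  push Not at hne
  obtain ⟨c, hc, hne⟩ := hne
  have ha : 0 < c / 2 := by linarith [hc.1]
  have hb : (c + Real.pi) / 2 < Real.pi := by linarith [hc.2]
  have hab : c / 2 ≤ (c + Real.pi) / 2 := by linarith
  have hcl : ∀ θ, max (c / 2) (min ((c + Real.pi) / 2) θ) ∈ Ioo 0 Real.pi := fun θ =>
    ⟨lt_max_of_lt_left ha, max_lt (hab.trans_lt hb) ((min_le_left _ _).trans_lt hb)⟩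
  -- A parabola cut off at zero, supported strictly inside (0, π). In g the argument of u is clamped
  -- to that support, which makes g continuous on the whole line although u is continuous only on
  -- the open interval.
  set χ : ℝ → ℝ := fun θ => max 0 ((θ - c / 2) * ((c + Real.pi) / 2 - θ)) with hχ
  set g : ℝ → ℝ := fun θ => u (max (c / 2) (min ((c + Real.pi) / 2) θ)) * χ θ with hg
  have hgc : Continuous g :=
    (hu.comp_continuous (f := fun θ => max (c / 2) (min ((c + Real.pi) / 2) θ))
      (by fun_prop) hcl).mul (by fun_prop)
  have hgu : ∀ θ, u θ * g θ = g θ * u (max (c / 2) (min ((c + Real.pi) / 2) θ)) := by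
    intro θ
    by_cases h0 : χ θ = 0
    · simp [hg, h0]
    · have h1 : 0 < (θ - c / 2) * ((c + Real.pi) / 2 - θ) := by
        by_contra h2
        exact h0 (max_eq_left (not_lt.mp h2))
      have h2 : c / 2 ≤ θ ∧ θ ≤ (c + Real.pi) / 2 := by
        rcases pos_and_pos_or_neg_and_neg_of_mul_pos h1 with h | h
        · exact ⟨by linarith [h.1], by linarith [h.2]⟩
        · linarith [h.1, h.2]
      rw [min_eq_right h2.2, max_eq_right h2.1, mul_comm]
  have hpos : 0 < ∫ θ in (0 : ℝ)..Real.pi, u θ * g θ := by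
    simp only [hgu]
    refine intervalIntegral.integral_pos hπ (hgc.continuousOn.mul
      (hu.comp_continuous (f := fun θ => max (c / 2) (min ((c + Real.pi) / 2) θ))
        (by fun_prop) hcl).continuousOn) (fun θ _ => ?_) ⟨c, ⟨hc.1.le, hc.2.le⟩, ?_⟩
    · rw [hg]
      have : 0 ≤ χ θ := le_max_left _ _
      nlinarith [mul_nonneg (mul_self_nonneg (u (max (c / 2) (min ((c + Real.pi) / 2) θ)))) this]
    · have e : max (c / 2) (min ((c + Real.pi) / 2) c) = c := by
        rw [min_eq_right (by linarith [hc.2]), max_eq_right (by linarith)]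
      have h3 : 0 < χ c := lt_max_of_lt_right (mul_pos (by linarith [hc.1]) (by linarith [hc.2]))
      simp only [hg, e]
      have h4 := mul_self_pos.mpr hne
      nlinarith [mul_pos h4 h3]
  exact absurd (hz g hgc) (not_le.mpr hpos)

theorem integral_poly_of_jac {u : ℝ → ℝ} (hu : IntervalIntegrable u volume 0 Real.pi) (m : ℤ)
    (h : ∀ ℓ, Adm m ℓ → ∫ θ in (0 : ℝ)..Real.pi, u θ * (jac m ℓ).eval (Real.cos θ) = 0) :
    ∀ (n : ℕ) (P : ℝ[X]), P.natDegree < n →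
      ∫ θ in (0 : ℝ)..Real.pi, u θ * P.eval (Real.cos θ) = 0 := by
  have hI : ∀ P : ℝ[X], IntervalIntegrable (fun θ => u θ * P.eval (Real.cos θ)) volume 0 Real.pi :=
    fun P => hu.mul_continuousOn (P.continuous.comp Real.continuous_cos).continuousOn
  intro n
  induction n with
  | zero => intro P hP; omega
  | succ n ih =>
    intro P hP
    -- With this ℓ the Jacobi polynomial has degree exactly n, so for fixed m there is one in every
    -- degree and they span all polynomials.
    have hA : Adm m (n + max 2 m.natAbs) := by unfold Adm; omega
    set J := jac m (n + max 2 m.natAbs) with hJ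
    have hd : J.natDegree = n := by
      have := jac_degree hA
      rw [← hJ] at this
      omega
    have hlc : J.leadingCoeff ≠ 0 := leadingCoeff_ne_zero.mpr (jac_ne hA)
    have hJc : J.coeff n ≠ 0 := by rwa [leadingCoeff, hd] at hlc
    set c := P.coeff n / J.coeff n
    have hQ : ∀ Q : ℝ[X], Q.natDegree ≤ n → Q.coeff n = 0 →
        ∫ θ in (0 : ℝ)..Real.pi, u θ * Q.eval (Real.cos θ) = 0 := by
      intro Q h1 h2
      rcases Nat.eq_zero_or_pos n with h0 | h0
      · have : Q = 0 := by
          rw [h0] at h1 h2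
          rw [eq_C_of_natDegree_le_zero h1, h2, C_0]
        rw [this]; simp
      · refine ih Q (lt_of_le_of_ne h1 fun h3 => ?_)
        have : Q.leadingCoeff = 0 := by rw [leadingCoeff, h3, h2]
        rw [leadingCoeff_eq_zero.mp this] at h3
        simp at h3
        omega
    have h3 := hQ (P - C c * J)
      ((natDegree_sub_le _ _).trans (max_le (by omega) ((natDegree_C_mul_le _ _).trans hd.le)))
      (by simp [c, hJc])
    have e : ∀ θ : ℝ, u θ * (P - C c * J).eval (Real.cos θ) =
        u θ * P.eval (Real.cos θ) - c * (u θ * J.eval (Real.cos θ)) := fun θ => by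
      simp; ring
    simp only [e] at h3
    rw [intervalIntegral.integral_sub (hI P) ((hI J).const_mul c),
      intervalIntegral.integral_const_mul, h _ hA, mul_zero, sub_zero] at h3
    exact h3

theorem Sml_complete_real {f : ℝ → ℝ} (hf : ContinuousOn f (Ioo 0 Real.pi))
    (hi : IntervalIntegrable (fun θ => f θ * Real.sin θ) volume 0 Real.pi) (m : ℤ)
    (h : ∀ ℓ, Adm m ℓ → ∫ θ in (0 : ℝ)..Real.pi, f θ * Sml m ℓ θ * Real.sin θ = 0) :
    ∀ θ ∈ Ioo 0 Real.pi, f θ = 0 := by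
  have hπ := Real.pi_pos
  have hu : IntervalIntegrable (fun θ => f θ * Real.sin θ * jacW m θ) volume 0 Real.pi :=
    hi.mul_continuousOn (jacW_continuous m).continuousOn
  have h1 := integral_poly_of_jac hu m fun ℓ hA => by
    have h2 := h ℓ hA
    have e : ∫ θ in (0 : ℝ)..Real.pi, f θ * Sml m ℓ θ * Real.sin θ =
        kap m ℓ * ∫ θ in (0 : ℝ)..Real.pi,
          f θ * Real.sin θ * jacW m θ * (jac m ℓ).eval (Real.cos θ) := by
      rw [← intervalIntegral.integral_const_mul]
      refine intervalIntegral.integral_congr_Ioo_of_le hπ.le fun θ hθ => ?_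
      simp only [Sml_eq_jacW hA hθ]
      ring
    rw [e] at h2
    exact (mul_eq_zero.mp h2).resolve_left (kap_ne hA)
  have h2 := eq_zero_of_integral_cos
    ((hf.mul Real.continuous_sin.continuousOn).mul (jacW_continuous m).continuousOn) hu
    fun P => h1 _ P (Nat.lt_succ_self _)
  intro θ hθ
  have h3 := h2 θ hθ
  have hs := Real.sin_pos_of_pos_of_lt_pi hθ.1 hθ.2
  have hw := jacW_pos hθ m
  simpa [hs.ne', hw.ne'] using h3

theorem Sml_continuousOn : ContinuousOn (Sml m ℓ) (Ioo 0 Real.pi) := fun _ h =>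
  (hasDerivAt_Sml h).continuousAt.continuousWithinAt

theorem ySml_continuousOn (hA : Adm m ℓ) : ContinuousOn (ySml m ℓ) (Ioo 0 Real.pi) := fun _ h =>
  (hasDerivAt_ySml hA h).continuousAt.continuousWithinAt

theorem Sml_complete {f : ℝ → ℂ} (hf : ContinuousOn f (Ioo 0 Real.pi))
    (hi : IntervalIntegrable (fun θ => f θ * (Real.sin θ : ℂ)) volume 0 Real.pi) (m : ℤ)
    (hI : ∀ ℓ, Adm m ℓ → IntervalIntegrable
      (fun θ => f θ * (Sml m ℓ θ : ℂ) * (Real.sin θ : ℂ)) volume 0 Real.pi)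
    (h : ∀ ℓ, Adm m ℓ → ∫ θ in (0 : ℝ)..Real.pi, f θ * (Sml m ℓ θ : ℂ) * (Real.sin θ : ℂ) = 0) :
    ∀ θ ∈ Ioo 0 Real.pi, f θ = 0 := by
  have ire : IntervalIntegrable (fun θ => (f θ).re * Real.sin θ) volume 0 Real.pi := by
    simpa [IntervalIntegrable, IntegrableOn, -Complex.ofReal_sin] using
      (⟨hi.1.re, hi.2.re⟩ : IntervalIntegrable _ _ _ _)
  have iim : IntervalIntegrable (fun θ => (f θ).im * Real.sin θ) volume 0 Real.pi := by
    simpa [IntervalIntegrable, IntegrableOn, -Complex.ofReal_sin] using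
      (⟨hi.1.im, hi.2.im⟩ : IntervalIntegrable _ _ _ _)
  have hre := Sml_complete_real (f := fun θ => (f θ).re)
    (Complex.continuous_re.comp_continuousOn hf) ire m fun ℓ hA => by
      have := congrArg Complex.re (h ℓ hA)
      rw [← Complex.reCLM_apply, ← Complex.reCLM.intervalIntegral_comp_comm (hI ℓ hA)] at this
      simpa [-Complex.ofReal_sin] using this
  have him := Sml_complete_real (f := fun θ => (f θ).im)
    (Complex.continuous_im.comp_continuousOn hf) iim m fun ℓ hA => by
      have := congrArg Complex.im (h ℓ hA)
      rw [← Complex.imCLM_apply, ← Complex.imCLM.intervalIntegral_comp_comm (hI ℓ hA)] at this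
      simpa [-Complex.ofReal_sin] using this
  exact fun θ hθ => Complex.ext (hre θ hθ) (him θ hθ)

end Completeness

/-! ### Local bounds -/

/-- The one-dimensional Sobolev inequality: f(x)² ≤ f(y)² + ∫(f² + f'²), since 2|ff'| ≤ f² + f'²;
then integrate over y. -/
theorem sq_le_integral_of_hasDerivAt {f f' : ℝ → ℝ} {a b : ℝ} (hab : a ≤ b)
    (hf : ∀ x ∈ Icc a b, HasDerivAt f (f' x) x) (hf' : ContinuousOn f' (Icc a b))
    {x : ℝ} (hx : x ∈ Icc a b) :
    (b - a) * f x ^ 2 ≤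
      (∫ y in a..b, f y ^ 2) + (b - a) * ∫ y in a..b, (f y ^ 2 + f' y ^ 2) := by
  have hc : ContinuousOn f (Icc a b) := fun y hy => (hf y hy).continuousAt.continuousWithinAt
  have hI : ∀ {c d : ℝ}, c ∈ Icc a b → d ∈ Icc a b →
      IntervalIntegrable (fun y => f y ^ 2 + f' y ^ 2) volume c d := fun hc' hd' =>
    (((hc.pow 2).add (hf'.pow 2)).mono (by
      exact (convex_Icc a b).ordConnected.uIcc_subset hc' hd')).intervalIntegrable
  have hI2 : ∀ {c d : ℝ}, c ∈ Icc a b → d ∈ Icc a b →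
      IntervalIntegrable (fun y => 2 * f y * f' y) volume c d := fun hc' hd' =>
    (((continuousOn_const.mul hc).mul hf').mono (by
      exact (convex_Icc a b).ordConnected.uIcc_subset hc' hd')).intervalIntegrable
  have ha : a ∈ Icc a b := ⟨le_rfl, hab⟩
  have hb : b ∈ Icc a b := ⟨hab, le_rfl⟩
  have hn : ∀ y, 0 ≤ f y ^ 2 + f' y ^ 2 := fun y => by positivity
  set K := ∫ y in a..b, (f y ^ 2 + f' y ^ 2)
  have hsub : ∀ {c d : ℝ}, a ≤ c → c ≤ d → d ≤ b → ∫ y in c..d, (f y ^ 2 + f' y ^ 2) ≤ K := by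
    intro c d h1 h2 h3
    exact intervalIntegral.integral_mono_interval h1 h2 h3 (ae_of_all _ hn) (hI ha hb)
  have hpt : ∀ y ∈ Icc a b, f x ^ 2 ≤ f y ^ 2 + K := by
    intro y hy
    have e : ∀ {c d : ℝ}, c ∈ Icc a b → d ∈ Icc a b →
        ∫ z in c..d, 2 * f z * f' z = f d ^ 2 - f c ^ 2 := fun hc' hd' =>
      intervalIntegral.integral_eq_sub_of_hasDerivAt (fun z hz => by
        have := (hf z ((convex_Icc a b).ordConnected.uIcc_subset hc' hd' hz)).pow 2
        simpa using this) (hI2 hc' hd')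
    rcases le_total y x with h | h
    · have h1 := e hy hx
      have h2 : ∫ z in y..x, 2 * f z * f' z ≤ ∫ z in y..x, (f z ^ 2 + f' z ^ 2) :=
        intervalIntegral.integral_mono_on h (hI2 hy hx) (hI hy hx)
          fun z _ => by nlinarith [sq_nonneg (f z - f' z)]
      linarith [hsub hy.1 h hx.2]
    · have h1 := e hx hy
      have h2 : ∫ z in x..y, -(2 * f z * f' z) ≤ ∫ z in x..y, (f z ^ 2 + f' z ^ 2) :=
        intervalIntegral.integral_mono_on h (hI2 hx hy).neg (hI hx hy)
          fun z _ => by nlinarith [sq_nonneg (f z + f' z)]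
      rw [intervalIntegral.integral_neg] at h2
      linarith [hsub hx.1 h hy.2]
  have hIf : IntervalIntegrable (fun y => f y ^ 2) volume a b :=
    ((hc.pow 2).mono (by rw [uIcc_of_le hab])).intervalIntegrable
  have := intervalIntegral.integral_mono_on hab (intervalIntegrable_const (c := f x ^ 2))
    (hIf.add (intervalIntegrable_const (c := K))) hpt
  rw [intervalIntegral.integral_add hIf intervalIntegrable_const, intervalIntegral.integral_const,
    intervalIntegral.integral_const] at this
  simpa [smul_eq_mul] using this

variable {m : ℤ} {ℓ : ℕ}

theorem Vang_nonneg (m : ℤ) (θ : ℝ) : 0 ≤ Vang m θ := by unfold Vang; positivity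

theorem integral_Sml_sq_le (hA : Adm m ℓ) {a b : ℝ} (ha : 0 < a) (hab : a ≤ b)
    (hb : b < Real.pi) : ∫ θ in a..b, Sml m ℓ θ ^ 2 * Real.sin θ ≤ 1 / (2 * Real.pi) := by
  rw [← integral_Sml_sq hA]
  simp only [pow_two]
  obtain ⟨K, hK0, hK⟩ := Sml_bounded hA
  refine intervalIntegral.integral_mono_interval ha.le hab hb.le ?_ ?_
  · refine (ae_restrict_iff' measurableSet_Ioc).mpr (ae_of_all _ fun θ hθ => ?_)
    exact mul_nonneg (mul_self_nonneg _) (Real.sin_nonneg_of_nonneg_of_le_pi hθ.1.le hθ.2)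
  · refine intervalIntegrable_of_bounded (C := K * K * 1) Real.pi_pos.le
      ((Sml_continuousOn.mul Sml_continuousOn).mul (by fun_prop)) fun x hx => ?_
    rw [norm_mul, norm_mul]
    have h2 := (hK x hx).1
    exact mul_le_mul (mul_le_mul h2 h2 (abs_nonneg _) hK0) (Real.abs_sin_le_one x)
      (abs_nonneg _) (by positivity)

theorem Icc_subset_Ioo' {a b : ℝ} (ha : 0 < a) (hb : b < Real.pi) :
    Icc a b ⊆ Ioo 0 Real.pi := fun _ h => ⟨ha.trans_le h.1, h.2.trans_lt hb⟩

/-- The energy identity: integrate the derivative of the product of S and sin θ ∂_θ S over (δ, π -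
δ). The potential term has a good sign, the boundary terms are O(sin δ), and δ → 0. -/
theorem integral_ySml_sq_le (hA : Adm m ℓ) {a b : ℝ} (ha : 0 < a) (hab : a ≤ b)
    (hb : b < Real.pi) : ∫ θ in a..b, ySml m ℓ θ ^ 2 / Real.sin θ ≤
      ℓ * (ℓ + 1) / (2 * Real.pi) := by
  obtain ⟨K, hK0, hK⟩ := Sml_bounded hA
  have hsin : ∀ x ∈ Ioo 0 Real.pi, Real.sin x ≠ 0 := fun x hx =>
    (Real.sin_pos_of_pos_of_lt_pi hx.1 hx.2).ne'
  have hV : ContinuousOn (Vang m) (Ioo 0 Real.pi) := by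
    unfold Vang
    exact ((by fun_prop : Continuous fun θ : ℝ => (m + 2 * Real.cos θ) ^ 2).continuousOn.div
      (by fun_prop) fun x hx => pow_ne_zero 2 (hsin x hx)).add continuousOn_const
  have hyc : ContinuousOn (fun θ => ySml m ℓ θ ^ 2 / Real.sin θ) (Ioo 0 Real.pi) :=
    ((ySml_continuousOn hA).pow 2).div (by fun_prop) hsin
  have hSc : ContinuousOn (fun θ => Vang m θ * (Sml m ℓ θ ^ 2 * Real.sin θ)) (Ioo 0 Real.pi) :=
    hV.mul ((Sml_continuousOn.pow 2).mul (by fun_prop))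
  have hSc' : ContinuousOn (fun θ => Sml m ℓ θ ^ 2 * Real.sin θ) (Ioo 0 Real.pi) :=
    (Sml_continuousOn.pow 2).mul (by fun_prop)
  have hbound : ∀ᶠ δ in 𝓝[>] (0 : ℝ), ∫ θ in a..b, ySml m ℓ θ ^ 2 / Real.sin θ ≤
      2 * K * (K * Real.sin δ) + ℓ * (ℓ + 1) / (2 * Real.pi) := by
    have hm : 0 < min a (Real.pi - b) := lt_min ha (by linarith)
    filter_upwards [Ioo_mem_nhdsGT hm] with δ hδ
    have h0 : 0 < δ := hδ.1
    have h1 : δ < a := hδ.2.trans_le (min_le_left _ _)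
    have h2 : b < Real.pi - δ := by have := hδ.2.trans_le (min_le_right _ _); linarith
    have hsub : Icc δ (Real.pi - δ) ⊆ Ioo 0 Real.pi := Icc_subset_Ioo' h0 (by linarith)
    have hu : uIcc δ (Real.pi - δ) = Icc δ (Real.pi - δ) := uIcc_of_le (by linarith)
    have I1 : IntervalIntegrable (fun θ => ySml m ℓ θ ^ 2 / Real.sin θ) volume δ (Real.pi - δ) :=
      (hyc.mono (hu ▸ hsub)).intervalIntegrable
    have I2 : IntervalIntegrable (fun θ => Vang m θ * (Sml m ℓ θ ^ 2 * Real.sin θ)) volume δ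
      (Real.pi - δ) := (hSc.mono (hu ▸ hsub)).intervalIntegrable
    have I3 : IntervalIntegrable (fun θ => Sml m ℓ θ ^ 2 * Real.sin θ) volume δ
      (Real.pi - δ) := (hSc'.mono (hu ▸ hsub)).intervalIntegrable
    have hftc := intervalIntegral.integral_eq_sub_of_hasDerivAt
      (f := fun θ => ySml m ℓ θ * Sml m ℓ θ)
      (f' := fun θ => ySml m ℓ θ ^ 2 / Real.sin θ + Vang m θ * (Sml m ℓ θ ^ 2 * Real.sin θ)
        - ℓ * (ℓ + 1) * (Sml m ℓ θ ^ 2 * Real.sin θ)) (a := δ) (b := Real.pi - δ)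
      (fun θ hθ => by
        have hθ' := hsub (hu ▸ hθ)
        refine ((hasDerivAt_ySml hA hθ').mul (hasDerivAt_Sml hθ')).congr_deriv ?_
        ring) ((I1.add I2).sub (I3.const_mul _))
    rw [intervalIntegral.integral_sub (I1.add I2) (I3.const_mul _),
      intervalIntegral.integral_add I1 I2, intervalIntegral.integral_const_mul] at hftc
    have p2 : 0 ≤ ∫ θ in δ..(Real.pi - δ), Vang m θ * (Sml m ℓ θ ^ 2 * Real.sin θ) :=
      intervalIntegral.integral_nonneg (by linarith) fun x hx =>
        mul_nonneg (Vang_nonneg _ _) (mul_nonneg (sq_nonneg _)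
          (Real.sin_pos_of_pos_of_lt_pi (hsub hx).1 (hsub hx).2).le)
    have p3 := integral_Sml_sq_le hA h0 (by linarith : δ ≤ Real.pi - δ) (by linarith)
    have hbd : ∀ θ ∈ Ioo 0 Real.pi, |ySml m ℓ θ * Sml m ℓ θ| ≤ K * (K * Real.sin θ) := by
      intro θ hθ
      rw [abs_mul, mul_comm]
      exact mul_le_mul (hK θ hθ).1 (hK θ hθ).2 (abs_nonneg _) hK0
    have q1 := hbd δ (hsub ⟨le_rfl, by linarith⟩)
    have q2 := hbd (Real.pi - δ) (hsub ⟨by linarith, le_rfl⟩)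
    rw [Real.sin_pi_sub] at q2
    have p1 : ∫ θ in a..b, ySml m ℓ θ ^ 2 / Real.sin θ ≤
        ∫ θ in δ..(Real.pi - δ), ySml m ℓ θ ^ 2 / Real.sin θ := by
      refine intervalIntegral.integral_mono_interval h1.le hab h2.le ?_ I1
      refine (ae_restrict_iff' measurableSet_Ioc).mpr (ae_of_all _ fun θ hθ => ?_)
      have := hsub ⟨hθ.1.le, hθ.2⟩
      exact div_nonneg (sq_nonneg _) (Real.sin_pos_of_pos_of_lt_pi this.1 this.2).le
    have p4 : (ℓ : ℝ) * (ℓ + 1) * ∫ θ in δ..(Real.pi - δ), Sml m ℓ θ ^ 2 * Real.sin θ ≤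
        ℓ * (ℓ + 1) / (2 * Real.pi) := by
      rw [div_eq_mul_one_div]
      exact mul_le_mul_of_nonneg_left p3 (by positivity)
    have := abs_le.mp q1
    have := abs_le.mp q2
    linarith
  have hlim : Tendsto (fun δ => 2 * K * (K * Real.sin δ) + ℓ * (ℓ + 1) / (2 * Real.pi))
      (𝓝[>] (0 : ℝ)) (𝓝 (ℓ * (ℓ + 1) / (2 * Real.pi))) := by
    have : Tendsto (fun δ => 2 * K * (K * Real.sin δ) + ℓ * (ℓ + 1) / (2 * Real.pi))
      (𝓝 (0 : ℝ)) (𝓝 (2 * K * (K * Real.sin 0) + ℓ * (ℓ + 1) / (2 * Real.pi))) :=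
      Continuous.tendsto (by fun_prop) 0
    simp only [Real.sin_zero, mul_zero, zero_add] at this
    exact this.mono_left nhdsWithin_le_nhds
  exact ge_of_tendsto hlim hbound

/-- Polynomial bounds of the harmonics, uniform away from the poles. -/
theorem Sml_local_bound {a b : ℝ} (ha : 0 < a) (hab : a < b) (hb : b < Real.pi) :
    ∃ C, 0 ≤ C ∧ ∀ (m : ℤ) (ℓ : ℕ), Adm m ℓ → ∀ θ ∈ Icc a b,
      |Sml m ℓ θ| ≤ C * (ℓ + 2) ^ 4 ∧ |ySml m ℓ θ| ≤ C * (ℓ + 2) ^ 4 ∧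
      |(Vang m θ - ℓ * (ℓ + 1)) * Real.sin θ * Sml m ℓ θ| ≤ C * (ℓ + 2) ^ 4 := by
  have hsub := Icc_subset_Ioo' ha hb
  obtain ⟨x0, hx0, hmin⟩ := (isCompact_Icc (a := a) (b := b)).exists_isMinOn
    ⟨a, le_rfl, hab.le⟩ Real.continuous_sin.continuousOn
  set s := Real.sin x0
  have hs : 0 < s := Real.sin_pos_of_pos_of_lt_pi (hsub hx0).1 (hsub hx0).2
  have hs1 : s ≤ 1 := Real.sin_le_one _
  have hmin' : ∀ θ ∈ Icc a b, s ≤ Real.sin θ := fun θ hθ => hmin hθ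
  have hba : 0 < b - a := by linarith
  have hπ : 1 / (2 * Real.pi) ≤ 1 := by
    rw [div_le_one (by positivity)]; linarith [Real.pi_gt_three]
  -- The summand 1/(b - a) comes from averaging in the Sobolev inequality, and powers of 1/s from
  -- sin θ ≥ s on [a, b]. In c2 the 9/s⁴ is the square of the bound 3/s² on the potential.
  set c := (1 / (b - a) + 1) / s with hc
  set c2 := 1 / (b - a) + 1 + 9 / s ^ 4 with hc2
  have hcp : 0 < 1 / (b - a) := by positivity
  have hc1 : 1 ≤ c := by rw [hc, le_div_iff₀ hs]; linarith
  have hc21 : 1 ≤ c2 := by have : 0 < 9 / s ^ 4 := by positivity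
                           linarith
  have hbound : ∀ (m : ℤ) (ℓ : ℕ), Adm m ℓ → ∀ θ ∈ Icc a b,
      |Sml m ℓ θ| ≤ c * (ℓ + 2) ∧ |ySml m ℓ θ| ≤ c2 * (ℓ + 2) ^ 4 ∧
      |Vang m θ - ℓ * (ℓ + 1)| ≤ 3 / s ^ 2 * (ℓ + 2) ^ 2 := by
    intro m ℓ hA
    have hN : (2 : ℝ) ≤ ℓ + 2 := by linarith [(Nat.cast_nonneg ℓ : (0 : ℝ) ≤ ℓ)]
    have hℓ : (0 : ℝ) ≤ ℓ := Nat.cast_nonneg ℓ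
    set N : ℝ := ℓ + 2 with hNdef
    have hΛ : (ℓ : ℝ) * (ℓ + 1) ≤ N ^ 2 - 1 := by rw [hNdef]; nlinarith
    have hS := (Sml_continuousOn (m := m) (ℓ := ℓ)).mono hsub
    have hy := (ySml_continuousOn hA).mono hsub
    have hsc : ContinuousOn Real.sin (Icc a b) := Real.continuous_sin.continuousOn
    have hne : ∀ x ∈ Icc a b, Real.sin x ≠ 0 := fun x hx => (hs.trans_le (hmin' x hx)).ne'
    have hVc : ContinuousOn (Vang m) (Icc a b) := by
      unfold Vang
      exact ((by fun_prop : Continuous fun θ : ℝ => (m + 2 * Real.cos θ) ^ 2).continuousOn.div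
        (by fun_prop) fun x hx => pow_ne_zero 2 (hne x hx)).add continuousOn_const
    have II : ∀ {f : ℝ → ℝ}, ContinuousOn f (Icc a b) → IntervalIntegrable f volume a b :=
      fun hf => (hf.mono (uIcc_of_le hab.le).subset).intervalIntegrable
    have J1 : ∫ θ in a..b, Sml m ℓ θ ^ 2 * Real.sin θ ≤ 1 :=
      (integral_Sml_sq_le hA ha hab.le hb).trans hπ
    have J2 : ∫ θ in a..b, ySml m ℓ θ ^ 2 / Real.sin θ ≤ N ^ 2 - 1 := by
      refine (integral_ySml_sq_le hA ha hab.le hb).trans ?_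
      rw [div_eq_mul_one_div]
      exact (mul_le_of_le_one_right (by positivity) hπ).trans hΛ
    have hVb : ∀ θ ∈ Icc a b, |Vang m θ - ℓ * (ℓ + 1)| ≤ 3 / s ^ 2 * N ^ 2 := by
      intro θ hθ
      have h1 : |(m : ℝ) + 2 * Real.cos θ| ≤ N := by
        obtain ⟨h2, h3, h4⟩ := hA
        have h3' : -(ℓ : ℝ) ≤ m := by exact_mod_cast h3
        have h4' : (m : ℝ) ≤ ℓ := by exact_mod_cast h4
        rw [abs_le]
        constructor <;> linarith [Real.neg_one_le_cos θ, Real.cos_le_one θ]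
      have h2 : ((m : ℝ) + 2 * Real.cos θ) ^ 2 ≤ N ^ 2 := by
        rw [← sq_abs]; exact pow_le_pow_left₀ (abs_nonneg _) h1 2
      have h3 : ((m : ℝ) + 2 * Real.cos θ) ^ 2 / Real.sin θ ^ 2 ≤ N ^ 2 / s ^ 2 :=
        div_le_div₀ (by positivity) h2 (by positivity)
          (pow_le_pow_left₀ hs.le (hmin' θ hθ) 2)
      have h4 : N ^ 2 ≤ N ^ 2 / s ^ 2 := by
        rw [le_div_iff₀ (by positivity)]
        exact mul_le_of_le_one_right (by positivity) (pow_le_one₀ hs.le hs1)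
      have h5 : 0 ≤ (ℓ : ℝ) * (ℓ + 1) := by positivity
      have h6 := Vang_nonneg m θ
      have h7 : Vang m θ ≤ N ^ 2 / s ^ 2 + 4 := by unfold Vang; linarith
      have h8 : 3 / s ^ 2 * N ^ 2 = 3 * (N ^ 2 / s ^ 2) := by ring
      rw [h8, abs_le]
      constructor <;> nlinarith
    have hSd : ∀ x ∈ Icc a b, HasDerivAt (Sml m ℓ) (ySml m ℓ x / Real.sin x) x :=
      fun x hx => hasDerivAt_Sml (hsub hx)
    have K1 : ∫ θ in a..b, Sml m ℓ θ ^ 2 ≤ 1 / s := by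
      have : ∫ θ in a..b, Sml m ℓ θ ^ 2 ≤ ∫ θ in a..b, 1 / s * (Sml m ℓ θ ^ 2 * Real.sin θ) := by
        refine intervalIntegral.integral_mono_on hab.le (II (hS.pow 2))
          (II (continuousOn_const.mul ((hS.pow 2).mul hsc))) fun θ hθ => ?_
        rw [one_div_mul_eq_div, le_div_iff₀ hs]
        exact mul_le_mul_of_nonneg_left (hmin' θ hθ) (sq_nonneg _)
      rw [intervalIntegral.integral_const_mul] at this
      exact this.trans (mul_le_of_le_one_right (by positivity) J1)
    have K2 : ∫ θ in a..b, (ySml m ℓ θ / Real.sin θ) ^ 2 ≤ 1 / s * (N ^ 2 - 1) := by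
      have : ∫ θ in a..b, (ySml m ℓ θ / Real.sin θ) ^ 2 ≤
          ∫ θ in a..b, 1 / s * (ySml m ℓ θ ^ 2 / Real.sin θ) := by
        refine intervalIntegral.integral_mono_on hab.le (II ((hy.div hsc hne).pow 2))
          (II (continuousOn_const.mul ((hy.pow 2).div hsc hne))) fun θ hθ => ?_
        have h1 := hmin' θ hθ
        have h2 := hs.trans_le h1
        rw [div_pow, div_mul_div_comm, one_mul]
        refine div_le_div_of_nonneg_left (sq_nonneg _) (by positivity) ?_
        rw [pow_two]
        exact mul_le_mul_of_nonneg_right h1 h2.le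
      rw [intervalIntegral.integral_const_mul] at this
      exact this.trans (mul_le_mul_of_nonneg_left J2 (by positivity))
    have K3 : ∫ θ in a..b, ySml m ℓ θ ^ 2 ≤ N ^ 2 := by
      refine le_trans ?_ (J2.trans (by linarith))
      refine intervalIntegral.integral_mono_on hab.le (II (hy.pow 2))
          (II ((hy.pow 2).div hsc hne)) fun θ hθ => ?_
      rw [le_div_iff₀ (hs.trans_le (hmin' θ hθ))]
      exact mul_le_of_le_one_right (sq_nonneg _) (Real.sin_le_one _)
    have hdc : ContinuousOn (fun θ => (Vang m θ - ℓ * (ℓ + 1)) * Real.sin θ * Sml m ℓ θ)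
        (Icc a b) := ((hVc.sub continuousOn_const).mul hsc).mul hS
    have K4 : ∫ θ in a..b, ((Vang m θ - ℓ * (ℓ + 1)) * Real.sin θ * Sml m ℓ θ) ^ 2 ≤
        9 / s ^ 4 * N ^ 4 := by
      have : ∫ θ in a..b, ((Vang m θ - ℓ * (ℓ + 1)) * Real.sin θ * Sml m ℓ θ) ^ 2 ≤
          ∫ θ in a..b, 9 / s ^ 4 * N ^ 4 * (Sml m ℓ θ ^ 2 * Real.sin θ) := by
        refine intervalIntegral.integral_mono_on hab.le (II (hdc.pow 2))
          (II (continuousOn_const.mul ((hS.pow 2).mul hsc))) fun θ hθ => ?_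
        have h1 := hs.trans_le (hmin' θ hθ)
        have h2 : (Vang m θ - ℓ * (ℓ + 1)) ^ 2 ≤ (3 / s ^ 2 * N ^ 2) ^ 2 := by
          rw [← sq_abs]; exact pow_le_pow_left₀ (abs_nonneg _) (hVb θ hθ) 2
        have h3 : (3 / s ^ 2 * N ^ 2) ^ 2 = 9 / s ^ 4 * N ^ 4 := by field_simp; norm_num
        rw [h3] at h2
        have h4 : Sml m ℓ θ ^ 2 * Real.sin θ ^ 2 ≤ Sml m ℓ θ ^ 2 * Real.sin θ := by
          refine mul_le_mul_of_nonneg_left ?_ (sq_nonneg _)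
          rw [pow_two]
          exact mul_le_of_le_one_left h1.le (Real.sin_le_one _)
        calc _ = (Vang m θ - ℓ * (ℓ + 1)) ^ 2 * (Sml m ℓ θ ^ 2 * Real.sin θ ^ 2) := by ring
          _ ≤ _ := mul_le_mul h2 h4 (by positivity) (by positivity)
      rw [intervalIntegral.integral_const_mul] at this
      exact this.trans (mul_le_of_le_one_right (by positivity) J1)
    have M1 : ∀ θ ∈ Icc a b, Sml m ℓ θ ^ 2 ≤ c * N ^ 2 := by
      intro θ hθ
      have h := sq_le_integral_of_hasDerivAt hab.le hSd (hy.div hsc hne) hθ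
      have h1 : ∫ y in a..b, (Sml m ℓ y ^ 2 + (ySml m ℓ y / Real.sin y) ^ 2) = _ :=
        intervalIntegral.integral_add (II (hS.pow 2)) (II ((hy.div hsc hne).pow 2))
      rw [h1] at h
      have h2 : (b - a) * ((∫ θ in a..b, Sml m ℓ θ ^ 2) +
          ∫ θ in a..b, (ySml m ℓ θ / Real.sin θ) ^ 2) ≤ (b - a) * (1 / s + 1 / s * (N ^ 2 - 1)) :=
        mul_le_mul_of_nonneg_left (add_le_add K1 K2) hba.le
      have h3 : (b - a) * Sml m ℓ θ ^ 2 ≤ (b - a) * (c * N ^ 2) := by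
        have e : (b - a) * (c * N ^ 2) = 1 / s * N ^ 2 + (b - a) * (1 / s * N ^ 2) := by
          rw [hc]; field_simp
        have : 1 / s ≤ 1 / s * N ^ 2 := le_mul_of_one_le_right (by positivity) (by nlinarith)
        have e2 : 1 / s + 1 / s * (N ^ 2 - 1) = 1 / s * N ^ 2 := by ring
        rw [e2] at h2
        rw [e]
        linarith
      exact le_of_mul_le_mul_left h3 hba
    have M2 : ∀ θ ∈ Icc a b, ySml m ℓ θ ^ 2 ≤ c2 * N ^ 4 := by
      intro θ hθ
      have h := sq_le_integral_of_hasDerivAt hab.le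
        (fun x hx => hasDerivAt_ySml hA (hsub hx)) hdc hθ
      have h1 : ∫ y in a..b, (ySml m ℓ y ^ 2 +
          ((Vang m y - ℓ * (ℓ + 1)) * Real.sin y * Sml m ℓ y) ^ 2) = _ :=
        intervalIntegral.integral_add (II (hy.pow 2)) (II (hdc.pow 2))
      rw [h1] at h
      have hN4 : N ^ 2 ≤ N ^ 4 := pow_le_pow_right₀ (by linarith) (by norm_num)
      have h2 : (b - a) * ((∫ θ in a..b, ySml m ℓ θ ^ 2) +
          ∫ θ in a..b, ((Vang m θ - ℓ * (ℓ + 1)) * Real.sin θ * Sml m ℓ θ) ^ 2) ≤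
          (b - a) * (N ^ 4 + 9 / s ^ 4 * N ^ 4) :=
        mul_le_mul_of_nonneg_left (add_le_add (K3.trans hN4) K4) hba.le
      have h3 : (b - a) * ySml m ℓ θ ^ 2 ≤ (b - a) * (c2 * N ^ 4) := by
        have e : (b - a) * (c2 * N ^ 4) = N ^ 4 + (b - a) * (N ^ 4 + 9 / s ^ 4 * N ^ 4) := by
          rw [hc2]; field_simp; ring
        rw [e]
        linarith
      exact le_of_mul_le_mul_left h3 hba
    intro θ hθ
    refine ⟨abs_le_of_sq_le_sq ((M1 θ hθ).trans ?_) (by positivity),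
      abs_le_of_sq_le_sq ((M2 θ hθ).trans ?_) (by positivity), hVb θ hθ⟩
    · rw [mul_pow]
      exact mul_le_mul_of_nonneg_right (by nlinarith) (by positivity)
    · rw [mul_pow]
      have : N ^ 4 ≤ (N ^ 4) ^ 2 := by
        rw [pow_two]
        exact le_mul_of_one_le_left (by positivity) (one_le_pow₀ (by linarith))
      exact mul_le_mul (by nlinarith) this (by positivity) (by positivity)
  refine ⟨c + c2 + 3 / s ^ 2 * c, by positivity, fun m ℓ hA θ hθ => ?_⟩
  obtain ⟨h1, h2, h3⟩ := hbound m ℓ hA θ hθ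
  have hN : (1 : ℝ) ≤ ℓ + 2 := by linarith [(Nat.cast_nonneg ℓ : (0 : ℝ) ≤ ℓ)]
  set N : ℝ := ℓ + 2
  have hp : 0 ≤ N ^ 4 := by positivity
  have e0 : 0 ≤ 3 / s ^ 2 * c := by positivity
  refine ⟨h1.trans ?_, h2.trans ?_, ?_⟩
  · exact mul_le_mul (by linarith) (le_self_pow₀ hN (by norm_num)) (by positivity) (by positivity)
  · exact mul_le_mul_of_nonneg_right (by linarith) hp
  · rw [abs_mul, abs_mul]
    calc _ ≤ 3 / s ^ 2 * N ^ 2 * 1 * (c * N) :=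
          mul_le_mul (mul_le_mul h3 (Real.abs_sin_le_one _) (abs_nonneg _) (by positivity)) h1
            (abs_nonneg _) (by positivity)
      _ = 3 / s ^ 2 * c * N ^ 3 := by ring
      _ ≤ _ := mul_le_mul (by linarith) (pow_le_pow_right₀ hN (by norm_num)) (by positivity)
            (by positivity)

end
end TeukolskySAdS

open scoped ContDiff
namespace TeukolskySAdS
open Set Filter Topology
noncomputable section

open MeasureTheory Chart

/-! ### Differentiation of mode integrals -/

section Param

variable {α : Type*} [MeasurableSpace α] {μ : Measure α} [IsFiniteMeasure μ]
  {E : Type*} [NormedAddCommGroup E] [NormedSpace ℝ E] {s : Set E}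

/-- Differentiation under the integral sign within a convex set. -/
theorem hasFDerivWithinAt_integral_of_bounded (hs : Convex ℝ s) {f : E → α → ℂ}
    {f' : E → α → E →L[ℝ] ℂ} {K : α → ℂ} {x : E} {CK C : ℝ} (hx : x ∈ s)
    (hK : AEStronglyMeasurable K μ) (hKb : ∀ᵐ a ∂μ, ‖K a‖ ≤ CK)
    (hf : ∀ y ∈ s, AEStronglyMeasurable (f y) μ) (hfb : ∀ᵐ a ∂μ, ‖f x a‖ ≤ C)
    (hf' : AEStronglyMeasurable (f' x) μ)
    (hd : ∀ᵐ a ∂μ, ∀ y ∈ s, HasFDerivWithinAt (fun z => f z a) (f' y a) s y)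
    (hb' : ∃ W ∈ 𝓝[s] x, ∀ᵐ a ∂μ, ∀ y ∈ W, ‖f' y a‖ ≤ C) :
    HasFDerivWithinAt (fun y => ∫ a, f y a * K a ∂μ) (∫ a, K a • f' x a ∂μ) s x := by
  obtain ⟨W, hW, hWb⟩ := hb'
  obtain ⟨ε, hε, hεW⟩ := Metric.mem_nhdsWithin_iff.mp hW
  have hev : ∀ᶠ y in 𝓝[s] x, y ∈ Metric.ball x ε ∩ s :=
    inter_mem (mem_nhdsWithin_of_mem_nhds (Metric.ball_mem_nhds x hε)) self_mem_nhdsWithin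
  have hconv : Convex ℝ (Metric.ball x ε ∩ s) := (convex_ball x ε).inter hs
  have hxm : x ∈ Metric.ball x ε ∩ s := ⟨Metric.mem_ball_self hε, hx⟩
  have hlip : ∀ᵐ a ∂μ, ∀ y ∈ Metric.ball x ε ∩ s, ‖f y a - f x a‖ ≤ C * ‖y - x‖ := by
    filter_upwards [hd, hWb] with a h1 h2 y hy
    exact hconv.norm_image_sub_le_of_norm_hasFDerivWithin_le
      (fun z hz => (h1 z hz.2).mono inter_subset_right) (fun z hz => h2 z (hεW hz)) hxm hy
  have hC0 : ∀ᵐ a ∂μ, 0 ≤ C := by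
    filter_upwards [hfb] with a h using (norm_nonneg _).trans h
  have hint : ∀ {g : α → ℂ} {B : ℝ}, AEStronglyMeasurable g μ → (∀ᵐ a ∂μ, ‖g a‖ ≤ B) →
      Integrable (fun a => g a * K a) μ := by
    intro g B hg hgB
    refine (integrable_const (B * CK)).mono' (hg.mul hK) ?_
    filter_upwards [hgB, hKb] with a h1 h2
    rw [norm_mul]
    exact mul_le_mul h1 h2 (norm_nonneg _) ((norm_nonneg _).trans h1)
  have hix : Integrable (fun a => f x a * K a) μ := hint (hf x hx) hfb
  have hiy : ∀ y ∈ Metric.ball x ε ∩ s, Integrable (fun a => f y a * K a) μ := fun y hy => by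
    refine hint (B := C * ‖y - x‖ + C) (hf y hy.2) ?_
    filter_upwards [hlip, hfb] with a h1 h2
    calc ‖f y a‖ = ‖(f y a - f x a) + f x a‖ := by rw [sub_add_cancel]
      _ ≤ _ := (norm_add_le _ _).trans (add_le_add (h1 y hy) h2)
  have hbx : ∀ᵐ a ∂μ, ‖f' x a‖ ≤ C := by
    filter_upwards [hWb] with a h using h x (hεW hxm)
  have hif' : Integrable (fun a => K a • f' x a) μ := by
    refine (integrable_const (CK * C)).mono' (hK.smul hf') ?_
    filter_upwards [hbx, hKb] with a h1 h2
    rw [norm_smul]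
    exact mul_le_mul h2 h1 (norm_nonneg _) ((norm_nonneg _).trans h2)
  -- The set need not be open, so the remainder quotient is estimated directly. The mean value
  -- inequality on the convex set dominates it, and dominated convergence applies.
  rw [hasFDerivWithinAt_iff_tendsto]
  have heq : ∀ᶠ y in 𝓝[s] x, ‖∫ a, (‖y - x‖⁻¹ : ℝ) • ((f y a - f x a - f' x a (y - x)) * K a) ∂μ‖ =
      ‖y - x‖⁻¹ * ‖(∫ a, f y a * K a ∂μ) - (∫ a, f x a * K a ∂μ) -
        (∫ a, K a • f' x a ∂μ) (y - x)‖ := by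
    filter_upwards [hev] with y hy
    rw [integral_smul, norm_smul, norm_inv, norm_norm]
    congr 2
    rw [ContinuousLinearMap.integral_apply hif', ← integral_sub (hiy y hy) hix, ← integral_sub]
    · refine integral_congr_ae (ae_of_all _ fun a => ?_)
      simp only [smul_apply, smul_eq_mul]
      ring
    · exact (hiy y hy).sub hix
    · exact (ContinuousLinearMap.apply ℝ ℂ (y - x)).integrable_comp hif'
  refine Tendsto.congr' heq ?_
  rw [← norm_zero (E := ℂ)]
  refine Tendsto.norm ?_
  have hz : (0 : ℂ) = ∫ _ : α, (0 : ℂ) ∂μ := by simp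
  rw [hz]
  refine tendsto_integral_filter_of_dominated_convergence (fun _ => 2 * C * CK) ?_ ?_
    (integrable_const _) ?_
  · filter_upwards [hev] with y hy
    have h1 : AEStronglyMeasurable (fun a => f' x a (y - x)) μ :=
      (ContinuousLinearMap.apply ℝ ℂ (y - x)).continuous.comp_aestronglyMeasurable hf'
    exact ((((hf y hy.2).sub (hf x hx)).sub h1).mul hK).const_smul (‖y - x‖⁻¹ : ℝ)
  · filter_upwards [hev] with y hy
    filter_upwards [hlip, hbx, hKb, hC0] with a h1 h2 h3 h4
    rw [norm_smul, norm_mul, norm_inv, norm_norm]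
    have h5 : ‖f y a - f x a - f' x a (y - x)‖ ≤ 2 * C * ‖y - x‖ := by
      refine (norm_sub_le _ _).trans ?_
      have := (f' x a).le_of_opNorm_le h2 (y - x)
      linarith [h1 y hy]
    have h6 : ‖y - x‖⁻¹ * ‖f y a - f x a - f' x a (y - x)‖ ≤ 2 * C := by
      rcases eq_or_ne (y - x) 0 with h | h
      · rw [h]; simp; exact h4
      · rw [inv_mul_le_iff₀ (norm_pos_iff.mpr h), mul_comm]; exact h5
    rw [← mul_assoc]
    exact mul_le_mul h6 h3 (norm_nonneg _) (by positivity)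
  · filter_upwards [hd] with a h
    have h1 := hasFDerivWithinAt_iff_tendsto.mp (h x hx)
    rw [tendsto_zero_iff_norm_tendsto_zero]
    have h2 := h1.mul_const ‖K a‖
    rw [zero_mul] at h2
    refine h2.congr fun y => ?_
    rw [norm_smul, norm_mul, norm_inv, norm_norm, mul_assoc]

end Param

/-- The coordinate domain of the sphere. -/
def Qm : Set (ℝ × ℝ) := Ioo 0 Real.pi ×ˢ Ioc 0 (2 * Real.pi)

/-- The kernel of the mode integrals. -/
def Kml (m : ℤ) (ℓ : ℕ) (q : ℝ × ℝ) : ℂ :=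
  (Sml m ℓ q.1 : ℂ) * Complex.exp (-Complex.I * (m : ℂ) * (q.2 : ℂ)) * (Real.sin q.1 : ℂ)

theorem measurableSet_Qm : MeasurableSet Qm := measurableSet_Ioo.prod measurableSet_Ioc

instance : IsFiniteMeasure (volume.restrict Qm) := by
  refine ⟨?_⟩
  rw [Measure.restrict_apply_univ, Qm, Measure.volume_eq_prod, Measure.prod_prod]
  simp [ENNReal.mul_lt_top]

variable {m : ℤ} {ℓ : ℕ}

theorem norm_exp_I (m : ℤ) (φ : ℝ) : ‖Complex.exp (-Complex.I * (m : ℂ) * (φ : ℂ))‖ = 1 := by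
  rw [Complex.norm_exp]
  simp

theorem norm_exp_I' (m : ℤ) (φ : ℝ) : ‖Complex.exp (Complex.I * (m : ℂ) * (φ : ℂ))‖ = 1 := by
  rw [Complex.norm_exp]
  simp

theorem Kml_continuousOn (m : ℤ) (ℓ : ℕ) : ContinuousOn (Kml m ℓ) (Ioo 0 Real.pi ×ˢ univ) := by
  unfold Kml
  refine (ContinuousOn.mul ?_ (by fun_prop)).mul (by fun_prop)
  exact Complex.continuous_ofReal.comp_continuousOn
    (Sml_continuousOn.comp continuousOn_fst fun q hq => hq.1)

theorem Qm_subset : Qm ⊆ Ioo 0 Real.pi ×ˢ univ := fun _ h => ⟨h.1, mem_univ _⟩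

theorem Kml_measurable (m : ℤ) (ℓ : ℕ) : AEStronglyMeasurable (Kml m ℓ) (volume.restrict Qm) :=
  ((Kml_continuousOn m ℓ).mono Qm_subset).aestronglyMeasurable measurableSet_Qm

theorem Kml_bounded (hA : Adm m ℓ) : ∃ C, 0 ≤ C ∧ ∀ q ∈ Qm, ‖Kml m ℓ q‖ ≤ C := by
  obtain ⟨C, hC0, hC⟩ := Sml_bounded hA
  refine ⟨C * 1 * 1, by positivity, fun q hq => ?_⟩
  unfold Kml
  rw [norm_mul, norm_mul, norm_exp_I, Complex.norm_real, Complex.norm_real]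
  exact mul_le_mul (mul_le_mul_of_nonneg_right (hC q.1 hq.1).1 zero_le_one)
    (Real.abs_sin_le_one _) (abs_nonneg _) (by positivity)

variable {M k rp t0 : ℝ}

/-- A field on the sphere at `p = (t⋆, r)`. -/
def slice (F : smAlg (Om rp t0)) (p q : ℝ × ℝ) : ℂ := smEv F (p.1, p.2, q.1, q.2)

theorem slice_continuousOn (F : smAlg (Om rp t0)) {p : ℝ × ℝ} (hp : p ∈ U2 rp t0) :
    ContinuousOn (slice F p) (Ioo 0 Real.pi ×ˢ univ) :=
  (smEv_continuousOn F).comp (by fun_prop) fun _ hq => ⟨hp.1, hp.2, hq.1, hq.2⟩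

theorem slice_measurable (F : smAlg (Om rp t0)) {p : ℝ × ℝ} (hp : p ∈ U2 rp t0) :
    AEStronglyMeasurable (slice F p) (volume.restrict Qm) :=
  ((slice_continuousOn F hp).mono Qm_subset).aestronglyMeasurable measurableSet_Qm

theorem nhdsWithin_U2_le (t0 rp t r : ℝ) : 𝓝[U2 rp t0] (t, r) ≤ 𝓝[Ici t0] t ×ˢ 𝓝 r := by
  rw [U2, nhdsWithin_prod_eq]
  exact prod_mono le_rfl nhdsWithin_le_nhds

theorem exists_slice_bound {F : smAlg (Om rp t0)} (hF : F ∈ locBdd rp t0) {p : ℝ × ℝ}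
    (hp : p ∈ U2 rp t0) :
    ∃ C, 0 ≤ C ∧ ∀ᶠ p' in 𝓝[U2 rp t0] p, ∀ q ∈ Qm, ‖slice F p' q‖ ≤ C := by
  obtain ⟨C, hC⟩ := hF p.1 p.2 hp.1 hp.2
  refine ⟨max C 0, le_max_right _ _, ?_⟩
  filter_upwards [nhdsWithin_U2_le t0 rp p.1 p.2 hC] with p' h q hq
  exact (h q.1 hq.1 q.2 ⟨hq.2.1.le, hq.2.2⟩).trans (le_max_left _ _)

/-- The differential of a slice in `(t⋆, r)`. -/
def slice' (F : smAlg (Om rp t0)) (p q : ℝ × ℝ) : ℝ × ℝ →L[ℝ] ℂ :=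
  (ContinuousLinearMap.fst ℝ ℝ ℝ).smulRight (slice ((C4 rp t0).T F) p q) +
    (ContinuousLinearMap.snd ℝ ℝ ℝ).smulRight (slice ((C4 rp t0).R F) p q)

theorem hasFDerivWithinAt_slice (F : smAlg (Om rp t0)) {p q : ℝ × ℝ} (hp : p ∈ U2 rp t0)
    (hq : q ∈ Qm) :
    HasFDerivWithinAt (fun p => slice F p q) (slice' F p q) (U2 rp t0) p := by
  have hx : (p.1, p.2, q.1, q.2) ∈ Om rp t0 := ⟨hp.1, hp.2, hq.1, mem_univ _⟩
  have hl : HasFDerivWithinAt (fun p : ℝ × ℝ => (p.1, p.2, q.1, q.2))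
      ((ContinuousLinearMap.fst ℝ ℝ ℝ).prod ((ContinuousLinearMap.snd ℝ ℝ ℝ).prod
        (0 : ℝ × ℝ →L[ℝ] ℝ × ℝ))) (U2 rp t0) p :=
    hasFDerivWithinAt_fst.prodMk (hasFDerivWithinAt_snd.prodMk
      (hasFDerivWithinAt_const ((q.1, q.2) : ℝ × ℝ) p _))
  have h := (smEv_differentiable F hx).hasFDerivWithinAt.comp p hl
    fun p' hp' => (⟨hp'.1, hp'.2, hq.1, mem_univ _⟩ : (p'.1, p'.2, q.1, q.2) ∈ Om rp t0)
  refine h.congr_fderiv ?_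
  refine ContinuousLinearMap.ext fun u => ?_
  have e : (u.1, u.2, (0 : ℝ × ℝ)) = u.1 • ((1, 0, 0, 0) : ℝ × ℝ × ℝ × ℝ) +
      u.2 • ((0, 1, 0, 0) : ℝ × ℝ × ℝ × ℝ) := by
    refine Prod.ext ?_ (Prod.ext ?_ (Prod.ext ?_ ?_)) <;> simp
  have h1 : slice ((C4 rp t0).T F) p q = _ := smEv_pd (1, 0, 0, 0) F hx
  have h2 : slice ((C4 rp t0).R F) p q = _ := smEv_pd (0, 1, 0, 0) F hx
  simp only [slice', add_apply, ContinuousLinearMap.smulRight_apply,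
    ContinuousLinearMap.comp_apply, ContinuousLinearMap.prod_apply, ContinuousLinearMap.coe_fst',
    ContinuousLinearMap.coe_snd', zero_apply, h1, h2]
  rw [e, map_add, map_smul, map_smul]

/-- The mode integral. -/
def modeInt (m : ℤ) (ℓ : ℕ) (F : smAlg (Om rp t0)) (p : ℝ × ℝ) : ℂ :=
  ∫ q in Qm, slice F p q * Kml m ℓ q

theorem norm_slice'_le {F : smAlg (Om rp t0)} {p q : ℝ × ℝ} {a b : ℝ}
    (ha : ‖slice ((C4 rp t0).T F) p q‖ ≤ a) (hb : ‖slice ((C4 rp t0).R F) p q‖ ≤ b) :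
    ‖slice' F p q‖ ≤ a + b := by
  refine (norm_add_le _ _).trans (add_le_add ?_ ?_)
  · rw [ContinuousLinearMap.norm_smulRight_apply]
    exact (mul_le_of_le_one_left (norm_nonneg _) (ContinuousLinearMap.norm_fst_le _ _ _)).trans ha
  · rw [ContinuousLinearMap.norm_smulRight_apply]
    exact (mul_le_of_le_one_left (norm_nonneg _) (ContinuousLinearMap.norm_snd_le _ _ _)).trans hb

theorem integrable_slice_Kml (hA : Adm m ℓ) {F : smAlg (Om rp t0)} (hF : F ∈ locBdd rp t0)
    {p : ℝ × ℝ} (hp : p ∈ U2 rp t0) :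
    Integrable (fun q => slice F p q * Kml m ℓ q) (volume.restrict Qm) := by
  obtain ⟨C, hC0, hC⟩ := exists_slice_bound hF hp
  obtain ⟨K, hK0, hK⟩ := Kml_bounded hA
  have hCp := hC.self_of_nhdsWithin hp
  refine (integrable_const (C * K)).mono' ((slice_measurable F hp).mul (Kml_measurable m ℓ)) ?_
  refine ae_restrict_of_forall_mem measurableSet_Qm fun q hq => ?_
  rw [norm_mul]
  exact mul_le_mul (hCp q hq) (hK q hq) (norm_nonneg _) hC0

/-- The domination needs F and its two first derivatives bounded near p uniformly over the sphere,
poles included; smoothness on the punctured sphere alone would not suffice. -/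
theorem hasFDerivWithinAt_modeInt (hA : Adm m ℓ) {F : smAlg (Om rp t0)} (hF : F ∈ locBdd rp t0)
    (hT : (C4 rp t0).T F ∈ locBdd rp t0) (hR : (C4 rp t0).R F ∈ locBdd rp t0)
    {p : ℝ × ℝ} (hp : p ∈ U2 rp t0) :
    HasFDerivWithinAt (modeInt m ℓ F)
      ((ContinuousLinearMap.fst ℝ ℝ ℝ).smulRight (modeInt m ℓ ((C4 rp t0).T F) p) +
        (ContinuousLinearMap.snd ℝ ℝ ℝ).smulRight (modeInt m ℓ ((C4 rp t0).R F) p))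
      (U2 rp t0) p := by
  obtain ⟨K, hK0, hK⟩ := Kml_bounded hA
  obtain ⟨C, hC0, hC⟩ := exists_slice_bound hF hp
  obtain ⟨CT, hCT0, hCT⟩ := exists_slice_bound hT hp
  obtain ⟨CR, hCR0, hCR⟩ := exists_slice_bound hR hp
  have hae : ∀ {P : ℝ × ℝ → Prop}, (∀ q ∈ Qm, P q) → ∀ᵐ q ∂(volume.restrict Qm), P q :=
    fun h => ae_restrict_of_forall_mem measurableSet_Qm h
  have hm' : AEStronglyMeasurable (slice' F p) (volume.restrict Qm) := by
    refine AEStronglyMeasurable.add ?_ ?_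
    · exact (ContinuousLinearMap.smulRightL ℝ (ℝ × ℝ) ℂ
        (ContinuousLinearMap.fst ℝ ℝ ℝ)).continuous.comp_aestronglyMeasurable
          (slice_measurable _ hp)
    · exact (ContinuousLinearMap.smulRightL ℝ (ℝ × ℝ) ℂ
        (ContinuousLinearMap.snd ℝ ℝ ℝ)).continuous.comp_aestronglyMeasurable
          (slice_measurable _ hp)
  have hbd : ∀ᶠ y in 𝓝[U2 rp t0] p, ∀ q ∈ Qm, ‖slice' F y q‖ ≤ C + (CT + CR) := by
    filter_upwards [hCT, hCR] with y h1 h2 q hq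
    exact (norm_slice'_le (h1 q hq) (h2 q hq)).trans (by linarith)
  have h := hasFDerivWithinAt_integral_of_bounded (μ := volume.restrict Qm) (s := U2 rp t0)
    (f := slice F) (f' := slice' F) (K := Kml m ℓ) (x := p) (CK := K) (C := C + (CT + CR))
    ((convex_Ici t0).prod (convex_Ioi rp)) hp (Kml_measurable m ℓ) (hae hK)
    (fun y hy => slice_measurable F hy)
    (hae fun q hq => (hC.self_of_nhdsWithin hp q hq).trans (by linarith)) hm'
    (hae fun q hq y hy => hasFDerivWithinAt_slice F hy hq)
    ⟨_, hbd, hae fun q hq y hy => hy q hq⟩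
  refine h.congr_fderiv ?_
  have i1 := integrable_slice_Kml hA hT hp
  have i2 := integrable_slice_Kml hA hR hp
  have hif : Integrable (fun q => Kml m ℓ q • slice' F p q) (volume.restrict Qm) := by
    refine (integrable_const (K * (C + (CT + CR)))).mono' ((Kml_measurable m ℓ).smul hm') ?_
    refine hae fun q hq => ?_
    rw [norm_smul]
    exact mul_le_mul (hK q hq) (hbd.self_of_nhdsWithin hp q hq) (norm_nonneg _) hK0
  refine ContinuousLinearMap.ext fun u => ?_
  rw [ContinuousLinearMap.integral_apply hif]
  simp only [slice', add_apply, ContinuousLinearMap.smulRight_apply,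
    smul_apply, ContinuousLinearMap.coe_fst', ContinuousLinearMap.coe_snd',
    modeInt]
  rw [← integral_smul, ← integral_smul]
  refine Eq.trans ?_ (integral_add (i1.smul u.1) (i2.smul u.2))
  refine integral_congr_ae (ae_of_all _ fun q => ?_)
  simp only [Complex.real_smul, smul_eq_mul, Pi.smul_apply]
  ring

end
end TeukolskySAdS

open scoped ContDiff
namespace TeukolskySAdS
open Set Filter Topology
noncomputable section

open MeasureTheory Chart

variable {m : ℤ} {ℓ : ℕ} {M k rp t0 : ℝ} {t r θ : ℝ}

/-! ### Azimuthal Fourier coefficients -/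

/-- The azimuthal Fourier coefficient. -/
def fc (m : ℤ) (F : smAlg (Om rp t0)) (t r θ : ℝ) : ℂ :=
  ∫ φ in (0 : ℝ)..(2 * Real.pi), ev F t r θ φ * Complex.exp (-Complex.I * (m : ℂ) * (φ : ℂ))

theorem ev_continuous_ph (F : smAlg (Om rp t0)) (h : Region rp t0 t r θ) :
    Continuous fun φ => ev F t r θ φ :=
  continuous_iff_continuousAt.mpr fun _ => (hasDerivAt_ev_ph F h).continuousAt

theorem fc_integrable (F : smAlg (Om rp t0)) (h : Region rp t0 t r θ) (m : ℤ) (a b : ℝ) :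
    IntervalIntegrable (fun φ : ℝ => ev F t r θ φ * Complex.exp (-Complex.I * (m : ℂ) * (φ : ℂ)))
      volume a b :=
  ((ev_continuous_ph F h).mul (by fun_prop)).intervalIntegrable _ _

section

variable {F G : smAlg (Om rp t0)} (h : Region rp t0 t r θ)

theorem fc_add (h : Region rp t0 t r θ) : fc m (F + G) t r θ = fc m F t r θ + fc m G t r θ := by
  unfold fc
  rw [← intervalIntegral.integral_add (fc_integrable F h m _ _) (fc_integrable G h m _ _)]
  simp only [ev_add, add_mul]

theorem fc_sub (h : Region rp t0 t r θ) : fc m (F - G) t r θ = fc m F t r θ - fc m G t r θ := by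
  unfold fc
  rw [← intervalIntegral.integral_sub (fc_integrable F h m _ _) (fc_integrable G h m _ _)]
  simp only [ev_sub, sub_mul]

theorem fc_neg : fc m (-F) t r θ = -fc m F t r θ := by
  unfold fc
  rw [← intervalIntegral.integral_neg]
  simp only [ev_neg, neg_mul]

theorem fc_mul {c : ℂ} (hG : ∀ φ, ev G t r θ φ = c) : fc m (G * F) t r θ = c * fc m F t r θ := by
  unfold fc
  rw [← intervalIntegral.integral_const_mul]
  simp only [ev_mul, hG, mul_assoc]

theorem hasDerivAt_exp_ph (m : ℤ) (φ : ℝ) :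
    HasDerivAt (fun φ : ℝ => Complex.exp (-Complex.I * (m : ℂ) * (φ : ℂ)))
      (-Complex.I * m * Complex.exp (-Complex.I * (m : ℂ) * (φ : ℂ))) φ := by
  have h1 : HasDerivAt (fun z : ℂ => Complex.exp (-Complex.I * (m : ℂ) * z))
      (Complex.exp (-Complex.I * (m : ℂ) * (φ : ℂ)) * (-Complex.I * (m : ℂ) * 1)) (φ : ℂ) :=
    (((hasDerivAt_id (φ : ℂ)).const_mul (-Complex.I * (m : ℂ)))).cexp
  refine h1.comp_ofReal.congr_deriv ?_
  ring

theorem exp_two_pi (m : ℤ) :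
    Complex.exp (-Complex.I * (m : ℂ) * ((2 * Real.pi : ℝ) : ℂ)) = 1 := by
  rw [show -Complex.I * (m : ℂ) * ((2 * Real.pi : ℝ) : ℂ) =
    ((-m : ℤ) : ℂ) * (2 * Real.pi * Complex.I) by push_cast; ring]
  exact Complex.exp_int_mul_two_pi_mul_I _

/-- Integration by parts in φ; periodicity removes the boundary terms. -/
theorem fc_Ph (hF : Per F) (h : Region rp t0 t r θ) :
    fc m (Ph F) t r θ = Complex.I * m * fc m F t r θ := by
  have h1 := intervalIntegral.integral_mul_deriv_eq_deriv_mul (a := 0) (b := 2 * Real.pi)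
    (u := fun φ : ℝ => Complex.exp (-Complex.I * (m : ℂ) * (φ : ℂ)))
    (v := fun φ => ev F t r θ φ) (fun φ _ => hasDerivAt_exp_ph m φ)
    (fun φ _ => hasDerivAt_ev_ph F h)
    (by apply Continuous.intervalIntegrable; fun_prop)
    ((ev_continuous_ph (Ph F) h).intervalIntegrable _ _)
  have hper : ev F t r θ (2 * Real.pi) = ev F t r θ 0 := by
    have := hF t r θ 0 h
    rwa [zero_add] at this
  rw [hper, exp_two_pi] at h1
  simp only [Complex.ofReal_zero, mul_zero, Complex.exp_zero, one_mul, sub_self, zero_sub] at h1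
  unfold fc
  rw [← intervalIntegral.integral_const_mul]
  calc _ = ∫ φ in (0 : ℝ)..(2 * Real.pi),
        Complex.exp (-Complex.I * (m : ℂ) * (φ : ℂ)) * ev (Ph F) t r θ φ := by
          simp only [mul_comm (ev (Ph F) t r θ _)]
    _ = _ := by
      rw [h1, ← intervalIntegral.integral_neg]
      congr 1
      funext φ
      ring

theorem hasDerivAt_fc (F : smAlg (Om rp t0)) (h : Region rp t0 t r θ) :
    HasDerivAt (fun y => fc m F t r y) (fc m (Th F) t r θ) θ := by
  have hp : (t, r) ∈ U2 rp t0 := mem_U2.2 ⟨h.1, h.2.1⟩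
  obtain ⟨a, b, ha, hb⟩ : ∃ a b, θ ∈ Ioo a b ∧ Icc a b ⊆ Ioo 0 Real.pi := by
    refine ⟨θ / 2, (θ + Real.pi) / 2, ⟨?_, ?_⟩, fun x hx => ?_⟩
    · linarith [h.2.2.1]
    · linarith [h.2.2.2]
    · constructor <;> linarith [h.2.2.1, h.2.2.2, hx.1, hx.2]
  obtain ⟨C, hC⟩ := ((isCompact_Icc (a := a) (b := b)).prod
    (isCompact_Icc (a := 0) (b := 2 * Real.pi))).exists_bound_of_continuousOn
      ((slice_continuousOn (Th F) hp).mono fun q hq => ⟨hb hq.1, mem_univ _⟩)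
  have hreg : ∀ y ∈ Icc a b, Region rp t0 t r y := fun y hy => ⟨h.1, h.2.1, hb hy⟩
  have hpi : (0 : ℝ) ≤ 2 * Real.pi := by positivity
  refine (intervalIntegral.hasDerivAt_integral_of_dominated_loc_of_deriv_le (μ := volume)
    (s := Icc a b) (bound := fun _ => C)
    (F' := fun y φ => ev (Th F) t r y φ * Complex.exp (-Complex.I * (m : ℂ) * (φ : ℂ)))
    (Icc_mem_nhds ha.1 ha.2) ?_ (fc_integrable F h m _ _) ?_ ?_ intervalIntegrable_const ?_).2
  · filter_upwards [Icc_mem_nhds ha.1 ha.2] with y hy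
    exact ((ev_continuous_ph F (hreg y hy)).mul (by fun_prop)).aestronglyMeasurable
  · exact ((ev_continuous_ph (Th F) h).mul (by fun_prop)).aestronglyMeasurable
  · refine ae_of_all _ fun φ hφ y hy => ?_
    rw [norm_mul, norm_exp_I, mul_one]
    rw [uIoc_of_le hpi] at hφ
    exact hC (y, φ) ⟨hy, hφ.1.le, hφ.2⟩
  · exact ae_of_all _ fun φ _ y hy => (hasDerivAt_ev_th F (hreg y hy)).mul_const _

/-- The radial equation satisfied by the Fourier coefficient. -/
theorem fc_angA (hF : Per F) (h : Region rp t0 t r θ) :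
    fc m (Th (sTh * Th F)) t r θ =
      Real.sin θ * (-fc m (angA 2 F) t r θ + Vang m θ * fc m F t r θ) := by
  have hs : (Real.sin θ : ℂ) ≠ 0 := by exact_mod_cast (sin_pos' h.mem).ne'
  have e1 : fc m (csc * Th (sTh * Th F)) t r θ = ((Real.sin θ)⁻¹ : ℝ) * fc m (Th (sTh * Th F)) t r θ :=
    fc_mul fun φ => ev_csc h
  have e2 : fc m (csc ^ 2 * Ph (Ph F)) t r θ = (((Real.sin θ)⁻¹ : ℝ) : ℂ) ^ 2 *
      fc m (Ph (Ph F)) t r θ := fc_mul fun φ => by rw [pow_two, ev_mul, ev_csc h, pow_two]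
  have e3 : fc m (2 * iS 2 * (cot * csc) * Ph F) t r θ = 2 * (Complex.I * 2) *
      ((Real.cos θ / Real.sin θ : ℝ) * ((Real.sin θ)⁻¹ : ℝ)) * fc m (Ph F) t r θ :=
    fc_mul fun φ => by
      rw [ev_mul, ev_mul, ev_mul, ev_csc h, ev_cot h, iS, ev_algebraMap _ h]
      unfold ev
      rw [smEv_ofNat _ (mem_Om.2 h)]
      norm_num
  have e4 : fc m (4 * cot ^ 2 * F) t r θ = 4 * ((Real.cos θ / Real.sin θ : ℝ) : ℂ) ^ 2 *
      fc m F t r θ := fc_mul fun φ => by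
      rw [ev_mul, pow_two, ev_mul, ev_cot h]
      unfold ev
      rw [smEv_ofNat _ (mem_Om.2 h)]
      ring
  have e5 : fc m (4 * F) t r θ = 4 * fc m F t r θ := fc_mul fun φ => by
      unfold ev
      rw [smEv_ofNat _ (mem_Om.2 h)]
  have e6 : fc m (Ph (Ph F)) t r θ = Complex.I * m * (Complex.I * m * fc m F t r θ) := by
    rw [fc_Ph hF.Ph h, fc_Ph hF h]
  unfold angA
  rw [fc_neg, fc_sub h, fc_sub h, fc_add h, fc_add h, e1, e2, e3, e4, e5, e6, fc_Ph hF h]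
  unfold Vang
  push_cast at hs ⊢
  field_simp
  linear_combination (-(m : ℂ) ^ 2 * fc m F t r θ
    - 4 * m * Complex.cos θ * fc m F t r θ) * Complex.I_sq

end

theorem slice_bound {F : smAlg (Om rp t0)} (hF : F ∈ locBdd rp t0) {p : ℝ × ℝ}
    (hp : p ∈ U2 rp t0) : ∃ C, 0 ≤ C ∧ ∀ q ∈ Qm, ‖slice F p q‖ ≤ C := by
  obtain ⟨C, h0, h⟩ := exists_slice_bound hF hp
  exact ⟨C, h0, h.self_of_nhdsWithin hp⟩

theorem norm_fc_le {F : smAlg (Om rp t0)} {C : ℝ}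
    (hC : ∀ φ ∈ Ioc 0 (2 * Real.pi), ‖ev F t r θ φ‖ ≤ C) : ‖fc m F t r θ‖ ≤ 2 * Real.pi * C := by
  have hpi : (0 : ℝ) ≤ 2 * Real.pi := by positivity
  have := intervalIntegral.norm_integral_le_of_norm_le_const (a := 0) (b := 2 * Real.pi) (C := C)
    (f := fun φ => ev F t r θ φ * Complex.exp (-Complex.I * (m : ℂ) * (φ : ℂ))) fun φ hφ => by
      rw [uIoc_of_le hpi] at hφ
      rw [norm_mul, norm_exp_I, mul_one]
      exact hC φ hφ
  rw [sub_zero, abs_of_nonneg hpi] at this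
  exact this.trans_eq (mul_comm _ _)

theorem fc_continuousOn (F : smAlg (Om rp t0)) (hp : (t, r) ∈ U2 rp t0) :
    ContinuousOn (fun θ => fc m F t r θ) (Ioo 0 Real.pi) := fun _ hθ =>
  (hasDerivAt_fc F ⟨hp.1, hp.2, hθ⟩).continuousAt.continuousWithinAt

theorem modeInt_eq (hA : Adm m ℓ) {F : smAlg (Om rp t0)} (hF : F ∈ locBdd rp t0)
    (hp : (t, r) ∈ U2 rp t0) : modeInt m ℓ F (t, r) =
      ∫ θ in (0 : ℝ)..Real.pi, fc m F t r θ * (Sml m ℓ θ : ℂ) * (Real.sin θ : ℂ) := by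
  have hpi : (0 : ℝ) ≤ 2 * Real.pi := by positivity
  have h1 := integrable_slice_Kml hA hF hp
  unfold modeInt Qm
  unfold Qm at h1
  rw [Measure.volume_eq_prod] at h1 ⊢
  rw [setIntegral_prod _ h1, intervalIntegral.integral_of_le Real.pi_pos.le,
    integral_Ioc_eq_integral_Ioo]
  refine setIntegral_congr_fun measurableSet_Ioo fun θ hθ => ?_
  simp only [fc]
  rw [← intervalIntegral.integral_mul_const, ← intervalIntegral.integral_mul_const,
    intervalIntegral.integral_of_le hpi]
  refine integral_congr_ae (ae_of_all _ fun φ => ?_)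
  simp only [slice, Kml, ev]
  ring

theorem modeCoeff_ev (hA : Adm m ℓ) {F : smAlg (Om rp t0)} (hF : F ∈ locBdd rp t0)
    (hp : (t, r) ∈ U2 rp t0) : modeCoeff m ℓ (ev F) t r = modeInt m ℓ F (t, r) := by
  rw [modeInt_eq hA hF hp]
  unfold modeCoeff fc
  simp only [← intervalIntegral.integral_mul_const]
  congr 1
  funext θ
  congr 1
  funext φ
  ring

/-- Self-adjointness of 𝓛. The difference of the two integrands is the θ-derivative of the Wronskian
sin θ (∂_θF · S - F · ∂_θS), which tends to zero at both poles because F, ∂_θF, S and ∂_θS are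
bounded. -/
theorem modeInt_angA (hB : Background M k rp) (hA : Adm m ℓ) {F : smAlg (Om rp t0)}
    (hF : F ∈ good rp t0 hB) {p : ℝ × ℝ} (hp : p ∈ U2 rp t0) :
    modeInt m ℓ (angA 2 F) p = ℓ * (ℓ + 1) * modeInt m ℓ F p := by
  obtain ⟨t, r⟩ := p
  have hreg : ∀ {θ}, θ ∈ Ioo 0 Real.pi → Region rp t0 t r θ := fun h => ⟨hp.1, hp.2, h⟩
  obtain ⟨C, hC0, hC⟩ := slice_bound (good_locBdd hB hF) hp
  obtain ⟨CA, hCA0, hCA⟩ := slice_bound (good_locBdd hB (good_ang hB hF)) hp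
  -- ∂_θ alone is not one of the regular operators, but it is a combination of two rotations with
  -- bounded coefficients.
  have hTh : Th F = -(sPh * Z1A 2 F) - cPh * Z2A 2 F := by
    rw [Z1A_apply, Z2A_apply]
    linear_combination (-Th F) * sPh_sq (rp := rp) (t0 := t0)
  obtain ⟨C1, h10, h1⟩ := slice_bound (good_locBdd hB (good_Z hB hF (Or.inl rfl))) hp
  obtain ⟨C2, h20, h2⟩ := slice_bound (good_locBdd hB (good_Z hB hF (Or.inr (Or.inl rfl)))) hp
  have hThb : ∀ q ∈ Qm, ‖slice (Th F) (t, r) q‖ ≤ C1 + C2 := by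
    intro q hq
    have e : slice (Th F) (t, r) q = -(Real.sin q.2 * slice (Z1A 2 F) (t, r) q) -
        Real.cos q.2 * slice (Z2A 2 F) (t, r) q := by
      have hh : Region rp t0 t r q.1 := hreg hq.1
      change ev (Th F) t r q.1 q.2 = _
      rw [hTh, ev_sub, ev_neg, ev_mul, ev_mul, ev_sPh hh, ev_cPh hh]
      rfl
    rw [e]
    refine (norm_sub_le _ _).trans (add_le_add ?_ ?_)
    · rw [norm_neg, norm_mul, Complex.norm_real]
      exact (mul_le_of_le_one_left (norm_nonneg _) (Real.abs_sin_le_one _)).trans (h1 q hq)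
    · rw [norm_mul, Complex.norm_real]
      exact (mul_le_of_le_one_left (norm_nonneg _) (Real.abs_cos_le_one _)).trans (h2 q hq)
  obtain ⟨K, hK0, hK⟩ := Sml_bounded hA
  have bF : ∀ θ ∈ Ioo 0 Real.pi, ‖fc m F t r θ‖ ≤ 2 * Real.pi * C := fun θ hθ =>
    norm_fc_le fun φ hφ => hC (θ, φ) ⟨hθ, hφ⟩
  have bA : ∀ θ ∈ Ioo 0 Real.pi, ‖fc m (angA 2 F) t r θ‖ ≤ 2 * Real.pi * CA := fun θ hθ =>
    norm_fc_le fun φ hφ => hCA (θ, φ) ⟨hθ, hφ⟩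
  have bT : ∀ θ ∈ Ioo 0 Real.pi, ‖fc m (Th F) t r θ‖ ≤ 2 * Real.pi * (C1 + C2) := fun θ hθ =>
    norm_fc_le fun φ hφ => hThb (θ, φ) ⟨hθ, hφ⟩
  have hcS : ContinuousOn (fun θ => (Sml m ℓ θ : ℂ)) (Ioo 0 Real.pi) :=
    Complex.continuous_ofReal.comp_continuousOn Sml_continuousOn
  have hint : ∀ {G : smAlg (Om rp t0)} {B : ℝ}, (∀ θ ∈ Ioo 0 Real.pi, ‖fc m G t r θ‖ ≤ B) →
      IntervalIntegrable (fun θ => fc m G t r θ * (Sml m ℓ θ : ℂ) * (Real.sin θ : ℂ)) volume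
        0 Real.pi := fun {G B} hG => by
    refine intervalIntegrable_of_bounded (C := B * K * 1) Real.pi_pos.le
      (((fc_continuousOn G hp).mul hcS).mul (by fun_prop)) fun θ hθ => ?_
    have h0 := (norm_nonneg _).trans (hG θ hθ)
    rw [norm_mul, norm_mul, Complex.norm_real, Complex.norm_real]
    exact mul_le_mul (mul_le_mul (hG θ hθ) (hK θ hθ).1 (abs_nonneg _) h0)
      (Real.abs_sin_le_one _) (abs_nonneg _) (by positivity)
  have hy : ∀ θ ∈ Ioo 0 Real.pi, fc m (sTh * Th F) t r θ = Real.sin θ * fc m (Th F) t r θ :=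
    fun θ hθ => fc_mul fun φ => ev_sTh (hreg hθ)
  have hW : ∀ θ ∈ Ioo 0 Real.pi, HasDerivAt
      (fun θ => fc m (sTh * Th F) t r θ * (Sml m ℓ θ : ℂ) - fc m F t r θ * (ySml m ℓ θ : ℂ))
      ((ℓ * (ℓ + 1)) * (fc m F t r θ * (Sml m ℓ θ : ℂ) * (Real.sin θ : ℂ)) -
        fc m (angA 2 F) t r θ * (Sml m ℓ θ : ℂ) * (Real.sin θ : ℂ)) θ := by
    intro θ hθ
    have hs : (Real.sin θ : ℂ) ≠ 0 := by exact_mod_cast (sin_pos' hθ).ne'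
    refine (((hasDerivAt_fc (m := m) (sTh * Th F) (hreg hθ)).mul
      (hasDerivAt_Sml (m := m) (ℓ := ℓ) hθ).ofReal_comp).sub
      ((hasDerivAt_fc F (hreg hθ)).mul (hasDerivAt_ySml hA hθ).ofReal_comp)).congr_deriv ?_
    rw [fc_angA hF.1 (hreg hθ), hy θ hθ]
    push_cast
    push_cast at hs
    field_simp
    ring
  have hlim : ∀ l : Filter ℝ, Tendsto Real.sin l (𝓝 0) → (∀ᶠ θ in l, θ ∈ Ioo 0 Real.pi) →
      Tendsto (fun θ => fc m (sTh * Th F) t r θ * (Sml m ℓ θ : ℂ) -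
        fc m F t r θ * (ySml m ℓ θ : ℂ)) l (𝓝 0) := by
    intro l hl hm
    have h0 : Tendsto (fun θ => (2 * Real.pi * (C1 + C2) * K + 2 * Real.pi * C * K) * Real.sin θ)
        l (𝓝 0) := by
      simpa using hl.const_mul (2 * Real.pi * (C1 + C2) * K + 2 * Real.pi * C * K)
    refine squeeze_zero_norm' ?_ h0
    filter_upwards [hm] with θ hθ
    have hs := (sin_pos' hθ).le
    rw [hy θ hθ]
    refine (norm_sub_le _ _).trans ?_
    rw [norm_mul, norm_mul, norm_mul, Complex.norm_real, Complex.norm_real, Complex.norm_real,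
      Real.norm_of_nonneg hs]
    have a1 := mul_le_mul (bT θ hθ) (hK θ hθ).1 (abs_nonneg _) (by positivity)
    have a2 := mul_le_mul (bF θ hθ) (hK θ hθ).2 (abs_nonneg _) (by positivity)
    have a3 := mul_le_mul_of_nonneg_left a1 hs
    simp only [Real.norm_eq_abs]
    nlinarith
  have e0 : ∀ᶠ θ in 𝓝[>] (0 : ℝ), θ ∈ Ioo 0 Real.pi := Ioo_mem_nhdsGT Real.pi_pos
  have e1 : ∀ᶠ θ in 𝓝[<] Real.pi, θ ∈ Ioo 0 Real.pi := Ioo_mem_nhdsLT Real.pi_pos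
  have s0 : Tendsto Real.sin (𝓝[>] (0 : ℝ)) (𝓝 0) := by
    have := Real.continuous_sin.tendsto 0
    rw [Real.sin_zero] at this
    exact this.mono_left nhdsWithin_le_nhds
  have s1 : Tendsto Real.sin (𝓝[<] Real.pi) (𝓝 0) := by
    have := Real.continuous_sin.tendsto Real.pi
    rw [Real.sin_pi] at this
    exact this.mono_left nhdsWithin_le_nhds
  have hFTC := intervalIntegral.integral_eq_sub_of_hasDerivAt_of_tendsto Real.pi_pos hW
    (((hint bF).const_mul _).sub (hint bA)) (hlim _ s0 e0) (hlim _ s1 e1)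
  rw [intervalIntegral.integral_sub ((hint bF).const_mul _) (hint bA),
    intervalIntegral.integral_const_mul, ← modeInt_eq hA (good_locBdd hB hF) hp,
    ← modeInt_eq hA (good_locBdd hB (good_ang hB hF)) hp, sub_zero] at hFTC
  exact (sub_eq_zero.mp hFTC).symm

/-- The bound does not depend on m and ℓ: from 2|S| ≤ 1 + S² only the normalisation of S enters.
This uniformity is what the rapid decay of modes rests on. -/
theorem norm_modeInt_le (hA : Adm m ℓ) {F : smAlg (Om rp t0)} (hF : F ∈ locBdd rp t0) {p : ℝ × ℝ}
    (hp : p ∈ U2 rp t0) {C : ℝ} (hC : ∀ q ∈ Qm, ‖slice F p q‖ ≤ C) :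
    ‖modeInt m ℓ F p‖ ≤ 4 * Real.pi * C := by
  obtain ⟨t, r⟩ := p
  have hC0 : 0 ≤ C := (norm_nonneg _).trans
    (hC (Real.pi / 2, Real.pi) ⟨⟨by positivity, by linarith [Real.pi_pos]⟩,
      by positivity, by linarith [Real.pi_pos]⟩)
  obtain ⟨K, hK0, hK⟩ := Sml_bounded hA
  rw [modeInt_eq hA hF hp]
  have i0 : IntervalIntegrable Real.sin volume 0 Real.pi :=
    Real.continuous_sin.intervalIntegrable _ _
  have i1 : IntervalIntegrable (fun θ => Sml m ℓ θ * Sml m ℓ θ * Real.sin θ) volume 0 Real.pi := by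
    refine intervalIntegrable_of_bounded (C := K * K * 1) Real.pi_pos.le
      ((Sml_continuousOn.mul Sml_continuousOn).mul (by fun_prop)) fun θ hθ => ?_
    rw [norm_mul, norm_mul]
    exact mul_le_mul (mul_le_mul (hK θ hθ).1 (hK θ hθ).1 (abs_nonneg _) hK0)
      (Real.abs_sin_le_one _) (abs_nonneg _) (by positivity)
  have i2 : IntervalIntegrable (fun θ => Real.pi * C * (Real.sin θ +
      Sml m ℓ θ * Sml m ℓ θ * Real.sin θ)) volume 0 Real.pi := (i0.add i1).const_mul _
  have hb := intervalIntegral.norm_integral_le_of_norm_le (a := 0) (b := Real.pi) Real.pi_pos.le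
    (f := fun θ => fc m F t r θ * (Sml m ℓ θ : ℂ) * (Real.sin θ : ℂ))
    (g := fun θ => Real.pi * C * (Real.sin θ + Sml m ℓ θ * Sml m ℓ θ * Real.sin θ))
    (by
      have hne : ∀ᵐ θ ∂(volume : Measure ℝ), θ ≠ Real.pi := by simp [ae_iff]
      filter_upwards [hne] with θ hne hθ
      have hθ' : θ ∈ Ioo 0 Real.pi := ⟨hθ.1, lt_of_le_of_ne hθ.2 hne⟩
      have hs := (sin_pos' hθ').le
      rw [norm_mul, norm_mul, Complex.norm_real, Complex.norm_real, Real.norm_of_nonneg hs,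
        Real.norm_eq_abs]
      have h1 : ‖fc m F t r θ‖ ≤ 2 * Real.pi * C := norm_fc_le fun φ hφ => hC (θ, φ) ⟨hθ', hφ⟩
      have h2 : 2 * |Sml m ℓ θ| ≤ 1 + Sml m ℓ θ * Sml m ℓ θ := by
        nlinarith [sq_abs (Sml m ℓ θ), sq_nonneg (|Sml m ℓ θ| - 1)]
      have h3 := mul_le_mul_of_nonneg_right h1 (abs_nonneg (Sml m ℓ θ))
      have h4 := mul_le_mul_of_nonneg_left h2 (by positivity : 0 ≤ Real.pi * C)
      calc _ ≤ (Real.pi * C * (1 + Sml m ℓ θ * Sml m ℓ θ)) * Real.sin θ :=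
            mul_le_mul_of_nonneg_right (by linarith) hs
        _ = _ := by ring) i2
  refine hb.trans ?_
  rw [intervalIntegral.integral_const_mul, intervalIntegral.integral_add i0 i1,
    integral_Sml_sq hA, integral_sin]
  have : 1 / (2 * Real.pi) ≤ 1 := by
    rw [div_le_one (by positivity)]; linarith [Real.pi_gt_three]
  rw [Real.cos_zero, Real.cos_pi]
  have h5 : 0 ≤ Real.pi * C := by positivity
  nlinarith

/-- The components of the differential are the mode integrals of ∂_tF and ∂_rF, which are good
again; hence the induction over all of `good` at once. -/
theorem contDiffOn_modeInt (hB : Background M k rp) (hA : Adm m ℓ) (n : ℕ) :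
    ∀ F ∈ good rp t0 hB, ContDiffOn ℝ n (modeInt m ℓ F) (U2 rp t0) := by
  have hd : ∀ F ∈ good rp t0 hB, ∀ p ∈ U2 rp t0, HasFDerivWithinAt (modeInt m ℓ F) _ (U2 rp t0) p :=
    fun F hF p hp => hasFDerivWithinAt_modeInt hA (good_locBdd hB hF)
      (good_locBdd hB (good_T hB hF)) (good_locBdd hB (good_R hB hF)) hp
  induction n with
  | zero =>
    intro F hF
    rw [Nat.cast_zero, contDiffOn_zero]
    exact fun p hp => (hd F hF p hp).continuousWithinAt
  | succ n ih =>
    intro F hF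
    rw [Nat.cast_succ, contDiffOn_succ_iff_hasFDerivWithinAt_of_uniqueDiffOn
      (niceSet_U2 rp t0).uniq]
    refine ⟨by simp, _, ?_, hd F hF⟩
    exact (contDiffOn_const.smulRight (ih _ (good_T hB hF))).add
      (contDiffOn_const.smulRight (ih _ (good_R hB hF)))

end
end TeukolskySAdS

open scoped ContDiff
namespace TeukolskySAdS
open Set Filter Topology
noncomputable section

open MeasureTheory Chart

variable {m : ℤ} {ℓ : ℕ} {M k rp t0 : ℝ}

/-! ### Families of mode functions -/

/-- Families of functions of `(t⋆, r)`. -/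
abbrev Fm (rp t0 : ℝ) := ℤ → ℕ → smAlg (U2 rp t0)

namespace Fm

/-- `∂_t` -/
def mT (h : Fm rp t0) : Fm rp t0 := fun m ℓ => (C2 rp t0).T (h m ℓ)
/-- `∂_r` at fixed `t⋆` -/
def mR (h : Fm rp t0) : Fm rp t0 := fun m ℓ => (C2 rp t0).R (h m ℓ)
/-- Multiplication by a radial function. -/
def mrad (a : smAlg (Ioi rp)) (h : Fm rp t0) : Fm rp t0 := fun m ℓ => (C2 rp t0).rad a * h m ℓ
/-- Multiplication by constants. -/
def wt (c : ℤ → ℕ → ℂ) (h : Fm rp t0) : Fm rp t0 := fun m ℓ => c m ℓ • h m ℓ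
/-- `m ↦ -m` and complex conjugation. -/
def refl (h : Fm rp t0) : Fm rp t0 := fun m ℓ => smConj (h (-m) ℓ)

end Fm

open Fm

/-- Rapidly decaying families. -/
def RD (h : Fm rp t0) : Prop := ∀ (n : ℕ), ∀ p ∈ U2 rp t0, ∃ C, 0 ≤ C ∧
  ∀ᶠ q in 𝓝[U2 rp t0] p, ∀ m ℓ, Adm m ℓ → (ℓ + 2 : ℝ) ^ n * ‖smEv (h m ℓ) q‖ ≤ C

/-- Constants of polynomial growth. -/
def PolyBdd (c : ℤ → ℕ → ℂ) : Prop := ∃ C, 0 ≤ C ∧ ∃ n : ℕ, ∀ m ℓ, Adm m ℓ →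
  ‖c m ℓ‖ ≤ C * (ℓ + 2 : ℝ) ^ n

theorem RD.add {g h : Fm rp t0} (hg : RD g) (hh : RD h) : RD (g + h) := fun n p hp => by
  obtain ⟨C, hC0, hC⟩ := hg n p hp
  obtain ⟨C', hC0', hC'⟩ := hh n p hp
  refine ⟨C + C', by positivity, ?_⟩
  filter_upwards [hC, hC'] with q h1 h2 m ℓ hA
  have h3 := norm_add_le (smEv (g m ℓ) q) (smEv (h m ℓ) q)
  have e : smEv ((g + h) m ℓ) q = smEv (g m ℓ) q + smEv (h m ℓ) q := smEv_add _ _ _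
  rw [e]
  have h4 := mul_le_mul_of_nonneg_left h3 (by positivity : 0 ≤ (ℓ + 2 : ℝ) ^ n)
  rw [mul_add] at h4
  linarith [h1 m ℓ hA, h2 m ℓ hA]

theorem RD.wt {h : Fm rp t0} (hh : RD h) {c : ℤ → ℕ → ℂ} (hc : PolyBdd c) :
    RD (wt c h) := fun n p hp => by
  obtain ⟨D, hD0, d, hD⟩ := hc
  obtain ⟨C, hC0, hC⟩ := hh (n + d) p hp
  refine ⟨D * C, by positivity, ?_⟩
  filter_upwards [hC] with q h1 m ℓ hA
  have e : smEv (Fm.wt c h m ℓ) q = c m ℓ * smEv (h m ℓ) q := smEv_smul _ _ _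
  rw [e, norm_mul]
  have h2 := h1 m ℓ hA
  rw [pow_add] at h2
  calc _ = (ℓ + 2 : ℝ) ^ n * ‖smEv (h m ℓ) q‖ * ‖c m ℓ‖ := by ring
    _ ≤ (ℓ + 2 : ℝ) ^ n * ‖smEv (h m ℓ) q‖ * (D * (ℓ + 2 : ℝ) ^ d) :=
      mul_le_mul_of_nonneg_left (hD m ℓ hA) (by positivity)
    _ = D * ((ℓ + 2 : ℝ) ^ n * (ℓ + 2 : ℝ) ^ d * ‖smEv (h m ℓ) q‖) := by ring
    _ ≤ D * C := mul_le_mul_of_nonneg_left h2 hD0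

theorem Adm.neg (hA : Adm m ℓ) : Adm (-m) ℓ := by unfold Adm at *; omega

theorem RD.refl {h : Fm rp t0} (hh : RD h) : RD (refl h) := fun n p hp => by
  obtain ⟨C, hC0, hC⟩ := hh n p hp
  refine ⟨C, hC0, hC.mono fun q h1 m ℓ hA => ?_⟩
  have e : smEv (Fm.refl h m ℓ) q = (starRingEnd ℂ) (smEv (h (-m) ℓ) q) := smEv_conj _ _
  rw [e, RCLike.norm_conj]
  exact h1 _ _ hA.neg

/-- A set of rapidly decaying families closed under the differential operators. -/
structure ClosedFam (S : Set (Fm rp t0)) : Prop where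
  rd : ∀ g ∈ S, RD g
  T : ∀ g ∈ S, mT g ∈ S
  R : ∀ g ∈ S, mR g ∈ S
  rad : ∀ g ∈ S, ∀ a, mrad a g ∈ S

/-- Families which decay rapidly together with all derivatives. -/
def IsFam (h : Fm rp t0) : Prop := ∃ S : Set (Fm rp t0), h ∈ S ∧ ClosedFam S

namespace IsFam

variable {g h : Fm rp t0}

theorem rd (hh : IsFam h) : RD h := by obtain ⟨S, h1, h2⟩ := hh; exact h2.rd _ h1
theorem T (hh : IsFam h) : IsFam (mT h) := by obtain ⟨S, h1, h2⟩ := hh; exact ⟨S, h2.T _ h1, h2⟩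
theorem R (hh : IsFam h) : IsFam (mR h) := by obtain ⟨S, h1, h2⟩ := hh; exact ⟨S, h2.R _ h1, h2⟩
theorem rad (hh : IsFam h) (a : smAlg (Ioi rp)) : IsFam (mrad a h) := by
  obtain ⟨S, h1, h2⟩ := hh; exact ⟨S, h2.rad _ h1 a, h2⟩

/-- `IsFam` is a greatest fixed point: it suffices to exhibit some stable set of rapidly decaying
families containing the sum. Here it is the set of all sums. -/
theorem add (hg : IsFam g) (hh : IsFam h) : IsFam (g + h) := by
  obtain ⟨S, h1, h2⟩ := hg
  obtain ⟨S', h1', h2'⟩ := hh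
  refine ⟨image2 (· + ·) S S', mem_image2_of_mem h1 h1', ?_, ?_, ?_, ?_⟩
  · rintro _ ⟨a, ha, b, hb, rfl⟩
    exact (h2.rd a ha).add (h2'.rd b hb)
  · rintro _ ⟨a, ha, b, hb, rfl⟩
    exact ⟨_, h2.T a ha, _, h2'.T b hb, funext fun m => funext fun ℓ => (map_add _ _ _).symm⟩
  · rintro _ ⟨a, ha, b, hb, rfl⟩
    exact ⟨_, h2.R a ha, _, h2'.R b hb, funext fun m => funext fun ℓ => (map_add _ _ _).symm⟩
  · rintro _ ⟨a, ha, b, hb, rfl⟩ c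
    exact ⟨_, h2.rad a ha c, _, h2'.rad b hb c, funext fun m => funext fun ℓ => (mul_add _ _ _).symm⟩

theorem wt (hh : IsFam h) {c : ℤ → ℕ → ℂ} (hc : PolyBdd c) : IsFam (wt c h) := by
  obtain ⟨S, h1, h2⟩ := hh
  refine ⟨Fm.wt c '' S, mem_image_of_mem _ h1, ?_, ?_, ?_, ?_⟩
  · rintro _ ⟨a, ha, rfl⟩
    exact (h2.rd a ha).wt hc
  · rintro _ ⟨a, ha, rfl⟩
    exact ⟨_, h2.T a ha, funext fun m => funext fun ℓ => (Derivation.map_smul _ _ _).symm⟩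
  · rintro _ ⟨a, ha, rfl⟩
    exact ⟨_, h2.R a ha, funext fun m => funext fun ℓ => (Derivation.map_smul _ _ _).symm⟩
  · rintro _ ⟨a, ha, rfl⟩ b
    exact ⟨_, h2.rad a ha b, funext fun m => funext fun ℓ => (mul_smul_comm _ _ _).symm⟩

theorem conj_rad2 (a : smAlg (Ioi rp)) :
    smConj ((C2 rp t0).rad a) = (C2 rp t0).rad (smConj a) := sm_ext fun x hx => by
  rw [smEv_conj, (C2 rp t0).smEv_rad _ hx, (C2 rp t0).smEv_rad _ hx, smEv_conj]

theorem conj_mul2 (a b : smAlg (U2 rp t0)) : smConj (a * b) = smConj a * smConj b :=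
  sm_ext fun x _ => by simp only [smEv_conj, smEv_mul, map_mul]

theorem refl (hh : IsFam h) : IsFam (refl h) := by
  obtain ⟨S, h1, h2⟩ := hh
  refine ⟨Fm.refl '' S, mem_image_of_mem _ h1, ?_, ?_, ?_, ?_⟩
  · rintro _ ⟨a, ha, rfl⟩
    exact (h2.rd a ha).refl
  · rintro _ ⟨a, ha, rfl⟩
    exact ⟨_, h2.T a ha, funext fun m => funext fun ℓ => (pd_conj _ _).symm⟩
  · rintro _ ⟨a, ha, rfl⟩
    exact ⟨_, h2.R a ha, funext fun m => funext fun ℓ => (pd_conj _ _).symm⟩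
  · rintro _ ⟨a, ha, rfl⟩ b
    refine ⟨_, h2.rad a ha (smConj b), funext fun m => funext fun ℓ => ?_⟩
    have e : smConj (smConj b) = b := sm_ext fun x _ => by simp only [smEv_conj, Complex.conj_conj]
    change smConj (_ * _) = _
    rw [conj_mul2, conj_rad2, e]
    rfl

theorem polyBdd_const (c : ℂ) : PolyBdd fun _ _ => c :=
  ⟨‖c‖, norm_nonneg _, 0, fun _ _ _ => by simp⟩

theorem smul (hh : IsFam h) (c : ℂ) : IsFam (c • h) := hh.wt (polyBdd_const c)

end IsFam

/-! ### The modes of a regular function -/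

section Modes

variable (hB : Background M k rp)

open Classical in
/-- The modes of a regular spin-weighted function. -/
def md (F : good rp t0 hB) : Fm rp t0 := fun m ℓ =>
  if hA : Adm m ℓ then smMk (modeInt m ℓ F.1)
    (contDiffOn_infty.2 fun n => contDiffOn_modeInt hB hA n F.1 F.2) else 0

variable (F : good rp t0 hB)

theorem smEv_md (hA : Adm m ℓ) {p : ℝ × ℝ} (hp : p ∈ U2 rp t0) :
    smEv (md hB F m ℓ) p = modeInt m ℓ F.1 p := by
  rw [md, dif_pos hA, smEv_smMk _ _ hp]

theorem md_not (hA : ¬ Adm m ℓ) : md hB F m ℓ = 0 := by rw [md, dif_neg hA]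

theorem fderivWithin_md (hA : Adm m ℓ) {p : ℝ × ℝ} (hp : p ∈ U2 rp t0) (u : ℝ × ℝ) :
    smEv (pd u (md hB F m ℓ)) p = u.1 • modeInt m ℓ ((C4 rp t0).T F.1) p +
      u.2 • modeInt m ℓ ((C4 rp t0).R F.1) p := by
  rw [smEv_pd _ _ hp, fderivWithin_congr (fun y hy => smEv_md hB F hA hy) (smEv_md hB F hA hp),
    (hasFDerivWithinAt_modeInt hA (good_locBdd hB F.2) (good_locBdd hB (good_T hB F.2))
      (good_locBdd hB (good_R hB F.2)) hp).fderivWithin ((niceSet_U2 rp t0).uniq p hp)]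
  rfl

theorem md_T : md hB ⟨(C4 rp t0).T F.1, good_T hB F.2⟩ = mT (md hB F) := by
  funext m ℓ
  by_cases hA : Adm m ℓ
  · refine sm_ext fun p hp => ?_
    rw [smEv_md hB _ hA hp]
    refine Eq.trans ?_ (fderivWithin_md hB F hA hp (1, 0)).symm
    simp
  · rw [md_not hB _ hA, mT, md_not hB _ hA, map_zero]

theorem md_R : md hB ⟨(C4 rp t0).R F.1, good_R hB F.2⟩ = mR (md hB F) := by
  funext m ℓ
  by_cases hA : Adm m ℓ
  · refine sm_ext fun p hp => ?_
    rw [smEv_md hB _ hA hp]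
    refine Eq.trans ?_ (fderivWithin_md hB F hA hp (0, 1)).symm
    simp
  · rw [md_not hB _ hA, mR, md_not hB _ hA, map_zero]

theorem md_rad (a : smAlg (Ioi rp)) :
    md hB ⟨(C4 rp t0).rad a * F.1, good_rad hB F.2 a⟩ = mrad a (md hB F) := by
  funext m ℓ
  by_cases hA : Adm m ℓ
  · refine sm_ext fun p hp => ?_
    rw [smEv_md hB _ hA hp, mrad, smEv_mul, (C2 rp t0).smEv_rad _ hp, smEv_md hB _ hA hp]
    unfold modeInt
    rw [← integral_const_mul]
    refine setIntegral_congr_fun measurableSet_Qm fun q hq => ?_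
    have hx : (p.1, p.2, q.1, q.2) ∈ Om rp t0 := ⟨hp.1, hp.2, hq.1, mem_univ _⟩
    simp only [slice, smEv_mul]
    rw [(C4 rp t0).smEv_rad _ hx, mul_assoc]
    rfl
  · rw [md_not hB _ hA, mrad, md_not hB _ hA, mul_zero]

theorem md_ang : md hB ⟨angA 2 F.1, good_ang hB F.2⟩ =
    wt (fun _ ℓ => (ℓ : ℂ) * (ℓ + 1)) (md hB F) := by
  funext m ℓ
  by_cases hA : Adm m ℓ
  · refine sm_ext fun p hp => ?_
    rw [smEv_md hB _ hA hp, wt, smEv_smul, smEv_md hB _ hA hp, modeInt_angA hB hA F.2 hp]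
  · rw [md_not hB _ hA, wt, md_not hB _ hA, smul_zero]

theorem md_bound {p : ℝ × ℝ} (hp : p ∈ U2 rp t0) : ∃ C, 0 ≤ C ∧ ∀ᶠ q in 𝓝[U2 rp t0] p, ∀ m ℓ, Adm m ℓ →
    ‖smEv (md hB F m ℓ) q‖ ≤ C := by
  obtain ⟨C, hC0, hC⟩ := exists_slice_bound (good_locBdd hB F.2) hp
  refine ⟨4 * Real.pi * C, by positivity, ?_⟩
  filter_upwards [hC, self_mem_nhdsWithin] with q h1 h2 m ℓ hA
  rw [smEv_md hB F hA h2]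
  exact norm_modeInt_le hA (good_locBdd hB F.2) h2 h1

/-- The modes of 𝓛F are those of F times ℓ(ℓ+1) ≥ ℓ + 2, and 𝓛F is again good. So each application
of 𝓛 gains one power of ℓ + 2 over the uniform bound `md_bound`. -/
theorem md_rd : ∀ F : good rp t0 hB, RD (md hB F) := by
  intro F n
  induction n generalizing F with
  | zero =>
    intro p hp
    simpa using md_bound hB F hp
  | succ n ih =>
    intro p hp
    obtain ⟨C, hC0, hC⟩ := ih ⟨angA 2 F.1, good_ang hB F.2⟩ p hp
    refine ⟨C, hC0, hC.mono fun q h1 m ℓ hA => ?_⟩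
    have h2 := h1 m ℓ hA
    rw [md_ang, wt, smEv_smul, norm_mul] at h2
    refine le_trans ?_ h2
    have h3 : (ℓ + 2 : ℝ) ≤ ‖(ℓ : ℂ) * (ℓ + 1)‖ := by
      have e : (ℓ : ℂ) * (ℓ + 1) = ((ℓ * (ℓ + 1) : ℕ) : ℂ) := by push_cast; ring
      rw [e, Complex.norm_natCast]
      have : 2 ≤ ℓ := hA.1
      have : ℓ + 2 ≤ ℓ * (ℓ + 1) := by nlinarith
      exact_mod_cast this
    rw [pow_succ, mul_assoc]
    exact mul_le_mul_of_nonneg_left (mul_le_mul_of_nonneg_right h3 (norm_nonneg _)) (by positivity)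

theorem md_isFam : IsFam (md hB F) := by
  refine ⟨range (md hB), mem_range_self _, ?_, ?_, ?_, ?_⟩
  · rintro _ ⟨F, rfl⟩; exact md_rd hB F
  · rintro _ ⟨F, rfl⟩; exact ⟨_, md_T hB F⟩
  · rintro _ ⟨F, rfl⟩; exact ⟨_, md_R hB F⟩
  · rintro _ ⟨F, rfl⟩ a; exact ⟨_, md_rad hB F a⟩

end Modes

end
end TeukolskySAdS

open scoped ContDiff
namespace TeukolskySAdS
open Set Filter Topology
noncomputable section

open MeasureTheory Chart Fm

variable {m : ℤ} {ℓ : ℕ} {M k rp t0 : ℝ}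

/-! ### Series of modes -/

/-- Termwise differentiation within a convex set. -/
theorem hasDerivWithinAt_tsum_of_bounded {J : Set ℝ} (hJ : Convex ℝ J) {x : ℝ} (hx : x ∈ J)
    {f f' : ℕ → ℝ → ℂ} {u : ℕ → ℝ} (hu : Summable u)
    (hd : ∀ n, ∀ y ∈ J, HasDerivWithinAt (f n) (f' n y) J y)
    (hb : ∀ᶠ y in 𝓝[J] x, ∀ n, ‖f' n y‖ ≤ u n)
    (hs : ∀ᶠ y in 𝓝[J] x, Summable fun n => f n y) :
    HasDerivWithinAt (fun y => ∑' n, f n y) (∑' n, f' n x) J x := by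
  obtain ⟨ε, hε, hεW⟩ := Metric.mem_nhdsWithin_iff.mp hb
  have hev : ∀ᶠ y in 𝓝[J] x, y ∈ Metric.ball x ε ∩ J :=
    inter_mem (mem_nhdsWithin_of_mem_nhds (Metric.ball_mem_nhds x hε)) self_mem_nhdsWithin
  have hconv : Convex ℝ (Metric.ball x ε ∩ J) := (convex_ball x ε).inter hJ
  have hxm : x ∈ Metric.ball x ε ∩ J := ⟨Metric.mem_ball_self hε, hx⟩
  have hlip : ∀ n, ∀ y ∈ Metric.ball x ε ∩ J, ‖f n y - f n x‖ ≤ u n * ‖y - x‖ := fun n y hy =>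
    hconv.norm_image_sub_le_of_norm_hasDerivWithin_le
      (fun z hz => (hd n z hz.2).mono inter_subset_right) (fun z hz => hεW hz n) hxm hy
  have hsx := hs.self_of_nhdsWithin hx
  rw [hasDerivWithinAt_iff_tendsto_slope]
  have hle : 𝓝[J \ {x}] x ≤ 𝓝[J] x := nhdsWithin_mono _ sdiff_subset
  have heq : ∀ᶠ y in 𝓝[J \ {x}] x, ∑' n, slope (f n) x y = slope (fun y => ∑' n, f n y) x y := by
    filter_upwards [hle hs] with y hy
    simp only [slope, vsub_eq_sub]
    rw [← hy.tsum_sub hsx, tsum_const_smul'']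
  refine Tendsto.congr' heq ?_
  refine tendsto_tsum_of_dominated_convergence (bound := u) hu (fun n => ?_) ?_
  · exact hasDerivWithinAt_iff_tendsto_slope.mp (hd n x hx)
  · filter_upwards [hle hev, self_mem_nhdsWithin] with y hy hne n
    have h1 := hlip n y hy
    have h2 : 0 < ‖y - x‖ := norm_pos_iff.mpr (sub_ne_zero.mpr hne.2)
    rw [slope, vsub_eq_sub, norm_smul, norm_inv, inv_mul_le_iff₀ h2, mul_comm]
    exact h1

/-- The `ℓ = n + 2` part of a mode series, with angular functions `W`. -/
def serT (W : ℤ → ℕ → ℝ) (h : Fm rp t0) (p : ℝ × ℝ) (φ : ℝ) (n : ℕ) : ℂ :=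
  ∑ m ∈ Finset.Icc (-((n + 2 : ℕ) : ℤ)) ((n + 2 : ℕ) : ℤ),
    smEv (h m (n + 2)) p * (W m (n + 2) : ℂ) * Complex.exp (Complex.I * (m : ℂ) * (φ : ℂ))

/-- The field with modes `h`. -/
def ser (h : Fm rp t0) : Field4 := fun t r θ φ =>
  ∑' n, serT (fun m ℓ => Sml m ℓ θ) h (t, r) φ n

theorem adm_of_mem {n : ℕ} {m : ℤ}
    (hm : m ∈ Finset.Icc (-((n + 2 : ℕ) : ℤ)) ((n + 2 : ℕ) : ℤ)) : Adm m (n + 2) := by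
  rw [Finset.mem_Icc] at hm
  exact ⟨by omega, hm.1, hm.2⟩

theorem serT_bound {h : Fm rp t0} (hh : RD h) {p : ℝ × ℝ} (hp : p ∈ U2 rp t0) :
    ∃ C, 0 ≤ C ∧ ∀ᶠ q in 𝓝[U2 rp t0] p, ∀ (W : ℤ → ℕ → ℝ) (D : ℝ), 0 ≤ D →
      (∀ m ℓ, Adm m ℓ → |W m ℓ| ≤ D * (ℓ + 2) ^ 4) → ∀ φ n,
        ‖serT W h q φ n‖ ≤ C * D * (1 / ((n : ℝ) + 1) ^ 2) := by
  -- Seven powers: four for the growth of W, one for the number of m's at a given ℓ, two for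
  -- summability over ℓ.
  obtain ⟨C, hC0, hC⟩ := hh 7 p hp
  refine ⟨2 * C, by positivity, hC.mono fun q h1 W D hD0 hW φ n => ?_⟩
  unfold serT
  have hN : (0 : ℝ) < ((n + 2 : ℕ) : ℝ) + 2 := by positivity
  set N : ℝ := ((n + 2 : ℕ) : ℝ) + 2 with hNd
  have hterm : ∀ m ∈ Finset.Icc (-((n + 2 : ℕ) : ℤ)) ((n + 2 : ℕ) : ℤ),
      ‖smEv (h m (n + 2)) q * (W m (n + 2) : ℂ) * Complex.exp (Complex.I * (m : ℂ) * (φ : ℂ))‖ ≤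
        C * D / N ^ 3 := by
    intro m hm
    have hA := adm_of_mem hm
    rw [norm_mul, norm_mul, norm_exp_I', mul_one, Complex.norm_real, le_div_iff₀ (by positivity)]
    have h2 := h1 m _ hA
    have h3 := hW m _ hA
    rw [← hNd] at h2 h3
    calc _ ≤ ‖smEv (h m (n + 2)) q‖ * (D * N ^ 4) * N ^ 3 :=
          mul_le_mul_of_nonneg_right (mul_le_mul_of_nonneg_left h3 (norm_nonneg _)) (by positivity)
      _ = (N ^ 7 * ‖smEv (h m (n + 2)) q‖) * D := by ring
      _ ≤ C * D := mul_le_mul_of_nonneg_right h2 hD0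
  refine (norm_sum_le_of_le _ hterm).trans ?_
  rw [Finset.sum_const, nsmul_eq_mul, Int.card_Icc]
  have hcard : (((((n + 2 : ℕ) : ℤ) + 1 - -((n + 2 : ℕ) : ℤ)).toNat : ℕ) : ℝ) ≤ 2 * N := by
    have : ((((n + 2 : ℕ) : ℤ) + 1 - -((n + 2 : ℕ) : ℤ)).toNat : ℕ) = 2 * n + 5 := by omega
    rw [this, hNd]; push_cast; linarith
  have hn1 : (0 : ℝ) < (n : ℝ) + 1 := by positivity
  have hle : (n : ℝ) + 1 ≤ N := by rw [hNd]; push_cast; linarith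
  calc _ ≤ 2 * N * (C * D / N ^ 3) := mul_le_mul_of_nonneg_right hcard (by positivity)
    _ = 2 * C * D * (1 / N ^ 2) := by field_simp
    _ ≤ _ := by
      refine mul_le_mul_of_nonneg_left ?_ (by positivity)
      exact one_div_le_one_div_of_le (by positivity) (pow_le_pow_left₀ hn1.le hle 2)

theorem summable_inv_sq : Summable fun n : ℕ => 1 / ((n : ℝ) + 1) ^ 2 := by
  have := (summable_nat_add_iff 1).mpr (Real.summable_one_div_nat_pow.mpr (by norm_num : 1 < 2))
  simpa using this

theorem serT_summable {h : Fm rp t0} (hh : RD h) {p : ℝ × ℝ} (hp : p ∈ U2 rp t0)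
    {W : ℤ → ℕ → ℝ} {D : ℝ} (hD : 0 ≤ D) (hW : ∀ m ℓ, Adm m ℓ → |W m ℓ| ≤ D * (ℓ + 2) ^ 4)
    (φ : ℝ) : Summable (serT W h p φ) := by
  obtain ⟨C, hC0, hC⟩ := serT_bound hh hp
  exact Summable.of_norm_bounded (summable_inv_sq.mul_left (C * D))
    fun n => hC.self_of_nhdsWithin hp W D hD hW φ n

theorem exists_bound_at {θ : ℝ} (hθ : θ ∈ Ioo 0 Real.pi) : ∃ D, 0 ≤ D ∧ ∀ m ℓ, Adm m ℓ →
    |Sml m ℓ θ| ≤ D * (ℓ + 2) ^ 4 := by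
  obtain ⟨C, h0, hC⟩ := Sml_local_bound (a := θ / 2) (b := (θ + Real.pi) / 2)
    (by linarith [hθ.1]) (by linarith [hθ.1, hθ.2]) (by linarith [hθ.2])
  exact ⟨C, h0, fun m ℓ hA => (hC m ℓ hA θ ⟨by linarith [hθ.1], by linarith [hθ.2]⟩).1⟩

theorem ser_summable {h : Fm rp t0} (hh : RD h) {t r θ : ℝ} (hr : Region rp t0 t r θ) (φ : ℝ) :
    Summable (serT (fun m ℓ => Sml m ℓ θ) h (t, r) φ) := by
  obtain ⟨D, hD0, hD⟩ := exists_bound_at hr.mem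
  exact serT_summable hh (mem_U2.2 ⟨hr.1, hr.2.1⟩) hD0 hD φ

variable {h g : Fm rp t0} {t r θ φ : ℝ}

theorem hasDerivWithinAt_serT_t (W : ℤ → ℕ → ℝ) (h : Fm rp t0) (hp : (t, r) ∈ U2 rp t0) (n : ℕ) :
    HasDerivWithinAt (fun τ => serT W h (τ, r) φ n) (serT W (mT h) (t, r) φ n) (Ici t0) t := by
  unfold serT
  refine HasDerivWithinAt.fun_sum fun m _ => HasDerivWithinAt.mul_const
    (HasDerivWithinAt.mul_const ?_ _) _
  exact smEv_comp_hasDerivWithinAt (h m (n + 2)) (γ := fun τ => (τ, r)) (v := (1, 0))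
    ((hasDerivWithinAt_id _ _).prodMk (hasDerivWithinAt_const _ _ _)) (fun τ hτ => ⟨hτ, hp.2⟩) hp

theorem hasDerivWithinAt_serT_r (W : ℤ → ℕ → ℝ) (h : Fm rp t0) (hp : (t, r) ∈ U2 rp t0) (n : ℕ) :
    HasDerivWithinAt (fun ρ => serT W h (t, ρ) φ n) (serT W (mR h) (t, r) φ n) (Ioi rp) r := by
  unfold serT
  refine HasDerivWithinAt.fun_sum fun m _ => HasDerivWithinAt.mul_const
    (HasDerivWithinAt.mul_const ?_ _) _
  exact smEv_comp_hasDerivWithinAt (h m (n + 2)) (γ := fun τ => (t, τ)) (v := (0, 1))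
    ((hasDerivWithinAt_const _ _ _).prodMk (hasDerivWithinAt_id _ _)) (fun τ hτ => ⟨hp.1, hτ⟩) hp

theorem hasDerivWithinAt_ser_t (hh : IsFam h) (hr : Region rp t0 t r θ) :
    HasDerivWithinAt (fun τ => ser h τ r θ φ) (ser (mT h) t r θ φ) (Ici t0) t := by
  have hp : (t, r) ∈ U2 rp t0 := mem_U2.2 ⟨hr.1, hr.2.1⟩
  obtain ⟨D, hD0, hD⟩ := exists_bound_at hr.mem
  obtain ⟨C, hC0, hC⟩ := serT_bound hh.T.rd hp
  refine hasDerivWithinAt_tsum_of_bounded (convex_Ici t0) hr.1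
    (f := fun n τ => serT (fun m ℓ => Sml m ℓ θ) h (τ, r) φ n)
    (f' := fun n τ => serT (fun m ℓ => Sml m ℓ θ) (mT h) (τ, r) φ n)
    (summable_inv_sq.mul_left (C * D))
    (fun n y hy => hasDerivWithinAt_serT_t _ h (mem_U2.2 ⟨hy, hr.2.1⟩) n) ?_ ?_
  · have hl : Tendsto (fun τ => (τ, r)) (𝓝[Ici t0] t) (𝓝[U2 rp t0] (t, r)) := by
      refine tendsto_nhdsWithin_iff.mpr ⟨?_, ?_⟩
      · exact ((by fun_prop : Continuous fun τ : ℝ => (τ, r)).tendsto t).mono_left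
          nhdsWithin_le_nhds
      · filter_upwards [self_mem_nhdsWithin] with τ hτ using ⟨hτ, hp.2⟩
    exact (hl.eventually hC).mono fun τ h1 n => h1 _ D hD0 hD φ n
  · filter_upwards [self_mem_nhdsWithin] with τ hτ using ser_summable hh.rd ⟨hτ, hr.2⟩ φ

theorem hasDerivAt_ser_r (hh : IsFam h) (hr : Region rp t0 t r θ) :
    HasDerivAt (fun ρ => ser h t ρ θ φ) (ser (mR h) t r θ φ) r := by
  have hp : (t, r) ∈ U2 rp t0 := mem_U2.2 ⟨hr.1, hr.2.1⟩
  obtain ⟨D, hD0, hD⟩ := exists_bound_at hr.mem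
  obtain ⟨C, hC0, hC⟩ := serT_bound hh.R.rd hp
  refine (hasDerivWithinAt_tsum_of_bounded (convex_Ioi rp) hr.2.1
    (f := fun n τ => serT (fun m ℓ => Sml m ℓ θ) h (t, τ) φ n)
    (f' := fun n τ => serT (fun m ℓ => Sml m ℓ θ) (mR h) (t, τ) φ n)
    (summable_inv_sq.mul_left (C * D))
    (fun n y hy => hasDerivWithinAt_serT_r _ h (mem_U2.2 ⟨hr.1, hy⟩) n) ?_ ?_).hasDerivAt
      (Ioi_mem_nhds hr.2.1)
  · have hl : Tendsto (fun τ => (t, τ)) (𝓝[Ioi rp] r) (𝓝[U2 rp t0] (t, r)) := by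
      refine tendsto_nhdsWithin_iff.mpr ⟨?_, ?_⟩
      · exact ((by fun_prop : Continuous fun τ : ℝ => (t, τ)).tendsto r).mono_left
          nhdsWithin_le_nhds
      · filter_upwards [self_mem_nhdsWithin] with τ hτ using ⟨hp.1, hτ⟩
    exact (hl.eventually hC).mono fun τ h1 n => h1 _ D hD0 hD φ n
  · filter_upwards [self_mem_nhdsWithin] with τ hτ using ser_summable hh.rd ⟨hr.1, hτ, hr.2.2⟩ φ

theorem polyBdd_m : PolyBdd fun m _ => Complex.I * (m : ℂ) := by
  refine ⟨1, zero_le_one, 1, fun m ℓ hA => ?_⟩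
  obtain ⟨h1, h2, h3⟩ := hA
  rw [norm_mul, Complex.norm_I, one_mul, one_mul, pow_one, Complex.norm_intCast]
  have h2' : -(ℓ : ℝ) ≤ m := by exact_mod_cast h2
  have h3' : (m : ℝ) ≤ ℓ := by exact_mod_cast h3
  exact abs_le.mpr ⟨by linarith, by linarith⟩

theorem hasDerivAt_exp_ph' (m : ℤ) (φ : ℝ) :
    HasDerivAt (fun φ : ℝ => Complex.exp (Complex.I * (m : ℂ) * (φ : ℂ)))
      (Complex.I * m * Complex.exp (Complex.I * (m : ℂ) * (φ : ℂ))) φ := by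
  have := hasDerivAt_exp_ph (-m) φ
  simpa using this

theorem hasDerivAt_ser_ph (hh : IsFam h) (hr : Region rp t0 t r θ) :
    HasDerivAt (fun y => ser h t r θ y) (ser (wt (fun m _ => Complex.I * m) h) t r θ φ) φ := by
  have hp : (t, r) ∈ U2 rp t0 := mem_U2.2 ⟨hr.1, hr.2.1⟩
  obtain ⟨D, hD0, hD⟩ := exists_bound_at hr.mem
  obtain ⟨C, hC0, hC⟩ := serT_bound (hh.wt polyBdd_m).rd hp
  refine (hasDerivWithinAt_tsum_of_bounded convex_univ (mem_univ _)
    (f := fun n y => serT (fun m ℓ => Sml m ℓ θ) h (t, r) y n)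
    (f' := fun n y => serT (fun m ℓ => Sml m ℓ θ) (wt (fun m _ => Complex.I * m) h) (t, r) y n)
    (summable_inv_sq.mul_left (C * D)) (fun n y _ => ?_) ?_ ?_).hasDerivAt univ_mem
  · refine HasDerivAt.hasDerivWithinAt ?_
    unfold serT
    refine HasDerivAt.fun_sum fun m _ => ((hasDerivAt_exp_ph' m y).const_mul _).congr_deriv ?_
    rw [wt, smEv_smul]
    ring
  · exact Eventually.of_forall fun y n => hC.self_of_nhdsWithin hp _ D hD0 hD y n
  · exact Eventually.of_forall fun y => ser_summable hh.rd hr y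

/-- The angular factor W is left general because 𝓛 needs this twice: for S and for sin θ ∂_θS. -/
theorem hasDerivAt_serW_th (hh : RD h) (hp : (t, r) ∈ U2 rp t0) {W W' : ℤ → ℕ → ℝ → ℝ}
    (hW : ∀ m ℓ, Adm m ℓ → ∀ θ ∈ Ioo 0 Real.pi, HasDerivAt (W m ℓ) (W' m ℓ θ) θ)
    (hb : ∀ a b, 0 < a → a < b → b < Real.pi → ∃ D, 0 ≤ D ∧ ∀ m ℓ, Adm m ℓ → ∀ θ ∈ Icc a b,
      |W m ℓ θ| ≤ D * (ℓ + 2) ^ 4 ∧ |W' m ℓ θ| ≤ D * (ℓ + 2) ^ 4) (hθ : θ ∈ Ioo 0 Real.pi) :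
    HasDerivAt (fun y => ∑' n, serT (fun m ℓ => W m ℓ y) h (t, r) φ n)
      (∑' n, serT (fun m ℓ => W' m ℓ θ) h (t, r) φ n) θ := by
  obtain ⟨C, hC0, hC⟩ := serT_bound hh hp
  have ha : 0 < θ / 2 := by linarith [hθ.1]
  have hbp : (θ + Real.pi) / 2 < Real.pi := by linarith [hθ.2]
  have hta : θ / 2 < θ := by linarith [hθ.1]
  have htb : θ < (θ + Real.pi) / 2 := by linarith [hθ.2]
  obtain ⟨D, hD0, hD⟩ := hb (θ / 2) ((θ + Real.pi) / 2) ha (hta.trans htb) hbp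
  have hsub := Icc_subset_Ioo' ha hbp
  refine (hasDerivWithinAt_tsum_of_bounded (convex_Icc (θ / 2) ((θ + Real.pi) / 2))
    ⟨hta.le, htb.le⟩ (f := fun n y => serT (fun m ℓ => W m ℓ y) h (t, r) φ n)
    (f' := fun n y => serT (fun m ℓ => W' m ℓ y) h (t, r) φ n)
    (summable_inv_sq.mul_left (C * D)) (fun n y hy => ?_) ?_ ?_).hasDerivAt
      (Icc_mem_nhds hta htb)
  · refine HasDerivAt.hasDerivWithinAt ?_
    unfold serT
    exact HasDerivAt.fun_sum fun m hm =>
      (((hW m _ (adm_of_mem hm) y (hsub hy)).ofReal_comp).const_mul _).mul_const _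
  · filter_upwards [self_mem_nhdsWithin] with y hy n
    exact hC.self_of_nhdsWithin hp _ D hD0 (fun m ℓ hA => (hD m ℓ hA y hy).2) φ n
  · filter_upwards [self_mem_nhdsWithin] with y hy
    exact serT_summable hh hp hD0 (fun m ℓ hA => (hD m ℓ hA y hy).1) φ

theorem ser_add (hg : RD g) (hh : RD h) (hr : Region rp t0 t r θ) :
    ser (g + h) t r θ φ = ser g t r θ φ + ser h t r θ φ := by
  unfold ser
  rw [← (ser_summable hg hr φ).tsum_add (ser_summable hh hr φ)]
  refine tsum_congr fun n => ?_
  unfold serT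
  rw [← Finset.sum_add_distrib]
  refine Finset.sum_congr rfl fun m _ => ?_
  have e : smEv ((g + h) m (n + 2)) (t, r) = _ := smEv_add _ _ _
  rw [e]
  ring

theorem ser_smul (c : ℂ) (h : Fm rp t0) : ser (c • h) t r θ φ = c * ser h t r θ φ := by
  unfold ser
  rw [← tsum_mul_left]
  refine tsum_congr fun n => ?_
  unfold serT
  rw [Finset.mul_sum]
  refine Finset.sum_congr rfl fun m _ => ?_
  have e : smEv ((c • h) m (n + 2)) (t, r) = _ := smEv_smul _ _ _
  rw [e]
  ring

theorem ser_mrad (a : smAlg (Ioi rp)) (h : Fm rp t0) (hp : (t, r) ∈ U2 rp t0) :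
    ser (mrad a h) t r θ φ = smEv a r * ser h t r θ φ := by
  unfold ser
  rw [← tsum_mul_left]
  refine tsum_congr fun n => ?_
  unfold serT
  rw [Finset.mul_sum]
  refine Finset.sum_congr rfl fun m _ => ?_
  rw [mrad, smEv_mul, (C2 rp t0).smEv_rad _ hp]
  change smEv a r * _ * _ * _ = _
  ring

theorem Sml_deriv_local_bound {a b : ℝ} (ha : 0 < a) (hab : a < b) (hb : b < Real.pi) :
    ∃ D, 0 ≤ D ∧ ∀ m ℓ, Adm m ℓ → ∀ θ ∈ Icc a b, |Sml m ℓ θ| ≤ D * (ℓ + 2) ^ 4 ∧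
      |ySml m ℓ θ / Real.sin θ| ≤ D * (ℓ + 2) ^ 4 := by
  obtain ⟨C, h0, hC⟩ := Sml_local_bound ha hab hb
  obtain ⟨x0, hx0, hmin⟩ := (isCompact_Icc (a := a) (b := b)).exists_isMinOn
    ⟨a, le_rfl, hab.le⟩ Real.continuous_sin.continuousOn
  have hx := Icc_subset_Ioo' ha hb hx0
  have hs' : 0 < Real.sin x0 := sin_pos' hx
  refine ⟨C / Real.sin x0, by positivity, fun m ℓ hA θ hθ => ?_⟩
  obtain ⟨h1, h2, -⟩ := hC m ℓ hA θ hθ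
  have h3 : Real.sin x0 ≤ Real.sin θ := hmin hθ
  have h4 : C * (ℓ + 2 : ℝ) ^ 4 ≤ C / Real.sin x0 * (ℓ + 2) ^ 4 := by
    refine mul_le_mul_of_nonneg_right ?_ (by positivity)
    rw [le_div_iff₀ hs']
    exact mul_le_of_le_one_right h0 (Real.sin_le_one _)
  refine ⟨h1.trans h4, ?_⟩
  rw [abs_div, abs_of_pos (hs'.trans_le h3), div_mul_eq_mul_div]
  exact div_le_div₀ (by positivity) h2 hs' h3

theorem polyBdd_lam : PolyBdd fun _ ℓ => (ℓ : ℂ) * (ℓ + 1) := by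
  refine ⟨1, zero_le_one, 2, fun m ℓ _ => ?_⟩
  have e : (ℓ : ℂ) * (ℓ + 1) = ((ℓ * (ℓ + 1) : ℕ) : ℂ) := by push_cast; ring
  change ‖(ℓ : ℂ) * (ℓ + 1)‖ ≤ _
  rw [e, Complex.norm_natCast]
  push_cast
  nlinarith [(Nat.cast_nonneg ℓ : (0 : ℝ) ≤ ℓ)]

/-- Differentiating termwise through sin θ ∂_θS matches the self-adjoint form of 𝓛. The potential
terms then cancel against those of ∂_φ² and ∂_φ, mode by mode. -/
theorem angL_ser (hh : IsFam h) (hr : Region rp t0 t r θ) :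
    angL 2 (ser h) t r θ φ = ser (wt (fun _ ℓ => (ℓ : ℂ) * (ℓ + 1)) h) t r θ φ := by
  have hp : (t, r) ∈ U2 rp t0 := mem_U2.2 ⟨hr.1, hr.2.1⟩
  have hs0 : Real.sin θ ≠ 0 := (sin_pos' hr.mem).ne'
  have hs : (Complex.sin θ : ℂ) ≠ 0 := by exact_mod_cast hs0
  have d1 : ∀ y ∈ Ioo 0 Real.pi, (Real.sin y : ℂ) * dTh (ser h) t r y φ =
      ∑' n, serT (fun m ℓ => ySml m ℓ y) h (t, r) φ n := by
    intro y hy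
    have hsy : (Real.sin y : ℂ) ≠ 0 := by exact_mod_cast (sin_pos' hy).ne'
    have := hasDerivAt_serW_th (φ := φ) hh.rd hp (W := Sml) (W' := fun m ℓ θ => ySml m ℓ θ / Real.sin θ)
      (fun m ℓ _ θ hθ => hasDerivAt_Sml hθ) (fun a b ha hab hb => Sml_deriv_local_bound ha hab hb) hy
    have e : dTh (ser h) t r y φ = _ := this.deriv
    rw [e, ← tsum_mul_left]
    refine tsum_congr fun n => ?_
    unfold serT
    rw [Finset.mul_sum]
    refine Finset.sum_congr rfl fun m _ => ?_
    push_cast at hsy ⊢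
    field_simp
  have d2 : deriv (fun x => (Real.sin x : ℂ) * dTh (ser h) t r x φ) θ =
      ∑' n, serT (fun m ℓ => (Vang m θ - ℓ * (ℓ + 1)) * Real.sin θ * Sml m ℓ θ) h (t, r) φ n := by
    refine Eq.trans (Filter.EventuallyEq.deriv_eq ?_) (hasDerivAt_serW_th (φ := φ) hh.rd hp
      (W := ySml) (W' := fun m ℓ θ => (Vang m θ - ℓ * (ℓ + 1)) * Real.sin θ * Sml m ℓ θ)
      (fun m ℓ hA θ hθ => hasDerivAt_ySml hA hθ) (fun a b ha hab hb => by
        obtain ⟨C, h0, hC⟩ := Sml_local_bound ha hab hb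
        exact ⟨C, h0, fun m ℓ hA θ hθ => (hC m ℓ hA θ hθ).2⟩) hr.mem).deriv
    filter_upwards [Ioo_mem_nhds hr.mem.1 hr.mem.2] with y hy using d1 y hy
  have d3 : ∀ φ, dPh (ser h) t r θ φ = ser (wt (fun m _ => Complex.I * m) h) t r θ φ :=
    fun φ => (hasDerivAt_ser_ph hh hr).deriv
  have d4 : dPh (dPh (ser h)) t r θ φ =
      ser (wt (fun m _ => Complex.I * m) (wt (fun m _ => Complex.I * m) h)) t r θ φ := by
    refine Eq.trans ?_ (hasDerivAt_ser_ph (hh.wt polyBdd_m) hr).deriv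
    exact Filter.EventuallyEq.deriv_eq (Eventually.of_forall d3)
  have hsum : ∀ {g : Fm rp t0}, IsFam g → Summable (serT (fun m ℓ => Sml m ℓ θ) g (t, r) φ) :=
    fun hg => ser_summable hg.rd hr φ
  have hlam := hh.wt polyBdd_lam
  have hm1 := hh.wt polyBdd_m
  have hm2 := hm1.wt polyBdd_m
  unfold angL
  rw [d2, d3, d4]
  have e2 : ∑' n, serT (fun m ℓ => (Vang m θ - ℓ * (ℓ + 1)) * Real.sin θ * Sml m ℓ θ) h (t, r) φ n =
      ∑' n, (Real.sin θ * (-(((Real.sin θ)⁻¹ : ℝ) : ℂ) ^ 2 *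
        serT (fun m ℓ => Sml m ℓ θ) (wt (fun m _ => Complex.I * m) (wt (fun m _ => Complex.I * m) h))
          (t, r) φ n + -(4 * Complex.I * (Real.cos θ / Real.sin θ ^ 2 : ℝ)) *
        serT (fun m ℓ => Sml m ℓ θ) (wt (fun m _ => Complex.I * m) h) (t, r) φ n +
        (4 * ((Real.cos θ / Real.sin θ : ℝ) : ℂ) ^ 2 + 4) *
        serT (fun m ℓ => Sml m ℓ θ) h (t, r) φ n -
        serT (fun m ℓ => Sml m ℓ θ) (wt (fun _ ℓ => (ℓ : ℂ) * (ℓ + 1)) h) (t, r) φ n) : ℂ) := by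
    refine tsum_congr fun n => ?_
    unfold serT
    simp only [Finset.mul_sum]
    rw [← Finset.sum_add_distrib, ← Finset.sum_add_distrib, ← Finset.sum_sub_distrib,
      Finset.mul_sum]
    refine Finset.sum_congr rfl fun m _ => ?_
    simp only [wt, smEv_smul, Vang]
    push_cast
    field_simp
    linear_combination (smEv (h m (n + 2)) (t, r) * Sml m (n + 2) θ) * (m ^ 2 + 4 * m * Complex.cos θ : ℂ) * Complex.I_sq
  rw [e2, tsum_mul_left, Summable.tsum_sub ((((hsum hm2).mul_left _).add ((hsum hm1).mul_left _)).add
    ((hsum hh).mul_left _)) (hsum hlam), Summable.tsum_add (((hsum hm2).mul_left _).add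
    ((hsum hm1).mul_left _)) ((hsum hh).mul_left _), Summable.tsum_add ((hsum hm2).mul_left _)
    ((hsum hm1).mul_left _), tsum_mul_left, tsum_mul_left, tsum_mul_left]
  change _ = ∑' n, _
  simp only [ser]
  push_cast
  field_simp
  ring

end
end TeukolskySAdS

open scoped ContDiff
namespace TeukolskySAdS
open Set Filter Topology
noncomputable section

open MeasureTheory Chart Fm

variable {m : ℤ} {ℓ : ℕ} {M k rp t0 : ℝ}

/-! ### Modes of a series, and the expansion of regular functions -/

theorem integrable_tsum_of_summable {α : Type*} [MeasurableSpace α] {μ : Measure α}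
    {f : ℕ → α → ℂ} (hi : ∀ n, Integrable (f n) μ) (hs : Summable fun n => ∫ x, ‖f n x‖ ∂μ)
    (hm : AEStronglyMeasurable (fun x => ∑' n, f n x) μ) :
    Integrable (fun x => ∑' n, f n x) μ := by
  refine ⟨hm, ?_⟩
  refine lt_of_le_of_lt (lintegral_mono fun x => enorm_tsum_le_tsum_enorm) ?_
  rw [lintegral_tsum fun n => (hi n).aestronglyMeasurable.enorm]
  simp only [← fun n => ofReal_integral_norm_eq_lintegral_enorm (hi n)]
  rw [← ENNReal.ofReal_tsum_of_nonneg (fun n => integral_nonneg fun _ => norm_nonneg _) hs]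
  exact ENNReal.ofReal_lt_top

theorem integral_norm_Sml_le (hA : Adm m ℓ) {W : ℝ → ℝ} {K : ℝ} (hW : ContinuousOn W (Ioo 0 Real.pi))
    (hK : ∀ θ ∈ Ioo 0 Real.pi, |W θ| ≤ K) :
    IntegrableOn (fun θ => (Sml m ℓ θ : ℂ) * (W θ : ℂ) * (Real.sin θ : ℂ)) (Ioo 0 Real.pi) ∧
    ∫ θ in Ioo 0 Real.pi, ‖(Sml m ℓ θ : ℂ) * (W θ : ℂ) * (Real.sin θ : ℂ)‖ ≤ 1 + K ^ 2 := by
  obtain ⟨C, hC0, hC⟩ := Sml_bounded hA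
  have hpi := Real.pi_pos
  have hK0 : 0 ≤ K := (abs_nonneg _).trans (hK (Real.pi / 2) ⟨by linarith, by linarith⟩)
  have hc : ContinuousOn (fun θ => (Sml m ℓ θ : ℂ) * (W θ : ℂ) * (Real.sin θ : ℂ))
      (Ioo 0 Real.pi) :=
    ((Complex.continuous_ofReal.comp_continuousOn Sml_continuousOn).mul
      (Complex.continuous_ofReal.comp_continuousOn hW)).mul (by fun_prop)
  have hi : IntegrableOn (fun θ => (Sml m ℓ θ : ℂ) * (W θ : ℂ) * (Real.sin θ : ℂ))
      (Ioo 0 Real.pi) := by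
    rw [← intervalIntegrable_iff_integrableOn_Ioo_of_le hpi.le]
    refine intervalIntegrable_of_bounded (C := C * K * 1) hpi.le hc fun θ hθ => ?_
    rw [norm_mul, norm_mul, Complex.norm_real, Complex.norm_real, Complex.norm_real]
    exact mul_le_mul (mul_le_mul (hC θ hθ).1 (hK θ hθ) (abs_nonneg _) hC0)
      (Real.abs_sin_le_one θ) (abs_nonneg _) (by positivity)
  refine ⟨hi, ?_⟩
  have hj : IntegrableOn (fun θ => Sml m ℓ θ * Sml m ℓ θ * Real.sin θ) (Ioo 0 Real.pi) := by
    rw [← intervalIntegrable_iff_integrableOn_Ioo_of_le hpi.le]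
    refine intervalIntegrable_of_bounded (C := C * C * 1) hpi.le
      ((Sml_continuousOn.mul Sml_continuousOn).mul (by fun_prop)) fun θ hθ => ?_
    rw [norm_mul, norm_mul]
    exact mul_le_mul (mul_le_mul (hC θ hθ).1 (hC θ hθ).1 (abs_nonneg _) hC0)
      (Real.abs_sin_le_one θ) (abs_nonneg _) (by positivity)
  have hs : IntegrableOn Real.sin (Ioo 0 Real.pi) := by
    rw [← intervalIntegrable_iff_integrableOn_Ioo_of_le hpi.le]
    exact Real.continuous_sin.intervalIntegrable _ _
  have h1 : ∫ θ in Ioo 0 Real.pi, ‖(Sml m ℓ θ : ℂ) * (W θ : ℂ) * (Real.sin θ : ℂ)‖ ≤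
      ∫ θ in Ioo 0 Real.pi, ((1 / 2) * (Sml m ℓ θ * Sml m ℓ θ * Real.sin θ) +
        (K ^ 2 / 2) * Real.sin θ) := by
    refine setIntegral_mono_on hi.norm ((hj.const_mul _).add (hs.const_mul _)) measurableSet_Ioo
      fun θ hθ => ?_
    have hsin := sin_pos' hθ
    rw [norm_mul, norm_mul, Complex.norm_real, Complex.norm_real, Complex.norm_real,
      Real.norm_eq_abs, Real.norm_eq_abs, Real.norm_eq_abs, abs_of_pos hsin]
    have h2 : |Sml m ℓ θ| * |W θ| ≤ 1 / 2 * (Sml m ℓ θ * Sml m ℓ θ) + K ^ 2 / 2 := by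
      have h3 := mul_le_mul_of_nonneg_left (hK θ hθ) (abs_nonneg (Sml m ℓ θ))
      nlinarith [abs_mul_abs_self (Sml m ℓ θ), sq_nonneg (|Sml m ℓ θ| - K)]
    calc _ ≤ (1 / 2 * (Sml m ℓ θ * Sml m ℓ θ) + K ^ 2 / 2) * Real.sin θ :=
          mul_le_mul_of_nonneg_right h2 hsin.le
      _ = _ := by ring
  refine h1.trans ?_
  rw [integral_add (hj.const_mul _) (hs.const_mul _), integral_const_mul, integral_const_mul,
    ← integral_Ioc_eq_integral_Ioo, ← integral_Ioc_eq_integral_Ioo,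
    ← intervalIntegral.integral_of_le hpi.le, ← intervalIntegral.integral_of_le hpi.le,
    integral_Sml_sq hA, integral_sin, Real.cos_zero, Real.cos_pi]
  have : 1 / (2 * Real.pi) ≤ 1 := by
    rw [div_le_one (by positivity)]
    linarith [Real.pi_gt_three]
  linarith

/-- The projection to one azimuthal number. -/
def azi (m : ℤ) (h : Fm rp t0) : Fm rp t0 := wt (fun m' _ => if m' = m then 1 else 0) h

theorem RD.azi {h : Fm rp t0} (hh : RD h) (m : ℤ) : RD (azi m h) :=
  hh.wt ⟨1, zero_le_one, 0, fun m' ℓ _ => by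
    change ‖if m' = m then (1 : ℂ) else 0‖ ≤ _
    split_ifs <;> simp⟩

variable {h g : Fm rp t0} {t r θ φ : ℝ}

theorem serT_azi (W : ℤ → ℕ → ℝ) (h : Fm rp t0) (p : ℝ × ℝ) (n : ℕ) :
    serT W (azi m h) p 0 n = if m ∈ Finset.Icc (-((n + 2 : ℕ) : ℤ)) ((n + 2 : ℕ) : ℤ) then
      smEv (h m (n + 2)) p * W m (n + 2) else 0 := by
  unfold serT
  rw [← Finset.sum_ite_eq' _ m fun m' => smEv (h m' (n + 2)) p * (W m' (n + 2) : ℂ)]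
  refine Finset.sum_congr rfl fun m' _ => ?_
  simp only [azi, wt, smEv_smul]
  split_ifs <;> simp

theorem integral_exp_mul_exp (m m' : ℤ) :
    ∫ φ in (0 : ℝ)..(2 * Real.pi), Complex.exp (Complex.I * (m' : ℂ) * (φ : ℂ)) *
      Complex.exp (-Complex.I * (m : ℂ) * (φ : ℂ)) = if m' = m then 2 * (Real.pi : ℂ) else 0 := by
  simp only [← Complex.exp_add]
  split_ifs with h
  · subst h
    simp
  · have e : ∀ φ : ℝ, Complex.exp (Complex.I * (m' : ℂ) * (φ : ℂ) + -Complex.I * (m : ℂ) * (φ : ℂ)) =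
        Complex.exp ((((m' - m : ℤ) : ℂ) * Complex.I) * φ) := fun φ => by
      congr 1
      push_cast
      ring
    simp only [e]
    have hc : ((m' - m : ℤ) : ℂ) * Complex.I ≠ 0 :=
      mul_ne_zero (Int.cast_ne_zero.2 (sub_ne_zero.2 h)) Complex.I_ne_zero
    rw [integral_exp_mul_complex hc]
    have e2 : ((m' - m : ℤ) : ℂ) * Complex.I * ((2 * Real.pi : ℝ) : ℂ) =
        ((m' - m : ℤ) : ℂ) * (2 * Real.pi * Complex.I) := by push_cast; ring
    rw [e2, Complex.exp_int_mul_two_pi_mul_I]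
    simp

theorem integral_serT (W : ℤ → ℕ → ℝ) (h : Fm rp t0) (p : ℝ × ℝ) (n : ℕ) :
    ∫ φ in (0 : ℝ)..(2 * Real.pi), serT W h p φ n * Complex.exp (-Complex.I * (m : ℂ) * (φ : ℂ)) =
      2 * Real.pi * serT W (azi m h) p 0 n := by
  rw [serT_azi]
  unfold serT
  simp only [Finset.sum_mul, mul_assoc]
  rw [intervalIntegral.integral_finsetSum fun m' _ =>
    Continuous.intervalIntegrable (by fun_prop) _ _]
  have := integral_exp_mul_exp m
  simp only [mul_assoc] at this
  simp only [intervalIntegral.integral_const_mul, this]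
  simp only [mul_ite, mul_zero]
  rw [Finset.sum_ite_eq']
  refine if_congr Iff.rfl ?_ rfl
  ring

theorem integral_ser (hh : RD h) (hr : Region rp t0 t r θ) :
    ∫ φ in (0 : ℝ)..(2 * Real.pi), ser h t r θ φ * Complex.exp (-Complex.I * (m : ℂ) * (φ : ℂ)) =
      2 * Real.pi * ser (azi m h) t r θ 0 := by
  have hp : (t, r) ∈ U2 rp t0 := mem_U2.2 ⟨hr.1, hr.2.1⟩
  obtain ⟨D, hD0, hD⟩ := exists_bound_at hr.mem
  obtain ⟨C, hC0, hC⟩ := serT_bound hh hp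
  have hb := fun φ n => hC.self_of_nhdsWithin hp _ D hD0 hD φ n
  have := intervalIntegral.hasSum_integral_of_dominated_convergence (a := 0) (b := 2 * Real.pi)
    (μ := volume)
    (F := fun n φ => serT (fun m ℓ => Sml m ℓ θ) h (t, r) φ n *
      Complex.exp (-Complex.I * (m : ℂ) * (φ : ℂ)))
    (f := fun φ => ser h t r θ φ * Complex.exp (-Complex.I * (m : ℂ) * (φ : ℂ)))
    (fun n _ => C * D * (1 / ((n : ℝ) + 1) ^ 2))
    (fun n => Continuous.aestronglyMeasurable (by unfold serT; fun_prop))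
    (fun n => ae_of_all _ fun φ _ => by rw [norm_mul, norm_exp_I, mul_one]; exact hb φ n)
    (ae_of_all _ fun φ _ => summable_inv_sq.mul_left _) intervalIntegrable_const
    (ae_of_all _ fun φ _ => (ser_summable hh hr φ).hasSum.mul_right _)
  rw [← this.tsum_eq]
  simp only [integral_serT]
  rw [tsum_mul_left]
  rfl

theorem ser_azi_continuousOn (hh : RD h) (hp : (t, r) ∈ U2 rp t0) :
    ContinuousOn (fun θ => ser h t r θ 0) (Ioo 0 Real.pi) := fun θ hθ => by
  have := hasDerivAt_serW_th (φ := 0) hh hp (W := Sml)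
    (W' := fun m ℓ θ => ySml m ℓ θ / Real.sin θ) (fun m ℓ _ θ hθ => hasDerivAt_Sml hθ)
    (fun a b ha hab hb => Sml_deriv_local_bound ha hab hb) hθ
  exact this.continuousAt.continuousWithinAt

/-- The L¹ norms of S·W are bounded independently of ℓ, so decay of the coefficients allows sum and
integral to be exchanged although the harmonics have no uniform pointwise bound here up to the
poles. -/
theorem hasSum_serT_azi (hh : RD h) (hp : (t, r) ∈ U2 rp t0) {W : ℝ → ℝ} {K : ℝ}
    (hW : ContinuousOn W (Ioo 0 Real.pi)) (hK : ∀ θ ∈ Ioo 0 Real.pi, |W θ| ≤ K) :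
    IntegrableOn (fun θ => ser (azi m h) t r θ 0 * (W θ : ℂ) * (Real.sin θ : ℂ)) (Ioo 0 Real.pi) ∧
    ∫ θ in Ioo 0 Real.pi, ser (azi m h) t r θ 0 * (W θ : ℂ) * (Real.sin θ : ℂ) =
      ∑' n, if m ∈ Finset.Icc (-((n + 2 : ℕ) : ℤ)) ((n + 2 : ℕ) : ℤ) then
        smEv (h m (n + 2)) (t, r) * ∫ θ in Ioo 0 Real.pi,
          (Sml m (n + 2) θ : ℂ) * (W θ : ℂ) * (Real.sin θ : ℂ) else 0 := by
  set f : ℕ → ℝ → ℂ := fun n θ => if m ∈ Finset.Icc (-((n + 2 : ℕ) : ℤ)) ((n + 2 : ℕ) : ℤ) then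
        smEv (h m (n + 2)) (t, r) * ((Sml m (n + 2) θ : ℂ) * (W θ : ℂ) * (Real.sin θ : ℂ)) else 0
  have hi : ∀ n, IntegrableOn (f n) (Ioo 0 Real.pi) := fun n => by
    by_cases hm : m ∈ Finset.Icc (-((n + 2 : ℕ) : ℤ)) ((n + 2 : ℕ) : ℤ)
    · simp only [f, if_pos hm]
      exact (integral_norm_Sml_le (adm_of_mem hm) hW hK).1.const_mul _
    · simp only [f, if_neg hm]
      exact integrableOn_zero
  obtain ⟨C, hC0, hC⟩ := hh 2 _ hp
  have hC := hC.self_of_nhdsWithin hp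
  have hs : Summable fun n => ∫ θ in Ioo 0 Real.pi, ‖f n θ‖ := by
    refine Summable.of_nonneg_of_le (fun n => integral_nonneg fun _ => norm_nonneg _) (fun n => ?_)
      (summable_inv_sq.mul_left (C * (1 + K ^ 2)))
    by_cases hm : m ∈ Finset.Icc (-((n + 2 : ℕ) : ℤ)) ((n + 2 : ℕ) : ℤ)
    · simp only [f, if_pos hm]
      have h1 := (integral_norm_Sml_le (adm_of_mem hm) hW hK).2
      have h2 := hC m _ (adm_of_mem hm)
      have h3 : ‖smEv (h m (n + 2)) (t, r)‖ ≤ C * (1 / ((n : ℝ) + 1) ^ 2) := by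
        rw [mul_one_div, le_div_iff₀ (by positivity), mul_comm]
        refine (mul_le_mul_of_nonneg_right ?_ (norm_nonneg _)).trans h2
        push_cast
        exact pow_le_pow_left₀ (by positivity) (by linarith) 2
      have e : ∀ θ : ℝ, ‖smEv (h m (n + 2)) (t, r) * ((Sml m (n + 2) θ : ℂ) * (W θ : ℂ) *
          (Real.sin θ : ℂ))‖ = ‖smEv (h m (n + 2)) (t, r)‖ * ‖(Sml m (n + 2) θ : ℂ) * (W θ : ℂ) *
          (Real.sin θ : ℂ)‖ := fun θ => norm_mul _ _
      simp only [e]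
      rw [integral_const_mul]
      calc _ ≤ C * (1 / ((n : ℝ) + 1) ^ 2) * (1 + K ^ 2) :=
            mul_le_mul h3 h1 (integral_nonneg fun _ => norm_nonneg _) (by positivity)
        _ = _ := by ring
    · simp only [f, if_neg hm, norm_zero, integral_zero]
      positivity
  have hf : ∀ θ, ∑' n, f n θ = ser (azi m h) t r θ 0 * (W θ : ℂ) * (Real.sin θ : ℂ) := fun θ => by
    unfold ser
    rw [← tsum_mul_right, ← tsum_mul_right]
    refine tsum_congr fun n => ?_
    rw [serT_azi]
    simp only [f, ite_mul, zero_mul, mul_assoc]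
  have hm : AEStronglyMeasurable (fun θ => ∑' n, f n θ) (volume.restrict (Ioo 0 Real.pi)) := by
    simp only [hf]
    exact (((ser_azi_continuousOn (hh.azi m) hp).mul
      (Complex.continuous_ofReal.comp_continuousOn hW)).mul
        (by fun_prop)).aestronglyMeasurable measurableSet_Ioo
  refine ⟨?_, ?_⟩
  · have := integrable_tsum_of_summable hi hs hm
    simp only [hf] at this
    exact this
  · have := integral_tsum_of_summable_integral_norm hi hs
    simp only [hf] at this
    rw [← this]
    refine tsum_congr fun n => ?_
    split_ifs with h1
    · simp only [f, if_pos h1]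
      rw [← integral_const_mul]
    · simp only [f, if_neg h1, integral_zero]

theorem integral_ser_Sml (hh : RD h) (hp : (t, r) ∈ U2 rp t0) (hA : Adm m ℓ) :
    IntegrableOn (fun θ => ser (azi m h) t r θ 0 * (Sml m ℓ θ : ℂ) * (Real.sin θ : ℂ))
      (Ioo 0 Real.pi) ∧
    ∫ θ in Ioo 0 Real.pi, ser (azi m h) t r θ 0 * (Sml m ℓ θ : ℂ) * (Real.sin θ : ℂ) =
      smEv (h m ℓ) (t, r) / (2 * Real.pi) := by
  obtain ⟨K, -, hK⟩ := Sml_bounded hA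
  obtain ⟨h1, h2⟩ := hasSum_serT_azi (m := m) hh hp Sml_continuousOn fun θ hθ => (hK θ hθ).1
  refine ⟨h1, h2.trans ?_⟩
  have e : ∀ ℓ' : ℕ, ∫ θ in Ioo 0 Real.pi, (Sml m ℓ' θ : ℂ) * (Sml m ℓ θ : ℂ) * (Real.sin θ : ℂ) =
      ((∫ θ in (0 : ℝ)..Real.pi, Sml m ℓ' θ * Sml m ℓ θ * Real.sin θ : ℝ) : ℂ) := fun ℓ' => by
    rw [intervalIntegral.integral_of_le Real.pi_pos.le, integral_Ioc_eq_integral_Ioo,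
      ← integral_complex_ofReal]
    push_cast
    rfl
  have hA' := hA
  obtain ⟨a1, a2, a3⟩ := hA'
  rw [tsum_eq_single (ℓ - 2)]
  · have hl : ℓ - 2 + 2 = ℓ := by omega
    simp only [hl]
    rw [if_pos (Finset.mem_Icc.2 ⟨a2, a3⟩), e, integral_Sml_sq hA]
    push_cast
    ring
  · intro n hn
    split_ifs with hm
    · rw [e, integral_Sml_ne (adm_of_mem hm) hA (by omega)]
      simp
    · rfl

theorem modeCoeff_ser (hh : RD h) (hp : (t, r) ∈ U2 rp t0) (hA : Adm m ℓ) :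
    modeCoeff m ℓ (ser h) t r = smEv (h m ℓ) (t, r) := by
  unfold modeCoeff
  rw [intervalIntegral.integral_of_le Real.pi_pos.le, integral_Ioc_eq_integral_Ioo]
  have e : ∀ θ ∈ Ioo 0 Real.pi, (∫ φ in (0 : ℝ)..(2 * Real.pi), ser h t r θ φ * (Sml m ℓ θ : ℂ) *
      Complex.exp (-Complex.I * (m : ℂ) * (φ : ℂ)) * (Real.sin θ : ℂ)) =
      2 * Real.pi * (ser (azi m h) t r θ 0 * (Sml m ℓ θ : ℂ) * (Real.sin θ : ℂ)) := fun θ hθ => by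
    have := integral_ser (m := m) hh (⟨hp.1, hp.2, hθ⟩ : Region rp t0 t r θ)
    rw [← mul_assoc, ← mul_assoc, ← this, mul_assoc, ← intervalIntegral.integral_mul_const]
    congr 1
    funext φ
    ring
  rw [setIntegral_congr_fun measurableSet_Ioo e, integral_const_mul, (integral_ser_Sml hh hp hA).2]
  have : (Real.pi : ℂ) ≠ 0 := by exact_mod_cast Real.pi_pos.ne'
  field_simp

/-- A continuous `2π`-periodic function whose Fourier coefficients vanish is zero. -/
theorem eq_zero_of_fourier {f : ℝ → ℂ} (hc : Continuous f) (hper : Function.Periodic f (2 * Real.pi))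
    (hf : ∀ m : ℤ, ∫ φ in (0 : ℝ)..(2 * Real.pi),
      f φ * Complex.exp (-Complex.I * (m : ℂ) * (φ : ℂ)) = 0) (φ : ℝ) : f φ = 0 := by
  have : Fact (0 < 2 * Real.pi) := ⟨Real.two_pi_pos⟩
  set G : C(AddCircle (2 * Real.pi), ℂ) := ⟨AddCircle.liftIco (2 * Real.pi) 0 f,
    AddCircle.liftIco_zero_continuous (by simpa using (hper 0).symm) hc.continuousOn⟩
  have hG : ∀ n, fourierCoeff G n = 0 := fun n => by
    change fourierCoeff (AddCircle.liftIco (2 * Real.pi) 0 f) n = 0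
    rw [fourierCoeff_liftIco_eq, fourierCoeffOn_eq_integral]
    have e : ∀ x : ℝ, (fourier (-n) (x : AddCircle (0 + 2 * Real.pi - 0)) : ℂ) • f x =
        f x * Complex.exp (-Complex.I * (n : ℂ) * (x : ℂ)) := fun x => by
      rw [fourier_coe_apply, smul_eq_mul, mul_comm]
      congr 2
      have : (Real.pi : ℂ) ≠ 0 := by exact_mod_cast Real.pi_pos.ne'
      push_cast
      rw [zero_add, sub_zero]
      field_simp
    rw [intervalIntegral.integral_congr fun x _ => e x, zero_add, hf, smul_zero]
  obtain ⟨y, hy, hyφ⟩ := hper.exists_mem_Ico₀ Real.two_pi_pos φ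
  have h1 := has_pointwise_sum_fourier_series_of_summable (f := G)
    (by rw [funext hG]; exact summable_zero) (y : AddCircle (2 * Real.pi))
  simp only [hG, zero_smul] at h1
  have h2 := h1.unique hasSum_zero
  rw [hyφ]
  rw [← h2]
  exact (AddCircle.liftIco_zero_coe_apply hy).symm

theorem ser_periodic (h : Fm rp t0) : ser h t r θ (φ + 2 * Real.pi) = ser h t r θ φ := by
  unfold ser serT
  refine tsum_congr fun n => Finset.sum_congr rfl fun m _ => ?_
  congr 1
  have e : Complex.I * (m : ℂ) * ((φ + 2 * Real.pi : ℝ) : ℂ) =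
      Complex.I * m * φ + m * (2 * Real.pi * Complex.I) := by push_cast; ring
  rw [e, Complex.exp_add, Complex.exp_int_mul_two_pi_mul_I, mul_one]

/-- A regular function is the sum of its modes. -/
theorem ev_eq_ser (hB : Background M k rp) (F : good rp t0 hB) :
    EqOnRegion rp t0 (ev F.1) (ser (md hB F)) := by
  intro t r θ φ hr
  have hp : (t, r) ∈ U2 rp t0 := mem_U2.2 ⟨hr.1, hr.2.1⟩
  have hF := good_locBdd hB F.2
  have hh := md_isFam hB F
  have hpi := Real.pi_pos
  obtain ⟨C, hC0, hC⟩ := slice_bound hF hp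
  -- Uniqueness in two stages: for fixed m the difference of Fourier coefficients is orthogonal to
  -- every harmonic in θ, hence zero; then Fourier uniqueness in φ.
  have key : ∀ m : ℤ, ∀ θ ∈ Ioo 0 Real.pi,
      fc m F.1 t r θ - 2 * Real.pi * ser (azi m (md hB F)) t r θ 0 = 0 := by
    intro m
    have hCf : ∀ θ ∈ Ioo 0 Real.pi, ‖fc m F.1 t r θ‖ ≤ 2 * Real.pi * C := fun θ hθ =>
      norm_fc_le fun φ hφ => hC (θ, φ) ⟨hθ, hφ⟩
    have hint : ∀ (W : ℝ → ℝ) (K : ℝ), ContinuousOn W (Ioo 0 Real.pi) →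
        (∀ θ ∈ Ioo 0 Real.pi, |W θ| ≤ K) → IntegrableOn (fun θ => fc m F.1 t r θ * (W θ : ℂ) *
          (Real.sin θ : ℂ)) (Ioo 0 Real.pi) := by
      intro W K hW hK
      rw [← intervalIntegrable_iff_integrableOn_Ioo_of_le hpi.le]
      refine intervalIntegrable_of_bounded (C := 2 * Real.pi * C * K * 1) hpi.le
        (((fc_continuousOn F.1 hp).mul (Complex.continuous_ofReal.comp_continuousOn hW)).mul
          (by fun_prop)) fun θ hθ => ?_
      rw [norm_mul, norm_mul, Complex.norm_real, Complex.norm_real]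
      have hK0 : 0 ≤ K := (abs_nonneg _).trans (hK θ hθ)
      exact mul_le_mul (mul_le_mul (hCf θ hθ) (hK θ hθ) (abs_nonneg _) (by positivity))
        (Real.abs_sin_le_one θ) (abs_nonneg _) (by positivity)
    have hs := fun W K hW hK => (hasSum_serT_azi (m := m) (W := W) (K := K) hh.rd hp hW hK).1
    have hall : ∀ (W : ℝ → ℝ) (K : ℝ), ContinuousOn W (Ioo 0 Real.pi) →
        (∀ θ ∈ Ioo 0 Real.pi, |W θ| ≤ K) → IntervalIntegrable (fun θ =>
          (fc m F.1 t r θ - 2 * Real.pi * ser (azi m (md hB F)) t r θ 0) * (W θ : ℂ) *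
          (Real.sin θ : ℂ)) volume 0 Real.pi := by
      intro W K hW hK
      rw [intervalIntegrable_iff_integrableOn_Ioo_of_le hpi.le]
      refine ((hint W K hW hK).sub ((hs W K hW hK).const_mul (2 * Real.pi))).congr
        (ae_of_all _ fun θ => ?_)
      simp only [Pi.sub_apply]
      ring
    refine Sml_complete (((fc_continuousOn F.1 hp).sub
      ((ser_azi_continuousOn (hh.rd.azi m) hp).const_mul _))) ?_ m (fun ℓ hA => ?_) fun ℓ hA => ?_
    · simpa using hall (fun _ => 1) 1 continuousOn_const (by simp)
    · obtain ⟨K, -, hK⟩ := Sml_bounded hA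
      exact hall _ K Sml_continuousOn fun θ hθ => (hK θ hθ).1
    · obtain ⟨K, -, hK⟩ := Sml_bounded hA
      have i1 := hint _ K Sml_continuousOn fun θ hθ => (hK θ hθ).1
      obtain ⟨i2, i3⟩ := integral_ser_Sml hh.rd hp hA
      have i4 := modeInt_eq hA hF hp
      rw [intervalIntegral.integral_of_le hpi.le, integral_Ioc_eq_integral_Ioo] at i4 ⊢
      have e : ∀ θ : ℝ, (fc m F.1 t r θ - 2 * Real.pi * ser (azi m (md hB F)) t r θ 0) *
          (Sml m ℓ θ : ℂ) * (Real.sin θ : ℂ) = fc m F.1 t r θ * (Sml m ℓ θ : ℂ) * (Real.sin θ : ℂ) -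
          2 * Real.pi * (ser (azi m (md hB F)) t r θ 0 * (Sml m ℓ θ : ℂ) * (Real.sin θ : ℂ)) :=
        fun θ => by ring
      simp only [e]
      rw [integral_sub i1 (i2.const_mul _), integral_const_mul, i3, ← i4, smEv_md hB F hA hp]
      have : (Real.pi : ℂ) ≠ 0 := by exact_mod_cast hpi.ne'
      field_simp
      ring
  have hc : Continuous fun φ => ser (md hB F) t r θ φ := continuous_iff_continuousAt.mpr fun φ =>
    (hasDerivAt_ser_ph hh hr).continuousAt
  have h0 := eq_zero_of_fourier (f := fun φ => ev F.1 t r θ φ - ser (md hB F) t r θ φ)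
    ((ev_continuous_ph F.1 hr).sub hc) (fun φ => ?_) (fun m => ?_) φ
  · exact sub_eq_zero.1 h0
  · simp only
    rw [F.2.1 t r θ φ hr, ser_periodic]
  · simp only [sub_mul]
    rw [intervalIntegral.integral_sub (fc_integrable F.1 hr m _ _)
      (Continuous.intervalIntegrable (u := fun φ => ser (md hB F) t r θ φ *
        Complex.exp (-Complex.I * (m : ℂ) * (φ : ℂ))) (hc.mul (by fun_prop)) _ _),
      integral_ser hh.rd hr]
    exact key m θ hr.mem

end
end TeukolskySAdS

open scoped ContDiff
namespace TeukolskySAdS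
open Set Filter Topology
noncomputable section

open MeasureTheory Chart Fm

variable {m : ℤ} {ℓ : ℕ} {M k rp t0 : ℝ} {f f' : Field4} {h g : Fm rp t0}

/-! ### Fields represented by families of modes -/

/-- `f` is the sum of the modes `h`. -/
structure RepS (f : Field4) (h : Fm rp t0) : Prop where
  fam : IsFam h
  eq : EqOnRegion rp t0 f (ser h)

theorem modeCoeff_congr (hf : EqOnRegion rp t0 f f') {t r : ℝ} (hp : (t, r) ∈ U2 rp t0) :
    modeCoeff m ℓ f t r = modeCoeff m ℓ f' t r := by
  unfold modeCoeff
  rw [intervalIntegral.integral_of_le Real.pi_pos.le, intervalIntegral.integral_of_le Real.pi_pos.le,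
    integral_Ioc_eq_integral_Ioo, integral_Ioc_eq_integral_Ioo]
  refine setIntegral_congr_fun measurableSet_Ioo fun θ hθ => ?_
  simp only [hf t r θ _ ⟨hp.1, hp.2, hθ⟩]

theorem EqOnRegion.angL (hf : EqOnRegion rp t0 f f') (s : ℤ) :
    EqOnRegion rp t0 (angL s f) (angL s f') := fun t r θ φ hr => by
  have h1 : deriv (fun x => (Real.sin x : ℂ) * TeukolskySAdS.dTh f t r x φ) θ =
      deriv (fun x => (Real.sin x : ℂ) * TeukolskySAdS.dTh f' t r x φ) θ := by
    refine Filter.EventuallyEq.deriv_eq ?_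
    filter_upwards [Ioo_mem_nhds hr.2.2.1 hr.2.2.2] with y hy
    rw [hf.dTh t r y φ ⟨hr.1, hr.2.1, hy⟩]
  simp only [TeukolskySAdS.angL, h1, hf.dPh.dPh t r θ φ hr, hf.dPh t r θ φ hr, hf t r θ φ hr]

namespace Fm

variable (hB : Background M k rp)

/-- `w⁻¹ L` on modes. -/
def mvL (h : Fm rp t0) : Fm rp t0 := fun m ℓ => (C2 rp t0).v hB * (C2 rp t0).L hB (h m ℓ)

/-- `w⁻¹ L̲` on modes. -/
def mvLb (h : Fm rp t0) : Fm rp t0 := fun m ℓ => (C2 rp t0).v hB * (C2 rp t0).Lb hB (h m ℓ)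

/-- `L` on modes. -/
def mL (h : Fm rp t0) : Fm rp t0 := fun m ℓ => (C2 rp t0).L hB (h m ℓ)

/-- `L̲` on modes. -/
def mLb (h : Fm rp t0) : Fm rp t0 := fun m ℓ => (C2 rp t0).Lb hB (h m ℓ)

/-- The eigenvalue `ℓ (ℓ + 1)`. -/
def eigL (_ : ℤ) (ℓ : ℕ) : ℂ := (ℓ : ℂ) * (ℓ + 1)

/-- The eigenvalue `(ℓ - 1) ℓ (ℓ + 1) (ℓ + 2)`. -/
def eigN (m : ℤ) (ℓ : ℕ) : ℂ := eigL m ℓ * (eigL m ℓ - 2)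

end Fm

namespace RepS

theorem dT (hf : RepS f h) : RepS (dT t0 f) (mT h) :=
  ⟨hf.fam.T, (EqOnRegion.dT hf.eq).trans fun t _ _ _ hr =>
    (hasDerivWithinAt_ser_t hf.fam hr).derivWithin (uniqueDiffOn_Ici t0 t hr.1)⟩

theorem dRstar (hf : RepS f h) : RepS (dRstar f) (mR h) :=
  ⟨hf.fam.R, (EqOnRegion.dRstar hf.eq).trans fun _ _ _ _ hr => (hasDerivAt_ser_r hf.fam hr).deriv⟩

theorem add (hf : RepS f h) (hg : RepS f' g) : RepS (f + f') (h + g) :=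
  ⟨hf.fam.add hg.fam, (EqOnRegion.add hf.eq hg.eq).trans fun _ _ _ _ hr =>
    (ser_add hf.fam.rd hg.fam.rd hr).symm⟩

theorem smul (hf : RepS f h) (c : ℂ) : RepS (c • f) (c • h) :=
  ⟨hf.fam.smul c, (EqOnRegion.smul hf.eq c).trans fun _ _ _ _ _ => (ser_smul c h).symm⟩

theorem neg (hf : RepS f h) : RepS (-f) (-h) := by
  have e1 : (-1 : ℂ) • f = -f := by simp
  have e2 : (-1 : ℂ) • h = -h := by
    funext m ℓ
    simp
  exact e1 ▸ e2 ▸ hf.smul (-1)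

theorem sub (hf : RepS f h) (hg : RepS f' g) : RepS (f - f') (h - g) := by
  rw [sub_eq_add_neg, sub_eq_add_neg]
  exact hf.add hg.neg

theorem rmul (hf : RepS f h) (a : ℝ → ℝ) (ha : ContDiffOn ℝ ∞ a (Ioi rp)) :
    RepS (rmul a f) (mrad (rmk a ha) h) :=
  ⟨hf.fam.rad _, (EqOnRegion.rmul hf.eq a).trans fun t r θ φ hr => by
    rw [ser_mrad _ _ (mem_U2.2 ⟨hr.1, hr.2.1⟩), smEv_rmk _ _ hr.2.1]; rfl⟩

variable (hB : Background M k rp)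

theorem opL (hf : RepS f h) : RepS (opL M k t0 f) (mL hB h) :=
  hf.dT.add ((hf.dRstar.add (hf.dT.rmul _ hB.smooth_shift)).rmul _ hB.smooth_f)

theorem opLb (hf : RepS f h) : RepS (opLb M k t0 f) (mLb hB h) :=
  hf.dT.sub ((hf.dRstar.add (hf.dT.rmul _ hB.smooth_shift)).rmul _ hB.smooth_f)

theorem winvL (hf : RepS f h) : RepS (winvL M k t0 f) (mvL hB h) := (hf.opL hB).rmul _ hB.smooth_v

theorem winvLb (hf : RepS f h) : RepS (winvLb M k t0 f) (mvLb hB h) :=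
  (hf.opLb hB).rmul _ hB.smooth_v

theorem angL (hf : RepS f h) : RepS (angL 2 f) (wt eigL h) :=
  ⟨hf.fam.wt polyBdd_lam, (EqOnRegion.angL hf.eq 2).trans fun _ _ _ _ hr => angL_ser hf.fam hr⟩

theorem angL4 (hf : RepS f h) : RepS (angL4 2 f) (wt eigN h) := by
  have := (hf.angL.sub (hf.smul 2)).angL
  have e : wt eigL (wt eigL h - (2 : ℂ) • h) = wt eigN h := by
    funext m ℓ
    change eigL m ℓ • (eigL m ℓ • h m ℓ - (2 : ℂ) • h m ℓ) = eigN m ℓ • h m ℓ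
    rw [← sub_smul, smul_smul]
    rfl
  rwa [e] at this

theorem modeCoeff (hf : RepS f h) {t r : ℝ} (hp : (t, r) ∈ U2 rp t0) (hA : Adm m ℓ) :
    modeCoeff m ℓ f t r = smEv (h m ℓ) (t, r) := by
  rw [modeCoeff_congr hf.eq hp, modeCoeff_ser hf.fam.rd hp hA]

/-- The operator 𝓒 replaces S_{mℓ} by S_{(-m)ℓ} under the same exponential, and conjugation flips
the exponential. The result is again a spin +2 sum, whose m-th coefficient is the conjugate of the
(-m)-th. -/
theorem cc_conjC (hf : RepS f h) : RepS (cc (conjC f)) (refl h) := by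
  refine ⟨hf.fam.refl, fun t r θ φ hr => ?_⟩
  have hp : (t, r) ∈ U2 rp t0 := mem_U2.2 ⟨hr.1, hr.2.1⟩
  unfold cc conjC ser
  rw [Complex.conj_tsum]
  refine tsum_congr fun n => ?_
  rw [map_sum]
  unfold serT
  refine Finset.sum_equiv (Equiv.neg ℤ) (fun m => ?_) fun m hm => ?_
  · simp only [Finset.mem_Icc, Equiv.neg_apply]
    omega
  · rw [hf.modeCoeff hp (adm_of_mem hm)]
    simp only [Equiv.neg_apply, Fm.refl, neg_neg, smEv_conj, map_mul, Complex.conj_ofReal,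
      ← Complex.exp_conj, Complex.conj_I, map_intCast]
    push_cast
    congr 2
    ring

theorem symP (hf : RepS f h) : RepS (symP f) ((1 / 2 : ℂ) • h + (1 / 2 : ℂ) • refl h) :=
  (hf.smul _).add (hf.cc_conjC.smul _)

theorem antiP (hf : RepS f h) : RepS (antiP f) ((1 / 2 : ℂ) • h - (1 / 2 : ℂ) • refl h) :=
  (hf.smul _).sub (hf.cc_conjC.smul _)

theorem _root_.TeukolskySAdS.eigN_add_two (n : ℕ) (m : ℤ) : eigN m (n + 2) =
    ((n + 1 : ℕ) : ℂ) * ((n + 2 : ℕ) : ℂ) * ((n + 3 : ℕ) : ℂ) * ((n + 4 : ℕ) : ℂ) := by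
  unfold eigN eigL
  push_cast
  ring

theorem _root_.TeukolskySAdS.eigN_inv_polyBdd : PolyBdd fun m ℓ => (eigN m ℓ)⁻¹ := by
  refine ⟨1, zero_le_one, 0, fun m ℓ hA => ?_⟩
  obtain ⟨n, rfl⟩ : ∃ n, ℓ = n + 2 := ⟨ℓ - 2, by have := hA.1; omega⟩
  change ‖(eigN m (n + 2))⁻¹‖ ≤ _
  rw [eigN_add_two, pow_zero, mul_one, norm_inv]
  refine inv_le_one_of_one_le₀ ?_
  rw [← Nat.cast_mul, ← Nat.cast_mul, ← Nat.cast_mul, Complex.norm_natCast]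
  exact_mod_cast Nat.one_le_iff_ne_zero.2 (by positivity)

theorem invAngL4 (hf : RepS f h) : RepS (invAngL4 f) (wt (fun m ℓ => (eigN m ℓ)⁻¹) h) := by
  refine ⟨hf.fam.wt eigN_inv_polyBdd, fun t r θ φ hr => ?_⟩
  have hp : (t, r) ∈ U2 rp t0 := mem_U2.2 ⟨hr.1, hr.2.1⟩
  unfold TeukolskySAdS.invAngL4 ser serT
  refine tsum_congr fun n => Finset.sum_congr rfl fun m hm => ?_
  rw [hf.modeCoeff hp (adm_of_mem hm), wt, smEv_smul, eigN_add_two]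
  ring

/-- The passage from identities of fields to identities of modes. It needs nothing about the fields
at the poles beyond the convergence of their mode sums. -/
theorem eqOn_iff (hf : RepS f h) (hg : RepS f' g) :
    EqOnRegion rp t0 f f' ↔ ∀ m ℓ, Adm m ℓ → h m ℓ = g m ℓ := by
  refine ⟨fun e m ℓ hA => sm_ext fun p hp => ?_, fun e => hf.eq.trans (EqOnRegion.trans ?_ hg.eq.symm)⟩
  · rw [← hf.modeCoeff hp hA, ← hg.modeCoeff hp hA, modeCoeff_congr e hp]
  · intro t r θ φ _
    unfold ser serT
    refine tsum_congr fun n => Finset.sum_congr rfl fun m hm => ?_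
    rw [e m _ (adm_of_mem hm)]

theorem eq_zero_iff (hf : RepS f h) :
    EqOnRegion rp t0 f 0 ↔ ∀ m ℓ, Adm m ℓ → h m ℓ = 0 := by
  have h0 := hf.smul 0
  rw [zero_smul] at h0
  rw [hf.eqOn_iff h0]
  refine forall₃_congr fun m ℓ _ => ?_
  change h m ℓ = (0 : ℂ) • h m ℓ ↔ _
  rw [zero_smul]

end RepS

end
end TeukolskySAdS

open scoped ContDiff
namespace TeukolskySAdS
open Set Filter Topology
noncomputable section

open MeasureTheory Chart Fm

variable {m : ℤ} {ℓ : ℕ} {M k rp t0 : ℝ} {f g : Field4} {A B : Fm rp t0}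

/-! ### Complex conjugation of fields -/

theorem cc_cc (f : Field4) : cc (cc f) = f := by
  funext t r θ φ
  simp [cc]

theorem cc_add (f g : Field4) : cc (f + g) = cc f + cc g := by
  funext t r θ φ
  simp [cc]

theorem cc_sub (f g : Field4) : cc (f - g) = cc f - cc g := by
  funext t r θ φ
  simp [cc]

theorem cc_neg (f : Field4) : cc (-f) = -cc f := by
  funext t r θ φ
  simp [cc]

theorem cc_smul (c : ℂ) (f : Field4) : cc (c • f) = (starRingEnd ℂ c) • cc f := by
  funext t r θ φ
  simp [cc]

theorem cc_rmul (a : ℝ → ℝ) (f : Field4) : cc (rmul a f) = rmul a (cc f) := by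
  funext t r θ φ
  simp [cc, rmul]

theorem cc_dT (f : Field4) : cc (dT t0 f) = dT t0 (cc f) := by
  funext t r θ φ
  exact (derivWithin.star (f := fun τ => f τ r θ φ)).symm

theorem cc_dRstar (f : Field4) : cc (dRstar f) = dRstar (cc f) := by
  funext t r θ φ
  exact (deriv.star (f := fun ρ => f t ρ θ φ)).symm

theorem cc_dTh (f : Field4) : cc (dTh f) = dTh (cc f) := by
  funext t r θ φ
  exact (deriv.star (f := fun x => f t r x φ)).symm

theorem cc_dPh (f : Field4) : cc (dPh f) = dPh (cc f) := by
  funext t r θ φ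
  exact (deriv.star (f := fun x => f t r θ x)).symm

theorem cc_opL (f : Field4) : cc (opL M k t0 f) = opL M k t0 (cc f) := by
  simp only [opL, dR, cc_add, cc_rmul, cc_dT, cc_dRstar]

theorem cc_opLb (f : Field4) : cc (opLb M k t0 f) = opLb M k t0 (cc f) := by
  simp only [opLb, dR, cc_add, cc_sub, cc_rmul, cc_dT, cc_dRstar]

theorem cc_winvL (f : Field4) : cc (winvL M k t0 f) = winvL M k t0 (cc f) := by
  simp only [winvL, cc_rmul, cc_opL]

theorem cc_winvLb (f : Field4) : cc (winvLb M k t0 f) = winvLb M k t0 (cc f) := by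
  simp only [winvLb, cc_rmul, cc_opLb]

theorem cc_angL (s : ℤ) (f : Field4) : cc (angL s f) = angL (-s) (cc f) := by
  have h1 : ∀ t r θ φ, (starRingEnd ℂ) (deriv (fun x => (Real.sin x : ℂ) * dTh f t r x φ) θ) =
      deriv (fun x => (Real.sin x : ℂ) * dTh (cc f) t r x φ) θ := fun t r θ φ => by
    refine (deriv.star (f := fun x => (Real.sin x : ℂ) * dTh f t r x φ)).symm.trans ?_
    congr 1
    funext x
    rw [← cc_dTh]
    exact (map_mul (starRingEnd ℂ) _ _).trans (by rw [Complex.conj_ofReal]; rfl)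
  have h2 : ∀ t r θ φ, (starRingEnd ℂ) (dPh f t r θ φ) = dPh (cc f) t r θ φ := fun t r θ φ =>
    congrFun (congrFun (congrFun (congrFun (cc_dPh f) t) r) θ) φ
  have h3 : ∀ t r θ φ, (starRingEnd ℂ) (dPh (dPh f) t r θ φ) = dPh (dPh (cc f)) t r θ φ :=
    fun t r θ φ => by
      rw [← cc_dPh f, ← cc_dPh (dPh f)]
      rfl
  funext t r θ φ
  unfold cc angL
  simp only [map_neg, map_sub, map_add, map_mul, Complex.conj_ofReal, Complex.conj_I, map_intCast,
    map_ofNat, h1, h2, h3]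
  unfold cc
  push_cast
  ring

theorem cc_angL4 (s : ℤ) (f : Field4) : cc (angL4 s f) = angL4 (-s) (cc f) := by
  simp only [angL4, cc_angL, cc_sub, cc_smul, map_ofNat]

theorem cc_symM (f : Field4) : cc (symM f) = symP (cc f) := by
  simp only [symM, symP, cc_add, cc_smul, map_div₀, map_one, map_ofNat]

theorem cc_antiM (f : Field4) : cc (antiM f) = antiP (cc f) := by
  simp only [antiM, antiP, cc_sub, cc_smul, map_div₀, map_one, map_ofNat]

theorem cc_PsiM (f : Field4) : cc (PsiM M k t0 f) = winvL M k t0 (winvL M k t0 (cc f)) := by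
  simp only [PsiM, cc_winvL]

theorem EqOnRegion.cc_iff : EqOnRegion rp t0 (cc f) (cc g) ↔ EqOnRegion rp t0 f g := by
  refine forall_congr' fun t => forall_congr' fun r => forall_congr' fun θ => forall_congr' fun φ =>
    forall_congr' fun _ => ?_
  exact (starRingEnd ℂ).injective.eq_iff

/-! ### Complex conjugation of modes -/

section Conj

variable (a b : smAlg (U2 rp t0)) (hB : Background M k rp)

theorem conj2_add : smConj (a + b) = smConj a + smConj b := sm_ext fun x _ => by
  simp only [smEv_conj, smEv_add, map_add]

theorem conj2_sub : smConj (a - b) = smConj a - smConj b := sm_ext fun x _ => by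
  simp only [smEv_conj, smEv_sub, map_sub]

theorem conj2_smul (c : ℂ) : smConj (c • a) = (starRingEnd ℂ c) • smConj a := sm_ext fun x _ => by
  simp only [smEv_conj, smEv_smul, map_mul]

theorem conj2_rad (c : ℝ → ℝ) (hc : ContDiffOn ℝ ∞ c (Ioi rp)) :
    smConj ((C2 rp t0).rad (rmk c hc)) = (C2 rp t0).rad (rmk c hc) := sm_ext fun x hx => by
  rw [smEv_conj, (C2 rp t0).smEv_rad_rmk _ _ hx, Complex.conj_ofReal]

theorem conj2_T : smConj ((C2 rp t0).T a) = (C2 rp t0).T (smConj a) := (pd_conj _ _).symm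

theorem conj2_R : smConj ((C2 rp t0).R a) = (C2 rp t0).R (smConj a) := (pd_conj _ _).symm

theorem conj2_L : smConj ((C2 rp t0).L hB a) = (C2 rp t0).L hB (smConj a) := by
  simp only [Chart.L_apply, Chart.D_apply, conj2_add, IsFam.conj_mul2, conj2_rad, conj2_T, conj2_R]

theorem conj2_Lb : smConj ((C2 rp t0).Lb hB a) = (C2 rp t0).Lb hB (smConj a) := by
  simp only [Chart.Lb_apply, Chart.D_apply, conj2_add, conj2_sub, IsFam.conj_mul2, conj2_rad, conj2_T, conj2_R]

theorem conj2_w : smConj ((C2 rp t0).w hB) = (C2 rp t0).w hB := conj2_rad _ _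
theorem conj2_v : smConj ((C2 rp t0).v hB) = (C2 rp t0).v hB := conj2_rad _ _
theorem conj2_x : smConj ((C2 rp t0).x hB) = (C2 rp t0).x hB := conj2_rad _ _

theorem conj2_real (c : ℝ) : smConj (algebraMap ℂ (smAlg (U2 rp t0)) (c : ℂ)) =
    algebraMap ℂ _ (c : ℂ) := sm_ext fun x hx => by
  rw [smEv_conj, smEv_algebraMap _ hx, Complex.conj_ofReal]

theorem conj2_ofNat (n : ℕ) [n.AtLeastTwo] : smConj (ofNat(n) : smAlg (U2 rp t0)) = ofNat(n) :=
  sm_ext fun x hx => by rw [smEv_conj, smEv_ofNat n hx, map_ofNat]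

end Conj

/-- The symmetrised (`σ = 1`) and antisymmetrised (`σ = -1`) family. -/
def sy (σ : ℝ) (h : Fm rp t0) : Fm rp t0 := fun m ℓ =>
  (1 / 2 : ℂ) • (h m ℓ + (σ : ℂ) • smConj (h (-m) ℓ))

theorem RepS.symP' (hf : RepS f A) : RepS (TeukolskySAdS.symP f) (sy 1 A) := by
  have e : sy 1 A = (1 / 2 : ℂ) • A + (1 / 2 : ℂ) • Fm.refl A := by
    funext m ℓ
    change (1 / 2 : ℂ) • (A m ℓ + ((1 : ℝ) : ℂ) • smConj (A (-m) ℓ)) =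
      (1 / 2 : ℂ) • A m ℓ + (1 / 2 : ℂ) • smConj (A (-m) ℓ)
    rw [Complex.ofReal_one, one_smul, smul_add]
  rw [e]
  exact hf.symP

theorem RepS.antiP' (hf : RepS f A) : RepS (TeukolskySAdS.antiP f) (sy (-1) A) := by
  have e : sy (-1) A = (1 / 2 : ℂ) • A - (1 / 2 : ℂ) • Fm.refl A := by
    funext m ℓ
    change (1 / 2 : ℂ) • (A m ℓ + ((-1 : ℝ) : ℂ) • smConj (A (-m) ℓ)) =
      (1 / 2 : ℂ) • A m ℓ - (1 / 2 : ℂ) • smConj (A (-m) ℓ)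
    rw [Complex.ofReal_neg, Complex.ofReal_one, neg_one_smul, smul_add, smul_neg, sub_eq_add_neg]
  rw [e]
  exact hf.antiP

variable (hB : Background M k rp) (σ : ℝ)

/-- Symmetrisation is only real-linear, so it commutes with operators whose coefficients are real
and unchanged under m ↦ -m. This covers every operator in the problem. -/
theorem sy_add : sy σ (A + B) = sy σ A + sy σ B := by
  funext m ℓ
  simp only [sy, Pi.add_apply, conj2_add, smul_add]
  abel

theorem sy_sub : sy σ (A - B) = sy σ A - sy σ B := by
  funext m ℓ
  simp only [sy, Pi.sub_apply, conj2_sub, smul_add, smul_sub]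
  abel

theorem sy_mvL : sy σ (mvL hB A) = mvL hB (sy σ A) := by
  funext m ℓ
  simp only [sy, mvL, IsFam.conj_mul2, conj2_v, conj2_L, map_add, Derivation.map_smul, mul_add,
    mul_smul_comm, smul_add]

theorem sy_mvLb : sy σ (mvLb hB A) = mvLb hB (sy σ A) := by
  funext m ℓ
  simp only [sy, mvLb, IsFam.conj_mul2, conj2_v, conj2_Lb, map_add, Derivation.map_smul, mul_add,
    mul_smul_comm, smul_add]

theorem sy_mT : sy σ (mT A) = mT (sy σ A) := by
  funext m ℓ
  simp only [sy, mT, conj2_T, map_add, Derivation.map_smul, smul_add]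

theorem sy_wt {c : ℤ → ℕ → ℂ} (hc : ∀ m ℓ, (starRingEnd ℂ) (c (-m) ℓ) = c m ℓ) :
    sy σ (wt c A) = wt c (sy σ A) := by
  funext m ℓ
  simp only [sy, wt, conj2_smul, hc, smul_add, smul_smul]
  congr 2 <;> ring

/-! ### The mode equations -/

/-- The constant `M` in the algebra of modes. -/
abbrev mM (M rp t0 : ℝ) : smAlg (U2 rp t0) := algebraMap ℂ _ (M : ℂ)

/-- The eigenvalue `ℓ (ℓ + 1)` in the algebra of modes. -/
abbrev mLam (rp t0 : ℝ) (ℓ : ℕ) : smAlg (U2 rp t0) := algebraMap ℂ _ (eigL 0 ℓ)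

/-- The Teukolsky equations of a pair of modes. -/
abbrev ModePair (ℓ : ℕ) (a b : smAlg (U2 rp t0)) : Prop :=
  NullPair.TeukPair ((C2 rp t0).L hB) ((C2 rp t0).Lb hB) ((C2 rp t0).w hB) ((C2 rp t0).v hB)
    ((C2 rp t0).x hB) (mM M rp t0) (mLam rp t0 ℓ) a b

theorem smul_eq_mLam (a : smAlg (U2 rp t0)) : eigL m ℓ • a = mLam rp t0 ℓ * a :=
  Algebra.smul_def _ _

theorem eigN_smul (a : smAlg (U2 rp t0)) :
    eigN m ℓ • a = mLam rp t0 ℓ * (mLam rp t0 ℓ - 2) * a := by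
  rw [Algebra.smul_def]
  unfold eigN mLam eigL
  rw [map_mul, map_sub, map_ofNat]

theorem twelve_T (a : smAlg (U2 rp t0)) : (12 * M : ℂ) • (C2 rp t0).T a =
    6 * mM M rp t0 * ((C2 rp t0).L hB a + (C2 rp t0).Lb hB a) := by
  rw [Chart.L_apply, Chart.Lb_apply, Algebra.smul_def, map_mul, map_ofNat]
  ring

end
end TeukolskySAdS

open scoped ContDiff
namespace TeukolskySAdS
open Set Filter Topology
noncomputable section

open MeasureTheory Chart Fm

variable {m : ℤ} {ℓ : ℕ} {M k rp t0 : ℝ} {f g : Field4} {A B : Fm rp t0}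
variable (hB : Background M k rp)

/-! ### The Teukolsky equations for modes -/

/-- The factor (Δ/r²) ∂_r log w is the logarithmic radial derivative of w, i.e. the q = 6Mx² - 2x of
the algebra. -/
theorem coef_eq {r : ℝ} (hB : Background M k rp) (hr : rp < r) :
    2 * (Del M k r / r ^ 2) * deriv (fun ρ => Real.log (Del M k ρ / ρ ^ 4)) r =
      2 * (6 * M * r⁻¹ ^ 2 - 2 * r⁻¹) := by
  have hr0 := (hB.r_pos hr).ne'
  have hw := (hB.w_pos hr).ne'
  have hd := (hB.Del_pos r hr).ne'
  have h1 : deriv (fun ρ => Real.log (Del M k ρ / ρ ^ 4)) r = _ :=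
    ((hasDerivAt_wfun (M := M) (k := k) hr0).log hw).deriv
  rw [h1]
  unfold wfun at hw ⊢
  field_simp
  ring

theorem smooth_coef (hB : Background M k rp) :
    ContDiffOn ℝ ∞ (fun r : ℝ => 2 * (6 * M * r⁻¹ ^ 2 - 2 * r⁻¹)) (Ioi rp) :=
  contDiffOn_const.mul ((contDiffOn_const.mul (hB.smooth_inv.pow 2)).sub
    (contDiffOn_const.mul hB.smooth_inv))

theorem smooth_six (hB : Background M k rp) :
    ContDiffOn ℝ ∞ (fun r : ℝ => 6 * M / r) (Ioi rp) :=
  (contDiffOn_const.mul hB.smooth_inv : ContDiffOn ℝ ∞ (fun r : ℝ => 6 * M * r⁻¹) (Ioi rp)).congr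
    fun _ _ => div_eq_mul_inv _ _

theorem rad_coef : (C2 rp t0).rad (rmk _ (smooth_coef hB)) =
    2 * (6 * mM M rp t0 * (C2 rp t0).x hB ^ 2 - 2 * (C2 rp t0).x hB) := sm_ext fun p hp => by
  rw [smEv_rad_rmk _ _ _ hp]
  simp only [smEv_mul, smEv_sub, smEv_pow _ _ hp, smEv_ofNat _ hp, smEv_algebraMap _ hp, Chart.x,
    smEv_rad_rmk _ _ _ hp]
  push_cast
  ring

theorem rad_six : (C2 rp t0).rad (rmk _ (smooth_six hB)) =
    6 * mM M rp t0 * (C2 rp t0).x hB := sm_ext fun p hp => by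
  rw [smEv_rad_rmk _ _ _ hp]
  simp only [smEv_mul, smEv_ofNat _ hp, smEv_algebraMap _ hp, Chart.x, smEv_rad_rmk _ _ _ hp]
  push_cast
  ring

/-- The spin `+2` equation for one mode. -/
abbrev ModeTeuk (ℓ : ℕ) (a : smAlg (U2 rp t0)) : Prop :=
  NullPair.Teuk ((C2 rp t0).L hB) ((C2 rp t0).Lb hB) ((C2 rp t0).w hB)
    ((C2 rp t0).x hB) (mM M rp t0) (mLam rp t0 ℓ) a

/-- The conjugated spin `-2` equation for one mode. -/
abbrev ModeTeuk' (ℓ : ℕ) (a : smAlg (U2 rp t0)) : Prop :=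
  NullPair.Teuk (-(C2 rp t0).Lb hB) (-(C2 rp t0).L hB) ((C2 rp t0).w hB)
    ((C2 rp t0).x hB) (mM M rp t0) (mLam rp t0 ℓ) a

theorem RepS.mode_teukP (hf : RepS f A) (h : EqOnRegion rp t0 (teukP M k t0 f) 0) :
    ∀ m ℓ, Adm m ℓ → ModeTeuk hB ℓ (A m ℓ) := by
  have h1 := ((((hf.opLb hB).opL hB).neg).add ((hf.opLb hB).rmul _ (smooth_coef hB))).sub
    (((hf.angL.sub (hf.smul 2)).add (hf.rmul _ (smooth_six hB))).rmul _ hB.smooth_w)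
  have h2 := h1.eq_zero_iff.1 (EqOnRegion.trans (by
    intro t r θ φ hr
    simp only [teukP, Pi.add_apply, Pi.sub_apply, Pi.neg_apply, TeukolskySAdS.rmul,
      coef_eq hB hr.2.1]
    rfl) h)
  · intro m ℓ hA
    have h3 : -(C2 rp t0).L hB ((C2 rp t0).Lb hB (A m ℓ)) +
      (C2 rp t0).rad (rmk _ (smooth_coef hB)) * (C2 rp t0).Lb hB (A m ℓ) -
      (C2 rp t0).w hB * (eigL m ℓ • A m ℓ - (2 : ℂ) • A m ℓ +
        (C2 rp t0).rad (rmk _ (smooth_six hB)) * A m ℓ) = 0 := h2 m ℓ hA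
    rw [rad_coef hB, rad_six hB, smul_eq_mLam, Algebra.smul_def (2 : ℂ), map_ofNat] at h3
    unfold ModeTeuk NullPair.Teuk
    linear_combination -h3

/-- Conjugation turns 𝓛^{[-2]} into 𝓛^{[+2]}; what then still distinguishes the equation from the
spin +2 one is the reflection (L, L̲) ↦ (-L̲, -L). -/
theorem RepS.mode_teukM (hf : RepS (cc f) A) (h : EqOnRegion rp t0 (teukM M k t0 f) 0) :
    ∀ m ℓ, Adm m ℓ → ModeTeuk' hB ℓ (A m ℓ) := by
  have h0 : EqOnRegion rp t0 (cc (teukM M k t0 f)) 0 := fun t r θ φ hr => by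
    simp only [cc, h t r θ φ hr, Pi.zero_apply, map_zero]
  simp only [teukM, cc_sub, cc_add, cc_neg, cc_opL, cc_opLb, cc_rmul, cc_angL, cc_smul, map_ofNat,
    neg_neg] at h0
  have h1 := ((((hf.opLb hB).opL hB).neg).sub ((hf.opL hB).rmul _ (smooth_coef hB))).sub
    (((hf.angL.sub (hf.smul 2)).add (hf.rmul _ (smooth_six hB))).rmul _ hB.smooth_w)
  have h2 := h1.eq_zero_iff.1 (EqOnRegion.trans (by
    intro t r θ φ hr
    simp only [Pi.add_apply, Pi.sub_apply, Pi.neg_apply, TeukolskySAdS.rmul, coef_eq hB hr.2.1]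
    rfl) h0)
  · intro m ℓ hA
    have h3 : -(C2 rp t0).L hB ((C2 rp t0).Lb hB (A m ℓ)) -
      (C2 rp t0).rad (rmk _ (smooth_coef hB)) * (C2 rp t0).L hB (A m ℓ) -
      (C2 rp t0).w hB * (eigL m ℓ • A m ℓ - (2 : ℂ) • A m ℓ +
        (C2 rp t0).rad (rmk _ (smooth_six hB)) * A m ℓ) = 0 := h2 m ℓ hA
    rw [rad_coef hB, rad_six hB, smul_eq_mLam, Algebra.smul_def (2 : ℂ), map_ofNat] at h3
    unfold ModeTeuk' NullPair.Teuk
    simp only [Derivation.neg_apply, map_neg, neg_neg]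
    rw [(C2 rp t0).L_Lb hB]
    linear_combination -h3

/-- The equation is linear with real coefficients depending on ℓ only, so the conjugate of the mode
-m solves the equation of the mode m. -/
theorem mode_teuk_sy (σ : ℝ) (h : ∀ m ℓ, Adm m ℓ → ModeTeuk hB ℓ (A m ℓ)) (hA : Adm m ℓ) :
    ModeTeuk hB ℓ (sy σ A m ℓ) := by
  have h1 := h m ℓ hA
  have h2 := congrArg smConj (h (-m) ℓ hA.neg)
  unfold ModeTeuk NullPair.Teuk at h1 ⊢
  have hl : smConj (mLam rp t0 ℓ) = mLam rp t0 ℓ := by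
    have := conj2_real (rp := rp) (t0 := t0) ((ℓ : ℝ) * (ℓ + 1))
    push_cast at this
    exact this
  simp only [conj2_L, conj2_Lb, conj2_sub, IsFam.conj_mul2, conj2_ofNat, pow_two, conj2_w, conj2_x,
    conj2_real, conj2_add, hl] at h2
  have sd : ∀ (c : ℂ) (a : smAlg (U2 rp t0)), c • a = algebraMap ℂ _ c * a := Algebra.smul_def
  simp only [sy, Derivation.map_smul, map_add]
  rw [h1, h2]
  simp only [sd]
  ring

theorem mode_teuk_sy' (σ : ℝ) (h : ∀ m ℓ, Adm m ℓ → ModeTeuk' hB ℓ (A m ℓ)) (hA : Adm m ℓ) :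
    ModeTeuk' hB ℓ (sy σ A m ℓ) := by
  have h1 := h m ℓ hA
  have h2 := congrArg smConj (h (-m) ℓ hA.neg)
  unfold ModeTeuk' NullPair.Teuk at h1 ⊢
  simp only [Derivation.neg_apply, map_neg, neg_neg] at h1 h2 ⊢
  have hl : smConj (mLam rp t0 ℓ) = mLam rp t0 ℓ := by
    have := conj2_real (rp := rp) (t0 := t0) ((ℓ : ℝ) * (ℓ + 1))
    push_cast at this
    exact this
  have hn : ∀ a : smAlg (U2 rp t0), smConj (-a) = -smConj a := fun a => sm_ext fun x _ => by
    simp only [smEv_conj, smEv_neg, map_neg]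
  simp only [conj2_L, conj2_Lb, conj2_sub, IsFam.conj_mul2, conj2_ofNat, pow_two, conj2_w, conj2_x,
    conj2_real, conj2_add, hl, hn] at h2
  have sd : ∀ (c : ℂ) (a : smAlg (U2 rp t0)), c • a = algebraMap ℂ _ c * a := Algebra.smul_def
  simp only [sy, Derivation.map_smul, map_add]
  rw [h1, h2]
  simp only [sd]
  ring

theorem isUnit_mM (hB : Background M k rp) : IsUnit (mM M rp t0) :=
  ((isUnit_iff_ne_zero.2 (Complex.ofReal_ne_zero.2 hB.M_pos.ne')).map (algebraMap ℂ _))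

theorem eigN_ne_zero (hA : Adm m ℓ) : eigN m ℓ ≠ 0 := by
  obtain ⟨n, rfl⟩ : ∃ n, ℓ = n + 2 := ⟨ℓ - 2, by have := hA.1; omega⟩
  rw [eigN_add_two]
  exact_mod_cast (by positivity : (n + 1) * (n + 2) * (n + 3) * (n + 4) ≠ 0)

theorem mN_eq : mLam rp t0 ℓ * (mLam rp t0 ℓ - 2) = algebraMap ℂ _ (eigN m ℓ) := by
  unfold eigN mLam
  rw [map_mul, map_sub, map_ofNat]
  rfl

theorem isUnit_mN (hA : Adm m ℓ) : IsUnit (mLam rp t0 ℓ * (mLam rp t0 ℓ - 2)) := by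
  rw [mN_eq (m := m)]
  exact (isUnit_iff_ne_zero.2 (eigN_ne_zero hA)).map (algebraMap ℂ _)

/-- For ℓ ≥ 2 and r > 0 the function λ - 2 + 6M/r is positive, and its inverse is a smooth radial
function. -/
theorem isUnit_pot (hA : Adm m ℓ) :
    IsUnit (mLam rp t0 ℓ - 2 + 6 * mM M rp t0 * (C2 rp t0).x hB) := by
  have hpos : ∀ r, rp < r → 0 < (ℓ : ℝ) * (ℓ + 1) - 2 + 6 * M * r⁻¹ := fun r hr => by
    have h1 := inv_pos.2 (hB.r_pos hr)
    have h2 : (2 : ℝ) ≤ ℓ := by exact_mod_cast hA.1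
    have := mul_pos hB.M_pos h1
    nlinarith
  have hs : ContDiffOn ℝ ∞ (fun r : ℝ => ((ℓ : ℝ) * (ℓ + 1) - 2 + 6 * M * r⁻¹)⁻¹) (Ioi rp) :=
    (contDiffOn_const.add (contDiffOn_const.mul hB.smooth_inv)).inv fun r hr => (hpos r hr).ne'
  refine IsUnit.of_mul_eq_one ((C2 rp t0).rad (rmk _ hs)) (sm_ext fun p hp => ?_)
  have h1 := (hpos _ ((C2 rp t0).maps hp)).ne'
  simp only [smEv_mul, smEv_add, smEv_sub, smEv_ofNat _ hp, smEv_algebraMap _ hp, smEv_one hp,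
    Chart.x, smEv_rad_rmk _ _ _ hp]
  have h2 : eigL 0 ℓ - 2 + 6 * (M : ℂ) * (((C2 rp t0).ρ p)⁻¹ : ℝ) =
    (((ℓ : ℝ) * (ℓ + 1) - 2 + 6 * M * ((C2 rp t0).ρ p)⁻¹ : ℝ) : ℂ) := by
      unfold eigL
      push_cast
      ring
  rw [h2, ← Complex.ofReal_mul, mul_inv_cancel₀ h1, Complex.ofReal_one]

/-! ### The Teukolsky-Starobinsky relations for modes -/

/-- The Teukolsky-Starobinsky relations of a pair of modes. -/
def ModeTS (σ : ℂ) (ℓ : ℕ) (a b : smAlg (U2 rp t0)) : Prop :=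
  letI L := (C2 rp t0).L hB
  letI Lb := (C2 rp t0).Lb hB
  letI w := (C2 rp t0).w hB
  letI v := (C2 rp t0).v hB
  letI N := mLam rp t0 ℓ * (mLam rp t0 ℓ - 2)
  w ^ 2 * (v * L (v * L (v * L (v * L b)))) = σ • (N * a) - 6 * mM M rp t0 * (L a + Lb a) ∧
  w ^ 2 * (v * Lb (v * Lb (v * Lb (v * Lb a)))) = σ • (N * b) + 6 * mM M rp t0 * (L b + Lb b)

theorem rad_w_sq : (C2 rp t0).rad (rmk _ (hB.smooth_w.pow 2)) = (C2 rp t0).w hB ^ 2 :=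
  sm_ext fun p hp => by
    rw [smEv_rad_rmk _ _ _ hp, smEv_pow _ _ hp, Chart.w, smEv_rad_rmk _ _ _ hp]
    push_cast
    rfl

/-- The second relation is an identity between spin -2 functions. Conjugating it expresses
everything through f and the conjugate of g, both of which have spin +2 mode expansions. -/
theorem ts_iff {σ : ℂ} (hσ : starRingEnd ℂ σ = σ) (hf : RepS f A) (hg : RepS (cc g) B) :
    TSRelations M k rp t0 σ f g ↔ ∀ m ℓ, Adm m ℓ → ModeTS hB σ ℓ (A m ℓ) (B m ℓ) := by
  unfold TSRelations
  rw [← EqOnRegion.cc_iff (f := rmul _ ((winvLb M k t0)^[4] (cc f)))]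
  have e1 : cc (rmul (fun r => wfun M k r ^ 2) ((winvLb M k t0)^[4] (cc f))) =
      rmul (fun r => wfun M k r ^ 2) ((winvLb M k t0)^[4] f) := by
    simp only [Function.iterate_succ, Function.iterate_zero, Function.comp, id, cc_rmul, cc_winvLb,
      cc_cc]
  have e2 : cc (σ • angL4 (-2) g + (12 * M : ℂ) • dT t0 g) =
      σ • angL4 2 (cc g) + (12 * M : ℂ) • dT t0 (cc g) := by
    simp only [cc_add, cc_smul, cc_angL4, cc_dT, hσ, map_mul, map_ofNat, Complex.conj_ofReal,
      neg_neg]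
  rw [e1, e2]
  have h1 : RepS ((winvL M k t0)^[4] (cc g)) (mvL hB (mvL hB (mvL hB (mvL hB B)))) :=
    (((hg.winvL hB).winvL hB).winvL hB).winvL hB
  have h2 : RepS ((winvLb M k t0)^[4] f) (mvLb hB (mvLb hB (mvLb hB (mvLb hB A)))) :=
    (((hf.winvLb hB).winvLb hB).winvLb hB).winvLb hB
  rw [(h1.rmul _ (hB.smooth_w.pow 2)).eqOn_iff ((hf.angL4.smul σ).sub (hf.dT.smul (12 * M))),
    (h2.rmul _ (hB.smooth_w.pow 2)).eqOn_iff ((hg.angL4.smul σ).add (hg.dT.smul (12 * M))),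
    ← forall_and]
  refine forall_congr' fun m => ?_
  rw [← forall_and]
  refine forall_congr' fun ℓ => ?_
  rw [← forall_and]
  refine forall_congr' fun hA => ?_
  unfold ModeTS
  rw [← rad_w_sq, ← twelve_T, ← twelve_T, ← eigN_smul (m := m), ← eigN_smul (m := m)]
  rfl

/-- `Ψ^{[+2]} - (Ψ^{[-2]})^*` for a pair of modes. -/
abbrev modeD (a b : smAlg (U2 rp t0)) : smAlg (U2 rp t0) :=
  (C2 rp t0).v hB * (C2 rp t0).Lb hB ((C2 rp t0).v hB * (C2 rp t0).Lb hB a) -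
    (C2 rp t0).v hB * (C2 rp t0).L hB ((C2 rp t0).v hB * (C2 rp t0).L hB b)

/-- `Ψ^{[+2]} + (Ψ^{[-2]})^*` for a pair of modes. -/
abbrev modeS (a b : smAlg (U2 rp t0)) : smAlg (U2 rp t0) :=
  (C2 rp t0).v hB * (C2 rp t0).Lb hB ((C2 rp t0).v hB * (C2 rp t0).Lb hB a) +
    (C2 rp t0).v hB * (C2 rp t0).L hB ((C2 rp t0).v hB * (C2 rp t0).L hB b)

/-- `𝓛 (𝓛 - 2) Ψ^R` for a pair of modes. -/
abbrev modeR (ℓ : ℕ) (a b : smAlg (U2 rp t0)) : smAlg (U2 rp t0) :=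
  mLam rp t0 ℓ * (mLam rp t0 ℓ - 2) * modeS hB a b +
    6 * mM M rp t0 * ((C2 rp t0).L hB (modeD hB a b) + (C2 rp t0).Lb hB (modeD hB a b))

theorem RepS.PsiD (hf : RepS f A) (hg : RepS (cc g) B) :
    RepS (PsiD M k t0 f g) (mvLb hB (mvLb hB A) - mvL hB (mvL hB B)) := by
  unfold TeukolskySAdS.PsiD
  rw [cc_PsiM]
  exact ((hf.winvLb hB).winvLb hB).sub ((hg.winvL hB).winvL hB)

theorem psiD_iff (hf : RepS f A) (hg : RepS (cc g) B) :
    EqOnRegion rp t0 (symP (PsiD M k t0 f g)) 0 ↔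
      ∀ m ℓ, Adm m ℓ → modeD hB (sy 1 A m ℓ) (sy 1 B m ℓ) = 0 := by
  rw [(hf.PsiD hB hg).symP'.eq_zero_iff, sy_sub, sy_mvLb, sy_mvLb, sy_mvL, sy_mvL]
  rfl

/-- Multiplying each mode by N ≠ 0 clears the inverse elliptic operator and produces `modeR`. -/
theorem psiR_iff (hf : RepS f A) (hg : RepS (cc g) B) :
    EqOnRegion rp t0 (antiP (PsiR M k t0 f g)) 0 ↔
      ∀ m ℓ, Adm m ℓ → modeR hB ℓ (sy (-1) A m ℓ) (sy (-1) B m ℓ) = 0 := by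
  have h1 : RepS (PsiR M k t0 f g) (mvLb hB (mvLb hB A) + mvL hB (mvL hB B) +
      wt (fun _ _ => (12 * M : ℂ)) (wt (fun m ℓ => (eigN m ℓ)⁻¹)
        (mT (mvLb hB (mvLb hB A) - mvL hB (mvL hB B))))) := by
    unfold PsiR
    rw [cc_PsiM]
    exact (((hf.winvLb hB).winvLb hB).add ((hg.winvL hB).winvL hB)).add
      (((((hf.winvLb hB).winvLb hB).sub ((hg.winvL hB).winvL hB)).dT.invAngL4).smul _)
  have hreal : ∀ (m : ℤ) (ℓ : ℕ), starRingEnd ℂ (eigN m ℓ)⁻¹ = (eigN m ℓ)⁻¹ := fun m ℓ => by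
    simp only [eigN, eigL, map_inv₀, map_mul, map_sub, map_add, map_natCast, map_one, map_ofNat]
  rw [h1.antiP'.eq_zero_iff, sy_add, sy_add, sy_wt (-1) (fun _ _ => by simp only [map_mul, map_ofNat, Complex.conj_ofReal]), sy_wt (-1) (fun m ℓ => hreal m ℓ),
    sy_mT, sy_sub, sy_mvLb, sy_mvLb, sy_mvL, sy_mvL]
  refine forall_congr' fun m => forall_congr' fun ℓ => forall_congr' fun hA => ?_
  have hN := eigN_ne_zero hA
  change modeS hB (sy (-1) A m ℓ) (sy (-1) B m ℓ) + (12 * M : ℂ) • ((eigN m ℓ)⁻¹ •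
    (C2 rp t0).T (modeD hB (sy (-1) A m ℓ) (sy (-1) B m ℓ))) = 0 ↔ _
  rw [smul_comm, modeR, ← twelve_T, ← eigN_smul (m := m), ← (smul_right_injective _ hN).eq_iff,
    smul_zero]
  simp only [smul_add, smul_inv_smul₀ hN]

end
end TeukolskySAdS

open scoped ContDiff
namespace TeukolskySAdS
open Set Filter Topology
noncomputable section

open Chart Fm

variable {m : ℤ} {ℓ : ℕ} {M k rp t0 : ℝ}

/-! ### Bounded and decaying modes at infinity -/

/-- The filter of neighbourhoods of `(t, ∞)`. -/
abbrev nhdsInf (t0 t : ℝ) : Filter (ℝ × ℝ) := 𝓝[Ici t0] t ×ˢ atTop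

theorem nhdsInf_U2 (rp t0 t : ℝ) : ∀ᶠ p in nhdsInf t0 t, p ∈ U2 rp t0 :=
  prod_mem_prod self_mem_nhdsWithin (Ioi_mem_atTop rp)

theorem tendsto_nhdsInf {t : ℝ} (ht : t0 ≤ t) : Tendsto (fun r => (t, r)) atTop (nhdsInf t0 t) :=
  Tendsto.prodMk (tendsto_const_pure.mono_right (pure_le_nhdsWithin ht)) tendsto_id

/-- Functions which are bounded near infinity. -/
def bdInf (rp t0 : ℝ) : Subalgebra ℂ (smAlg (U2 rp t0)) where
  carrier := {h | ∀ t, t0 ≤ t → ∃ C : ℝ, ∀ᶠ p in nhdsInf t0 t, ‖smEv h p‖ ≤ C}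
  mul_mem' {a b} ha hb t ht := by
    obtain ⟨C, hC⟩ := ha t ht
    obtain ⟨D, hD⟩ := hb t ht
    refine ⟨C * D, ?_⟩
    filter_upwards [hC, hD] with p h1 h2
    rw [smEv_mul, norm_mul]
    exact mul_le_mul h1 h2 (norm_nonneg _) ((norm_nonneg _).trans h1)
  add_mem' {a b} ha hb t ht := by
    obtain ⟨C, hC⟩ := ha t ht
    obtain ⟨D, hD⟩ := hb t ht
    refine ⟨C + D, ?_⟩
    filter_upwards [hC, hD] with p h1 h2
    rw [smEv_add]
    exact (norm_add_le _ _).trans (add_le_add h1 h2)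
  algebraMap_mem' c t ht := by
    refine ⟨‖c‖, ?_⟩
    filter_upwards [nhdsInf_U2 rp t0 t] with p hp
    rw [smEv_algebraMap c hp]

/-- Functions which tend to zero at infinity, at each time. -/
def decInf (rp t0 : ℝ) : Submodule ℂ (smAlg (U2 rp t0)) where
  carrier := {h | ∀ t, t0 ≤ t → Tendsto (fun r => smEv h (t, r)) atTop (𝓝 0)}
  add_mem' {a b} ha hb t ht := by
    simpa only [smEv_add, add_zero] using (ha t ht).add (hb t ht)
  zero_mem' t ht := by
    simp only [smEv_zero]
    exact tendsto_const_nhds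
  smul_mem' c a ha t ht := by
    simpa only [smEv_smul, mul_zero] using (ha t ht).const_mul c

variable {a b h g : smAlg (U2 rp t0)}

theorem mul_mem_decInf (hg : g ∈ bdInf rp t0) (hh : h ∈ decInf rp t0) : g * h ∈ decInf rp t0 := by
  intro t ht
  obtain ⟨C, hC⟩ := hg t ht
  have h1 := (tendsto_nhdsInf ht).eventually hC
  have h2 := (hh t ht).norm.const_mul C
  rw [norm_zero, mul_zero] at h2
  refine squeeze_zero_norm' ?_ h2
  filter_upwards [h1] with r hr
  rw [smEv_mul, norm_mul]
  exact mul_le_mul_of_nonneg_right hr (norm_nonneg _)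

theorem rad_mem_bdInf (c : ℝ → ℝ) (hc : ContDiffOn ℝ ∞ c (Ioi rp)) {y : ℝ}
    (hy : Tendsto c atTop (𝓝 y)) : (C2 rp t0).rad (rmk c hc) ∈ bdInf rp t0 := by
  intro t ht
  refine ⟨|y| + 1, ?_⟩
  have h1 := hy.abs.eventually_le_const (lt_add_one |y|)
  have h2 : ∀ᶠ p in nhdsInf t0 t, |c p.2| ≤ |y| + 1 := tendsto_snd.eventually h1
  filter_upwards [nhdsInf_U2 rp t0 t, h2] with p hp h3
  rw [smEv_rad_rmk _ _ _ hp, Complex.norm_real]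
  exact h3

variable (hB : Background M k rp)

theorem tendsto_wfun (M k : ℝ) : Tendsto (wfun M k) atTop (𝓝 (k ^ 2)) := by
  have hi : Tendsto (fun r : ℝ => r⁻¹) atTop (𝓝 0) := tendsto_inv_atTop_zero
  have h1 : Tendsto (fun r : ℝ => r⁻¹ ^ 2 + k ^ 2 - 2 * M * r⁻¹ ^ 3) atTop
      (𝓝 (0 ^ 2 + k ^ 2 - 2 * M * 0 ^ 3)) :=
    ((hi.pow 2).add tendsto_const_nhds).sub (tendsto_const_nhds.mul (hi.pow 3))
  have e : (0 : ℝ) ^ 2 + k ^ 2 - 2 * M * 0 ^ 3 = k ^ 2 := by ring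
  rw [e] at h1
  refine h1.congr' ?_
  filter_upwards [eventually_gt_atTop 0] with r hr
  unfold wfun Del
  field_simp

theorem x_mem_bdInf : (C2 rp t0).x hB ∈ bdInf rp t0 :=
  rad_mem_bdInf _ _ tendsto_inv_atTop_zero

theorem w_mem_bdInf : (C2 rp t0).w hB ∈ bdInf rp t0 := rad_mem_bdInf _ _ (tendsto_wfun M k)

theorem v_mem_bdInf : (C2 rp t0).v hB ∈ bdInf rp t0 :=
  rad_mem_bdInf _ _ ((tendsto_wfun M k).inv₀ (pow_ne_zero 2 hB.k_pos.ne'))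

theorem x_mem_decInf : (C2 rp t0).x hB ∈ decInf rp t0 := by
  intro t ht
  have h1 : Tendsto (fun r : ℝ => ((r⁻¹ : ℝ) : ℂ)) atTop (𝓝 0) := by
    have := (Complex.continuous_ofReal.tendsto 0).comp tendsto_inv_atTop_zero
    rwa [Complex.ofReal_zero] at this
  refine h1.congr' ?_
  filter_upwards [Ioi_mem_atTop rp] with r hr
  exact ((C2 rp t0).smEv_rad_rmk _ _ (mem_U2.2 ⟨ht, hr⟩)).symm

theorem hasDerivWithinAt_smEv_t (h : smAlg (U2 rp t0)) {t r : ℝ} (hp : (t, r) ∈ U2 rp t0) :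
    HasDerivWithinAt (fun τ => smEv h (τ, r)) (smEv ((C2 rp t0).T h) (t, r)) (Ici t0) t :=
  smEv_comp_hasDerivWithinAt h (γ := fun τ => (τ, r)) (v := (1, 0))
    ((hasDerivWithinAt_id _ _).prodMk (hasDerivWithinAt_const _ _ _)) (fun _ hτ => ⟨hτ, hp.2⟩) hp

theorem hasDerivAt_smEv_r (h : smAlg (U2 rp t0)) {t r : ℝ} (hp : (t, r) ∈ U2 rp t0) :
    HasDerivAt (fun ρ => smEv h (t, ρ)) (smEv ((C2 rp t0).R h) (t, r)) r :=
  (smEv_comp_hasDerivWithinAt h (γ := fun τ => (t, τ)) (v := (0, 1)) (J := Ioi rp)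
    ((hasDerivWithinAt_const _ _ _).prodMk (hasDerivWithinAt_id _ _)) (fun _ hτ => ⟨hp.1, hτ⟩)
      hp).hasDerivAt (Ioi_mem_nhds hp.2)

/-- Time derivatives of decaying functions with bounded second derivatives decay. -/
theorem T_mem_decInf (hh : h ∈ decInf rp t0) (hb : (C2 rp t0).T ((C2 rp t0).T h) ∈ bdInf rp t0) :
    (C2 rp t0).T h ∈ decInf rp t0 := by
  intro t ht
  obtain ⟨C, hC⟩ := hb t ht
  obtain ⟨pa, ha, pb, hpb, hab⟩ := eventually_prod_iff.1 hC
  obtain ⟨ε, hε, hεa⟩ := Metric.mem_nhdsWithin_iff.1 ha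
  rw [Metric.tendsto_nhds]
  intro η hη
  set C' := max C 0
  have hC'0 : 0 ≤ C' := le_max_right _ _
  -- From ‖s ∂_th(t)‖ ≤ ‖h(t+s)‖ + ‖h(t)‖ + C's² one first fixes s small, then takes r large. The
  -- step goes forward in time so as to remain in t⋆ ≥ t0.
  obtain ⟨s, hs0, hsε, hsη⟩ : ∃ s, 0 < s ∧ s < ε ∧ C' * s < η / 2 := by
    refine ⟨min (ε / 2) (η / (4 * (C' + 1))), by positivity, ?_, ?_⟩
    · exact (min_le_left _ _).trans_lt (half_lt_self hε)
    · calc C' * min (ε / 2) (η / (4 * (C' + 1))) ≤ C' * (η / (4 * (C' + 1))) :=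
            mul_le_mul_of_nonneg_left (min_le_right _ _) hC'0
        _ < η / 2 := by
          rw [← mul_div_assoc, div_lt_div_iff₀ (by positivity) (by positivity)]
          nlinarith
  have hts : t0 ≤ t + s := by linarith
  have z1 := (hh t ht).norm.eventually_lt_const (u := s * (η / 4)) (by rw [norm_zero]; positivity)
  have z2 := (hh _ hts).norm.eventually_lt_const (u := s * (η / 4)) (by rw [norm_zero]; positivity)
  filter_upwards [z1, z2, hpb, Ioi_mem_atTop rp] with r h1 h2 h3 h4
  rw [dist_zero_right]
  have hconv : Convex ℝ (Icc t (t + s)) := convex_Icc _ _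
  have hsub : Icc t (t + s) ⊆ Ici t0 := fun τ hτ => ht.trans hτ.1
  have hTT : ∀ τ ∈ Icc t (t + s), ‖smEv ((C2 rp t0).T ((C2 rp t0).T h)) (τ, r)‖ ≤ C' :=
    fun τ hτ => (hab (hεa ⟨by
      rw [Metric.mem_ball, Real.dist_eq, abs_of_nonneg (by linarith [hτ.1])]
      linarith [hτ.2], hsub hτ⟩) h3).trans (le_max_left _ _)
  have hm1 : ∀ τ ∈ Icc t (t + s),
      ‖smEv ((C2 rp t0).T h) (τ, r) - smEv ((C2 rp t0).T h) (t, r)‖ ≤ C' * s := fun τ hτ => by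
    have := hconv.norm_image_sub_le_of_norm_hasDerivWithin_le
      (f := fun τ => smEv ((C2 rp t0).T h) (τ, r))
      (fun x hx => (hasDerivWithinAt_smEv_t ((C2 rp t0).T h)
        (mem_U2.2 ⟨hsub hx, h4⟩)).mono hsub) hTT (left_mem_Icc.2 (by linarith)) hτ
    refine this.trans (mul_le_mul_of_nonneg_left ?_ hC'0)
    rw [Real.norm_eq_abs, abs_of_nonneg (by linarith [hτ.1])]
    linarith [hτ.2]
  have hm2 := hconv.norm_image_sub_le_of_norm_hasDerivWithin_le
      (f := fun τ => smEv h (τ, r) - (τ : ℂ) * smEv ((C2 rp t0).T h) (t, r))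
      (f' := fun τ => smEv ((C2 rp t0).T h) (τ, r) - 1 * smEv ((C2 rp t0).T h) (t, r))
      (fun x hx => ((hasDerivWithinAt_smEv_t h (mem_U2.2 ⟨hsub hx, h4⟩)).mono hsub).sub
        (((hasDerivAt_id x).ofReal_comp.mul_const _).hasDerivWithinAt))
      (C := C' * s) (fun x hx => by rw [one_mul]; exact hm1 x hx)
      (left_mem_Icc.2 (by linarith)) (right_mem_Icc.2 (by linarith))
  have e : (s : ℂ) * smEv ((C2 rp t0).T h) (t, r) = smEv h (t + s, r) - smEv h (t, r) -
      (smEv h (t + s, r) - ((t + s : ℝ) : ℂ) * smEv ((C2 rp t0).T h) (t, r) -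
        (smEv h (t, r) - (t : ℂ) * smEv ((C2 rp t0).T h) (t, r))) := by
    push_cast
    ring
  have e2 := congrArg norm e
  rw [norm_mul, Complex.norm_real, Real.norm_eq_abs, abs_of_pos hs0] at e2
  have e3 := (norm_sub_le (smEv h (t + s, r) - smEv h (t, r))
    (smEv h (t + s, r) - ((t + s : ℝ) : ℂ) * smEv ((C2 rp t0).T h) (t, r) -
        (smEv h (t, r) - (t : ℂ) * smEv ((C2 rp t0).T h) (t, r))))
  have e4 := norm_sub_le (smEv h (t + s, r)) (smEv h (t, r))
  have e5 : ‖t + s - t‖ = s := by rw [add_sub_cancel_left, Real.norm_eq_abs, abs_of_pos hs0]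
  rw [e5] at hm2
  have h6 : s * ‖smEv ((C2 rp t0).T h) (t, r)‖ < s * η := by
    have h7 : C' * s * s < η / 2 * s := mul_lt_mul_of_pos_right hsη hs0
    rw [e2]
    linarith
  exact lt_of_mul_lt_mul_left h6 hs0.le

/-- |g|² has derivative 2c|g|² ≥ 0, so it is nondecreasing with limit zero at infinity. -/
theorem eq_zero_of_growth {g : ℝ → ℂ} {c : ℝ → ℝ} (hg : ∀ r, rp < r → HasDerivAt g (c r * g r) r)
    (hc : ∀ r, rp < r → 0 ≤ c r) (hz : Tendsto g atTop (𝓝 0)) {r : ℝ} (hr : rp < r) : g r = 0 := by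
  have hd : ∀ r, rp < r → HasDerivAt (fun r => ‖g r‖ ^ 2) (2 * (c r * ‖g r‖ ^ 2)) r := fun r hr => by
    refine (hg r hr).norm_sq.congr_deriv ?_
    rw [← smul_eq_mul (c r : ℂ), Complex.coe_smul, inner_smul_right, real_inner_self_eq_norm_sq]
  have hm : MonotoneOn (fun r => ‖g r‖ ^ 2) (Ioi rp) := by
    refine monotoneOn_of_deriv_nonneg (convex_Ioi rp)
      (fun r hr => (hd r hr).continuousAt.continuousWithinAt)
      (fun r hr => (hd r (interior_subset hr)).differentiableAt.differentiableWithinAt)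
      fun r hr => ?_
    have hr := interior_subset hr
    rw [(hd r hr).deriv]
    have := hc r hr
    positivity
  have h1 : Tendsto (fun r => ‖g r‖ ^ 2) atTop (𝓝 0) := by
    simpa using (hz.norm.pow 2)
  have h2 : ‖g r‖ ^ 2 ≤ 0 := by
    refine ge_of_tendsto h1 ?_
    filter_upwards [eventually_ge_atTop r] with s hs using hm hr (hr.trans_le hs) hs
  have h3 := le_antisymm h2 (by positivity)
  simpa using h3

end
end TeukolskySAdS

/-! ### How the conditions at infinity control the difference of the defects -/

open scoped ContDiff
namespace TeukolskySAdS
open Set Filter Topology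
noncomputable section

open Chart Fm

namespace NullPair

variable {A : Type*} [CommRing A] [Algebra ℂ A] {L Lb : Derivation ℂ A A} {w v x m lam a b : A}

/-- L²f + L̲²f is T²f minus twice the mixed derivative, and the Regge-Wheeler equation replaces the
latter by a potential. The only radial derivative left has the coefficient 6mx² - 2x, which decays.
-/
theorem op_add_reverse (h : NullPair L Lb w v x m lam) {f : A} (hf : RW L Lb w x m lam f) :
    w ^ 2 * (v * L (v * L f)) + w ^ 2 * (v * Lb (v * Lb f)) =
      L (L f + Lb f) + Lb (L f + Lb f) + 2 * (w * (lam - 6 * m * x)) * f -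
        (6 * m * x ^ 2 - 2 * x) * (L f - Lb f) := by
  unfold RW at hf
  have hf' := hf
  rw [h.comm] at hf'
  have e1 : L (v * L f) = v * L (L f) - v * (6 * m * x ^ 2 - 2 * x) * L f := by
    rw [Derivation.leibniz, h.Lv, smul_eq_mul, smul_eq_mul]; ring
  have e2 : Lb (v * Lb f) = v * Lb (Lb f) + v * (6 * m * x ^ 2 - 2 * x) * Lb f := by
    rw [Derivation.leibniz, h.Lbv, smul_eq_mul, smul_eq_mul]; ring
  rw [e1, e2, map_add, map_add, hf, hf']
  have hw : w ^ 2 * (v * v) = 1 := by linear_combination (w * v + 1) * h.wv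
  linear_combination (L (L f) - (6 * m * x ^ 2 - 2 * x) * L f + Lb (Lb f) +
    (6 * m * x ^ 2 - 2 * x) * Lb f) * hw

namespace TeukPair

/-- The same mechanism one level lower: the difference of `L_first` and its reflection expresses
w(Ψ₊ - Ψ₋) by a time derivative, a term with decaying coefficient, and a - b. -/
theorem w_mul_diff (h : TeukPair L Lb w v x m lam a b) :
    w * (v * Lb (v * Lb a) - v * L (v * L b)) =
      L (v * Lb a - v * L b) + Lb (v * Lb a - v * L b) -
        (6 * m * x ^ 2 - 2 * x) * (v * Lb a + v * L b) + (lam - 2 + 6 * m * x) * (a - b) := by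
  have e1 := h.L_first h.ha
  have e2 := h.reverse.L_first h.hb
  simp only [Derivation.neg_apply, mul_neg, map_neg, neg_neg] at e2
  rw [map_sub, map_sub]
  linear_combination (Lb (v * Lb a) - L (v * L b)) * h.wv - e1 + e2

/-- J plays the bounded functions and Z the decaying ones, on which J acts. Decay climbs from a - b
to vL̲a - vLb, then to Ψ₊ - Ψ₋, then to the sum of its two transforms; `landau` handles each T. -/
theorem defect_sub_mem (h : TeukPair L Lb w v x m lam a b) {J : Subalgebra ℂ A}
    {Z : Submodule ℂ A} (hJZ : ∀ g ∈ J, ∀ f ∈ Z, g * f ∈ Z) (hL : ∀ f ∈ J, L f ∈ J)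
    (hLb : ∀ f ∈ J, Lb f ∈ J) (landau : ∀ f ∈ J, f ∈ Z → L f + Lb f ∈ Z) (hx : x ∈ J) (hxZ : x ∈ Z)
    (hw : w ∈ J) (hv : v ∈ J) (hm : m ∈ J) (hl : lam ∈ J) (ha : a ∈ J) (hb : b ∈ J)
    (h1 : a - b ∈ Z) (h2 : L (a + b) - Lb (a + b) ∈ Z) :
    w ^ 2 * (v * L (v * L (v * Lb (v * Lb a) - v * L (v * L b)))) +
      w ^ 2 * (v * Lb (v * Lb (v * Lb (v * Lb a) - v * L (v * L b)))) ∈ Z := by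
  have hn : ∀ (n : ℕ) [n.AtLeastTwo], (ofNat(n) : A) ∈ J := fun n _ => by
    have := J.algebraMap_mem (ofNat(n) : ℂ)
    rwa [map_ofNat] at this
  have hqZ : 6 * m * x ^ 2 - 2 * x ∈ Z := by
    have e : 6 * m * x ^ 2 - 2 * x = (6 * m * x - 2) * x := by ring
    rw [e]
    exact hJZ _ (sub_mem (mul_mem (mul_mem (hn 6) hm) hx) (hn 2)) _ hxZ
  have hqm : ∀ f ∈ J, (6 * m * x ^ 2 - 2 * x) * f ∈ Z := fun f hf => by
    rw [mul_comm]; exact hJZ _ hf _ hqZ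
  have e0 := h.w_mul_diff
  have rw1 := h.RWp.sub h.RWm
  have hPJ : v * Lb a ∈ J := mul_mem hv (hLb _ ha)
  have hQJ : v * L b ∈ J := mul_mem hv (hL _ hb)
  -- Twice this difference is v(T(a - b) - (L - L̲)(a + b)): the Dirichlet condition controls the
  -- first term, the Neumann condition the second.
  have hPQ : v * Lb a - v * L b ∈ Z := by
    have e : (2 : ℂ) • (v * Lb a - v * L b) =
        v * (L (a - b) + Lb (a - b) - (L (a + b) - Lb (a + b))) := by
      rw [two_smul, map_sub, map_sub, map_add, map_add]
      ring
    have h3 := Submodule.smul_mem _ (1 / 2 : ℂ)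
      (e ▸ hJZ _ hv _ (Submodule.sub_mem _ (landau _ (sub_mem ha hb) h1) h2))
    rw [smul_smul] at h3
    norm_num at h3
    exact h3
  have hΨJ : v * Lb (v * Lb a) - v * L (v * L b) ∈ J :=
    sub_mem (mul_mem hv (hLb _ hPJ)) (mul_mem hv (hL _ hQJ))
  have hwv := h.wv
  rw [h.op_add_reverse rw1]
  generalize v * Lb a = P at *
  generalize v * L b = Q at *
  generalize v * Lb P - v * L Q = Ψ at *
  have hwΨ : w * Ψ ∈ Z := by
    rw [e0]
    exact Submodule.add_mem _ (Submodule.sub_mem _ (landau _ (sub_mem hPJ hQJ) hPQ)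
      (hqm _ (add_mem hPJ hQJ))) (hJZ _ (add_mem (sub_mem hl (hn 2))
        (mul_mem (mul_mem (hn 6) hm) hx)) _ h1)
  have hΨZ : Ψ ∈ Z := by
    have e : Ψ = v * (w * Ψ) := by linear_combination -Ψ * hwv
    rw [e]
    exact hJZ _ hv _ hwΨ
  refine Submodule.sub_mem _ (Submodule.add_mem _ (landau _ (add_mem (hL _ hΨJ) (hLb _ hΨJ))
    (landau _ hΨJ hΨZ)) (hJZ _ ?_ _ hΨZ)) (hqm _ (sub_mem (hL _ hΨJ) (hLb _ hΨJ)))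
  exact mul_mem (hn 2) (mul_mem hw (sub_mem hl (mul_mem (mul_mem (hn 6) hm) hx)))

end TeukPair

end NullPair

variable {m : ℤ} {ℓ : ℕ} {M k rp t0 : ℝ} {a b y z δ h : smAlg (U2 rp t0)}
variable (hB : Background M k rp)

/-! ### The Dirichlet and Neumann conditions for modes -/

/-- `2 ∂_t`. -/
abbrev TT (rp t0 : ℝ) {M k : ℝ} (hB : Background M k rp) :
    Derivation ℂ (smAlg (U2 rp t0)) (smAlg (U2 rp t0)) := (C2 rp t0).L hB + (C2 rp t0).Lb hB

/-- `2 (Δ / r²) ∂_r`. -/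
abbrev DD (rp t0 : ℝ) {M k : ℝ} (hB : Background M k rp) :
    Derivation ℂ (smAlg (U2 rp t0)) (smAlg (U2 rp t0)) := (C2 rp t0).L hB - (C2 rp t0).Lb hB

theorem TT_apply : TT rp t0 hB a = 2 * (C2 rp t0).T a := by
  rw [Derivation.add_apply, Chart.L_apply, Chart.Lb_apply]
  ring

theorem TT_eq_add : TT rp t0 hB a = (C2 rp t0).L hB a + (C2 rp t0).Lb hB a := rfl

theorem DD_eq_sub : DD rp t0 hB a = (C2 rp t0).L hB a - (C2 rp t0).Lb hB a := rfl

theorem TT_DD : TT rp t0 hB (DD rp t0 hB a) = DD rp t0 hB (TT rp t0 hB a) := by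
  simp only [Derivation.add_apply, Derivation.sub_apply, map_add, map_sub, (C2 rp t0).L_Lb hB]
  ring

/-- All derivatives are bounded near infinity. -/
def AllBd (a : smAlg (U2 rp t0)) : Prop :=
  ∀ p q : ℕ, (DD rp t0 hB)^[p] ((TT rp t0 hB)^[q] a) ∈ bdInf rp t0

/-- The algebra generated by the derivatives of two modes, and the background. -/
def jetAlg (a b : smAlg (U2 rp t0)) : Subalgebra ℂ (smAlg (U2 rp t0)) :=
  Algebra.adjoin ℂ ({(C2 rp t0).x hB, (C2 rp t0).w hB, (C2 rp t0).v hB} ∪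
    {f | ∃ p q : ℕ, f = (DD rp t0 hB)^[p] ((TT rp t0 hB)^[q] a) ∨
      f = (DD rp t0 hB)^[p] ((TT rp t0 hB)^[q] b)})

theorem jetAlg_le (ha : AllBd hB a) (hb : AllBd hB b) : jetAlg hB a b ≤ bdInf rp t0 := by
  refine Algebra.adjoin_le ?_
  rintro f (hf | ⟨p, q, rfl | rfl⟩)
  · rcases hf with rfl | rfl | rfl
    exacts [x_mem_bdInf hB, w_mem_bdInf hB, v_mem_bdInf hB]
  · exact ha p q
  · exact hb p q

theorem x_mem_jet : (C2 rp t0).x hB ∈ jetAlg hB a b :=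
  Algebra.subset_adjoin (Or.inl (by simp))

theorem w_mem_jet : (C2 rp t0).w hB ∈ jetAlg hB a b :=
  Algebra.subset_adjoin (Or.inl (by simp))

theorem v_mem_jet : (C2 rp t0).v hB ∈ jetAlg hB a b :=
  Algebra.subset_adjoin (Or.inl (by simp))

theorem left_mem_jet : a ∈ jetAlg hB a b :=
  Algebra.subset_adjoin (Or.inr ⟨0, 0, Or.inl rfl⟩)

theorem right_mem_jet : b ∈ jetAlg hB a b :=
  Algebra.subset_adjoin (Or.inr ⟨0, 0, Or.inr rfl⟩)

theorem ofNat_mem (S : Subalgebra ℂ (smAlg (U2 rp t0))) (n : ℕ) [n.AtLeastTwo] :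
    (ofNat(n) : smAlg (U2 rp t0)) ∈ S := by
  have := S.algebraMap_mem (ofNat(n) : ℂ)
  rwa [map_ofNat] at this

theorem q_mem_jet : 6 * mM M rp t0 * (C2 rp t0).x hB ^ 2 - 2 * (C2 rp t0).x hB ∈ jetAlg hB a b :=
  sub_mem (mul_mem (mul_mem (ofNat_mem _ 6) (Subalgebra.algebraMap_mem _ _))
    (pow_mem (x_mem_jet hB) 2)) (mul_mem (ofNat_mem _ 2) (x_mem_jet hB))

theorem derivation_mem_jet (d : Derivation ℂ (smAlg (U2 rp t0)) (smAlg (U2 rp t0)))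
    {s : Set (smAlg (U2 rp t0))} (hd : ∀ f ∈ s, d f ∈ Algebra.adjoin ℂ s)
    (hh : h ∈ Algebra.adjoin ℂ s) : d h ∈ Algebra.adjoin ℂ s := by
  induction hh using Algebra.adjoin_induction with
  | mem x hx => exact hd x hx
  | algebraMap c => rw [Derivation.map_algebraMap]; exact zero_mem _
  | add x y _ _ hx hy => rw [map_add]; exact add_mem hx hy
  | mul x y hx' hy' hx hy =>
    rw [Derivation.leibniz, smul_eq_mul, smul_eq_mul]
    exact add_mem (mul_mem hx' hy) (mul_mem hy' hx)

/-- Stability is checked on generators: T and L - L̲ commute, so they permute the words applied to a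
and b, and the background functions are closed under both. -/
theorem L_mem_jet_aux : (∀ h ∈ jetAlg hB a b, TT rp t0 hB h ∈ jetAlg hB a b) ∧
    (∀ h ∈ jetAlg hB a b, DD rp t0 hB h ∈ jetAlg hB a b) := by
  have np := (C2 rp t0).nullPair hB 0
  have hq := q_mem_jet hB (a := a) (b := b)
  have hx := x_mem_jet hB (a := a) (b := b)
  have hw := w_mem_jet hB (a := a) (b := b)
  have hv := v_mem_jet hB (a := a) (b := b)
  refine ⟨fun h hh => derivation_mem_jet _ ?_ hh, fun h hh => derivation_mem_jet _ ?_ hh⟩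
  · rintro f (hf | ⟨p, q, hpq⟩)
    · rcases hf with rfl | rfl | rfl
      · rw [Derivation.add_apply, np.Lx, np.Lbx, neg_add_cancel]
        exact zero_mem _
      · rw [Derivation.add_apply, np.Lw, np.Lbw, add_neg_cancel]
        exact zero_mem _
      · rw [Derivation.add_apply, np.Lv, np.Lbv, neg_add_cancel]
        exact zero_mem _
    · have hc : Function.Commute (TT rp t0 hB) (DD rp t0 hB) := fun f => TT_DD hB
      have e : ∀ c : smAlg (U2 rp t0), TT rp t0 hB ((DD rp t0 hB)^[p] ((TT rp t0 hB)^[q] c)) =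
          (DD rp t0 hB)^[p] ((TT rp t0 hB)^[q + 1] c) := fun c => by
        rw [Function.iterate_succ_apply']
        exact (hc.iterate_right p) _
      refine Algebra.subset_adjoin (Or.inr ⟨p, q + 1, ?_⟩)
      rcases hpq with rfl | rfl
      · exact Or.inl (e a)
      · exact Or.inr (e b)
  · rintro f (hf | ⟨p, q, hpq⟩)
    · rcases hf with rfl | rfl | rfl
      · rw [Derivation.sub_apply, np.Lx, np.Lbx]
        exact sub_mem (neg_mem hw) hw
      · rw [Derivation.sub_apply, np.Lw, np.Lbw]
        exact sub_mem (mul_mem hw hq) (neg_mem (mul_mem hw hq))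
      · rw [Derivation.sub_apply, np.Lv, np.Lbv]
        exact sub_mem (neg_mem (mul_mem hv hq)) (mul_mem hv hq)
    · refine Algebra.subset_adjoin (Or.inr ⟨p + 1, q, ?_⟩)
      rcases hpq with rfl | rfl
      · exact Or.inl (Function.iterate_succ_apply' _ _ _).symm
      · exact Or.inr (Function.iterate_succ_apply' _ _ _).symm

theorem TT_mem_jet (hh : h ∈ jetAlg hB a b) : TT rp t0 hB h ∈ jetAlg hB a b :=
  (L_mem_jet_aux hB).1 h hh

theorem DD_mem_jet (hh : h ∈ jetAlg hB a b) : DD rp t0 hB h ∈ jetAlg hB a b :=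
  (L_mem_jet_aux hB).2 h hh

theorem L_mem_jet (hh : h ∈ jetAlg hB a b) : (C2 rp t0).L hB h ∈ jetAlg hB a b := by
  have h1 := Subalgebra.smul_mem _ (add_mem (TT_mem_jet hB hh) (DD_mem_jet hB hh)) (1 / 2 : ℂ)
  rw [TT_eq_add, DD_eq_sub, add_add_sub_cancel, ← two_smul ℂ, smul_smul] at h1
  norm_num at h1
  exact h1

theorem Lb_mem_jet (hh : h ∈ jetAlg hB a b) : (C2 rp t0).Lb hB h ∈ jetAlg hB a b := by
  have h1 := sub_mem (TT_mem_jet hB hh) (L_mem_jet hB hh)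
  rwa [TT_eq_add, add_sub_cancel_left] at h1

theorem TT_mem_decInf (hh : h ∈ decInf rp t0) (hb : TT rp t0 hB (TT rp t0 hB h) ∈ bdInf rp t0) :
    TT rp t0 hB h ∈ decInf rp t0 := by
  have e : ∀ f : smAlg (U2 rp t0), TT rp t0 hB f = (2 : ℂ) • (C2 rp t0).T f := fun f => by
    rw [TT_apply, Algebra.smul_def, map_ofNat]
  rw [e]
  refine Submodule.smul_mem _ _ (T_mem_decInf hh ?_)
  rw [e, e, Derivation.map_smul, smul_smul] at hb
  have := Subalgebra.smul_mem _ hb (1 / 4 : ℂ)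
  rw [smul_smul] at this
  norm_num at this
  exact this

/-- The difference of the two defects of the antisymmetric Teukolsky-Starobinsky relations
decays. -/
theorem defect_sub_mem_decInf (hp : ModePair hB ℓ a b) (ha : AllBd hB a) (hb : AllBd hB b)
    (h1 : a - b ∈ decInf rp t0) (h2 : DD rp t0 hB (a + b) ∈ decInf rp t0) :
    (C2 rp t0).w hB ^ 2 * ((C2 rp t0).v hB * (C2 rp t0).L hB ((C2 rp t0).v hB * (C2 rp t0).L hB
      (modeD hB a b))) + (C2 rp t0).w hB ^ 2 * ((C2 rp t0).v hB * (C2 rp t0).Lb hB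
      ((C2 rp t0).v hB * (C2 rp t0).Lb hB (modeD hB a b))) ∈ decInf rp t0 := by
  have hle := jetAlg_le hB ha hb
  rw [DD_eq_sub] at h2
  have landau : ∀ f ∈ jetAlg hB a b, f ∈ decInf rp t0 →
      (C2 rp t0).L hB f + (C2 rp t0).Lb hB f ∈ decInf rp t0 := fun f hf hz => by
    rw [← TT_eq_add]
    exact TT_mem_decInf hB hz (hle (TT_mem_jet hB (TT_mem_jet hB hf)))
  have hmul : ∀ g ∈ jetAlg hB a b, ∀ f ∈ decInf rp t0, g * f ∈ decInf rp t0 :=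
    fun _ hg _ hf => mul_mem_decInf (hle hg) hf
  have hL : ∀ f ∈ jetAlg hB a b, (C2 rp t0).L hB f ∈ jetAlg hB a b := fun _ hf => L_mem_jet hB hf
  have hLb : ∀ f ∈ jetAlg hB a b, (C2 rp t0).Lb hB f ∈ jetAlg hB a b := fun _ hf => Lb_mem_jet hB hf
  have key := NullPair.TeukPair.defect_sub_mem hp hmul hL hLb landau
    (x_mem_jet hB) (x_mem_decInf hB) (w_mem_jet hB) (v_mem_jet hB) (Subalgebra.algebraMap_mem _ _)
    (Subalgebra.algebraMap_mem _ _) (left_mem_jet hB) (right_mem_jet hB) h1 h2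
  convert key using 1

end
end TeukolskySAdS

/-! ### Algebraically special defects and their vanishing -/

open scoped ContDiff
namespace TeukolskySAdS
open Set Filter Topology
noncomputable section

open Chart Fm

namespace NullPair

variable {A : Type*} [CommRing A] [Algebra ℂ A] {L Lb : Derivation ℂ A A} {w v x m lam a b : A}

theorem sum_comm_Lb (h : NullPair L Lb w v x m lam) (f : A) :
    L (v * Lb f) + Lb (v * Lb f) = v * Lb (L f + Lb f) := by
  simp only [map_add, Derivation.leibniz, smul_eq_mul, h.Lv, h.Lbv, h.comm]
  ring

/-- vL̲ commutes with T and with constants, so vL̲y inherits the evolution equation of y; moreover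
it is constant along L̲. -/
theorem special_deriv (h : NullPair L Lb w v x m lam) {y : A}
    (h1 : lam * (lam - 2) * y = 6 * m * (L y + Lb y)) (h2 : v * Lb (v * Lb y) = 0) :
    lam * (lam - 2) * (v * Lb y) = 6 * m * (L (v * Lb y) + Lb (v * Lb y)) ∧ Lb (v * Lb y) = 0 := by
  have hNb : Lb (lam * (lam - 2)) = 0 := neg_eq_zero.mp h.reverse.L_N
  have hmb : Lb (6 * m) = 0 := neg_eq_zero.mp h.reverse.L_six_m
  refine ⟨?_, by linear_combination w * h2 - Lb (v * Lb y) * h.wv⟩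
  have h3 := congrArg (fun f => v * Lb f) h1
  simp only [leibniz_const hNb, leibniz_const hmb] at h3
  rw [h.sum_comm_Lb]
  linear_combination h3

namespace TeukPair

/-- The statements on z are those on y for the reflected pair, whence the opposite sign of its time
evolution. In y - z the two transforms of Ψ₊ - Ψ₋ add up, which is the combination `op_add_reverse`
controls. -/
theorem defects (h : TeukPair L Lb w v x m lam a b)
    (h0 : lam * (lam - 2) * (v * Lb (v * Lb a) + v * L (v * L b)) +
      6 * m * (L (v * Lb (v * Lb a) - v * L (v * L b)) +
        Lb (v * Lb (v * Lb a) - v * L (v * L b))) = 0) {y z : A}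
    (hy : y = w ^ 2 * (v * L (v * L (v * L (v * L b)))) + lam * (lam - 2) * a +
      6 * m * (L a + Lb a))
    (hz : z = w ^ 2 * (v * Lb (v * Lb (v * Lb (v * Lb a)))) + lam * (lam - 2) * b -
      6 * m * (L b + Lb b)) :
    (lam * (lam - 2) * y = 6 * m * (L y + Lb y) ∧ v * Lb (v * Lb y) = 0 ∧
      (lam - 6 * m * x) * (v * Lb y) = -(6 * m * y)) ∧
    (lam * (lam - 2) * z = -(6 * m * (L z + Lb z)) ∧ v * L (v * L z) = 0 ∧
      (lam - 6 * m * x) * (v * L z) = 6 * m * z) ∧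
    y - z = 2 * (lam * (lam - 2)) * (a - b) -
      (w ^ 2 * (v * L (v * L (v * Lb (v * Lb a) - v * L (v * L b)))) +
        w ^ 2 * (v * Lb (v * Lb (v * Lb (v * Lb a) - v * L (v * L b))))) := by
  obtain ⟨y1, y2, y3⟩ := h.defect_special h0 hy
  have hr := h.rev
  have e := hr.defect_eq
  have s := hr.defect_special (y := z)
  simp only [Derivation.neg_apply, mul_neg, map_neg, neg_neg] at e s
  obtain ⟨z1, z2, z3⟩ := s (by
    simp only [map_sub] at h0 ⊢
    linear_combination h0) (by linear_combination hz)
  have e' := h.defect_eq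
  refine ⟨⟨y1, y2, by linear_combination y3⟩, ⟨by linear_combination z1, z2,
    by linear_combination -z3⟩, ?_⟩
  have e1 : v * L (v * L b) - v * Lb (v * Lb a) = -(v * Lb (v * Lb a) - v * L (v * L b)) := by ring
  rw [e1] at e
  simp only [map_neg, mul_neg] at e
  rw [hy, hz]
  linear_combination e' - e

/-- A pair satisfying a Robin condition up to the elements of `Z`, on which there are no
algebraically special solutions. -/
theorem relations_of_robin (h : TeukPair L Lb w v x m lam a b)
    (h0 : lam * (lam - 2) * (v * Lb (v * Lb a) + v * L (v * L b)) +
      6 * m * (L (v * Lb (v * Lb a) - v * L (v * L b)) +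
        Lb (v * Lb (v * Lb a) - v * L (v * L b))) = 0)
    {J : Subalgebra ℂ A} {Z : Submodule ℂ A} (hJZ : ∀ g ∈ J, ∀ f ∈ Z, g * f ∈ Z)
    (hL : ∀ f ∈ J, L f ∈ J) (hLb : ∀ f ∈ J, Lb f ∈ J)
    (landau : ∀ f ∈ J, f ∈ Z → L f + Lb f ∈ Z)
    (hw : w ∈ J) (hv : v ∈ J) (hm : m ∈ J) (hl : lam ∈ J) (ha : a ∈ J) (hb : b ∈ J)
    (h1 : a - b ∈ Z)
    (hd : w ^ 2 * (v * L (v * L (v * Lb (v * Lb a) - v * L (v * L b)))) +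
      w ^ 2 * (v * Lb (v * Lb (v * Lb (v * Lb a) - v * L (v * L b)))) ∈ Z)
    {c : A} (hcJ : c ∈ J) (hc : c * (lam * (lam - 2)) = 1) (hmu : IsUnit (6 * m))
    (sp : ∀ y ∈ Z, ∀ δ, (lam - 6 * m * x) * δ = -(6 * m) * y → Lb δ = 0 →
      lam * (lam - 2) * δ = 6 * m * (L δ + Lb δ) → δ = 0)
    (sp' : ∀ y ∈ Z, ∀ δ, (lam - 6 * m * x) * δ = 6 * m * y → L δ = 0 →
      lam * (lam - 2) * δ = -(6 * m * (L δ + Lb δ)) → δ = 0) :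
    w ^ 2 * (v * L (v * L (v * L (v * L b)))) = -(lam * (lam - 2) * a) -
      6 * m * (L a + Lb a) ∧
    w ^ 2 * (v * Lb (v * Lb (v * Lb (v * Lb a)))) = -(lam * (lam - 2) * b) +
      6 * m * (L b + Lb b) := by
  have hn : ∀ (n : ℕ) [n.AtLeastTwo], (ofNat(n) : A) ∈ J := fun n _ => by
    have := J.algebraMap_mem (ofNat(n) : ℂ)
    rwa [map_ofNat] at this
  have hvL : ∀ f ∈ J, v * L f ∈ J := fun f hf => mul_mem hv (hL f hf)
  have hvLb : ∀ f ∈ J, v * Lb f ∈ J := fun f hf => mul_mem hv (hLb f hf)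
  have hNJ : lam * (lam - 2) ∈ J := mul_mem hl (sub_mem hl (hn 2))
  have hmJ : 6 * m ∈ J := mul_mem (hn 6) hm
  have hsJ : ∀ f ∈ J, 6 * m * (L f + Lb f) ∈ J :=
    fun f hf => mul_mem hmJ (add_mem (hL f hf) (hLb f hf))
  obtain ⟨y, hy⟩ : ∃ y, y = w ^ 2 * (v * L (v * L (v * L (v * L b)))) + lam * (lam - 2) * a +
      6 * m * (L a + Lb a) := ⟨_, rfl⟩
  obtain ⟨z, hz⟩ : ∃ z, z = w ^ 2 * (v * Lb (v * Lb (v * Lb (v * Lb a)))) +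
      lam * (lam - 2) * b - 6 * m * (L b + Lb b) := ⟨_, rfl⟩
  have hyJ : y ∈ J := by
    rw [hy]
    exact add_mem (add_mem (mul_mem (pow_mem hw 2) (hvL _ (hvL _ (hvL _ (hvL _ hb)))))
      (mul_mem hNJ ha)) (hsJ _ ha)
  have hzJ : z ∈ J := by
    rw [hz]
    exact sub_mem (add_mem (mul_mem (pow_mem hw 2) (hvLb _ (hvLb _ (hvLb _ (hvLb _ ha)))))
      (mul_mem hNJ hb)) (hsJ _ hb)
  obtain ⟨⟨y1, y2, y3⟩, ⟨z1, z2, z3⟩, hyz⟩ := h.defects h0 hy hz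
  have hsub : y - z ∈ Z := by
    rw [hyz]
    exact Submodule.sub_mem _ (hJZ _ (mul_mem (hn 2) hNJ) _ h1) hd
  have hadd : y + z ∈ Z := by
    -- Adding Ny = 6m Ty and Nz = -6m Tz: decay of the difference therefore passes to the sum.
    have e : y + z = c * (6 * m) * (L (y - z) + Lb (y - z)) := by
      rw [map_sub, map_sub]
      linear_combination c * y1 + c * z1 - (y + z) * hc
    rw [e]
    exact hJZ _ (mul_mem hcJ hmJ) _ (landau _ (sub_mem hyJ hzJ) hsub)
  have half : ∀ f, f + f ∈ Z → f ∈ Z := fun f hf => by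
    have := Submodule.smul_mem _ (1 / 2 : ℂ) hf
    rw [← two_smul ℂ, smul_smul] at this
    norm_num at this
    exact this
  have hyZ : y ∈ Z := half _ (by convert Submodule.add_mem _ hsub hadd using 1; ring)
  have hzZ : z ∈ Z := by
    have := Submodule.sub_mem _ hadd hyZ
    rwa [add_sub_cancel_left] at this
  have np := h.toNullPair
  obtain ⟨y4, y5⟩ := np.special_deriv y1 y2
  have hzr := np.reverse.special_deriv (y := z)
  simp only [Derivation.neg_apply, mul_neg, map_neg, neg_neg] at hzr
  obtain ⟨z4, z5⟩ := hzr (by linear_combination z1) z2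
  have dy := sp y hyZ _ (by linear_combination y3) y5 y4
  have dz := sp' z hzZ _ z3 z5 (by linear_combination -z4)
  rw [dy, mul_zero] at y3
  rw [dz, mul_zero] at z3
  have y0 : y = 0 := hmu.mul_right_eq_zero.1 (neg_eq_zero.1 y3.symm)
  have z0 : z = 0 := hmu.mul_right_eq_zero.1 z3.symm
  rw [y0] at hy
  rw [z0] at hz
  exact ⟨by linear_combination -hy, by linear_combination -hz⟩

end TeukPair

end NullPair

variable {m : ℤ} {ℓ : ℕ} {M k rp t0 : ℝ} {a b y z δ h : smAlg (U2 rp t0)}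
variable (hB : Background M k rp)

/-- Algebraically special modes that decay at infinity vanish. -/
theorem eq_zero_of_special (hA : Adm m ℓ) (hy : y ∈ decInf rp t0) {c : smAlg (U2 rp t0)}
    (hc : c ∈ bdInf rp t0)
    (h1 : (mLam rp t0 ℓ - 6 * mM M rp t0 * (C2 rp t0).x hB) * δ = c * y) {g : ℝ → ℝ}
    (hR : ∀ t r, (t, r) ∈ U2 rp t0 →
      smEv ((C2 rp t0).R δ) (t, r) = (g r : ℂ) * smEv δ (t, r))
    (hg : ∀ r, rp < r → 0 ≤ g r) : δ = 0 := by
  refine sm_ext fun p hp => ?_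
  obtain ⟨t, r⟩ := p
  rw [smEv_zero]
  have h2 := mul_mem_decInf hc hy t hp.1
  rw [← h1] at h2
  have hx : Tendsto (fun r : ℝ => (ℓ : ℝ) * (ℓ + 1) - 6 * M * r⁻¹) atTop
      (𝓝 ((ℓ : ℝ) * (ℓ + 1) - 6 * M * 0)) :=
    tendsto_const_nhds.sub (tendsto_inv_atTop_zero.const_mul _)
  have hl : (ℓ : ℝ) * (ℓ + 1) - 6 * M * 0 ≠ 0 := by
    have : (2 : ℝ) ≤ ℓ := by exact_mod_cast hA.1
    have h3 : (0 : ℝ) < (ℓ : ℝ) * (ℓ + 1) := by positivity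
    linarith
  -- The factor λ - 6M/r may vanish at a finite radius, but it tends to λ ≠ 0, so for large r the
  -- function δ is a bounded multiple of y.
  have hz : Tendsto (fun r => smEv δ (t, r)) atTop (𝓝 0) := by
    have h4 := ((Complex.continuous_ofReal.tendsto _).comp (hx.inv₀ hl)).mul h2
    rw [mul_zero] at h4
    refine h4.congr' ?_
    filter_upwards [hx.eventually_ne hl, Ioi_mem_atTop rp] with s hs hsr
    have hp' : (t, s) ∈ U2 rp t0 := mem_U2.2 ⟨hp.1, hsr⟩
    have e : smEv (mLam rp t0 ℓ - 6 * mM M rp t0 * (C2 rp t0).x hB) (t, s) =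
        (((ℓ : ℝ) * (ℓ + 1) - 6 * M * s⁻¹ : ℝ) : ℂ) := by
      simp only [smEv_sub, smEv_mul, smEv_algebraMap _ hp', smEv_ofNat _ hp', Chart.x,
        smEv_rad_rmk _ _ _ hp', eigL]
      push_cast
      rfl
    rw [smEv_mul, e]
    simp only [Function.comp_apply]
    rw [← mul_assoc, ← Complex.ofReal_mul, inv_mul_cancel₀ hs, Complex.ofReal_one, one_mul]
  exact eq_zero_of_growth (fun s hs => (hasDerivAt_smEv_r δ (mem_U2.2 ⟨hp.1, hs⟩)).congr_deriv
    (hR t s (mem_U2.2 ⟨hp.1, hs⟩))) hg hz hp.2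

/-- The real eigenvalue `(ℓ - 1) ℓ (ℓ + 1) (ℓ + 2)`. -/
def reN (ℓ : ℕ) : ℝ := (ℓ : ℝ) * (ℓ + 1) * ((ℓ : ℝ) * (ℓ + 1) - 2)

theorem reN_pos (hA : Adm m ℓ) : 0 < reN ℓ := by
  have : (2 : ℝ) ≤ ℓ := by exact_mod_cast hA.1
  unfold reN
  have h1 : (0 : ℝ) < (ℓ : ℝ) * (ℓ + 1) - 2 := by nlinarith
  positivity

theorem mN_eq_re : mLam rp t0 ℓ * (mLam rp t0 ℓ - 2) = algebraMap ℂ _ (reN ℓ : ℂ) := by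
  rw [mN_eq (m := 0)]
  congr 1
  unfold eigN eigL reN
  push_cast
  ring

/-- The evolution equation gives ∂_tδ = N/(12M) δ. In the coordinates (t⋆, r), L̲δ = 0 reads ∂_rδ =
(1 + k²r²)⁻¹ ∂_tδ, since the terms with r²/Δ cancel. -/
theorem smEv_R_of_Lb (ha : (C2 rp t0).Lb hB δ = 0)
    (h1 : mLam rp t0 ℓ * (mLam rp t0 ℓ - 2) * δ =
      6 * mM M rp t0 * ((C2 rp t0).L hB δ + (C2 rp t0).Lb hB δ)) {t r : ℝ}
    (hp : (t, r) ∈ U2 rp t0) : smEv ((C2 rp t0).R δ) (t, r) =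
      ((reN ℓ / (12 * M) * (1 / (1 + k ^ 2 * r ^ 2)) : ℝ) : ℂ) * smEv δ (t, r) := by
  have h2 := congrArg (fun f => smEv f (t, r)) h1
  have h3 := congrArg (fun f => smEv f (t, r)) ha
  rw [mN_eq_re, Chart.L_apply, Chart.Lb_apply, add_add_sub_cancel] at h2
  rw [Chart.Lb_apply, Chart.D_apply] at h3
  have hr := hp.2
  simp only [smEv_mul, smEv_add, smEv_sub, smEv_algebraMap _ hp, smEv_ofNat _ hp, smEv_zero,
    smEv_rad_rmk _ _ _ hp] at h2 h3
  have hρ : (C2 rp t0).ρ (t, r) = r := rfl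
  rw [hρ] at h3
  have hd := (hB.Del_pos r hr).ne'
  have hr0 := (hB.r_pos hr).ne'
  have hM := hB.M_pos.ne'
  have hk : (1 + k ^ 2 * r ^ 2) ≠ 0 := by positivity
  have hd' : (Del M k r : ℂ) ≠ 0 := by exact_mod_cast hd
  have hr' : (r : ℂ) ≠ 0 := by exact_mod_cast hr0
  have hM' : (M : ℂ) ≠ 0 := by exact_mod_cast hM
  have hk' : (1 + (k : ℂ) ^ 2 * (r : ℂ) ^ 2) ≠ 0 := by exact_mod_cast hk
  generalize smEv ((C2 rp t0).T δ) (t, r) = T at *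
  generalize smEv ((C2 rp t0).R δ) (t, r) = R at *
  generalize smEv δ (t, r) = d at *
  have h4 : T = (reN ℓ : ℂ) * d / (12 * M) := by
    field_simp
    linear_combination -h2
  have hq : (Del M k r : ℂ) / (r : ℂ) ^ 2 * ((r : ℂ) ^ 2 / Del M k r) = 1 := by field_simp
  push_cast at h3 ⊢
  have h5 : R = T / (1 + (k : ℂ) ^ 2 * (r : ℂ) ^ 2) := by
    rw [div_eq_mul_one_div]
    linear_combination (-((r : ℂ) ^ 2 / Del M k r)) * h3 -
      (R + ((r : ℂ) ^ 2 / Del M k r - 1 / (1 + (k : ℂ) ^ 2 * (r : ℂ) ^ 2)) * T) * hq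
  rw [h5, h4]
  field_simp

/-- Now ∂_tδ = -N/(12M) δ, and for L the terms with r²/Δ add up instead of cancelling. The two sign
changes leave a growth rate in r again. -/
theorem smEv_R_of_L (ha : (C2 rp t0).L hB δ = 0)
    (h1 : mLam rp t0 ℓ * (mLam rp t0 ℓ - 2) * δ =
      -(6 * mM M rp t0 * ((C2 rp t0).L hB δ + (C2 rp t0).Lb hB δ))) {t r : ℝ}
    (hp : (t, r) ∈ U2 rp t0) : smEv ((C2 rp t0).R δ) (t, r) =
      ((reN ℓ / (12 * M) * (2 * (r ^ 2 / Del M k r) - 1 / (1 + k ^ 2 * r ^ 2)) : ℝ) : ℂ) *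
        smEv δ (t, r) := by
  have h2 := congrArg (fun f => smEv f (t, r)) h1
  have h3 := congrArg (fun f => smEv f (t, r)) ha
  rw [mN_eq_re, Chart.L_apply, Chart.Lb_apply, add_add_sub_cancel] at h2
  rw [Chart.L_apply, Chart.D_apply] at h3
  have hr := hp.2
  simp only [smEv_mul, smEv_add, smEv_neg, smEv_algebraMap _ hp, smEv_ofNat _ hp, smEv_zero,
    smEv_rad_rmk _ _ _ hp] at h2 h3
  have hρ : (C2 rp t0).ρ (t, r) = r := rfl
  rw [hρ] at h3
  have hd := (hB.Del_pos r hr).ne'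
  have hr0 := (hB.r_pos hr).ne'
  have hM := hB.M_pos.ne'
  have hk : (1 + k ^ 2 * r ^ 2) ≠ 0 := by positivity
  have hd' : (Del M k r : ℂ) ≠ 0 := by exact_mod_cast hd
  have hr' : (r : ℂ) ≠ 0 := by exact_mod_cast hr0
  have hM' : (M : ℂ) ≠ 0 := by exact_mod_cast hM
  have hk' : (1 + (k : ℂ) ^ 2 * (r : ℂ) ^ 2) ≠ 0 := by exact_mod_cast hk
  generalize smEv ((C2 rp t0).T δ) (t, r) = T at *
  generalize smEv ((C2 rp t0).R δ) (t, r) = R at *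
  generalize smEv δ (t, r) = d at *
  have h4 : T = -((reN ℓ : ℂ) * d / (12 * M)) := by
    field_simp
    linear_combination h2
  have hq : (Del M k r : ℂ) / (r : ℂ) ^ 2 * ((r : ℂ) ^ 2 / Del M k r) = 1 := by field_simp
  push_cast at h3 ⊢
  have h5 : R = -(T * (2 * ((r : ℂ) ^ 2 / Del M k r) - 1 / (1 + (k : ℂ) ^ 2 * (r : ℂ) ^ 2))) := by
    linear_combination ((r : ℂ) ^ 2 / Del M k r) * h3 -
      (R + ((r : ℂ) ^ 2 / Del M k r - 1 / (1 + (k : ℂ) ^ 2 * (r : ℂ) ^ 2)) * T) * hq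
  rw [h5, h4]
  ring

theorem special_left (hA : Adm m ℓ) (hy : y ∈ decInf rp t0)
    (h1 : (mLam rp t0 ℓ - 6 * mM M rp t0 * (C2 rp t0).x hB) * δ = -(6 * mM M rp t0) * y)
    (h2 : (C2 rp t0).Lb hB δ = 0) (h3 : mLam rp t0 ℓ * (mLam rp t0 ℓ - 2) * δ =
      6 * mM M rp t0 * ((C2 rp t0).L hB δ + (C2 rp t0).Lb hB δ)) : δ = 0 := by
  have hNr := (reN_pos hA).le
  have hM := hB.M_pos
  exact eq_zero_of_special hB hA hy
    (neg_mem (mul_mem (ofNat_mem _ 6) (Subalgebra.algebraMap_mem _ _))) h1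
    (fun t r h => smEv_R_of_Lb hB h2 h3 h) (fun r hr => by positivity)

theorem special_right (hA : Adm m ℓ) (hy : y ∈ decInf rp t0)
    (h1 : (mLam rp t0 ℓ - 6 * mM M rp t0 * (C2 rp t0).x hB) * δ = 6 * mM M rp t0 * y)
    (h2 : (C2 rp t0).L hB δ = 0) (h3 : mLam rp t0 ℓ * (mLam rp t0 ℓ - 2) * δ =
      -(6 * mM M rp t0 * ((C2 rp t0).L hB δ + (C2 rp t0).Lb hB δ))) : δ = 0 := by
  have hNr := (reN_pos hA).le
  have hM := hB.M_pos
  refine eq_zero_of_special hB hA hy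
    (mul_mem (ofNat_mem _ 6) (Subalgebra.algebraMap_mem _ _)) h1
    (fun t r h => smEv_R_of_L hB h2 h3 h) (fun r hr => ?_)
  have h3 := hB.Del_pos r hr
  have h4 := hB.r_pos hr
  refine mul_nonneg (by positivity) ?_
  -- Because Δ = r²(1 + k²r²) - 2Mr ≤ r²(1 + k²r²).
  have h5 : 1 / (1 + k ^ 2 * r ^ 2) ≤ r ^ 2 / Del M k r := by
    rw [div_le_div_iff₀ (by positivity) h3]
    unfold Del
    nlinarith [mul_pos hM h4]
  have h6 : 0 ≤ r ^ 2 / Del M k r := by positivity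
  linarith

/-- The antisymmetric Teukolsky-Starobinsky relations for modes. -/
theorem modeTS_of_modeR (hA : Adm m ℓ) (hp : ModePair hB ℓ a b) (ha : AllBd hB a) (hb : AllBd hB b)
    (h1 : a - b ∈ decInf rp t0) (h2 : DD rp t0 hB (a + b) ∈ decInf rp t0)
    (h0 : modeR hB ℓ a b = 0) : ModeTS hB (-1) ℓ a b := by
  have hle := jetAlg_le hB ha hb
  have landau : ∀ f ∈ jetAlg hB a b, f ∈ decInf rp t0 →
      (C2 rp t0).L hB f + (C2 rp t0).Lb hB f ∈ decInf rp t0 := fun f hf hz => by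
    rw [← TT_eq_add]
    exact TT_mem_decInf hB hz (hle (TT_mem_jet hB (TT_mem_jet hB hf)))
  have hmul : ∀ g ∈ jetAlg hB a b, ∀ f ∈ decInf rp t0, g * f ∈ decInf rp t0 :=
    fun _ hg _ hf => mul_mem_decInf (hle hg) hf
  have hL : ∀ f ∈ jetAlg hB a b, (C2 rp t0).L hB f ∈ jetAlg hB a b := fun _ hf => L_mem_jet hB hf
  have hLb : ∀ f ∈ jetAlg hB a b, (C2 rp t0).Lb hB f ∈ jetAlg hB a b := fun _ hf => Lb_mem_jet hB hf
  have hd := defect_sub_mem_decInf hB hp ha hb h1 h2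
  have hM := hB.M_pos
  have hu : IsUnit (6 * mM M rp t0) := by
    have := (isUnit_iff_ne_zero.2 (mul_ne_zero (by norm_num : (6 : ℂ) ≠ 0)
      (Complex.ofReal_ne_zero.2 hM.ne'))).map (algebraMap ℂ (smAlg (U2 rp t0)))
    rwa [map_mul, map_ofNat] at this
  have hc : algebraMap ℂ (smAlg (U2 rp t0)) ((reN ℓ : ℂ)⁻¹) *
      (mLam rp t0 ℓ * (mLam rp t0 ℓ - 2)) = 1 := by
    rw [mN_eq_re, ← map_mul, inv_mul_cancel₀ (Complex.ofReal_ne_zero.2 (reN_pos hA).ne'), map_one]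
  have key := NullPair.TeukPair.relations_of_robin hp h0 hmul hL hLb landau (w_mem_jet hB)
    (v_mem_jet hB) (Subalgebra.algebraMap_mem _ _) (Subalgebra.algebraMap_mem _ _)
    (left_mem_jet hB) (right_mem_jet hB) h1 (by convert hd using 1)
    (Subalgebra.algebraMap_mem _ _) hc hu
    (fun y hy δ e1 e2 e3 => special_left hB hA hy e1 e2 e3)
    (fun y hy δ e1 e2 e3 => special_right hB hA hy e1 e2 e3)
  unfold ModeTS
  rw [neg_one_smul, neg_one_smul]
  refine ⟨?_, ?_⟩
  · convert key.1 using 1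
  · convert key.2 using 1

end
end TeukolskySAdS

open scoped ContDiff
namespace TeukolskySAdS
open Set Filter Topology
noncomputable section

open MeasureTheory Chart Fm

variable {m : ℤ} {ℓ : ℕ} {M k rp t0 : ℝ} {f g : Field4} {A B : Fm rp t0}

/-! ### Modes of regular functions at infinity -/

theorem RepS.smEv_eq_modeInt (hf : RepS f A) {F : smAlg (Om rp t0)} (hF : Rep f F)
    (hF' : F ∈ locBdd rp t0) (hA : Adm m ℓ) {p : ℝ × ℝ} (hp : p ∈ U2 rp t0) :
    smEv (A m ℓ) p = modeInt m ℓ F p := by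
  obtain ⟨t, r⟩ := p
  rw [← hf.modeCoeff hp hA, modeCoeff_congr hF hp, modeCoeff_ev hA hF' hp]

/-- Fields bounded near infinity. -/
def FieldBdd (t0 : ℝ) (f : Field4) : Prop := ∀ t, t0 ≤ t → ∃ C : ℝ, ∀ᶠ p in nhdsInf t0 t,
  ∀ θ ∈ Ioo (0 : ℝ) Real.pi, ∀ φ ∈ Icc (0 : ℝ) (2 * Real.pi), ‖f p.1 p.2 θ φ‖ ≤ C

theorem FieldBdd.cc (hf : FieldBdd t0 f) : FieldBdd t0 (cc f) := fun t ht => by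
  obtain ⟨C, hC⟩ := hf t ht
  refine ⟨C, hC.mono fun p hp θ hθ φ hφ => ?_⟩
  rw [TeukolskySAdS.cc, RCLike.norm_conj]
  exact hp θ hθ φ hφ

theorem FieldBdd.add (hf : FieldBdd t0 f) (hg : FieldBdd t0 g) : FieldBdd t0 (f + g) :=
  fun t ht => by
    obtain ⟨C, hC⟩ := hf t ht
    obtain ⟨D, hD⟩ := hg t ht
    refine ⟨C + D, ?_⟩
    filter_upwards [hC, hD] with p h1 h2 θ hθ φ hφ
    exact (norm_add_le _ _).trans (add_le_add (h1 θ hθ φ hφ) (h2 θ hθ φ hφ))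

theorem FieldBdd.sub (hf : FieldBdd t0 f) (hg : FieldBdd t0 g) : FieldBdd t0 (f - g) :=
  fun t ht => by
    obtain ⟨C, hC⟩ := hf t ht
    obtain ⟨D, hD⟩ := hg t ht
    refine ⟨C + D, ?_⟩
    filter_upwards [hC, hD] with p h1 h2 θ hθ φ hφ
    exact (norm_sub_le _ _).trans (add_le_add (h1 θ hθ φ hφ) (h2 θ hθ φ hφ))

theorem slice_le_of_field {F : smAlg (Om rp t0)} (hF : Rep f F) {p : ℝ × ℝ} (hp : p ∈ U2 rp t0)
    {C : ℝ} (hC : ∀ θ ∈ Ioo (0 : ℝ) Real.pi, ∀ φ ∈ Icc (0 : ℝ) (2 * Real.pi),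
      ‖f p.1 p.2 θ φ‖ ≤ C) : ∀ q ∈ Qm, ‖slice F p q‖ ≤ C := fun q hq => by
  have e : slice F p q = f p.1 p.2 q.1 q.2 := (hF _ _ _ _ ⟨hp.1, hp.2, hq.1⟩).symm
  rw [e]
  exact hC _ hq.1 _ (Ioc_subset_Icc_self hq.2)

theorem RepS.mem_bdInf (hf : RepS f A) {F : smAlg (Om rp t0)} (hF : Rep f F)
    (hF' : F ∈ locBdd rp t0) (hb : FieldBdd t0 f) (hA : Adm m ℓ) : A m ℓ ∈ bdInf rp t0 := by
  intro t ht
  obtain ⟨C, hC⟩ := hb t ht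
  refine ⟨4 * Real.pi * C, ?_⟩
  filter_upwards [nhdsInf_U2 rp t0 t, hC] with p hp h1
  rw [hf.smEv_eq_modeInt hF hF' hA hp]
  exact norm_modeInt_le hA hF' hp (slice_le_of_field hF hp h1)

/-- The boundary conditions are pointwise on the sphere. Regularity at infinity gives a uniform
bound, and dominated convergence passes the limit to the modes. -/
theorem RepS.mem_decInf (hf : RepS f A) {F : smAlg (Om rp t0)} (hF : Rep f F)
    (hF' : F ∈ locBdd rp t0) (hb : FieldBdd t0 f)
    (hz : ∀ t θ φ : ℝ, t0 ≤ t → 0 < θ → θ < Real.pi → Tendsto (fun r => f t r θ φ) atTop (𝓝 0))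
    (hA : Adm m ℓ) : A m ℓ ∈ decInf rp t0 := by
  intro t ht
  obtain ⟨C, hC⟩ := hb t ht
  have hC1 := (tendsto_nhdsInf ht).eventually hC
  obtain ⟨K, hK0, hK⟩ := Kml_bounded hA
  have hU : ∀ᶠ r in atTop, (t, r) ∈ U2 rp t0 := by
    filter_upwards [Ioi_mem_atTop rp] with r hr using mem_U2.2 ⟨ht, hr⟩
  have h1 : Tendsto (fun r => modeInt m ℓ F (t, r)) atTop (𝓝 (∫ _ in Qm, (0 : ℂ))) := by
    refine tendsto_integral_filter_of_dominated_convergence (fun _ => C * K) ?_ ?_ ?_ ?_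
    · filter_upwards [hU] with r hr
      exact (integrable_slice_Kml hA hF' hr).aestronglyMeasurable
    · filter_upwards [hU, hC1] with r hr h2
      filter_upwards [ae_restrict_mem measurableSet_Qm] with q hq
      rw [norm_mul]
      have h3 := slice_le_of_field hF hr h2 q hq
      exact mul_le_mul h3 (hK q hq) (norm_nonneg _) ((norm_nonneg _).trans h3)
    · exact integrable_const _
    · filter_upwards [ae_restrict_mem measurableSet_Qm] with q hq
      have h2 := (hz t q.1 q.2 ht hq.1.1 hq.1.2).mul_const (Kml m ℓ q)
      rw [zero_mul] at h2
      refine h2.congr' ?_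
      filter_upwards [hU] with r hr
      have e : slice F (t, r) q = f t r q.1 q.2 := (hF _ _ _ _ ⟨hr.1, hr.2, hq.1⟩).symm
      rw [e]
  rw [integral_zero] at h1
  refine h1.congr' ?_
  filter_upwards [hU] with r hr
  rw [hf.smEv_eq_modeInt hF hF' hA hr]

variable (hB : Background M k rp)

/-- `f` is the sum of the modes `A`, and smooth up to the poles. -/
def GoodRepS (f : Field4) (A : Fm rp t0) : Prop := RepS f A ∧ ∃ F ∈ good rp t0 hB, Rep f F

namespace GoodRepS

theorem add (hf : GoodRepS hB f A) (hg : GoodRepS hB g B) : GoodRepS hB (f + g) (A + B) := by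
  obtain ⟨h1, F, h2, h3⟩ := hf
  obtain ⟨h1', F', h2', h3'⟩ := hg
  exact ⟨h1.add h1', F + F', Submodule.add_mem _ h2 h2', h3.add h3'⟩

theorem sub (hf : GoodRepS hB f A) (hg : GoodRepS hB g B) : GoodRepS hB (f - g) (A - B) := by
  obtain ⟨h1, F, h2, h3⟩ := hf
  obtain ⟨h1', F', h2', h3'⟩ := hg
  exact ⟨h1.sub h1', F - F', Submodule.sub_mem _ h2 h2', h3.sub h3'⟩

theorem opL (hf : GoodRepS hB f A) : GoodRepS hB (opL M k t0 f) (mL hB A) := by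
  obtain ⟨h1, F, h2, h3⟩ := hf
  exact ⟨h1.opL hB, _, good_L hB h2, h3.opL hB⟩

theorem opLb (hf : GoodRepS hB f A) : GoodRepS hB (opLb M k t0 f) (mLb hB A) := by
  obtain ⟨h1, F, h2, h3⟩ := hf
  exact ⟨h1.opLb hB, _, good_Lb hB h2, h3.opLb hB⟩

theorem mem_bdInf (hf : GoodRepS hB f A) (hb : FieldBdd t0 f) (hA : Adm m ℓ) :
    A m ℓ ∈ bdInf rp t0 := by
  obtain ⟨h1, F, h2, h3⟩ := hf
  exact h1.mem_bdInf h3 (good_locBdd hB h2) hb hA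

theorem mem_decInf (hf : GoodRepS hB f A) (hb : FieldBdd t0 f)
    (hz : ∀ t θ φ : ℝ, t0 ≤ t → 0 < θ → θ < Real.pi → Tendsto (fun r => f t r θ φ) atTop (𝓝 0))
    (hA : Adm m ℓ) : A m ℓ ∈ decInf rp t0 := by
  obtain ⟨h1, F, h2, h3⟩ := hf
  exact h1.mem_decInf h3 (good_locBdd hB h2) hb hz hA

theorem iterate {X : Field4 → Field4} {Y : smAlg (U2 rp t0) → smAlg (U2 rp t0)}
    (h : ∀ f A, GoodRepS hB f A → GoodRepS hB (X f) (fun m ℓ => Y (A m ℓ))) (n : ℕ) :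
    ∀ f A, GoodRepS hB f A → GoodRepS hB (X^[n] f) (fun m ℓ => Y^[n] (A m ℓ)) := by
  induction n with
  | zero => exact fun f A hf => hf
  | succ n ih => exact fun f A hf => ih _ _ (h f A hf)

theorem allBd (hf : GoodRepS hB f A) (hb : ∀ p q, FieldBdd t0
    ((fun g => TeukolskySAdS.opL M k t0 g - TeukolskySAdS.opLb M k t0 g)^[p]
      ((fun g => TeukolskySAdS.opL M k t0 g + TeukolskySAdS.opLb M k t0 g)^[q] f)))
    (hA : Adm m ℓ) : AllBd hB (A m ℓ) := fun p q => by
  have h1 := iterate hB (Y := TT rp t0 hB) (fun f A hf => (hf.opL hB).add hB (hf.opLb hB)) q _ _ hf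
  have h2 := iterate hB (Y := DD rp t0 hB) (fun f A hf => (hf.opL hB).sub hB (hf.opLb hB)) p _ _ h1
  exact h2.mem_bdInf hB (hb p q) hA

end GoodRepS

theorem RegularAtInfinity.fieldBdd {s : ℤ} (hf : RegularAtInfinity M k t0 s f) (p q : ℕ) :
    FieldBdd t0 ((fun g => opL M k t0 g - opLb M k t0 g)^[p]
      ((fun g => opL M k t0 g + opLb M k t0 g)^[q] f)) :=
  fun t ht => (hf p q 0 0 0 t ht).bounded

theorem RegularAtInfinity.fieldBdd_cc {s : ℤ} (hf : RegularAtInfinity M k t0 s f) (p q : ℕ) :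
    FieldBdd t0 ((fun g => opL M k t0 g - opLb M k t0 g)^[p]
      ((fun g => opL M k t0 g + opLb M k t0 g)^[q] (cc f))) := by
  have h1 : Function.Semiconj cc (fun g => opL M k t0 g - opLb M k t0 g)
      (fun g => opL M k t0 g - opLb M k t0 g) := fun g => by rw [cc_sub, cc_opL, cc_opLb]
  have h2 : Function.Semiconj cc (fun g => opL M k t0 g + opLb M k t0 g)
      (fun g => opL M k t0 g + opLb M k t0 g) := fun g => by rw [cc_add, cc_opL, cc_opLb]
  rw [← (h2.iterate_right q).eq, ← (h1.iterate_right p).eq]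
  exact (hf.fieldBdd p q).cc

/-! ### Symmetrisation and the behaviour at infinity -/

section Sy

variable {a b : smAlg (U2 rp t0)}

theorem smConj_mem_bdInf (ha : a ∈ bdInf rp t0) : smConj a ∈ bdInf rp t0 := fun t ht => by
  obtain ⟨C, hC⟩ := ha t ht
  refine ⟨C, hC.mono fun p hp => ?_⟩
  rwa [smEv_conj, RCLike.norm_conj]

theorem smConj_mem_decInf (ha : a ∈ decInf rp t0) : smConj a ∈ decInf rp t0 := fun t ht => by
  rw [tendsto_zero_iff_norm_tendsto_zero]
  simp only [smEv_conj, RCLike.norm_conj]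
  exact tendsto_zero_iff_norm_tendsto_zero.1 (ha t ht)

theorem smConj_TT : smConj (TT rp t0 hB a) = TT rp t0 hB (smConj a) := by
  rw [TT_eq_add, TT_eq_add, conj2_add, conj2_L, conj2_Lb]

theorem smConj_DD : smConj (DD rp t0 hB a) = DD rp t0 hB (smConj a) := by
  rw [DD_eq_sub, DD_eq_sub, conj2_sub, conj2_L, conj2_Lb]

theorem AllBd.conj (ha : AllBd hB a) : AllBd hB (smConj a) := fun p q => by
  have h1 : Function.Semiconj smConj (DD rp t0 hB) (DD rp t0 hB) := fun _ => smConj_DD hB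
  have h2 : Function.Semiconj smConj (TT rp t0 hB) (TT rp t0 hB) := fun _ => smConj_TT hB
  rw [← (h2.iterate_right q).eq, ← (h1.iterate_right p).eq]
  exact smConj_mem_bdInf (ha p q)

theorem AllBd.add (ha : AllBd hB a) (hb : AllBd hB b) : AllBd hB (a + b) := fun p q => by
  rw [iterate_map_add, iterate_map_add]
  exact add_mem (ha p q) (hb p q)

theorem iterate_derivation_smul (D : Derivation ℂ (smAlg (U2 rp t0)) (smAlg (U2 rp t0))) (c : ℂ)
    (n : ℕ) (a : smAlg (U2 rp t0)) : D^[n] (c • a) = c • D^[n] a := by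
  induction n generalizing a with
  | zero => rfl
  | succ n ih => rw [Function.iterate_succ_apply, D.map_smul, ih]; rfl

theorem AllBd.smul (ha : AllBd hB a) (c : ℂ) : AllBd hB (c • a) := fun p q => by
  rw [iterate_derivation_smul, iterate_derivation_smul]
  exact Subalgebra.smul_mem _ (ha p q) c

theorem AllBd.sy (hA : Adm m ℓ) (h : ∀ m ℓ, Adm m ℓ → AllBd hB (A m ℓ)) (σ : ℝ) :
    AllBd hB (sy σ A m ℓ) :=
  ((h m ℓ hA).add hB (((h _ ℓ hA.neg).conj hB).smul hB _)).smul hB _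

theorem sy_mem_decInf (hA : Adm m ℓ) (h : ∀ m ℓ, Adm m ℓ → A m ℓ ∈ decInf rp t0) (σ : ℝ) :
    sy σ A m ℓ ∈ decInf rp t0 :=
  Submodule.smul_mem _ _ (Submodule.add_mem _ (h m ℓ hA)
    (Submodule.smul_mem _ _ (smConj_mem_decInf (h _ ℓ hA.neg))))

end Sy

end
end TeukolskySAdS

open scoped ContDiff
namespace TeukolskySAdS
open Set Filter Topology
noncomputable section

open Chart Fm

variable {m : ℤ} {ℓ : ℕ} {M k rp t0 : ℝ} {f αp αm : Field4} {A B : Fm rp t0}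
variable {a b : smAlg (U2 rp t0)}
variable (hB : Background M k rp)

/-! ### Teukolsky-Starobinsky relations and Regge-Wheeler quantities -/

theorem exists_goodRepS (hf : IsSmoothSpin M k rp t0 2 f) : ∃ A : Fm rp t0, GoodRepS hB f A := by
  obtain ⟨F, hF, hf'⟩ := exists_good hB hf
  exact ⟨md hB ⟨F, hF⟩, ⟨md_isFam hB _, EqOnRegion.trans hf' (ev_eq_ser hB ⟨F, hF⟩)⟩, F, hF, hf'⟩

theorem exists_goodRepS_conj (hf : IsSmoothSpin M k rp t0 (-2) f) :
    ∃ A : Fm rp t0, GoodRepS hB (cc f) A := by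
  obtain ⟨F, hF, hf'⟩ := exists_good_conj hB hf
  exact ⟨md hB ⟨F, hF⟩, ⟨md_isFam hB _, EqOnRegion.trans hf' (ev_eq_ser hB ⟨F, hF⟩)⟩, F, hF, hf'⟩

theorem modeTS_one_iff (hA : Adm m ℓ) (hp : ModePair hB ℓ a b) :
    ModeTS hB 1 ℓ a b ↔ modeD hB a b = 0 := by
  have key := NullPair.TeukPair.dirichlet_iff hp (isUnit_mM hB) (isUnit_mN hA) (isUnit_pot hB hA)
  unfold ModeTS
  rw [one_smul, one_smul]
  convert key using 1

theorem modeR_of_modeTS (hA : Adm m ℓ) (hp : ModePair hB ℓ a b) (h : ModeTS hB (-1) ℓ a b) :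
    modeR hB ℓ a b = 0 := by
  unfold ModeTS at h
  rw [neg_one_smul, neg_one_smul] at h
  have key := NullPair.TeukPair.robin_eq_zero hp (isUnit_mM hB) (isUnit_mN hA) (isUnit_pot hB hA)
    (by convert h.1 using 1) (by convert h.2 using 1)
  convert key using 1

theorem modePair_sy (hp : RepS αp A) (hm : RepS (cc αm) B)
    (h1 : EqOnRegion rp t0 (teukP M k t0 αp) 0) (h2 : EqOnRegion rp t0 (teukM M k t0 αm) 0) (σ : ℝ)
    (hA : Adm m ℓ) : ModePair hB ℓ (sy σ A m ℓ) (sy σ B m ℓ) where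
  toNullPair := (C2 rp t0).nullPair hB (eigL 0 ℓ)
  ha := mode_teuk_sy hB σ (hp.mode_teukP hB h1) hA
  hb := mode_teuk_sy' hB σ (hm.mode_teukM hB h2) hA

theorem sy_DD (σ : ℝ) (A : Fm rp t0) :
    sy σ (fun m ℓ => DD rp t0 hB (A m ℓ)) m ℓ = DD rp t0 hB (sy σ A m ℓ) := by
  unfold sy
  rw [Derivation.map_smul, map_add, Derivation.map_smul, smConj_DD]

theorem sub_mem_decInf (hp : GoodRepS hB αp A) (hm : GoodRepS hB (cc αm) B)
    (h : IsTeukolskySolution M k rp t0 αp αm) (hA : Adm m ℓ) : A m ℓ - B m ℓ ∈ decInf rp t0 :=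
  (hp.sub hB hm).mem_decInf hB ((h.infinity_p.fieldBdd 0 0).sub (h.infinity_m.fieldBdd_cc 0 0))
    h.dirichlet hA

theorem opL_sub_opLb (f : Field4) (t r θ φ : ℝ) : (opL M k t0 f - opLb M k t0 f) t r θ φ =
    ((2 * (Del M k r / r ^ 2) : ℝ) : ℂ) * dR M k t0 f t r θ φ := by
  simp only [opL, opLb, Pi.sub_apply, Pi.add_apply, rmul]
  push_cast
  ring

/-- L - L̲ = 2(Δ/r²)∂_r = 2w · r²∂_r and w → k², so the Neumann condition is exactly decay of this
derivative of the sum. -/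
theorem DD_add_mem_decInf (hp : GoodRepS hB αp A) (hm : GoodRepS hB (cc αm) B)
    (h : IsTeukolskySolution M k rp t0 αp αm) (hA : Adm m ℓ) :
    DD rp t0 hB (A m ℓ + B m ℓ) ∈ decInf rp t0 := by
  have h1 := ((hp.opL hB).sub hB (hp.opLb hB)).add hB ((hm.opL hB).sub hB (hm.opLb hB))
  rw [map_add]
  refine h1.mem_decInf hB ((h.infinity_p.fieldBdd 1 0).add (h.infinity_m.fieldBdd_cc 1 0))
    (fun t θ φ ht h0 hpi => ?_) hA
  have h2 := h.neumann t θ φ ht h0 hpi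
  have h3 := ((Complex.continuous_ofReal.tendsto _).comp ((tendsto_wfun M k).const_mul 2)).mul h2
  rw [mul_zero] at h3
  refine h3.congr' ?_
  filter_upwards [eventually_gt_atTop 0] with r hr
  have hr' : (r : ℂ) ≠ 0 := by exact_mod_cast hr.ne'
  rw [Pi.add_apply, Pi.add_apply, Pi.add_apply, Pi.add_apply, opL_sub_opLb, opL_sub_opLb]
  simp only [Function.comp_apply, rmul, wfun, Pi.add_apply]
  push_cast
  field_simp

theorem symmetric_iff (hB : Background M k rp) (h : IsTeukolskySolution M k rp t0 αp αm) :
    TSRelations M k rp t0 1 (symP αp) (symM αm) ↔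
      EqOnRegion rp t0 (symP (PsiD M k t0 αp αm)) 0 := by
  obtain ⟨A, hp⟩ := exists_goodRepS hB h.smooth_p
  obtain ⟨B, hm⟩ := exists_goodRepS_conj hB h.smooth_m
  have hm' : RepS (cc (symM αm)) (sy 1 B) := by
    rw [cc_symM]
    exact hm.1.symP'
  rw [ts_iff hB (map_one _) hp.1.symP' hm', psiD_iff hB hp.1 hm.1]
  exact forall₃_congr fun m ℓ hA => modeTS_one_iff hB hA
    (modePair_sy hB hp.1 hm.1 h.teukolsky_p h.teukolsky_m 1 hA)

/-- The forward implication is purely algebraic. The four goals left by the `refine` feed the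
converse: bounded jets of both modes, decay of a - b, and decay of the radial derivative of a + b,
each carried through antisymmetrisation. -/
theorem antisymmetric_iff (hB : Background M k rp)
    (h : IsTeukolskySolution M k rp t0 αp αm) :
    TSRelations M k rp t0 (-1) (antiP αp) (antiM αm) ↔
      EqOnRegion rp t0 (antiP (PsiR M k t0 αp αm)) 0 := by
  obtain ⟨A, hp⟩ := exists_goodRepS hB h.smooth_p
  obtain ⟨B, hm⟩ := exists_goodRepS_conj hB h.smooth_m
  have hm' : RepS (cc (antiM αm)) (sy (-1) B) := by
    rw [cc_antiM]
    exact hm.1.antiP'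
  rw [ts_iff hB (by simp) hp.1.antiP' hm', psiR_iff hB hp.1 hm.1]
  refine forall₃_congr fun m ℓ hA => ?_
  have mp := modePair_sy hB hp.1 hm.1 h.teukolsky_p h.teukolsky_m (-1) hA
  refine ⟨modeR_of_modeTS hB hA mp, modeTS_of_modeR hB hA mp ?_ ?_ ?_ ?_⟩
  · exact AllBd.sy hB hA (fun m ℓ hA => hp.allBd hB (h.infinity_p.fieldBdd) hA) _
  · exact AllBd.sy hB hA (fun m ℓ hA => hm.allBd hB (h.infinity_m.fieldBdd_cc) hA) _
  · have := sy_mem_decInf (A := A - B) hA (fun m ℓ hA => sub_mem_decInf hB hp hm h hA) (-1)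
    rwa [sy_sub] at this
  · have := sy_mem_decInf (A := fun m ℓ => DD rp t0 hB ((A + B) m ℓ)) hA
      (fun m ℓ hA => DD_add_mem_decInf hB hp hm h hA) (-1)
    rwa [sy_DD, sy_add] at this

end
end TeukolskySAdS

theorem proposition2p12 (M k rp t0 : ℝ) (hM : 0 < M) (hk : 0 < k)
    (hrp : IsGreatest {r : ℝ | TeukolskySAdS.Del M k r = 0} rp)
    (αp αm : TeukolskySAdS.Field4)
    (hα : TeukolskySAdS.IsTeukolskySolution M k rp t0 αp αm) :
    (TeukolskySAdS.TSRelations M k rp t0 1 (TeukolskySAdS.symP αp) (TeukolskySAdS.symM αm) ↔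
      TeukolskySAdS.EqOnRegion rp t0
        (TeukolskySAdS.symP (TeukolskySAdS.PsiD M k t0 αp αm)) 0) ∧
    (TeukolskySAdS.TSRelations M k rp t0 (-1) (TeukolskySAdS.antiP αp) (TeukolskySAdS.antiM αm) ↔
      TeukolskySAdS.EqOnRegion rp t0
        (TeukolskySAdS.antiP (TeukolskySAdS.PsiR M k t0 αp αm)) 0) := by
  have hB := TeukolskySAdS.Background.of_isGreatest hM hk hrp
  exact ⟨TeukolskySAdS.symmetric_iff hB hα, TeukolskySAdS.antisymmetric_iff hB hα⟩
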